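/- Let $\mathfrak H$ be a complex separable Hilbert space and let $Z=\{Z(h):h\in\mathfrak H\}$ be a complex isonormal Gaussian process on a probability space $(\Omega,\mathcal F,P)$, i.e. a centred jointly Gaussian family of complex random variables with $E[Z(h)^2]=0$ and $E[Z(g)\overline{Z(h)}]=\langle g,h\rangle$ for all $g,h\in\mathfrak H$ (inner products are linear in the first variable). Let $(e_i)$ be a complete orthonormal system of $\mathfrak H$. An element of $\mathfrak H^{\otimes m}\otimes\overline{\mathfrak H}^{\otimes n}$ (written $\mathfrak H^{\otimes(m+n)}$) is a series $$f=\sum_{j,k} f(j;k)\,e_{j_1}\otimes\dots\otimes e_{j_m}\otimes\bar e_{k_1}\otimes\dots\otimes\bar e_{k_n},\qquad \|f\|^2=\sum_{j,k}|f(j;k)|^2<\infty ,$$ and it belongs to $\mathfrak H^{\odot m}\otimes\mathfrak H^{\odot n}$ if $f(j;k)$ is symmetric in $j_1,\dots,j_m$ and in $k_1,\dots,k_n$. The complex multiple Wiener–Itô integral is $$I_{m,n}(f)=\sum_{j,k} f(j;k)\prod_{i}J_{m_i,n_i}(Z(e_i),1)\quad\text{in }L^2(\Omega),\qquad J_{p,q}(z,\rho)=\sum_{r=0}^{p\wedge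 q}(-1)^r r!\binom pr\binom qr z^{p-r}\bar z^{q-r}\rho^r,$$ where $m_i$ and $n_i$ are the numbers of occurrences of $i$ in $j$ and in $k$. The reversed complex conjugate of $f$ is $h(k;j)=\overline{f(j;k)}$. For $f\in\mathfrak H^{\otimes m}\otimes\overline{\mathfrak H}^{\otimes n}$, $g\in\mathfrak H^{\otimes p}\otimes\overline{\mathfrak H}^{\otimes q}$, $i\le m\wedge q$ and $j\le n\wedge p$, the contraction is $$(f\otimes_{i,j}g)(t,t';s,s')=\sum_{u,v} f(t,u;s,v)\,g(t',v;s',u),$$ with $u$ running over $i$-tuples and $v$ over $j$-tuples of indices, and $f\tilde\otimes_{i,j}g$ is its average over all permutations of the plain variables $(t,t')$ and all permutations of the conjugate variables $(s,s')$. The Malliavin derivative $D$ is the closure in $L^2(\Omega)\times L^2(\Omega,\mathfrak H)$ of $$D\,g(Z(\varphi_1),\dots,Z(\varphi_N))=\sum_{i=1}^N\frac{\partial g}{\partial z_i}(Z(\varphi_1),\dots,Z(\varphi_N))\,\varphi_i ,$$ where $g$ is smooth on $\mathbb C^N$, $g$ and all its partial derivatives have polynomial growth, and $\partial/\partial z_i$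 is the Wirtinger derivative. **Theorem (Fourth Moment Theorems).** Fix $m,n\ge 0$ with $l:=m+n\ge2$. For $k\in\mathbb N$ let $f_k\in\mathfrak H^{\odot m}\otimes\mathfrak H^{\odot n}$, let $h_k$ be the reversed complex conjugate of $f_k$, and let $F_k=I_{m,n}(f_k)$. Suppose that $E[|F_k|^2]\to\sigma^2$ and $E[F_k^2]\to c+\mathrm ib$ as $k\to\infty$, with $\sigma,c,b\in\mathbb R$. Then, for every $k$, $E[|F_k|^4]<\infty$, $\bar F_k=I_{n,m}(h_k)$ almost surely, and $F_k$ and $\bar F_k$ belong to the domain of $D$. Moreover, the following statements are equivalent: (i) $(\mathrm{Re}\,F_k,\mathrm{Im}\,F_k)$ converges in law to the centred bivariate normal distribution (possibly degenerate) with covariance matrix $\frac12\begin{bmatrix}\sigma^2+c& b\\ b&\sigma^2-c\end{bmatrix}$; (ii) $E[|F_k|^4]\to c^2+b^2+2\sigma^4$; (iii) $\|f_k\otimes_{i,j}f_k\|_{\mathfrak H^{\otimes 2(l-i-j)}}\to0$ for all $i,j\le m\wedge n$ with $0<i+j\le l-1$, and $\|f_k\otimes_{i,j}h_k\|_{\mathfrak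 H^{\otimes 2(l-i-j)}}\to0$ for all $i\le m$, $j\le n$ with $0<i+j\le l-1$; (iv) the same as (iii) with $\tilde\otimes_{i,j}$ in place of $\otimes_{i,j}$; (v) each of $\|DF_k\|_{\mathfrak H}^2$, $\|D\bar F_k\|_{\mathfrak H}^2$ and $\langle DF_k,D\bar F_k\rangle_{\mathfrak H}$ converges to a constant in $L^2(\Omega)$; (v$'$) $\mathrm{Var}(\|DF_k\|_{\mathfrak H}^2)\to0$, $\mathrm{Var}(\|D\bar F_k\|_{\mathfrak H}^2)\to0$ and $\mathrm{Var}(\langle DF_k,D\bar F_k\rangle_{\mathfrak H})\to0$, where $\mathrm{Var}(X)=E|X-EX|^2$. -/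

import Mathlib

open MeasureTheory ProbabilityTheory Filter Topology
open scoped ENNReal ComplexConjugate

noncomputable section

namespace ComplexWiener

/-! ### Complex isonormal Gaussian processes -/

/-- A complex (symmetric) isonormal Gaussian process `Z = {Z(h) : h ∈ H}` over a complex Hilbert
space `H`: a centred, jointly Gaussian family of complex random variables with `E[Z(h)²] = 0` and
`E[Z(g) conj Z(h)] = ⟨g, h⟩`.  Here `⟨g, h⟩` is linear in `g`, which in Mathlib's convention is
`inner ℂ h g`.  All integrands are integrable because the family is Gaussian. -/
structure IsComplexIsonormal {H Ω : Type*} [NormedAddCommGroup H] [InnerProductSpace ℂ H]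
    [MeasurableSpace Ω] (Z : H → Ω → ℂ) (P : Measure Ω) : Prop where
  gaussian : IsGaussianProcess Z P
  mean_zero : ∀ h, ∫ ω, Z h ω ∂P = 0
  pseudo_zero : ∀ h, ∫ ω, Z h ω ^ 2 ∂P = 0
  covariance : ∀ g h, ∫ ω, Z g ω * conj (Z h ω) ∂P = inner ℂ h g

/-- The complex Hermite polynomial
`J_{m,n}(z, ρ) = ∑_r (-1)^r r! (m choose r) (n choose r) z^(m-r) (conj z)^(n-r) ρ^r`. -/
def complexHermite (m n : ℕ) (z : ℂ) (ρ : ℝ) : ℂ :=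
  ∑ r ∈ Finset.range (min m n + 1),
    (-1 : ℂ) ^ r * (r.factorial : ℂ) * (m.choose r : ℂ) * (n.choose r : ℂ) *
      z ^ (m - r) * conj z ^ (n - r) * (ρ : ℂ) ^ r

/-! ### Kernels

Fix a complete orthonormal system `e = (e_i)_{i ∈ ι}` of `H`.  The elements of the Hilbert space
`H^{⊗m} ⊗ (conj H)^{⊗n}` are the series
`∑ a(j, k) e_{j 1} ⊗ ⋯ ⊗ e_{j m} ⊗ conj e_{k 1} ⊗ ⋯ ⊗ conj e_{k n}` with square summable
coefficients, and the norm is the `ℓ²` norm of the coefficients. -/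

/-- The Hilbert space `H^{⊗m} ⊗ (conj H)^{⊗n}`, i.e. `H^{⊗(m+n)}` with `m` plain and `n`
conjugate variables, in the coordinates of a complete orthonormal system indexed by `ι`. -/
abbrev Kernel (ι : Type*) (m n : ℕ) : Type _ :=
  lp (fun _ : (Fin m → ι) × (Fin n → ι) => ℂ) 2

theorem memlp_two_iff {α : Type*} {a : α → ℂ} :
    Memℓp a 2 ↔ Summable fun x => ‖a x‖ ^ 2 := by
  rw [memℓp_gen_iff (by norm_num)]
  simp

theorem Kernel.summable_sq {ι : Type*} {m n : ℕ} (f : Kernel ι m n) :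
    Summable fun x => ‖f x‖ ^ 2 :=
  memlp_two_iff.1 (lp.memℓp f)

/-- `f` belongs to `H^{⊙m} ⊗ H^{⊙n}`: it is symmetric in its first `m` variables and in its last
`n` variables. -/
def Kernel.IsSymm {ι : Type*} {m n : ℕ} (f : Kernel ι m n) : Prop :=
  ∀ (π : Equiv.Perm (Fin m)) (τ : Equiv.Perm (Fin n)) (j : Fin m → ι) (k : Fin n → ι),
    f (j ∘ π, k ∘ τ) = f (j, k)

theorem Kernel.memlp_revConj {ι : Type*} {m n : ℕ} (f : Kernel ι m n) :
    Memℓp (fun x : (Fin n → ι) × (Fin m → ι) => conj (f (x.2, x.1))) 2 := by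
  rw [memlp_two_iff]
  simp only [RCLike.norm_conj]
  exact f.summable_sq.comp_injective Prod.swap_injective

/-- The reversed complex conjugate `h(t, s) = conj (f(s, t))` of a kernel `f`. -/
def Kernel.revConj {ι : Type*} {m n : ℕ} (f : Kernel ι m n) : Kernel ι n m :=
  ⟨fun x => conj (f (x.2, x.1)), f.memlp_revConj⟩

/-- The variables `(t_1, …, t_{m-i}, u_1, …, u_i)`. -/
def glue {ι : Type*} {m i : ℕ} (hi : i ≤ m) (t : Fin (m - i) → ι) (u : Fin i → ι) : Fin m → ι :=
  fun x => Fin.append t u (Fin.cast (Nat.sub_add_cancel hi).symm x)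

theorem glue_inj {ι : Type*} {m i : ℕ} (hi : i ≤ m) {t t' : Fin (m - i) → ι} {u u' : Fin i → ι}
    (h : glue hi t u = glue hi t' u') : t = t' ∧ u = u' := by
  have h' : Fin.append t u = Fin.append t' u' := by
    funext x
    have := congrFun h (Fin.cast (Nat.sub_add_cancel hi) x)
    simpa [glue] using this
  constructor
  · funext x
    simpa using congrFun h' (Fin.castAdd i x)
  · funext x
    simpa using congrFun h' (Fin.natAdd (m - i) x)

/-- The coefficients of the contraction of `(i, j)` indices,
`(f ⊗_{i,j} g)(t, t'; s, s') = ∑_{u, v} f(t, u; s, v) g(t', v; s', u)`, where `u` runs over `i`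
indices (plain variables of `f` against conjugate variables of `g`) and `v` runs over `j` indices
(conjugate variables of `f` against plain variables of `g`). -/
def contractionFun {ι : Type*} {m n p q : ℕ} (f : Kernel ι m n) (g : Kernel ι p q) (i j : ℕ)
    (him : i ≤ m) (hiq : i ≤ q) (hjn : j ≤ n) (hjp : j ≤ p)
    (x : (Fin (m - i + (p - j)) → ι) × (Fin (n - j + (q - i)) → ι)) : ℂ :=
  ∑' w : (Fin i → ι) × (Fin j → ι),
    f (glue him (fun a => x.1 (Fin.castAdd (p - j) a)) w.1,
        glue hjn (fun a => x.2 (Fin.castAdd (q - i) a)) w.2) *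
      g (glue hjp (fun a => x.1 (Fin.natAdd (m - i) a)) w.2,
        glue hiq (fun a => x.2 (Fin.natAdd (n - j) a)) w.1)

theorem norm_tsum_mul_sq_le {α : Type*} {F G : α → ℂ} (hF : Summable fun w => ‖F w‖ ^ 2)
    (hG : Summable fun w => ‖G w‖ ^ 2) :
    ‖∑' w, F w * G w‖ ^ 2 ≤ (∑' w, ‖F w‖ ^ 2) * ∑' w, ‖G w‖ ^ 2 := by
  have hF' : Summable fun w => ‖F w‖ ^ (2 : ℝ) := by simpa using hF
  have hG' : Summable fun w => ‖G w‖ ^ (2 : ℝ) := by simpa using hG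
  have key := Real.summable_and_inner_le_Lp_mul_Lq_tsum_of_nonneg
    (Real.HolderConjugate.two_two) (fun w => norm_nonneg (F w)) (fun w => norm_nonneg (G w)) hF' hG'
  have h1 : ‖∑' w, F w * G w‖ ≤ ∑' w, ‖F w‖ * ‖G w‖ := by
    have := norm_tsum_le_tsum_norm (f := fun w => F w * G w) (by simpa using key.1)
    simpa using this
  have h2 := h1.trans key.2
  have hA : 0 ≤ ∑' w, ‖F w‖ ^ 2 := tsum_nonneg fun w => by positivity
  have hB : 0 ≤ ∑' w, ‖G w‖ ^ 2 := tsum_nonneg fun w => by positivity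
  simp only [Real.rpow_two, ← Real.sqrt_eq_rpow] at h2
  calc ‖∑' w, F w * G w‖ ^ 2
      ≤ (√(∑' w, ‖F w‖ ^ 2) * √(∑' w, ‖G w‖ ^ 2)) ^ 2 := by gcongr
    _ = _ := by rw [mul_pow, Real.sq_sqrt hA, Real.sq_sqrt hB]

theorem memlp_contractionFun {ι : Type*} {m n p q : ℕ} (f : Kernel ι m n) (g : Kernel ι p q)
    (i j : ℕ) (him : i ≤ m) (hiq : i ≤ q) (hjn : j ≤ n) (hjp : j ≤ p) :
    Memℓp (contractionFun f g i j him hiq hjn hjp) 2 := by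
  rw [memlp_two_iff]
  have hf : Summable fun y : ((Fin (m - i) → ι) × (Fin (n - j) → ι)) ×
      ((Fin i → ι) × (Fin j → ι)) =>
      ‖f (glue him y.1.1 y.2.1, glue hjn y.1.2 y.2.2)‖ ^ 2 := by
    refine f.summable_sq.comp_injective (i := fun y : ((Fin (m - i) → ι) × (Fin (n - j) → ι)) ×
      ((Fin i → ι) × (Fin j → ι)) => (glue him y.1.1 y.2.1, glue hjn y.1.2 y.2.2)) ?_
    rintro ⟨⟨a, b⟩, c, d⟩ ⟨⟨a', b'⟩, c', d'⟩ h
    simp only [Prod.mk.injEq] at h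
    obtain ⟨rfl, rfl⟩ := glue_inj him h.1
    obtain ⟨rfl, rfl⟩ := glue_inj hjn h.2
    rfl
  have hg : Summable fun y : ((Fin (p - j) → ι) × (Fin (q - i) → ι)) ×
      ((Fin i → ι) × (Fin j → ι)) =>
      ‖g (glue hjp y.1.1 y.2.2, glue hiq y.1.2 y.2.1)‖ ^ 2 := by
    refine g.summable_sq.comp_injective (i := fun y : ((Fin (p - j) → ι) × (Fin (q - i) → ι)) ×
      ((Fin i → ι) × (Fin j → ι)) => (glue hjp y.1.1 y.2.2, glue hiq y.1.2 y.2.1)) ?_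
    rintro ⟨⟨a, b⟩, c, d⟩ ⟨⟨a', b'⟩, c', d'⟩ h
    simp only [Prod.mk.injEq] at h
    obtain ⟨rfl, rfl⟩ := glue_inj hjp h.1
    obtain ⟨rfl, rfl⟩ := glue_inj hiq h.2
    rfl
  have hprod := hf.prod.mul_of_nonneg hg.prod (fun _ => tsum_nonneg fun _ => by positivity)
    (fun _ => tsum_nonneg fun _ => by positivity)
  let φ : (Fin (m - i + (p - j)) → ι) × (Fin (n - j + (q - i)) → ι) →
      ((Fin (m - i) → ι) × (Fin (n - j) → ι)) × ((Fin (p - j) → ι) × (Fin (q - i) → ι)) :=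
    fun x => ((fun a => x.1 (Fin.castAdd (p - j) a), fun a => x.2 (Fin.castAdd (q - i) a)),
      (fun a => x.1 (Fin.natAdd (m - i) a), fun a => x.2 (Fin.natAdd (n - j) a)))
  have hφ : Function.Injective φ := by
    rintro ⟨a, b⟩ ⟨a', b'⟩ h
    simp only [φ, Prod.mk.injEq] at h
    obtain ⟨⟨h1, h2⟩, h3, h4⟩ := h
    refine Prod.ext (funext fun x => ?_) (funext fun x => ?_)
    · exact Fin.addCases (fun y => congrFun h1 y) (fun y => congrFun h3 y) x
    · exact Fin.addCases (fun y => congrFun h2 y) (fun y => congrFun h4 y) x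
  refine Summable.of_nonneg_of_le (fun _ => by positivity) (fun x => ?_)
    (hprod.comp_injective hφ)
  exact norm_tsum_mul_sq_le (hf.prod_factor (φ x).1) (hg.prod_factor (φ x).2)

/-- The contraction `f ⊗_{i,j} g ∈ H^{⊗(m+n+p+q-2(i+j))}` of `f` and `g`. -/
def contraction {ι : Type*} {m n p q : ℕ} (f : Kernel ι m n) (g : Kernel ι p q) (i j : ℕ)
    (him : i ≤ m) (hiq : i ≤ q) (hjn : j ≤ n) (hjp : j ≤ p) :
    Kernel ι (m - i + (p - j)) (n - j + (q - i)) :=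
  ⟨contractionFun f g i j him hiq hjn hjp, memlp_contractionFun f g i j him hiq hjn hjp⟩

theorem Kernel.memlp_perm {ι : Type*} {m n : ℕ} (f : Kernel ι m n) (π : Equiv.Perm (Fin m))
    (τ : Equiv.Perm (Fin n)) :
    Memℓp (fun x : (Fin m → ι) × (Fin n → ι) => f (x.1 ∘ π, x.2 ∘ τ)) 2 := by
  rw [memlp_two_iff]
  refine f.summable_sq.comp_injective
    (i := fun x : (Fin m → ι) × (Fin n → ι) => (x.1 ∘ π, x.2 ∘ τ)) ?_
  rintro ⟨a, b⟩ ⟨a', b'⟩ h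
  simp only [Prod.mk.injEq] at h
  exact Prod.ext (π.surjective.injective_comp_right h.1) (τ.surjective.injective_comp_right h.2)

/-- The kernel `f` with its plain variables permuted by `π` and its conjugate ones by `τ`. -/
def Kernel.perm {ι : Type*} {m n : ℕ} (f : Kernel ι m n) (π : Equiv.Perm (Fin m))
    (τ : Equiv.Perm (Fin n)) : Kernel ι m n :=
  ⟨fun x => f (x.1 ∘ π, x.2 ∘ τ), f.memlp_perm π τ⟩

/-- Itô's symmetrization of a kernel: the average over all permutations of the plain variables and
all permutations of the conjugate variables. -/
def Kernel.symmetrize {ι : Type*} {m n : ℕ} (f : Kernel ι m n) : Kernel ι m n :=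
  ((m.factorial : ℂ) * (n.factorial : ℂ))⁻¹ •
    ∑ π : Equiv.Perm (Fin m), ∑ τ : Equiv.Perm (Fin n), f.perm π τ

/-! ### Multiple Wiener–Itô integrals -/

section Integral

variable {H Ω ι : Type*} [NormedAddCommGroup H] [InnerProductSpace ℂ H] [MeasurableSpace Ω]

open Classical in
/-- The Fourier–Hermite polynomial
`∏_i J_{m_i, n_i}(Z(e_i), 1) = ∏_i 2^{-(m_i + n_i)/2} J_{m_i, n_i}(√2 Z(e_i), 2)`, where `m_i` and
`n_i` count how often the index `i` occurs in `x.1` and in `x.2`.  It is the multiple integral of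
`e_{x.1 1} ⊗ ⋯ ⊗ e_{x.1 m} ⊗ conj e_{x.2 1} ⊗ ⋯ ⊗ conj e_{x.2 n}`.
Indices outside the finite product contribute the factor `J_{0,0} = 1`. -/
def fourierHermite (Z : H → Ω → ℂ) (e : ι → H) {m n : ℕ} (x : (Fin m → ι) × (Fin n → ι))
    (ω : Ω) : ℂ :=
  ∏ i ∈ Finset.univ.image x.1 ∪ Finset.univ.image x.2,
    complexHermite (Finset.univ.filter fun a => x.1 a = i).card
      (Finset.univ.filter fun a => x.2 a = i).card (Z (e i) ω) 1

theorem memLp_mul_all {P : Measure Ω} {F G : Ω → ℂ}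
    (hF : ∀ p : ℝ≥0∞, p ≠ ∞ → MemLp F p P) (hG : ∀ p : ℝ≥0∞, p ≠ ∞ → MemLp G p P)
    (p : ℝ≥0∞) (hp : p ≠ ∞) : MemLp (fun ω => F ω * G ω) p P := by
  have h2 : p * 2 ≠ ∞ := ENNReal.mul_ne_top hp (by norm_num)
  have : ENNReal.HolderTriple (p * 2) (p * 2) p := by
    constructor
    rw [ENNReal.mul_inv (Or.inr (by norm_num)) (Or.inr (by norm_num)), ← mul_add,
      ENNReal.inv_two_add_inv_two, mul_one]
  exact (hG _ h2).mul' (hF _ h2)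

theorem memLp_pow_all {P : Measure Ω} [IsProbabilityMeasure P] {F : Ω → ℂ}
    (hF : ∀ p : ℝ≥0∞, p ≠ ∞ → MemLp F p P) (k : ℕ)
    (p : ℝ≥0∞) (hp : p ≠ ∞) : MemLp (fun ω => F ω ^ k) p P := by
  induction k generalizing p with
  | zero => simpa using memLp_const (1 : ℂ)
  | succ k ih => simpa [pow_succ] using memLp_mul_all ih hF p hp

theorem memLp_prod_all {P : Measure Ω} [IsProbabilityMeasure P] {α : Type*} (s : Finset α)
    (F : α → Ω → ℂ) (hF : ∀ a, ∀ p : ℝ≥0∞, p ≠ ∞ → MemLp (F a) p P)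
    (p : ℝ≥0∞) (hp : p ≠ ∞) : MemLp (fun ω => ∏ a ∈ s, F a ω) p P := by
  classical
  induction s using Finset.induction_on generalizing p with
  | empty => simpa using memLp_const (1 : ℂ)
  | insert a s ha ih => simpa [Finset.prod_insert ha] using memLp_mul_all (hF a) ih p hp

theorem memLp_complexHermite {P : Measure Ω} [IsProbabilityMeasure P] {F : Ω → ℂ}
    (hF : ∀ p : ℝ≥0∞, p ≠ ∞ → MemLp F p P) (m n : ℕ) (ρ : ℝ)
    (p : ℝ≥0∞) (hp : p ≠ ∞) : MemLp (fun ω => complexHermite m n (F ω) ρ) p P := by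
  have hconj : ∀ p : ℝ≥0∞, p ≠ ∞ → MemLp (fun ω => conj (F ω)) p P := fun p hp => (hF p hp).star
  refine memLp_finsetSum _ fun r _ => ?_
  have h := (memLp_mul_all (memLp_pow_all hF (m - r)) (memLp_pow_all hconj (n - r)) p hp).const_mul
    ((-1 : ℂ) ^ r * (r.factorial : ℂ) * (m.choose r : ℂ) * (n.choose r : ℂ) * (ρ : ℂ) ^ r)
  convert h using 2 with ω
  ring

theorem memLp_fourierHermite {Z : H → Ω → ℂ} {P : Measure Ω} (hZ : IsComplexIsonormal Z P)
    (e : ι → H) {m n : ℕ} (x : (Fin m → ι) × (Fin n → ι)) :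
    MemLp (fourierHermite Z e x) 2 P := by
  have := hZ.gaussian.isProbabilityMeasure
  refine memLp_prod_all _ _ (fun i => memLp_complexHermite (fun p hp => ?_) _ _ 1) 2 (by norm_num)
  exact (hZ.gaussian.hasGaussianLaw_eval (e i)).memLp hp

/-- The complex multiple Wiener–Itô integral `I_{m,n}(f) ∈ L²(Ω)` of the kernel
`f = ∑ f(j, k) e_{j 1} ⊗ ⋯ ⊗ e_{j m} ⊗ conj e_{k 1} ⊗ ⋯ ⊗ conj e_{k n}`: the sum in `L²(Ω)` of the
(unconditionally convergent) series of the integrals of its terms. -/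
def multipleIntegral {Z : H → Ω → ℂ} {P : Measure Ω} (hZ : IsComplexIsonormal Z P)
    (e : HilbertBasis ι ℂ H) {m n : ℕ} (f : Kernel ι m n) : Lp ℂ 2 P :=
  ∑' x : (Fin m → ι) × (Fin n → ι), f x • (memLp_fourierHermite hZ e x).toLp

/-! ### The Malliavin derivative -/

/-- The Wirtinger derivative `∂f/∂z_i = (∂f/∂x_i - i ∂f/∂y_i) / 2`. -/
def wirtinger {N : ℕ} (f : (Fin N → ℂ) → ℂ) (i : Fin N) (z : Fin N → ℂ) : ℂ :=
  (1 / 2 : ℂ) * (fderiv ℝ f z (Pi.single i 1) - Complex.I * fderiv ℝ f z (Pi.single i Complex.I))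

/-- `G = g(Z(φ_1), …, Z(φ_N))` is a smooth random variable (`g` is smooth and `g` and all its
partial derivatives have polynomial growth) and `V = ∑ ∂_i g(Z(φ_1), …, Z(φ_N)) φ_i` is its
derivative `D G`. -/
def IsSmoothWithDeriv (Z : H → Ω → ℂ) (G : Ω → ℂ) (V : Ω → H) : Prop :=
  ∃ (N : ℕ) (φ : Fin N → H) (g : (Fin N → ℂ) → ℂ), Function.HasTemperateGrowth g ∧
    (∀ ω, G ω = g fun i => Z (φ i) ω) ∧
    ∀ ω, V ω = ∑ i, wirtinger g i (fun i => Z (φ i) ω) • φ i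

/-- `(F, U)` lies in the closure in `L²(Ω) × L²(Ω, H)` of the graph of `D` on smooth random
variables. -/
def HasMalliavinDeriv (Z : H → Ω → ℂ) (P : Measure Ω) (F : Ω → ℂ) (U : Lp H 2 P) : Prop :=
  ∀ ε : ℝ≥0∞, 0 < ε → ∃ (G : Ω → ℂ) (V : Ω → H), IsSmoothWithDeriv Z G V ∧
    eLpNorm (fun ω => F ω - G ω) 2 P < ε ∧ eLpNorm (fun ω => U ω - V ω) 2 P < ε

/-- `F` belongs to the domain `𝔻^{1,2}` of the closed operator `D`. -/
def MemMalliavinDomain (Z : H → Ω → ℂ) (P : Measure Ω) (F : Ω → ℂ) : Prop :=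
  MemLp F 2 P ∧ ∃ U : Lp H 2 P, HasMalliavinDeriv Z P F U

open Classical in
/-- The complex Malliavin derivative `D F ∈ L²(Ω, H)` of `F ∈ 𝔻^{1,2}` (and `0` if
`F ∉ 𝔻^{1,2}`). -/
def malliavinDeriv (Z : H → Ω → ℂ) (P : Measure Ω) (F : Ω → ℂ) : Lp H 2 P :=
  if h : MemMalliavinDomain Z P F then h.2.choose else 0

end Integral

/-- The variance `E|X - E X|²` of a complex random variable, as an extended nonnegative real. -/
def complexVariance {Ω : Type*} [MeasurableSpace Ω] (X : Ω → ℂ) (P : Measure Ω) : ℝ≥0∞ :=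
  ∫⁻ ω, ‖X ω - ∫ ω', X ω' ∂P‖ₑ ^ 2 ∂P

end ComplexWiener

end

/-!
The equivalence is proved through the cycle (i) ⇒ (ii) ⇒ (iii) ⇒ (iv) ⇒ (v') ⇔ (v), (v') ⇒ (i).

Everything about multiple integrals is reduced to finitely many variables `Z(e_i)`, where a
multiple integral is a Wick polynomial: the Wick map `wick` on polynomials in `z` and `conj z`
sends monomials to products of complex Hermite polynomials, it commutes with derivatives, and it
turns multiplication by a variable into multiplication minus differentiation in the conjugate
variable (`wick_X_mul`). Induction on words then gives the product formula (`wick_word_mul_wick`)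
and, for any functional with the Gaussian integration by parts rule, the pairings of Wick powers.
The general statements follow by truncating kernels to finite sets of indices and passing to the
limit in `L²` (`ae_eq_of_tendsto_Lp`); this yields the isometry, the product formula
`multipleIntegral_mul`, moments of all orders (`exists_eLpNorm_le`), and the formulas expressing
`‖DF‖²`, `‖D conj F‖²` and `⟨DF, D conj F⟩` as sums of multiple integrals of contractions weighted
by their orders (`inner_malliavinDeriv_revConj_left`).

* (i) ⇒ (ii): the eighth moments of `F_k` are bounded, so the fourth moments converge to that of
  the Gaussian limit (`tendsto_integral_norm_pow_four`).
* (ii) ⇒ (iii): `E|F|⁴` is the squared norm of both `F F` and `F conj F`. Each product splits into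
  its top chaos and an orthogonal rest whose norm is at least that of the mean
  (`norm_sq_integral_add_le`). The squared norm of the top chaos `I(f ⊗ g)` dominates `m! n! p!
  q!` times the sum of the squared norms of all contractions of `f` with the reversed conjugate of
  `g` (`sum_norm_sq_contr₀_le`). The contractions of order zero and of full order account for `2
  (E|F|²)² + |E F²|²`, so the remaining contractions are bounded by the excess of the fourth
  moment (`sq_norm_contr₀_revConj_le`, `sq_norm_contr₀_le`).
* (iii) ⇒ (iv) ⇒ (v'): symmetrization does not increase norms, and the centred versions of the
  three weighted sums only contain multiple integrals of the contractions in question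
  (`tendsto_center_chaosSum`).
* (v') ⇒ (i): with `l = m + n`, integration by parts gives `l E[F Ψ] = (i/2) E[(2 conj ζ ⟨DF, D
  conj F⟩ + ζ (‖DF‖² + ‖D conj F‖²)) Ψ]` for `Ψ = exp(i Re(conj ζ F))` (`integral_mul_phase`).
  When the coefficients are asymptotically constant, this is a perturbed linear differential
  equation for the characteristic function along rays, which forces convergence to the Gaussian
  characteristic function (`tendsto_integral_phase`); Lévy's theorem concludes.
-/

set_option linter.unusedSectionVars false

noncomputable section

namespace ComplexWiener

/-! ### Complex Hermite polynomials in a commutative ring -/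

section Hermite

variable {R : Type*} [CommRing R]

/-- The complex Hermite polynomial `J_{a,b}` at `ρ = 1`, with `z` and its conjugate replaced by two
independent elements of a commutative ring. -/
def hermiteRing (a b : ℕ) (z w : R) : R :=
  ∑ r ∈ Finset.range (min a b + 1),
    (-1 : R) ^ r * (r.factorial : R) * (a.choose r : R) * (b.choose r : R) * z ^ (a - r) * w ^ (b - r)

theorem hermiteRing_eq_sum_range {a b N : ℕ} (hN : min a b + 1 ≤ N) (z w : R) :
    hermiteRing a b z w = ∑ r ∈ Finset.range N,
      (-1 : R) ^ r * (r.factorial : R) * (a.choose r : R) * (b.choose r : R) * z ^ (a - r) *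
        w ^ (b - r) := by
  refine Finset.sum_subset (Finset.range_mono hN) fun r _ hr => ?_
  have hr' : min a b < r := by
    rw [Finset.mem_range] at hr
    omega
  rcases min_lt_iff.1 hr' with h | h
  · simp [Nat.choose_eq_zero_of_lt h]
  · simp [Nat.choose_eq_zero_of_lt h]

theorem hermiteRing_swap (a b : ℕ) (z w : R) : hermiteRing a b z w = hermiteRing b a w z := by
  unfold hermiteRing
  rw [min_comm]
  exact Finset.sum_congr rfl fun r _ => by ring

theorem hermiteRing_zero_zero (z w : R) : hermiteRing 0 0 z w = 1 := by
  simp [hermiteRing]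

theorem hermiteRing_succ_left (a b : ℕ) (z w : R) :
    hermiteRing (a + 1) b z w = z * hermiteRing a b z w - b * hermiteRing a (b - 1) z w := by
  have e1 := hermiteRing_eq_sum_range (a := a + 1) (b := b) (N := a + 2 + 1) (by grind) z w
  have e2 := hermiteRing_eq_sum_range (a := a) (b := b) (N := a + 2 + 1) (by grind) z w
  have e3 := hermiteRing_eq_sum_range (a := a) (b := b - 1) (N := a + 2) (by grind) z w
  rw [e1, e2, e3, Finset.sum_range_succ', Finset.sum_range_succ' (n := a + 2), mul_add,
    Finset.mul_sum, Finset.mul_sum, add_sub_right_comm, ← Finset.sum_sub_distrib]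
  congr 1
  · refine Finset.sum_congr rfl fun r _ => ?_
    rcases b with _ | b
    · simp
    have hb : ((b + 1 : ℕ) : R) * (b.choose r : R) =
        ((b + 1).choose (r + 1) : R) * ((r + 1 : ℕ) : R) := by
      exact_mod_cast congrArg (Nat.cast (R := R)) (Nat.add_one_mul_choose_eq b r)
    rw [Nat.choose_succ_succ a r, Nat.factorial_succ]
    rcases le_or_gt (r + 1) a with hra | hra
    · obtain ⟨c, rfl⟩ := Nat.exists_eq_add_of_le hra
      have h1 : r + 1 + c + 1 - (r + 1) = c + 1 := by omega
      have h2 : r + 1 + c - (r + 1) = c := by omega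
      have h3 : r + 1 + c - r = c + 1 := by omega
      have h4 : b + 1 - 1 - r = b - r := by omega
      have h5 : b + 1 - (r + 1) = b - r := by omega
      rw [h1, h2, h3, h4, h5, Nat.add_sub_cancel]
      push_cast
      push_cast at hb
      linear_combination
        ((-1 : R) ^ r * (r.factorial : R) * ((r + 1 + c).choose r : R) * z ^ (c + 1) *
          w ^ (b - r)) * hb
    · have h4 : b + 1 - 1 - r = b + 1 - (r + 1) := by omega
      have h5 : a + 1 - (r + 1) = a - r := by omega
      rw [Nat.choose_eq_zero_of_lt hra, h4, h5, Nat.add_sub_cancel]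
      push_cast
      push_cast at hb
      linear_combination
        ((-1 : R) ^ r * (r.factorial : R) * (a.choose r : R) * z ^ (a - r) *
          w ^ (b - r)) * hb
  · simp
    ring

theorem hermiteRing_succ_right (a b : ℕ) (z w : R) :
    hermiteRing a (b + 1) z w = w * hermiteRing a b z w - a * hermiteRing (a - 1) b z w := by
  rw [hermiteRing_swap, hermiteRing_succ_left, hermiteRing_swap b a, hermiteRing_swap b (a - 1)]

/-- The partial derivative of `J_{a,b}` in its first variable is `a J_{a-1,b}`. -/
theorem derivation_hermiteRing_left {A : Type*} [CommRing A] [Algebra A R]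
    (D : Derivation A R R) (a b : ℕ) {z w : R} (hz : D z = 1) (hw : D w = 0) :
    D (hermiteRing a b z w) = a * hermiteRing (a - 1) b z w := by
  induction a generalizing b with
  | zero => simp [hermiteRing, hw]
  | succ a ih =>
    rw [hermiteRing_succ_left]
    simp only [map_sub, Derivation.leibniz, smul_eq_mul, ih, hz, Derivation.map_natCast]
    rcases a with _ | a
    · simp
    · rw [Nat.add_sub_cancel, Nat.add_sub_cancel, hermiteRing_succ_left a b]
      push_cast
      ring

theorem derivation_hermiteRing_right {A : Type*} [CommRing A] [Algebra A R]
    (D : Derivation A R R) (a b : ℕ) {z w : R} (hz : D z = 0) (hw : D w = 1) :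
    D (hermiteRing a b z w) = b * hermiteRing a (b - 1) z w := by
  rw [hermiteRing_swap, derivation_hermiteRing_left D b a hw hz, hermiteRing_swap]

theorem map_hermiteRing {S : Type*} [CommRing S] (φ : R →+* S) (a b : ℕ) (z w : R) :
    φ (hermiteRing a b z w) = hermiteRing a b (φ z) (φ w) := by
  simp [hermiteRing]

theorem complexHermite_eq_hermiteRing (a b : ℕ) (z : ℂ) :
    complexHermite a b z 1 = hermiteRing a b z (conj z) := by
  simp [complexHermite, hermiteRing]

end Hermite

/-! ### Polynomials in the variables and their conjugates, and Wick powers -/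

section Wick

open MvPolynomial

variable {κ : Type*}

/-- Polynomials in the variables `z_x` (`X (inl x)`) and their formal conjugates (`X (inr x)`). -/
abbrev Poly (κ : Type*) := MvPolynomial (κ ⊕ κ) ℂ

variable [Fintype κ] [DecidableEq κ]

/-- Hermite polynomial in the variable `x` with exponents read off from `α`. -/
def siteHermite (α : κ ⊕ κ →₀ ℕ) (x : κ) : Poly κ :=
  hermiteRing (α (Sum.inl x)) (α (Sum.inr x)) (X (Sum.inl x)) (X (Sum.inr x))

/-- The Wick map `exp (-∑ ∂_x ∂̄_x)`, which sends a monomial to the product of complex Hermite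
polynomials with the same exponents. -/
def wick : Poly κ →ₗ[ℂ] Poly κ :=
  (basisMonomials (κ ⊕ κ) ℂ).constr ℂ fun α => ∏ x, siteHermite α x

theorem wick_monomial (α : κ ⊕ κ →₀ ℕ) :
    wick (monomial α (1 : ℂ)) = ∏ x, siteHermite α x := by
  have := (basisMonomials (κ ⊕ κ) ℂ).constr_basis ℂ (fun α => ∏ x, siteHermite α x) α
  simpa [wick] using this

theorem wick_one : wick (1 : Poly κ) = 1 := by
  rw [show (1 : Poly κ) = monomial 0 1 from rfl, wick_monomial]
  simp [siteHermite, hermiteRing_zero_zero]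

theorem prod_eq_mul_prod_erase (α : κ ⊕ κ →₀ ℕ) (x : κ) :
    ∏ y, siteHermite α y = siteHermite α x * ∏ y ∈ Finset.univ.erase x, siteHermite α y :=
  (Finset.mul_prod_erase _ _ (Finset.mem_univ x)).symm

theorem Derivation.prod_eq_zero {R A : Type*} [CommRing R] [CommRing A] [Algebra R A] {β : Type*}
    (D : Derivation R A A) (s : Finset β) (F : β → A) (h : ∀ b ∈ s, D (F b) = 0) :
    D (∏ b ∈ s, F b) = 0 := by
  classical
  induction s using Finset.induction_on with
  | empty => simp
  | insert b s hb ih =>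
    rw [Finset.prod_insert hb, Derivation.leibniz, h b (by simp),
      ih fun c hc => h c (by simp [hc])]
    simp

theorem pderiv_siteHermite_of_ne (α : κ ⊕ κ →₀ ℕ) {y : κ ⊕ κ} {x : κ} (hl : y ≠ Sum.inl x)
    (hr : y ≠ Sum.inr x) : pderiv y (siteHermite α x) = 0 := by
  simp [siteHermite, hermiteRing, Derivation.leibniz_pow, pderiv_X_of_ne hl.symm,
    pderiv_X_of_ne hr.symm, ← map_natCast (algebraMap ℂ (Poly κ)), -map_natCast]

theorem pderiv_prod_siteHermite (α : κ ⊕ κ →₀ ℕ) (y : κ ⊕ κ) (x : κ)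
    (h : y = Sum.inl x ∨ y = Sum.inr x) :
    pderiv y (∏ y ∈ Finset.univ.erase x, siteHermite α y) = 0 := by
  refine Derivation.prod_eq_zero _ _ _ fun x' hx' => ?_
  have hne : x' ≠ x := (Finset.mem_erase.1 hx').1
  refine pderiv_siteHermite_of_ne α ?_ ?_ <;> rcases h with rfl | rfl <;> simp [hne.symm]

theorem prod_erase_congr {α β : κ ⊕ κ →₀ ℕ} {x : κ}
    (h : ∀ x', x' ≠ x → α (Sum.inl x') = β (Sum.inl x') ∧ α (Sum.inr x') = β (Sum.inr x')) :
    ∏ y ∈ Finset.univ.erase x, siteHermite α y = ∏ y ∈ Finset.univ.erase x, siteHermite β y := by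
  refine Finset.prod_congr rfl fun x' hx' => ?_
  have := h x' (Finset.mem_erase.1 hx').1
  simp [siteHermite, this.1, this.2]

theorem pderiv_wick_monomial (y : κ ⊕ κ) (α : κ ⊕ κ →₀ ℕ) :
    pderiv y (wick (monomial α (1 : ℂ))) = wick (pderiv y (monomial α 1)) := by
  have key (β : κ ⊕ κ →₀ ℕ) (x : κ) (hy : y = Sum.inl x ∨ y = Sum.inr x)
      (hβ : ∀ x', x' ≠ x → α (Sum.inl x') = β (Sum.inl x') ∧ α (Sum.inr x') = β (Sum.inr x'))
      (h : pderiv y (siteHermite α x) = ((α y : ℕ) : ℂ) • siteHermite β x) :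
      pderiv y (∏ x, siteHermite α x) = ((α y : ℕ) : ℂ) • ∏ x, siteHermite β x := by
    rw [prod_eq_mul_prod_erase α x, prod_eq_mul_prod_erase β x, Derivation.leibniz,
      pderiv_prod_siteHermite α _ x hy, smul_zero, zero_add, h, smul_eq_mul, mul_comm,
      prod_erase_congr hβ, smul_mul_assoc]
  have hm : (monomial (α - fun₀ | y => 1)) (1 * ((α y : ℕ) : ℂ)) =
    ((α y : ℕ) : ℂ) • monomial (α - fun₀ | y => 1) (1 : ℂ) := by simp [smul_monomial]
  rw [pderiv_monomial, hm, map_smul, wick_monomial, wick_monomial]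
  rcases y with x | x
  · refine key _ x (by simp) (fun x' hx' => by simp [hx'.symm]) ?_
    simp only [siteHermite]
    rw [derivation_hermiteRing_left _ _ _ (by simp) (by simp)]
    simp [Algebra.smul_def]
  · refine key _ x (by simp) (fun x' hx' => by simp [hx'.symm]) ?_
    simp only [siteHermite]
    rw [derivation_hermiteRing_right _ _ _ (by simp) (by simp)]
    simp [Algebra.smul_def]

theorem pderiv_wick (y : κ ⊕ κ) (p : Poly κ) : pderiv y (wick p) = wick (pderiv y p) := by
  have : (pderiv y).toLinearMap ∘ₗ wick = wick ∘ₗ (pderiv y : Derivation ℂ (Poly κ) (Poly κ)).toLinearMap :=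
    (basisMonomials (κ ⊕ κ) ℂ).ext fun α => by simpa using pderiv_wick_monomial y α
  exact LinearMap.congr_fun this p

/-- Wick powers turn multiplication by a variable into multiplication by that variable minus
differentiation in the conjugate variable. -/
theorem wick_X_mul (y : κ ⊕ κ) (p : Poly κ) :
    wick (X y * p) = X y * wick p - wick (pderiv y.swap p) := by
  have : wick ∘ₗ LinearMap.mulLeft ℂ (X y) = LinearMap.mulLeft ℂ (X y) ∘ₗ wick -
      wick ∘ₗ (pderiv y.swap : Derivation ℂ (Poly κ) (Poly κ)).toLinearMap := by
    refine (basisMonomials (κ ⊕ κ) ℂ).ext fun α => ?_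
    simp only [coe_basisMonomials, LinearMap.comp_apply, LinearMap.mulLeft_apply,
      LinearMap.sub_apply, Derivation.coeFn_coe]
    have key (β : κ ⊕ κ →₀ ℕ) (x : κ) (hy : y.swap = Sum.inl x ∨ y.swap = Sum.inr x)
        (hβ : ∀ x', x' ≠ x → α (Sum.inl x') = β (Sum.inl x') ∧ α (Sum.inr x') = β (Sum.inr x'))
        (h : siteHermite β x = X y * siteHermite α x - pderiv y.swap (siteHermite α x)) :
        ∏ x, siteHermite β x = X y * ∏ x, siteHermite α x -
          pderiv y.swap (∏ x, siteHermite α x) := by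
      rw [prod_eq_mul_prod_erase α x, prod_eq_mul_prod_erase β x, Derivation.leibniz,
        pderiv_prod_siteHermite α _ x hy, smul_zero, zero_add, h, smul_eq_mul,
        prod_erase_congr hβ]
      ring
    have hm : X y * monomial α (1 : ℂ) = monomial (α + Finsupp.single y 1) 1 := by
      rw [X, monomial_mul, one_mul, add_comm]
    rw [← pderiv_wick, hm, wick_monomial, wick_monomial]
    rcases y with x | x
    · refine key _ x (by simp) (fun x' hx' => by simp [hx'.symm]) ?_
      simp only [siteHermite, Sum.swap_inl]
      rw [derivation_hermiteRing_right _ _ _ (by simp) (by simp)]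
      simpa using hermiteRing_succ_left _ _ _ _
    · refine key _ x (by simp) (fun x' hx' => by simp [hx'.symm]) ?_
      simp only [siteHermite, Sum.swap_inr]
      rw [derivation_hermiteRing_left _ _ _ (by simp) (by simp)]
      simpa using hermiteRing_succ_right _ _ _ _
  exact LinearMap.congr_fun this p

end Wick

/-! ### Exponentials of contraction operators -/

section ExpSum

variable {A : Type*} [Ring A] [Algebra ℂ A]

/-- The truncated exponential series `∑_{i < N} T^i / i!`. -/
def expSum (N : ℕ) (T : A) : A := ∑ i ∈ Finset.range N, ((i.factorial : ℂ)⁻¹) • T ^ i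

theorem mul_pow_succ_of_commutator {R T S : A} (h : R * T = T * R + S) (hS : S * T = T * S) (i : ℕ) :
    R * T ^ (i + 1) = T ^ (i + 1) * R + ((i + 1 : ℕ) : ℂ) • (T ^ i * S) := by
  induction i with
  | zero => simp [h]
  | succ i ih =>
    have hc : S * T ^ (i + 1) = T ^ (i + 1) * S := (Commute.pow_right hS (i + 1)).eq
    calc R * T ^ (i + 1 + 1) = (R * T) * T ^ (i + 1) := by rw [pow_succ' T (i + 1), mul_assoc]
      _ = T * (R * T ^ (i + 1)) + S * T ^ (i + 1) := by rw [h, add_mul, mul_assoc]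
      _ = T * (T ^ (i + 1) * R + ((i + 1 : ℕ) : ℂ) • (T ^ i * S)) + T ^ (i + 1) * S := by
        rw [ih, hc]
      _ = T ^ (i + 1 + 1) * R + ((i + 1 + 1 : ℕ) : ℂ) • (T ^ (i + 1) * S) := by
        rw [mul_add, mul_smul_comm, ← mul_assoc, ← mul_assoc, ← pow_succ', ← pow_succ', add_assoc]
        push_cast
        module

/-- If the commutator `S` of `R` with `T` commutes with `T`, then the commutator of `R` with
`exp T` is `(exp T) S`. -/
theorem mul_expSum_of_commutator {R T S : A} (h : R * T = T * R + S) (hS : S * T = T * S) (N : ℕ) :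
    R * expSum (N + 1) T = expSum (N + 1) T * R + expSum N T * S := by
  have h1 : expSum (N + 1) T = ∑ i ∈ Finset.range N, (((i + 1).factorial : ℂ)⁻¹) • T ^ (i + 1) + 1 := by
    rw [expSum, Finset.sum_range_succ']
    simp
  rw [h1, mul_add, add_mul, Finset.mul_sum, Finset.sum_mul, mul_one, one_mul, expSum,
    Finset.sum_mul, add_right_comm, ← Finset.sum_add_distrib]
  congr 1
  refine Finset.sum_congr rfl fun i _ => ?_
  rw [mul_smul_comm, mul_pow_succ_of_commutator h hS, smul_add, smul_mul_assoc, smul_mul_assoc,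
    smul_smul]
  congr 2
  rw [Nat.factorial_succ]
  push_cast
  have : (i : ℂ) + 1 ≠ 0 := by exact_mod_cast i.succ_ne_zero
  field_simp

theorem commute_expSum {R T : A} (h : Commute R T) (N : ℕ) : Commute R (expSum N T) :=
  Commute.sum_right _ _ _ fun _ _ => (h.pow_right _).smul_right _

theorem mul_expSum_mul_expSum {R T T' S : A} (h : R * T = T * R + S) (hS : Commute S T)
    (hR : Commute R T') (hS' : Commute S T') (N M : ℕ) :
    R * (expSum (N + 1) T * expSum M T') =
      expSum (N + 1) T * expSum M T' * R + expSum N T * expSum M T' * S := by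
  rw [← mul_assoc, mul_expSum_of_commutator h hS.eq N, add_mul, mul_assoc, mul_assoc,
    (commute_expSum hR M).eq, (commute_expSum hS' M).eq, mul_assoc, mul_assoc]

theorem mul_expSum_mul_expSum' {R T T' S : A} (h : R * T' = T' * R + S) (hS : Commute S T')
    (hR : Commute R T) (N M : ℕ) :
    R * (expSum N T * expSum (M + 1) T') =
      expSum N T * expSum (M + 1) T' * R + expSum N T * expSum M T' * S := by
  rw [← mul_assoc, (commute_expSum hR N).eq, mul_assoc, mul_expSum_of_commutator h hS.eq M,
    mul_add, mul_assoc, mul_assoc]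

end ExpSum

section Contraction

open MvPolynomial

variable {κ : Type*} [Fintype κ] [DecidableEq κ] {V : Type*} [AddCommGroup V] [Module ℂ V]

/-- Differentiation with respect to the variable `y`, as a linear map. -/
abbrev diff (y : κ ⊕ κ) : Poly κ →ₗ[ℂ] Poly κ :=
  (pderiv y : Derivation ℂ (Poly κ) (Poly κ)).toLinearMap

/-- Bilinear maps on polynomials. -/
abbrev Bilin (κ V : Type*) [AddCommGroup V] [Module ℂ V] := Poly κ →ₗ[ℂ] Poly κ →ₗ[ℂ] V

/-- The operator which differentiates the first argument in `s x` and the second one in the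
conjugate variable, and sums over `x`. -/
def contr (s : κ → κ ⊕ κ) : Module.End ℂ (Bilin κ V) where
  toFun φ := ∑ x, φ.compl₁₂ (diff (s x)) (diff (s x).swap)
  map_add' φ ψ := by
    rw [← Finset.sum_add_distrib]
    rfl
  map_smul' c φ := by
    rw [RingHom.id_apply, Finset.smul_sum]
    rfl

theorem contr_apply (s : κ → κ ⊕ κ) (φ : Bilin κ V) (p q : Poly κ) :
    contr s φ p q = ∑ x, φ (pderiv (s x) p) (pderiv (s x).swap q) := by
  simp [contr, LinearMap.sum_apply]

/-- Composition of the first argument with multiplication by the variable `y`. -/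
def mulFst (y : κ ⊕ κ) : Module.End ℂ (Bilin κ V) where
  toFun φ := φ ∘ₗ LinearMap.mulLeft ℂ (X y)
  map_add' _ _ := rfl
  map_smul' _ _ := rfl

/-- Composition of the second argument with differentiation in the variable `y`. -/
def diffSnd (y : κ ⊕ κ) : Module.End ℂ (Bilin κ V) where
  toFun φ := φ.compl₂ (diff y)
  map_add' _ _ := rfl
  map_smul' _ _ := rfl

theorem mulFst_apply (y : κ ⊕ κ) (φ : Bilin κ V) (p q : Poly κ) :
    mulFst y φ p q = φ (X y * p) q := rfl

theorem diffSnd_apply (y : κ ⊕ κ) (φ : Bilin κ V) (p q : Poly κ) :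
    diffSnd y φ p q = φ p (pderiv y q) := rfl

theorem pderiv_comm (y y' : κ ⊕ κ) (p : Poly κ) :
    pderiv y (pderiv y' p) = pderiv y' (pderiv y p) := by
  have h : ⁅(pderiv y : Derivation ℂ (Poly κ) (Poly κ)),
      (pderiv y' : Derivation ℂ (Poly κ) (Poly κ))⁆ = 0 := by
    refine MvPolynomial.derivation_ext (R := ℂ) fun z => ?_
    rw [Derivation.commutator_apply, pderiv_X, pderiv_X]
    simp only [Pi.single_apply]
    split_ifs <;> simp
  have := congrArg (fun D => D p) h
  simpa [Derivation.commutator_apply, sub_eq_zero] using this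

theorem commute_diffSnd_contr (s : κ → κ ⊕ κ) (y : κ ⊕ κ) :
    Commute (diffSnd y : Module.End ℂ (Bilin κ V)) (contr s) := by
  rw [commute_iff_eq]
  ext1 φ
  refine LinearMap.ext₂ fun p q => ?_
  rw [Module.End.mul_apply, Module.End.mul_apply, diffSnd_apply, contr_apply, contr_apply]
  exact Finset.sum_congr rfl fun x _ => by rw [diffSnd_apply, pderiv_comm]

theorem pderiv_X_mul (y y' : κ ⊕ κ) (p : Poly κ) :
    pderiv y (X y' * p) = X y' * pderiv y p + if y = y' then p else 0 := by
  rw [Derivation.leibniz, pderiv_X, Pi.single_apply]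
  split_ifs with h h' h' <;> simp_all

theorem mulFst_mul_contr (s : κ → κ ⊕ κ) (hs : Function.Injective s) (x : κ) :
    (mulFst (s x) * contr s : Module.End ℂ (Bilin κ V)) =
      contr s * mulFst (s x) + diffSnd (s x).swap := by
  ext1 φ
  refine LinearMap.ext₂ fun p q => ?_
  rw [LinearMap.add_apply, LinearMap.add_apply, LinearMap.add_apply, Module.End.mul_apply,
    Module.End.mul_apply, mulFst_apply, contr_apply, contr_apply, diffSnd_apply]
  simp only [pderiv_X_mul, map_add, LinearMap.add_apply, Finset.sum_add_distrib, mulFst_apply,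
    hs.eq_iff]
  congr 1
  rw [Finset.sum_eq_single x] <;> simp +contextual

theorem commute_mulFst_contr (s : κ → κ ⊕ κ) (y : κ ⊕ κ) (hy : ∀ x, s x ≠ y) :
    Commute (mulFst y : Module.End ℂ (Bilin κ V)) (contr s) := by
  rw [commute_iff_eq]
  ext1 φ
  refine LinearMap.ext₂ fun p q => ?_
  rw [Module.End.mul_apply, Module.End.mul_apply, mulFst_apply, contr_apply, contr_apply]
  simp [hy, mulFst_apply]

theorem commute_contr (s s' : κ → κ ⊕ κ) :
    Commute (contr s : Module.End ℂ (Bilin κ V)) (contr s') := by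
  rw [commute_iff_eq]
  ext1 φ
  refine LinearMap.ext₂ fun p q => ?_
  rw [Module.End.mul_apply, Module.End.mul_apply]
  simp only [contr_apply]
  rw [Finset.sum_comm]
  refine Finset.sum_congr rfl fun x _ => Finset.sum_congr rfl fun x' _ => ?_
  rw [pderiv_comm, pderiv_comm (s x').swap]

/-- The truncated exponential of the total contraction operator, the sum of
`(contr inl)^i (contr inr)^j / (i! j!)` over `i < N` and `j < M`. -/
def expContr (N M : ℕ) : Module.End ℂ (Bilin κ V) :=
  expSum N (contr Sum.inl) * expSum M (contr Sum.inr)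

theorem expContr_apply (N M : ℕ) (φ : Bilin κ V) (p q : Poly κ) :
    expContr N M φ p q = ∑ i ∈ Finset.range N, ∑ j ∈ Finset.range M,
      ((i.factorial : ℂ)⁻¹ * (j.factorial : ℂ)⁻¹) •
        ((contr Sum.inl ^ i) ((contr Sum.inr ^ j) φ)) p q := by
  simp [expContr, expSum, Finset.sum_mul_sum, LinearMap.sum_apply, smul_smul, mul_comm]

theorem commute_diffSnd_expContr (N M : ℕ) (y : κ ⊕ κ) :
    Commute (diffSnd y : Module.End ℂ (Bilin κ V)) (expContr N M) :=
  (commute_expSum (commute_diffSnd_contr _ y) N).mul_right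
    (commute_expSum (commute_diffSnd_contr _ y) M)

theorem expContr_diffSnd (N M : ℕ) (y : κ ⊕ κ) (φ : Bilin κ V) (p q : Poly κ) :
    expContr N M (diffSnd y φ) p q = expContr N M φ p (pderiv y q) := by
  have := LinearMap.congr_fun (commute_diffSnd_expContr (V := V) N M y).eq φ
  exact (LinearMap.congr_fun₂ this p q).symm

/-- A new plain variable in the first argument is either kept or contracted against a conjugate
variable of the second argument. -/
theorem expContr_X_inl_mul (N M : ℕ) (x : κ) (φ : Bilin κ V) (p q : Poly κ) :
    expContr (N + 1) M φ (X (Sum.inl x) * p) q =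
      expContr (N + 1) M (mulFst (Sum.inl x) φ) p q +
        expContr N M φ p (pderiv (Sum.inr x) q) := by
  have h := mul_expSum_mul_expSum (A := Module.End ℂ (Bilin κ V)) (mulFst_mul_contr (V := V) Sum.inl Sum.inl_injective x)
    (commute_diffSnd_contr (V := V) Sum.inl (Sum.inr x))
    (commute_mulFst_contr (V := V) Sum.inr (Sum.inl x) fun _ => Sum.inr_ne_inl)
    (commute_diffSnd_contr (V := V) Sum.inr (Sum.inr x)) N M
  have h' := LinearMap.congr_fun₂ (LinearMap.congr_fun h φ) p q
  rw [← expContr_diffSnd]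
  simpa only [LinearMap.add_apply, Module.End.mul_apply] using! h'

theorem expContr_X_inr_mul (N M : ℕ) (x : κ) (φ : Bilin κ V) (p q : Poly κ) :
    expContr N (M + 1) φ (X (Sum.inr x) * p) q =
      expContr N (M + 1) (mulFst (Sum.inr x) φ) p q +
        expContr N M φ p (pderiv (Sum.inl x) q) := by
  have h := mul_expSum_mul_expSum' (A := Module.End ℂ (Bilin κ V)) (mulFst_mul_contr (V := V) Sum.inr Sum.inr_injective x)
    (commute_diffSnd_contr (V := V) Sum.inr (Sum.inl x))
    (commute_mulFst_contr (V := V) Sum.inl (Sum.inr x) fun _ => Sum.inl_ne_inr) N M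
  have h' := LinearMap.congr_fun₂ (LinearMap.congr_fun h φ) p q
  rw [← expContr_diffSnd]
  simpa only [LinearMap.add_apply, Module.End.mul_apply] using! h'

theorem contr_pow_succ_one (s : κ → κ ⊕ κ) (i : ℕ) (φ : Bilin κ V) (q : Poly κ) :
    (contr s ^ (i + 1)) φ 1 q = 0 := by
  rw [pow_succ', Module.End.mul_apply, contr_apply]
  simp

theorem contr_pow_comm (s s' : κ → κ ⊕ κ) (i j : ℕ) (φ : Bilin κ V) :
    (contr s ^ i) ((contr s' ^ j) φ) = (contr s' ^ j) ((contr s ^ i) φ) := by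
  rw [← Module.End.mul_apply, ← Module.End.mul_apply]
  congr 1
  exact (commute_contr s s').pow_pow i j

theorem expContr_one (N M : ℕ) (φ : Bilin κ V) (q : Poly κ) :
    expContr (N + 1) (M + 1) φ 1 q = φ 1 q := by
  rw [expContr_apply, Finset.sum_range_succ', Finset.sum_range_succ']
  have h1 : ∀ i ∈ Finset.range N, ∑ j ∈ Finset.range (M + 1),
      (((i + 1).factorial : ℂ)⁻¹ * (j.factorial : ℂ)⁻¹) •
        ((contr Sum.inl ^ (i + 1)) ((contr Sum.inr ^ j) φ)) 1 q = 0 := fun i _ =>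
    Finset.sum_eq_zero fun j _ => by rw [contr_pow_succ_one, smul_zero]
  have h2 : ∀ j ∈ Finset.range M, (((0 : ℕ).factorial : ℂ)⁻¹ * ((j + 1).factorial : ℂ)⁻¹) •
        ((contr Sum.inl ^ 0) ((contr Sum.inr ^ (j + 1)) φ)) 1 q = 0 := fun j _ => by
    rw [contr_pow_comm, contr_pow_succ_one, smul_zero]
  rw [Finset.sum_eq_zero h1, Finset.sum_eq_zero h2]
  simp

/-- The product of the variables in `a` and of the conjugate variables in `b`. -/
def word (a b : Multiset κ) : Poly κ :=
  (a.map fun x => X (Sum.inl x)).prod * (b.map fun x => X (Sum.inr x)).prod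

theorem word_zero : word (0 : Multiset κ) 0 = 1 := by simp [word]

theorem word_cons_left (x : κ) (a b : Multiset κ) :
    word (x ::ₘ a) b = X (Sum.inl x) * word a b := by simp [word, mul_assoc]

theorem word_cons_right (x : κ) (a b : Multiset κ) :
    word a (x ::ₘ b) = X (Sum.inr x) * word a b := by simp [word, mul_left_comm]

theorem word_mul_word (a b a' b' : Multiset κ) :
    word a b * word a' b' = word (a + a') (b + b') := by
  simp [word]
  ring

/-- Induction on words. -/
theorem word_induction {Q : Multiset κ → Multiset κ → Prop} (h0 : Q 0 0)
    (hl : ∀ x a b, Q a b → Q (x ::ₘ a) b) (hr : ∀ x a b, Q a b → Q a (x ::ₘ b))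
    (a b : Multiset κ) : Q a b := by
  induction a using Multiset.induction_on with
  | empty =>
    induction b using Multiset.induction_on with
    | empty => exact h0
    | cons x b ih => exact hr x _ _ ih
  | cons x a ih => exact hl x _ _ ih

/-- Contractions commute with post-composition by a linear map. -/
theorem contr_pow_compr₂ {V' : Type*} [AddCommGroup V'] [Module ℂ V'] (s : κ → κ ⊕ κ) (i : ℕ)
    (φ : Bilin κ V) (T : V →ₗ[ℂ] V') :
    (contr s ^ i) (φ.compr₂ T) = ((contr s ^ i) φ).compr₂ T := by
  induction i with
  | zero => rfl
  | succ i ih =>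
    refine LinearMap.ext₂ fun p q => ?_
    rw [pow_succ', Module.End.mul_apply, ih, pow_succ', Module.End.mul_apply, contr_apply,
      LinearMap.compr₂_apply, contr_apply, map_sum]
    rfl

theorem expContr_compr₂ {V' : Type*} [AddCommGroup V'] [Module ℂ V'] (N M : ℕ)
    (φ : Bilin κ V) (T : V →ₗ[ℂ] V') (p q : Poly κ) :
    expContr N M (φ.compr₂ T) p q = T (expContr N M φ p q) := by
  simp only [expContr_apply, map_sum, map_smul, contr_pow_compr₂, LinearMap.compr₂_apply]

/-- The product formula for Wick powers. -/
theorem wick_word_mul_wick (a b : Multiset κ) (q : Poly κ) (N M : ℕ) (hN : a.card < N)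
    (hM : b.card < M) :
    wick (word a b) * wick q = wick (expContr N M (LinearMap.mul ℂ (Poly κ)) (word a b) q) := by
  have hmul (y : κ ⊕ κ) (N M : ℕ) (p q : Poly κ) :
      expContr N M (mulFst y (LinearMap.mul ℂ (Poly κ))) p q =
        X y * expContr N M (LinearMap.mul ℂ (Poly κ)) p q := by
    have h3 : mulFst y (LinearMap.mul ℂ (Poly κ)) =
        (LinearMap.mul ℂ (Poly κ)).compr₂ (LinearMap.mulLeft ℂ (X y)) :=
      LinearMap.ext₂ fun p q => mul_assoc _ _ _
    rw [h3, expContr_compr₂, LinearMap.mulLeft_apply]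
  -- The step from `p` to `X y * p`, where `B` is the exponential contraction of `p` and `q`.
  have step (q : Poly κ) (y : κ ⊕ κ) (p B B' : Poly κ) (h : wick p * wick q = wick B)
      (h' : wick p * wick (pderiv y.swap q) = wick B') :
      wick (X y * p) * wick q = wick (X y * B + B') := by
    have hd := congrArg (pderiv y.swap) h
    rw [Derivation.leibniz, pderiv_wick, pderiv_wick, pderiv_wick, smul_eq_mul, smul_eq_mul] at hd
    rw [wick_X_mul, map_add, wick_X_mul, ← hd, ← h, ← h']
    ring
  induction a, b using word_induction generalizing q N M with
  | h0 =>
    obtain ⟨N, rfl⟩ : ∃ N', N = N' + 1 := ⟨N - 1, by simp at hN; omega⟩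
    obtain ⟨M, rfl⟩ : ∃ M', M = M' + 1 := ⟨M - 1, by simp at hM; omega⟩
    rw [word_zero, expContr_one, wick_one, one_mul, LinearMap.mul_apply', one_mul]
  | hl x a b ih =>
    rw [Multiset.card_cons] at hN
    obtain ⟨N, rfl⟩ : ∃ N', N = N' + 1 := ⟨N - 1, by omega⟩
    rw [word_cons_left, expContr_X_inl_mul, hmul]
    exact step q _ _ _ _ (ih q _ _ (by omega) hM) (ih _ _ _ (by omega) hM)
  | hr x a b ih =>
    rw [Multiset.card_cons] at hM
    obtain ⟨M, rfl⟩ : ∃ N', M = N' + 1 := ⟨M - 1, by omega⟩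
    rw [word_cons_right, expContr_X_inr_mul, hmul]
    exact step q _ _ _ _ (ih q _ _ hN (by omega)) (ih _ _ _ hN (by omega))

end Contraction

/-! ### Symmetric kernels over a finite index set -/

section SymPoly

open MvPolynomial

/-- The multiset of the entries of a tuple. -/
def entries {κ : Type*} {m : ℕ} (j : Fin m → κ) : Multiset κ := Finset.univ.val.map j

theorem card_entries {κ : Type*} {m : ℕ} (j : Fin m → κ) : (entries j).card = m := by
  simp [entries]

theorem entries_zero {κ : Type*} (j : Fin 0 → κ) : entries j = 0 := by
  simp [entries]

theorem entries_insertNth {κ : Type*} {m : ℕ} (c : Fin (m + 1)) (x : κ) (j : Fin m → κ) :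
    entries (Fin.insertNth (α := fun _ => κ) c x j) = x ::ₘ entries j := by
  unfold entries
  rw [Fin.univ_succAbove _ c, Finset.cons_val, Multiset.map_cons, Finset.map_val, Multiset.map_map]
  simp [Function.comp_def]

theorem entries_append {κ : Type*} {m n : ℕ} (j : Fin m → κ) (k : Fin n → κ) :
    entries (Fin.append j k) = entries j + entries k := by
  induction n with
  | zero =>
    have : Fin.append j k = j := by
      rw [Subsingleton.elim k Fin.elim0, Fin.append_elim0]; rfl
    exact (congrArg entries this).trans
      ((add_zero (entries j)).symm.trans (congrArg _ (entries_zero k).symm))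
  | succ n ih =>
    obtain ⟨⟨x, k⟩, rfl⟩ := (Fin.insertNthEquiv (fun _ => κ) (Fin.last n)).surjective k
    have : Fin.append j (Fin.insertNth (α := fun _ => κ) (Fin.last n) x k) =
        Fin.insertNth (α := fun _ => κ) (Fin.last (m + n)) x (Fin.append j k) := by
      rw [Fin.insertNth_last', Fin.insertNth_last', Fin.append_snoc]
    change entries (Fin.append j (Fin.insertNth (α := fun _ => κ) (Fin.last n) x k)) =
      entries j + entries (Fin.insertNth (α := fun _ => κ) (Fin.last n) x k)
    rw [this, entries_insertNth (Fin.last n), Multiset.add_cons, ← ih]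
    exact entries_insertNth _ _ _

theorem entries_comp_cast {κ : Type*} {m n : ℕ} (h : n = m) (j : Fin m → κ) :
    entries (fun x => j (Fin.cast h x)) = entries j := by
  subst h
  rfl

variable {κ : Type*} [Fintype κ] [DecidableEq κ]

theorem sum_insertNth {M : Type*} [AddCommMonoid M] {a : ℕ} (c : Fin (a + 1))
    (G : (Fin (a + 1) → κ) → M) :
    ∑ j, G j = ∑ x, ∑ j : Fin a → κ, G (Fin.insertNth (α := fun _ => κ) c x j) := by
  rw [← (Fin.insertNthEquiv (fun _ => κ) c).sum_comp, Fintype.sum_prod_type]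
  rfl

theorem sum_entries_succ {M : Type*} [AddCommMonoid M] (a : ℕ) (G : Multiset κ → M) :
    ∑ j : Fin (a + 1) → κ, G (entries j) = ∑ x, ∑ j : Fin a → κ, G (x ::ₘ entries j) := by
  simp only [sum_insertNth 0, entries_insertNth]

/-- Summing over the position of a fixed entry. -/
theorem sum_count_entries {M : Type*} [AddCommMonoid M] (a : ℕ) (x : κ) (G : Multiset κ → M) :
    ∑ j : Fin (a + 1) → κ, (entries j).count x • G (entries j) =
      (a + 1) • ∑ j : Fin a → κ, G (x ::ₘ entries j) := by
  have hcount (j : Fin (a + 1) → κ) :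
      (entries j).count x = ∑ c : Fin (a + 1), if x = j c then 1 else 0 := by
    rw [entries, Multiset.count_map, Finset.sum_boole]
    rfl
  simp only [hcount, Finset.sum_smul]
  rw [Finset.sum_comm]
  have hc (c : Fin (a + 1)) : ∑ j : Fin (a + 1) → κ, (if x = j c then 1 else 0) • G (entries j) =
      ∑ j : Fin a → κ, G (x ::ₘ entries j) := by
    simp only [sum_insertNth c, entries_insertNth, Fin.insertNth_apply_same]
    rw [Finset.sum_eq_single x] <;> simp +contextual [eq_comm]
  simp only [hc, Finset.sum_const, Finset.card_univ, Fintype.card_fin]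

theorem pderiv_inl_word (y : κ) (A B : Multiset κ) :
    pderiv (Sum.inl y) (word A B) = A.count y • word (A.erase y) B := by
  induction A using Multiset.induction_on with
  | empty =>
    induction B using Multiset.induction_on with
    | empty => simp [word_zero]
    | cons x B ih => simp [word_cons_right, ih]
  | cons x A ih =>
    rw [word_cons_left, pderiv_X_mul, ih]
    by_cases h : x = y
    · subst h
      by_cases hx : x ∈ A
      · rw [mul_smul_comm, ← word_cons_left, Multiset.cons_erase hx]
        simp [add_smul]
      · simp [Multiset.count_eq_zero_of_notMem hx]
    · rw [Multiset.count_cons_of_ne (Ne.symm h), Multiset.erase_cons_tail _ h, word_cons_left,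
        mul_smul_comm, if_neg (by simpa using Ne.symm h), add_zero]

theorem pderiv_inr_word (y : κ) (A B : Multiset κ) :
    pderiv (Sum.inr y) (word A B) = B.count y • word A (B.erase y) := by
  induction B using Multiset.induction_on with
  | empty =>
    induction A using Multiset.induction_on with
    | empty => simp [word_zero]
    | cons x B ih => simp [word_cons_left, ih]
  | cons x B ih =>
    rw [word_cons_right, pderiv_X_mul, ih]
    by_cases h : x = y
    · subst h
      by_cases hx : x ∈ B
      · rw [mul_smul_comm, ← word_cons_right, Multiset.cons_erase hx]
        simp [add_smul]
      · simp [Multiset.count_eq_zero_of_notMem hx]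
    · rw [Multiset.count_cons_of_ne (Ne.symm h), Multiset.erase_cons_tail _ h, word_cons_right,
        mul_smul_comm, if_neg (by simpa using Ne.symm h), add_zero]

/-- The polynomial `∑ φ(j; k) z_{j 1} ⋯ z_{j a} z̄_{k 1} ⋯ z̄_{k b}` of a kernel `φ`. -/
def tuplePoly {a b : ℕ} (φ : (Fin a → κ) × (Fin b → κ) → ℂ) : Poly κ :=
  ∑ x, φ x • word (entries x.1) (entries x.2)

/-- The polynomial of a symmetric kernel.  A symmetric kernel is encoded as a function of the
multisets of its plain and of its conjugate arguments, so that the number of arguments does not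
appear in its type. -/
def symPoly (a b : ℕ) (ψ : Multiset κ → Multiset κ → ℂ) : Poly κ :=
  tuplePoly fun x : (Fin a → κ) × (Fin b → κ) => ψ (entries x.1) (entries x.2)

/-- Fixing some of the arguments of a symmetric kernel. -/
def shift (ψ : Multiset κ → Multiset κ → ℂ) (A B : Multiset κ) : Multiset κ → Multiset κ → ℂ :=
  fun A' B' => ψ (A' + A) (B' + B)

theorem shift_zero (ψ : Multiset κ → Multiset κ → ℂ) : shift ψ 0 0 = ψ := by
  funext A B
  simp [shift]

theorem shift_shift (ψ : Multiset κ → Multiset κ → ℂ) (A B A' B' : Multiset κ) :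
    shift (shift ψ A B) A' B' = shift ψ (A' + A) (B' + B) := by
  funext A'' B''
  simp [shift, add_assoc]

theorem symPoly_eq (a b : ℕ) (ψ : Multiset κ → Multiset κ → ℂ) :
    symPoly a b ψ = ∑ j : Fin a → κ, ∑ k : Fin b → κ,
      ψ (entries j) (entries k) • word (entries j) (entries k) := by
  rw [symPoly, tuplePoly, Fintype.sum_prod_type]

theorem pderiv_inl_symPoly_zero (y : κ) (b : ℕ) (ψ : Multiset κ → Multiset κ → ℂ) :
    pderiv (Sum.inl y) (symPoly 0 b ψ) = 0 := by
  simp [symPoly_eq, pderiv_inl_word, entries_zero]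

theorem pderiv_inr_symPoly_zero (y : κ) (a : ℕ) (ψ : Multiset κ → Multiset κ → ℂ) :
    pderiv (Sum.inr y) (symPoly a 0 ψ) = 0 := by
  simp [symPoly_eq, pderiv_inr_word, entries_zero]

theorem pderiv_inl_symPoly_succ (y : κ) (a b : ℕ) (ψ : Multiset κ → Multiset κ → ℂ) :
    pderiv (Sum.inl y) (symPoly (a + 1) b ψ) =
      ((a + 1 : ℕ) : ℂ) • symPoly a b (shift ψ {y} 0) := by
  have h := sum_count_entries a y fun A : Multiset κ =>
    ∑ k : Fin b → κ, ψ A (entries k) • word (A.erase y) (entries k)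
  rw [symPoly_eq, symPoly_eq, Nat.cast_smul_eq_nsmul]
  simp only [map_sum, Derivation.map_smul, pderiv_inl_word]
  convert h using 1
  · refine Finset.sum_congr rfl fun j _ => ?_
    rw [Finset.smul_sum]
    exact Finset.sum_congr rfl fun k _ => smul_comm _ _ _
  · simp only [shift, add_comm _ {y}, Multiset.singleton_add, add_zero, Multiset.erase_cons_head]

theorem pderiv_inr_symPoly_succ (y : κ) (a b : ℕ) (ψ : Multiset κ → Multiset κ → ℂ) :
    pderiv (Sum.inr y) (symPoly a (b + 1) ψ) =
      ((b + 1 : ℕ) : ℂ) • symPoly a b (shift ψ 0 {y}) := by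
  rw [symPoly_eq, symPoly_eq, Nat.cast_smul_eq_nsmul, Finset.smul_sum]
  simp only [map_sum, Derivation.map_smul, pderiv_inr_word]
  refine Finset.sum_congr rfl fun j _ => ?_
  have h := sum_count_entries b y fun B : Multiset κ =>
    ψ (entries j) B • word (entries j) (B.erase y)
  convert h using 1
  · exact Finset.sum_congr rfl fun k _ => smul_comm _ _ _
  · simp only [shift, add_comm _ {y}, Multiset.singleton_add, add_zero, Multiset.erase_cons_head]

variable {V : Type*} [AddCommGroup V] [Module ℂ V]

/-- Repeated contraction of symmetric kernels: plain arguments of the first one against conjugate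
arguments of the second one. -/
theorem contr_inl_pow_symPoly (i m n p q : ℕ) (φ : Bilin κ V) (ψ γ : Multiset κ → Multiset κ → ℂ) :
    (contr Sum.inl ^ i) φ (symPoly m n ψ) (symPoly p q γ) =
      ((m.descFactorial i : ℂ) * (q.descFactorial i : ℂ)) • ∑ u : Fin i → κ,
        φ (symPoly (m - i) n (shift ψ (entries u) 0)) (symPoly p (q - i) (shift γ 0 (entries u))) := by
  induction i generalizing m q ψ γ with
  | zero => simp [entries_zero, shift_zero]
  | succ i ih =>
    rw [pow_succ', Module.End.mul_apply, contr_apply]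
    rcases m with _ | m
    · simp [pderiv_inl_symPoly_zero]
    rcases q with _ | q
    · simp [pderiv_inr_symPoly_zero]
    simp only [Sum.swap_inl, pderiv_inl_symPoly_succ, pderiv_inr_symPoly_succ, map_smul,
      LinearMap.smul_apply, ih, shift_shift, Nat.succ_descFactorial_succ, Nat.add_sub_add_right,
      smul_smul, ← Finset.smul_sum]
    rw [sum_entries_succ i fun A => φ (symPoly (m - i) n (shift ψ A 0))
      (symPoly p (q - i) (shift γ 0 A))]
    congr 1
    · push_cast
      ring
    · simp [← Multiset.singleton_add, add_comm]

theorem contr_inr_pow_symPoly (i m n p q : ℕ) (φ : Bilin κ V) (ψ γ : Multiset κ → Multiset κ → ℂ) :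
    (contr Sum.inr ^ i) φ (symPoly m n ψ) (symPoly p q γ) =
      ((n.descFactorial i : ℂ) * (p.descFactorial i : ℂ)) • ∑ v : Fin i → κ,
        φ (symPoly m (n - i) (shift ψ 0 (entries v))) (symPoly (p - i) q (shift γ (entries v) 0)) := by
  induction i generalizing n p ψ γ with
  | zero => simp [entries_zero, shift_zero]
  | succ i ih =>
    rw [pow_succ', Module.End.mul_apply, contr_apply]
    rcases n with _ | n
    · simp [pderiv_inr_symPoly_zero]
    rcases p with _ | p
    · simp [pderiv_inl_symPoly_zero]
    simp only [Sum.swap_inr, pderiv_inl_symPoly_succ, pderiv_inr_symPoly_succ, map_smul,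
      LinearMap.smul_apply, ih, shift_shift, Nat.succ_descFactorial_succ, Nat.add_sub_add_right,
      smul_smul, ← Finset.smul_sum]
    rw [sum_entries_succ i fun A => φ (symPoly m (n - i) (shift ψ 0 A))
      (symPoly (p - i) q (shift γ A 0))]
    congr 1
    · push_cast
      ring
    · simp [← Multiset.singleton_add, add_comm]

theorem contr_pow_symPoly (i j m n p q : ℕ) (φ : Bilin κ V) (ψ γ : Multiset κ → Multiset κ → ℂ) :
    (contr Sum.inl ^ i) ((contr Sum.inr ^ j) φ) (symPoly m n ψ) (symPoly p q γ) =
      ((m.descFactorial i : ℂ) * q.descFactorial i * n.descFactorial j * p.descFactorial j) •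
        ∑ u : Fin i → κ, ∑ v : Fin j → κ,
          φ (symPoly (m - i) (n - j) (shift ψ (entries u) (entries v)))
            (symPoly (p - j) (q - i) (shift γ (entries v) (entries u))) := by
  rw [contr_inl_pow_symPoly]
  simp only [contr_inr_pow_symPoly, shift_shift, ← Finset.smul_sum, smul_smul, zero_add, add_zero]
  congr 1
  ring

theorem wick_tuplePoly_mul_wick {m n : ℕ} (φ : (Fin m → κ) × (Fin n → κ) → ℂ) (q : Poly κ)
    (N M : ℕ) (hN : m < N) (hM : n < M) :
    wick (tuplePoly φ) * wick q =
      wick (expContr N M (LinearMap.mul ℂ (Poly κ)) (tuplePoly φ) q) := by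
  simp only [tuplePoly, map_sum, map_smul, LinearMap.sum_apply, LinearMap.smul_apply,
    Finset.sum_mul, smul_mul_assoc]
  refine Finset.sum_congr rfl fun x _ => ?_
  rw [wick_word_mul_wick _ _ q N M (by rwa [card_entries]) (by rwa [card_entries])]

theorem symPoly_mul_symPoly (a b a' b' : ℕ) (ψ γ : Multiset κ → Multiset κ → ℂ) :
    symPoly a b ψ * symPoly a' b' γ =
      tuplePoly fun x : (Fin (a + a') → κ) × (Fin (b + b') → κ) =>
        ψ (entries fun c => x.1 (Fin.castAdd a' c)) (entries fun c => x.2 (Fin.castAdd b' c)) *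
        γ (entries fun c => x.1 (Fin.natAdd a c)) (entries fun c => x.2 (Fin.natAdd b c)) := by
  rw [tuplePoly, Fintype.sum_prod_type, ← (Fin.appendEquiv a a').sum_comp,
    Fintype.sum_prod_type]
  have hinner (j : Fin a → κ) (j' : Fin a' → κ) (G : (Fin (b + b') → κ) → Poly κ) :
      ∑ k, G k = ∑ k : Fin b → κ, ∑ k' : Fin b' → κ, G (Fin.append k k') := by
    rw [← (Fin.appendEquiv b b').sum_comp, Fintype.sum_prod_type]
    rfl
  simp only [Fin.appendEquiv, Equiv.coe_fn_mk]
  rw [symPoly_eq, symPoly_eq, Finset.sum_mul_sum]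
  refine Finset.sum_congr rfl fun j _ => Finset.sum_congr rfl fun j' _ => ?_
  rw [hinner j j', Finset.sum_mul_sum]
  refine Finset.sum_congr rfl fun k _ => Finset.sum_congr rfl fun k' _ => ?_
  simp only [Fin.append_left, Fin.append_right, entries_append, ← word_mul_word, smul_mul_smul_comm]

/-- The contraction of two symmetric kernels over a finite index set. -/
def symContraction (m n p q i j : ℕ) (ψ γ : Multiset κ → Multiset κ → ℂ)
    (x : (Fin (m - i + (p - j)) → κ) × (Fin (n - j + (q - i)) → κ)) : ℂ :=
  ∑ u : Fin i → κ, ∑ v : Fin j → κ,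
    ψ ((entries fun c => x.1 (Fin.castAdd (p - j) c)) + entries u)
      ((entries fun c => x.2 (Fin.castAdd (q - i) c)) + entries v) *
    γ ((entries fun c => x.1 (Fin.natAdd (m - i) c)) + entries v)
      ((entries fun c => x.2 (Fin.natAdd (n - j) c)) + entries u)

theorem contr_pow_mul_symPoly (i j m n p q : ℕ) (ψ γ : Multiset κ → Multiset κ → ℂ) :
    (contr Sum.inl ^ i) ((contr Sum.inr ^ j) (LinearMap.mul ℂ (Poly κ))) (symPoly m n ψ)
        (symPoly p q γ) =
      ((m.descFactorial i : ℂ) * q.descFactorial i * n.descFactorial j * p.descFactorial j) •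
        tuplePoly (symContraction m n p q i j ψ γ) := by
  rw [contr_pow_symPoly]
  congr 1
  simp only [LinearMap.mul_apply', symPoly_mul_symPoly, tuplePoly, symContraction, Finset.sum_smul]
  simp only [shift]
  have h (u : Fin i → κ) := Finset.sum_comm (s := (Finset.univ : Finset (Fin j → κ)))
    (t := (Finset.univ : Finset ((Fin (m - i + (p - j)) → κ) × (Fin (n - j + (q - i)) → κ))))
    (f := fun v x => (ψ ((entries fun c => x.1 (Fin.castAdd (p - j) c)) + entries u)
      ((entries fun c => x.2 (Fin.castAdd (q - i) c)) + entries v) *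
    γ ((entries fun c => x.1 (Fin.natAdd (m - i) c)) + entries v)
      ((entries fun c => x.2 (Fin.natAdd (n - j) c)) + entries u)) • word (entries x.1) (entries x.2))
  simp only [h]
  rw [Finset.sum_comm]

/-- The coefficient `i! j! (m choose i) (q choose i) (n choose j) (p choose j)` of the product
formula for multiple integrals of orders `(m, n)` and `(p, q)`. -/
def productCoeff (m n p q i j : ℕ) : ℂ :=
  ((i.factorial : ℂ)⁻¹ * (j.factorial : ℂ)⁻¹) *
    ((m.descFactorial i : ℂ) * q.descFactorial i * n.descFactorial j * p.descFactorial j)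

/-- The product formula for symmetric kernels. -/
theorem wick_symPoly_mul_wick_symPoly (m n p q : ℕ) (ψ γ : Multiset κ → Multiset κ → ℂ) :
    wick (symPoly m n ψ) * wick (symPoly p q γ) =
      ∑ i ∈ Finset.range (m + 1), ∑ j ∈ Finset.range (n + 1),
        productCoeff m n p q i j • wick (tuplePoly (symContraction m n p q i j ψ γ)) := by
  have h := wick_tuplePoly_mul_wick
    (fun x : (Fin m → κ) × (Fin n → κ) => ψ (entries x.1) (entries x.2)) (symPoly p q γ)
    (m + 1) (n + 1) (by omega) (by omega)
  rw [← symPoly, expContr_apply] at h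
  rw [h, map_sum]
  refine Finset.sum_congr rfl fun i _ => ?_
  rw [map_sum]
  refine Finset.sum_congr rfl fun j _ => ?_
  rw [contr_pow_mul_symPoly, smul_smul, map_smul, productCoeff]

end SymPoly

/-! ### Gaussian functionals on polynomials -/

section Pairing

open MvPolynomial

variable {κ : Type*} [Fintype κ] [DecidableEq κ]

/-- The normalized linear functionals on polynomials satisfying the Gaussian integration by parts
rule; the expectation under a standard complex Gaussian law is one. -/
structure IsGaussianFunctional (L : Poly κ →ₗ[ℂ] ℂ) : Prop where
  map_one : L 1 = 1
  map_X_mul : ∀ y p, L (X y * p) = L (pderiv y.swap p)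

variable {L : Poly κ →ₗ[ℂ] ℂ}

/-- The pairing `E[wick p * wick q]`. -/
def pairing (L : Poly κ →ₗ[ℂ] ℂ) : Bilin κ ℂ :=
  ((LinearMap.mul ℂ (Poly κ)).compr₂ L).compl₁₂ wick wick

theorem pairing_apply (p q : Poly κ) : pairing L p q = L (wick p * wick q) := rfl

theorem IsGaussianFunctional.map_wick (hL : IsGaussianFunctional L) (p : Poly κ) :
    L (wick p) = constantCoeff p := by
  induction p using MvPolynomial.induction_on with
  | C a =>
    rw [show (C a : Poly κ) = a • 1 by rw [smul_eq_C_mul, mul_one], map_smul, wick_one, map_smul,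
      hL.map_one]
    simp [smul_eq_C_mul]
  | add p q hp hq => rw [map_add, map_add, map_add, hp, hq]
  | mul_X p y _ =>
    rw [mul_comm, wick_X_mul, map_sub, hL.map_X_mul, pderiv_wick, sub_self, map_mul,
      constantCoeff_X, zero_mul]

theorem IsGaussianFunctional.pairing_X_mul (hL : IsGaussianFunctional L) (y : κ ⊕ κ)
    (p q : Poly κ) : pairing L (X y * p) q = pairing L p (pderiv y.swap q) := by
  have h := hL.map_X_mul y (wick p * wick q)
  rw [pairing_apply, pairing_apply, wick_X_mul, sub_mul, map_sub, mul_assoc, h, Derivation.leibniz,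
    map_add, pderiv_wick, pderiv_wick, smul_eq_mul, smul_eq_mul, mul_comm (wick q)]
  ring

theorem constantCoeff_word {A B : Multiset κ} (h : ¬ (A.card = 0 ∧ B.card = 0)) :
    constantCoeff (word A B) = 0 := by
  induction A using Multiset.induction_on with
  | cons x A _ => rw [word_cons_left, map_mul, constantCoeff_X, zero_mul]
  | empty =>
    induction B using Multiset.induction_on with
    | cons x A _ => rw [word_cons_right, map_mul, constantCoeff_X, zero_mul]
    | empty => simp at h

theorem IsGaussianFunctional.pairing_word_symPoly (hL : IsGaussianFunctional L)
    (A B : Multiset κ) (p q : ℕ) (γ : Multiset κ → Multiset κ → ℂ) :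
    pairing L (word A B) (symPoly p q γ) =
      if A.card = q ∧ B.card = p then (p.factorial : ℂ) * q.factorial * γ B A else 0 := by
  induction A, B using word_induction generalizing p q γ with
  | h0 =>
    rw [word_zero, pairing_apply, wick_one, one_mul, hL.map_wick, symPoly, tuplePoly, map_sum]
    by_cases h : p = 0 ∧ q = 0
    · obtain ⟨rfl, rfl⟩ := h
      simp [entries_zero, word_zero, smul_eq_C_mul]
    · rw [if_neg (by simpa [eq_comm, and_comm] using h)]
      refine Finset.sum_eq_zero fun x _ => ?_
      rw [smul_eq_C_mul, map_mul, constantCoeff_word (by rwa [card_entries, card_entries]), mul_zero]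
  | hl x A B ih =>
    rw [word_cons_left, hL.pairing_X_mul, Sum.swap_inl, Multiset.card_cons]
    rcases q with _ | q
    · simp [pderiv_inr_symPoly_zero]
    rw [pderiv_inr_symPoly_succ, map_smul, ih, smul_eq_mul, mul_ite, mul_zero]
    simp only [add_left_inj, Nat.factorial_succ, shift, add_zero, add_comm A, Multiset.singleton_add]
    congr 1
    push_cast
    ring
  | hr x A B ih =>
    rw [word_cons_right, hL.pairing_X_mul, Sum.swap_inr, Multiset.card_cons]
    rcases p with _ | p
    · simp [pderiv_inl_symPoly_zero]
    rw [pderiv_inl_symPoly_succ, map_smul, ih, smul_eq_mul, mul_ite, mul_zero]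
    simp only [add_left_inj, Nat.factorial_succ, shift, add_zero, add_comm B, Multiset.singleton_add]
    congr 1
    push_cast
    ring

/-- The isometry formula, in bilinear form. -/
theorem IsGaussianFunctional.pairing_tuplePoly_symPoly (hL : IsGaussianFunctional L) {m n : ℕ}
    (φ : (Fin m → κ) × (Fin n → κ) → ℂ) (p q : ℕ) (γ : Multiset κ → Multiset κ → ℂ) :
    pairing L (tuplePoly φ) (symPoly p q γ) =
      if m = q ∧ n = p then (p.factorial : ℂ) * q.factorial *
        ∑ x, φ x * γ (entries x.2) (entries x.1) else 0 := by
  simp only [tuplePoly, map_sum, map_smul, LinearMap.sum_apply, LinearMap.smul_apply,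
    hL.pairing_word_symPoly, card_entries, smul_eq_mul]
  split_ifs
  · rw [Finset.mul_sum]
    exact Finset.sum_congr rfl fun x _ => by ring
  · simp

/-- The product of the pairings of `p` with `q'` and of `q` with `p'`, as a bilinear form in
`(p, p')` with values in bilinear forms in `(q, q')`. -/
def crossPairing (L : Poly κ →ₗ[ℂ] ℂ) : Bilin κ (Bilin κ ℂ) :=
  LinearMap.mk₂ ℂ (fun p p' => (LinearMap.mul ℂ ℂ).compl₁₂ ((pairing L).flip p') (pairing L p))
    (fun p₁ p₂ p' => LinearMap.ext₂ fun q q' => by simp [mul_add])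
    (fun c p p' => LinearMap.ext₂ fun q q' => by simp [mul_left_comm])
    (fun p p₁ p₂ => LinearMap.ext₂ fun q q' => by simp)
    (fun c p p' => LinearMap.ext₂ fun q q' => by simp [mul_assoc])

theorem crossPairing_apply (p p' q q' : Poly κ) :
    crossPairing L p p' q q' = pairing L q p' * pairing L p q' := rfl

theorem IsGaussianFunctional.mulFst_crossPairing_one (hL : IsGaussianFunctional L) (y : κ ⊕ κ)
    (p' : Poly κ) :
    mulFst y (crossPairing L 1 p') = crossPairing L 1 (pderiv y.swap p') :=
  LinearMap.ext₂ fun q q' => by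
    rw [mulFst_apply, crossPairing_apply, crossPairing_apply, hL.pairing_X_mul]

theorem IsGaussianFunctional.crossPairing_X_mul (hL : IsGaussianFunctional L) (y : κ ⊕ κ)
    (p p' : Poly κ) :
    crossPairing L (X y * p) p' = diffSnd y.swap (crossPairing L p p') :=
  LinearMap.ext₂ fun q q' => by
    rw [diffSnd_apply, crossPairing_apply, crossPairing_apply, hL.pairing_X_mul]

/-- The pairing of a word with a product is the sum over all ways of distributing the variables of
the word over the two factors. -/
theorem IsGaussianFunctional.pairing_word_mul (hL : IsGaussianFunctional L) (A B : Multiset κ)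
    (p' q' : Poly κ) (N M : ℕ) (hN : A.card < N) (hM : B.card < M) :
    pairing L (word A B) (p' * q') = expContr N M (crossPairing L 1 p') (word A B) q' := by
  induction A, B using word_induction generalizing p' q' N M with
  | h0 =>
    obtain ⟨N, rfl⟩ : ∃ k, N = k + 1 := ⟨N - 1, by simp at hN; omega⟩
    obtain ⟨M, rfl⟩ : ∃ k, M = k + 1 := ⟨M - 1, by simp at hM; omega⟩
    rw [word_zero, expContr_one, crossPairing_apply]
    simp only [pairing_apply, wick_one, one_mul, hL.map_wick, map_mul]
  | hl x A B ih =>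
    rw [Multiset.card_cons] at hN
    obtain ⟨N, rfl⟩ : ∃ k, N = k + 1 := ⟨N - 1, by omega⟩
    rw [word_cons_left, hL.pairing_X_mul, Derivation.leibniz, map_add, expContr_X_inl_mul,
      hL.mulFst_crossPairing_one,
      ← ih _ _ _ _ (by omega) hM, ← ih _ _ _ _ (by omega) hM, smul_eq_mul, smul_eq_mul, add_comm,
      mul_comm q', Sum.swap_inl]
  | hr x A B ih =>
    rw [Multiset.card_cons] at hM
    obtain ⟨M, rfl⟩ : ∃ k, M = k + 1 := ⟨M - 1, by omega⟩
    rw [word_cons_right, hL.pairing_X_mul, Derivation.leibniz, map_add, expContr_X_inr_mul,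
      hL.mulFst_crossPairing_one,
      ← ih _ _ _ _ hN (by omega), ← ih _ _ _ _ hN (by omega), smul_eq_mul, smul_eq_mul, add_comm,
      mul_comm q', Sum.swap_inr]

/-- The cross pairing of `p` with `q'` and of `q` with `p'`, after contraction of `q` with `q'`. -/
def doubleContr (L : Poly κ →ₗ[ℂ] ℂ) (N' M' : ℕ) : Bilin κ (Bilin κ ℂ) :=
  (crossPairing L).compr₂ (expContr N' M')

theorem doubleContr_apply (N' M' : ℕ) (p p' : Poly κ) :
    doubleContr L N' M' p p' = expContr N' M' (crossPairing L p p') := rfl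

theorem IsGaussianFunctional.expContr_mulFst_doubleContr (hL : IsGaussianFunctional L)
    (y : κ ⊕ κ) (N M N' M' : ℕ) (p p' q q' : Poly κ) :
    expContr N M (mulFst y (doubleContr L N' M')) p p' q q' =
      expContr N M (doubleContr L N' M') p p' q (pderiv y.swap q') := by
  have h : mulFst y (doubleContr L N' M') = (doubleContr L N' M').compr₂ (diffSnd y.swap) := by
    refine LinearMap.ext₂ fun p p' => LinearMap.ext₂ fun q q' => ?_
    rw [mulFst_apply, LinearMap.compr₂_apply, doubleContr_apply, doubleContr_apply,
      hL.crossPairing_X_mul, expContr_diffSnd, diffSnd_apply]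
  rw [h, expContr_compr₂, diffSnd_apply]

/-- The pairing of two products: the factors `p` and `p'` are contracted against each other by the
outer operator, `q` and `q'` by the inner one, and the remaining variables of `p` and `q'` and those
of `q` and `p'` are paired. -/
theorem IsGaussianFunctional.pairing_mul_mul (hL : IsGaussianFunctional L) (A B A' B' : Multiset κ)
    (p' q' : Poly κ) (N M N' M' : ℕ) (hN : A.card < N) (hM : B.card < M) (hN' : A'.card < N')
    (hM' : B'.card < M') :
    pairing L (word A B * word A' B') (p' * q') =
      expContr N M (doubleContr L N' M') (word A B) p' (word A' B') q' := by
  induction A, B using word_induction generalizing p' q' N M with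
  | h0 =>
    obtain ⟨N, rfl⟩ : ∃ k, N = k + 1 := ⟨N - 1, by simp at hN; omega⟩
    obtain ⟨M, rfl⟩ : ∃ k, M = k + 1 := ⟨M - 1, by simp at hM; omega⟩
    rw [word_zero, expContr_one, one_mul, doubleContr_apply,
      hL.pairing_word_mul A' B' p' q' N' M' hN' hM']
  | hl x A B ih =>
    rw [Multiset.card_cons] at hN
    obtain ⟨N, rfl⟩ : ∃ k, N = k + 1 := ⟨N - 1, by omega⟩
    rw [word_cons_left, mul_assoc, hL.pairing_X_mul, Derivation.leibniz, map_add,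
      expContr_X_inl_mul, LinearMap.add_apply, LinearMap.add_apply, hL.expContr_mulFst_doubleContr,
      ← ih _ _ _ _ (by omega) hM, ← ih _ _ _ _ (by omega) hM, smul_eq_mul, smul_eq_mul,
      mul_comm q', Sum.swap_inl]
  | hr x A B ih =>
    rw [Multiset.card_cons] at hM
    obtain ⟨M, rfl⟩ : ∃ k, M = k + 1 := ⟨M - 1, by omega⟩
    rw [word_cons_right, mul_assoc, hL.pairing_X_mul, Derivation.leibniz, map_add,
      expContr_X_inr_mul, LinearMap.add_apply, LinearMap.add_apply, hL.expContr_mulFst_doubleContr,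
      ← ih _ _ _ _ hN (by omega), ← ih _ _ _ _ hN (by omega), smul_eq_mul, smul_eq_mul,
      mul_comm q', Sum.swap_inr]

end Pairing

/-! ### Squared norms of products of Wick powers -/

section LowerBound

open MvPolynomial

variable {κ : Type*} [Fintype κ] [DecidableEq κ] {L : Poly κ →ₗ[ℂ] ℂ}

theorem IsGaussianFunctional.pairing_tuplePoly_mul (hL : IsGaussianFunctional L) {m n p q : ℕ}
    (φ : (Fin m → κ) × (Fin n → κ) → ℂ) (φ' : (Fin p → κ) × (Fin q → κ) → ℂ) (p' q' : Poly κ) :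
    pairing L (tuplePoly φ * tuplePoly φ') (p' * q') =
      expContr (m + 1) (n + 1) (doubleContr L (p + 1) (q + 1)) (tuplePoly φ) p' (tuplePoly φ') q' := by
  simp only [tuplePoly, Finset.sum_mul_sum, smul_mul_smul_comm, map_sum, map_smul,
    LinearMap.sum_apply, LinearMap.smul_apply, Finset.smul_sum, smul_smul]
  rw [Finset.sum_comm]
  refine Finset.sum_congr rfl fun x _ => Finset.sum_congr rfl fun y _ => ?_
  rw [hL.pairing_mul_mul _ _ _ _ p' q' (m + 1) (n + 1) (p + 1) (q + 1), mul_comm] <;>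
    rw [card_entries] <;> omega

/-- The complex conjugate of a symmetric kernel, with plain and conjugate arguments exchanged. -/
def symConj (ψ : Multiset κ → Multiset κ → ℂ) : Multiset κ → Multiset κ → ℂ :=
  fun B A => conj (ψ A B)

theorem shift_symConj (ψ : Multiset κ → Multiset κ → ℂ) (A B : Multiset κ) :
    shift (symConj ψ) B A = symConj (shift ψ A B) := rfl

theorem IsGaussianFunctional.pairing_symPoly_symConj (hL : IsGaussianFunctional L)
    (a b a' b' : ℕ) (ψ γ : Multiset κ → Multiset κ → ℂ) :
    pairing L (symPoly a b ψ) (symPoly b' a' (symConj γ)) =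
      if a = a' ∧ b = b' then (b.factorial : ℂ) * a.factorial *
        ∑ x : (Fin a → κ) × (Fin b → κ),
          ψ (entries x.1) (entries x.2) * conj (γ (entries x.1) (entries x.2)) else 0 := by
  rw [symPoly, hL.pairing_tuplePoly_symPoly]
  split_ifs with h
  · rw [h.1, h.2]
    rfl
  · rfl

theorem IsGaussianFunctional.conj_pairing_symPoly (hL : IsGaussianFunctional L)
    (a b a' b' : ℕ) (ψ γ : Multiset κ → Multiset κ → ℂ) :
    pairing L (symPoly a' b' γ) (symPoly b a (symConj ψ)) =
      conj (pairing L (symPoly a b ψ) (symPoly b' a' (symConj γ))) := by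
  rw [hL.pairing_symPoly_symConj, hL.pairing_symPoly_symConj]
  by_cases h : a = a' ∧ b = b'
  · obtain ⟨rfl, rfl⟩ := h
    simp [mul_comm]
  · rw [if_neg h, if_neg (by simpa [eq_comm] using h), map_zero]

theorem expContr_symPoly {V : Type*} [AddCommGroup V] [Module ℂ V] (N M m n p q : ℕ)
    (φ : Bilin κ V) (ψ γ : Multiset κ → Multiset κ → ℂ) :
    expContr N M φ (symPoly m n ψ) (symPoly p q γ) =
      ∑ i ∈ Finset.range N, ∑ j ∈ Finset.range M, productCoeff m n p q i j •
        ∑ u : Fin i → κ, ∑ v : Fin j → κ,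
          φ (symPoly (m - i) (n - j) (shift ψ (entries u) (entries v)))
            (symPoly (p - j) (q - i) (shift γ (entries v) (entries u))) := by
  simp only [expContr_apply, contr_pow_symPoly, smul_smul, productCoeff]

/-- The squared modulus of the pairing of the derivatives of `ψ` of order `(i, j)` with those of
`γ` of order `(i', j')`, summed over all directions. -/
def pairingSq (L : Poly κ →ₗ[ℂ] ℂ) (m n p q : ℕ) (ψ γ : Multiset κ → Multiset κ → ℂ)
    (i j i' j' : ℕ) : ℝ :=
  ∑ u : Fin i → κ, ∑ v : Fin j → κ, ∑ u' : Fin i' → κ, ∑ v' : Fin j' → κ,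
    ‖pairing L (symPoly (m - i) (n - j) (shift ψ (entries u) (entries v)))
      (symPoly (q - j') (p - i') (symConj (shift γ (entries u') (entries v'))))‖ ^ 2

theorem pairingSq_nonneg (m n p q : ℕ) (ψ γ : Multiset κ → Multiset κ → ℂ) (i j i' j' : ℕ) :
    0 ≤ pairingSq L m n p q ψ γ i j i' j' := by
  unfold pairingSq
  positivity

/-- The real coefficient of `pairingSq` in the expansion of the norm of a product. -/
def squareCoeff (m n i j : ℕ) : ℝ :=
  ((i.factorial : ℝ)⁻¹ * (j.factorial : ℝ)⁻¹) * ((m.descFactorial i : ℝ) * n.descFactorial j) ^ 2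

theorem squareCoeff_nonneg (m n i j : ℕ) : 0 ≤ squareCoeff m n i j := by
  unfold squareCoeff
  positivity

theorem productCoeff_eq_squareCoeff (m n i j : ℕ) :
    productCoeff m n n m i j = (squareCoeff m n i j : ℂ) := by
  simp only [productCoeff, squareCoeff]
  push_cast
  ring

/-- The squared norm of a product of symmetric kernels is a sum of squares. -/
theorem IsGaussianFunctional.pairing_symPoly_mul (hL : IsGaussianFunctional L) (m n p q : ℕ)
    (ψ γ : Multiset κ → Multiset κ → ℂ) :
    pairing L (symPoly m n ψ * symPoly p q γ) (symPoly n m (symConj ψ) * symPoly q p (symConj γ)) =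
      ((∑ i ∈ Finset.range (m + 1), ∑ j ∈ Finset.range (n + 1), ∑ i' ∈ Finset.range (p + 1),
        ∑ j' ∈ Finset.range (q + 1), squareCoeff m n i j * squareCoeff p q i' j' *
          pairingSq L m n p q ψ γ i j i' j' : ℝ) : ℂ) := by
  have h := hL.pairing_tuplePoly_mul
    (fun x : (Fin m → κ) × (Fin n → κ) => ψ (entries x.1) (entries x.2))
    (fun x : (Fin p → κ) × (Fin q → κ) => γ (entries x.1) (entries x.2))
    (symPoly n m (symConj ψ)) (symPoly q p (symConj γ))
  rw [← symPoly, ← symPoly] at h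
  rw [h, expContr_symPoly]
  simp only [LinearMap.sum_apply, LinearMap.smul_apply, doubleContr_apply, expContr_symPoly]
  push_cast
  refine Finset.sum_congr rfl fun i _ => Finset.sum_congr rfl fun j _ => ?_
  simp only [pairingSq, smul_eq_mul, Complex.ofReal_sum, Finset.mul_sum,
    crossPairing_apply, productCoeff_eq_squareCoeff, shift_symConj]
  have hcomm (u : Fin i → κ) := Finset.sum_comm (s := (Finset.univ : Finset (Fin j → κ)))
    (t := Finset.range (p + 1)) (f := fun v i' => ∑ j' ∈ Finset.range (q + 1),
      ∑ u' : Fin i' → κ, ∑ v' : Fin j' → κ, ((squareCoeff m n i j * squareCoeff p q i' j' *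
        ‖pairing L (symPoly (m - i) (n - j) (shift ψ (entries u) (entries v)))
      (symPoly (q - j') (p - i') (symConj (shift γ (entries u') (entries v'))))‖ ^ 2 : ℝ) : ℂ))
  trans ∑ u : Fin i → κ, ∑ v : Fin j → κ, ∑ i' ∈ Finset.range (p + 1), ∑ j' ∈ Finset.range (q + 1),
      ∑ u' : Fin i' → κ, ∑ v' : Fin j' → κ, ((squareCoeff m n i j * squareCoeff p q i' j' *
        ‖pairing L (symPoly (m - i) (n - j) (shift ψ (entries u) (entries v)))
      (symPoly (q - j') (p - i') (symConj (shift γ (entries u') (entries v'))))‖ ^ 2 : ℝ) : ℂ)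
  · refine Finset.sum_congr rfl fun u _ => Finset.sum_congr rfl fun v _ =>
      Finset.sum_congr rfl fun i' _ => Finset.sum_congr rfl fun j' _ =>
      Finset.sum_congr rfl fun u' _ => Finset.sum_congr rfl fun v' _ => ?_
    rw [hL.conj_pairing_symPoly (m - i) (n - j) (p - i') (q - j'), mul_comm (conj _),
      Complex.mul_conj']
    push_cast
    ring
  simp only [hcomm]
  rw [Finset.sum_comm]
  refine Finset.sum_congr rfl fun i' _ => ?_
  simp only [Finset.sum_comm (s := (Finset.univ : Finset (Fin j → κ)))
    (t := Finset.range (q + 1))]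
  rw [Finset.sum_comm]
  refine Finset.sum_congr rfl fun j' _ => ?_
  push_cast
  rfl

/-- Derivatives of order `m - a` of `ψ` and `p - a` of `γ` leave `a` plain variables of each to be
paired, and likewise for the conjugate variables; the result is the squared norm of the contraction
of order `(a, b)` of `ψ` with the conjugate of `γ`. -/
theorem pairingSq_eq (hL : IsGaussianFunctional L) {m n p q a b : ℕ}
    (ha : a ≤ m) (ha' : a ≤ p) (hb : b ≤ n) (hb' : b ≤ q) (ψ γ : Multiset κ → Multiset κ → ℂ) :
    pairingSq L m n p q ψ γ (m - a) (n - b) (p - a) (q - b) =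
      ((b.factorial : ℝ) * a.factorial) ^ 2 *
        ∑ x, ‖symContraction m n q p a b ψ (symConj γ) x‖ ^ 2 := by
  have e1 : m - (m - a) = a := by omega
  have e2 : n - (n - b) = b := by omega
  have e3 : p - (p - a) = a := by omega
  have e4 : q - (q - b) = b := by omega
  have hsplit {α : Type} [AddCommMonoid α] (c d : ℕ) (G : (Fin (c + d) → κ) → α) :
      ∑ k, G k = ∑ k : Fin c → κ, ∑ k' : Fin d → κ, G (Fin.append k k') := by
    rw [← (Fin.appendEquiv c d).sum_comp, Fintype.sum_prod_type]
    rfl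
  rw [Fintype.sum_prod_type, hsplit]
  simp only [hsplit, pairingSq, symContraction, e1, e2, e3, e4, hL.pairing_symPoly_symConj,
    and_self, if_true, Fin.append_left, Fin.append_right, norm_mul, Complex.norm_natCast, mul_pow]
  simp only [Finset.mul_sum]
  refine Finset.sum_congr rfl fun u _ => ?_
  trans ∑ v : Fin (n - b) → κ, ∑ v' : Fin (q - b) → κ, ∑ u' : Fin (p - a) → κ,
    (b.factorial : ℝ) ^ 2 * (a.factorial : ℝ) ^ 2 * ‖∑ x : (Fin a → κ) × (Fin b → κ),
      shift ψ (entries u) (entries v) (entries x.1) (entries x.2) *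
      conj (shift γ (entries u') (entries v') (entries x.1) (entries x.2))‖ ^ 2
  · exact Finset.sum_congr rfl fun v _ => Finset.sum_comm
  rw [Finset.sum_comm]
  refine Finset.sum_congr rfl fun v' _ => Finset.sum_congr rfl fun v _ =>
    Finset.sum_congr rfl fun u' _ => ?_
  rw [Fintype.sum_prod_type]
  simp only [shift, symConj, add_comm]

theorem factorial_le_squareCoeff {m p a : ℕ} (ha : a ≤ m) (ha' : a ≤ p) :
    (m.factorial : ℝ) * p.factorial ≤
      ((m - a).factorial : ℝ)⁻¹ * (m.descFactorial (m - a) : ℝ) ^ 2 *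
      (((p - a).factorial : ℝ)⁻¹ * (p.descFactorial (p - a) : ℝ) ^ 2) * (a.factorial : ℝ) ^ 2 := by
  have key {m : ℕ} (ha : a ≤ m) : (m.factorial : ℝ) ≤
      ((m - a).factorial : ℝ)⁻¹ * (m.descFactorial (m - a) : ℝ) ^ 2 * (a.factorial : ℝ) := by
    have h1 : (a.factorial : ℝ) * m.descFactorial (m - a) = m.factorial := by
      have := Nat.factorial_mul_descFactorial (Nat.sub_le m a)
      rw [show m - (m - a) = a by omega] at this
      exact_mod_cast this
    have h2 : (m.descFactorial (m - a) : ℝ) = (m - a).factorial * m.choose (m - a) := by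
      exact_mod_cast Nat.descFactorial_eq_factorial_mul_choose m (m - a)
    have h3 : (1 : ℝ) ≤ m.choose (m - a) := by
      exact_mod_cast Nat.succ_le_of_lt (Nat.choose_pos (Nat.sub_le m a))
    have h4 : ((m - a).factorial : ℝ) ≠ 0 := by positivity
    calc (m.factorial : ℝ) ≤ m.choose (m - a) * m.factorial :=
          le_mul_of_one_le_left (by positivity) h3
      _ = _ := by
        rw [← h1, h2]
        field_simp
  calc (m.factorial : ℝ) * p.factorial ≤ _ :=
        mul_le_mul (key ha) (key ha') (by positivity) (by positivity)
    _ = _ := by ring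

/-- The squared norm of a product of symmetric kernels dominates the squared norms of all the
contractions of the first kernel with the conjugate of the second one. -/
theorem IsGaussianFunctional.sum_contraction_le (hL : IsGaussianFunctional L) (m n p q : ℕ)
    (ψ γ : Multiset κ → Multiset κ → ℂ) :
    (m.factorial : ℝ) * p.factorial * (n.factorial * q.factorial) *
      ∑ a ∈ Finset.range (min m p + 1), ∑ b ∈ Finset.range (min n q + 1),
        ∑ x, ‖symContraction m n q p a b ψ (symConj γ) x‖ ^ 2 ≤
    (pairing L (symPoly m n ψ * symPoly p q γ)
      (symPoly n m (symConj ψ) * symPoly q p (symConj γ))).re := by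
  rw [hL.pairing_symPoly_mul, Complex.ofReal_re]
  set T : ℕ × ℕ × ℕ × ℕ → ℝ := fun k => squareCoeff m n k.1 k.2.1 * squareCoeff p q k.2.2.1 k.2.2.2 *
          pairingSq L m n p q ψ γ k.1 k.2.1 k.2.2.1 k.2.2.2 with hT
  have hT0 : ∀ k, 0 ≤ T k := fun k => mul_nonneg
    (mul_nonneg (squareCoeff_nonneg _ _ _ _) (squareCoeff_nonneg _ _ _ _))
    (pairingSq_nonneg _ _ _ _ _ _ _ _ _ _)
  have h1 : (∑ i ∈ Finset.range (m + 1), ∑ j ∈ Finset.range (n + 1), ∑ i' ∈ Finset.range (p + 1),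
        ∑ j' ∈ Finset.range (q + 1), squareCoeff m n i j * squareCoeff p q i' j' *
          pairingSq L m n p q ψ γ i j i' j') =
      ∑ k ∈ Finset.range (m + 1) ×ˢ (Finset.range (n + 1) ×ˢ (Finset.range (p + 1) ×ˢ
        Finset.range (q + 1))), T k := by
    simp only [Finset.sum_product, hT]
  -- All terms of the expansion are nonnegative; only those which belong to contractions are kept.
  let g : ℕ × ℕ → ℕ × ℕ × ℕ × ℕ := fun c => (m - c.1, n - c.2, p - c.1, q - c.2)
  have hg : Set.InjOn g (Finset.range (min m p + 1) ×ˢ Finset.range (min n q + 1) : Finset _) := by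
    rintro ⟨a, b⟩ h ⟨a', b'⟩ h' he
    simp only [Finset.coe_product, Set.mem_prod, Finset.mem_coe, Finset.mem_range] at h h'
    simp only [g, Prod.mk.injEq] at he ⊢
    omega
  rw [h1, ← Finset.sum_product', Finset.mul_sum]
  calc _ ≤ ∑ c ∈ Finset.range (min m p + 1) ×ˢ Finset.range (min n q + 1), T (g c) := by
        refine Finset.sum_le_sum fun c hc => ?_
        simp only [Finset.mem_product, Finset.mem_range] at hc
        have hm : c.1 ≤ m := by omega
        have hp : c.1 ≤ p := by omega
        have hn : c.2 ≤ n := by omega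
        have hq : c.2 ≤ q := by omega
        simp only [hT, g]
        rw [pairingSq_eq hL hm hp hn hq, ← mul_assoc (_ * _) (_ ^ 2)]
        refine mul_le_mul_of_nonneg_right ?_ (Finset.sum_nonneg fun _ _ => sq_nonneg _)
        refine (mul_le_mul (factorial_le_squareCoeff hm hp) (factorial_le_squareCoeff hn hq)
          (by positivity) (by positivity)).trans_eq ?_
        simp only [squareCoeff]
        ring
    _ = ∑ k ∈ (Finset.range (min m p + 1) ×ˢ Finset.range (min n q + 1)).image g, T k :=
        (Finset.sum_image hg).symm
    _ ≤ _ := by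
        refine Finset.sum_le_sum_of_subset_of_nonneg ?_ fun k _ _ => hT0 k
        intro k hk
        obtain ⟨c, -, rfl⟩ := Finset.mem_image.1 hk
        simp only [g, Finset.mem_product, Finset.mem_range]
        omega

end LowerBound

/-! ### Sums of products of derivatives of Wick powers -/

section Gamma

open MvPolynomial

variable {κ : Type*} [Fintype κ] [DecidableEq κ]

theorem sum_range_shift_factorial {V : Type*} [AddCommGroup V] [Module ℂ V] (m : ℕ) (g : ℕ → V)
    (hg : g (m + 1) = 0) :
    ∑ i ∈ Finset.range (m + 1), ((i.factorial : ℂ)⁻¹) • g (i + 1) =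
      ∑ i ∈ Finset.range (m + 1), ((i : ℂ) * (i.factorial : ℂ)⁻¹) • g i := by
  rw [Finset.sum_range_succ, hg, smul_zero, add_zero, Finset.sum_range_succ']
  simp only [Nat.cast_zero, zero_mul, zero_smul, add_zero]
  refine Finset.sum_congr rfl fun i _ => ?_
  congr 1
  rw [Nat.factorial_succ]
  push_cast
  have : (i : ℂ) + 1 ≠ 0 := by exact_mod_cast i.succ_ne_zero
  field_simp

/-- The plain derivatives of the first factor against the conjugate derivatives of the second one:
the terms of the product formula are multiplied by the number `i` of contractions of this kind. -/
theorem sum_wick_pderiv_inl_mul (m n p q : ℕ) (ψ γ : Multiset κ → Multiset κ → ℂ) :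
    ∑ x, wick (pderiv (Sum.inl x) (symPoly m n ψ)) * wick (pderiv (Sum.inr x) (symPoly p q γ)) =
      ∑ i ∈ Finset.range (m + 1), ∑ j ∈ Finset.range (n + 1),
        ((i : ℂ) * productCoeff m n p q i j) • wick (tuplePoly (symContraction m n p q i j ψ γ)) := by
  have h1 (x : κ) : wick (pderiv (Sum.inl x) (symPoly m n ψ)) *
      wick (pderiv (Sum.inr x) (symPoly p q γ)) = wick (expContr (m + 1) (n + 1)
        (LinearMap.mul ℂ (Poly κ)) (pderiv (Sum.inl x) (symPoly m n ψ))
        (pderiv (Sum.inr x) (symPoly p q γ))) := by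
    rcases m with _ | m
    · simp [pderiv_inl_symPoly_zero]
    · rw [pderiv_inl_symPoly_succ, map_smul, map_smul, LinearMap.smul_apply, map_smul,
        smul_mul_assoc, symPoly, wick_tuplePoly_mul_wick _ _ (m + 1 + 1) (n + 1) (by omega) (by omega)]
  simp only [h1]
  rw [← map_sum]
  have h2 : ∑ x, expContr (m + 1) (n + 1) (LinearMap.mul ℂ (Poly κ))
      (pderiv (Sum.inl x) (symPoly m n ψ)) (pderiv (Sum.inr x) (symPoly p q γ)) =
      ∑ i ∈ Finset.range (m + 1), ((i.factorial : ℂ)⁻¹) • ∑ j ∈ Finset.range (n + 1),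
        ((j.factorial : ℂ)⁻¹) • (contr Sum.inl ^ (i + 1)) ((contr Sum.inr ^ j)
          (LinearMap.mul ℂ (Poly κ))) (symPoly m n ψ) (symPoly p q γ) := by
    simp only [expContr_apply, pow_succ', Module.End.mul_apply, contr_apply, Sum.swap_inl,
      Finset.smul_sum, smul_smul]
    rw [Finset.sum_comm]
    exact Finset.sum_congr rfl fun i _ => Finset.sum_comm
  rw [h2, sum_range_shift_factorial m fun i => ∑ j ∈ Finset.range (n + 1),
        ((j.factorial : ℂ)⁻¹) • (contr Sum.inl ^ i) ((contr Sum.inr ^ j)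
          (LinearMap.mul ℂ (Poly κ))) (symPoly m n ψ) (symPoly p q γ)]
  · simp only [contr_pow_mul_symPoly, map_sum, Finset.smul_sum, smul_smul, map_smul, productCoeff]
    refine Finset.sum_congr rfl fun i _ => Finset.sum_congr rfl fun j _ => ?_
    congr 1
    ring
  · refine Finset.sum_eq_zero fun j _ => ?_
    rw [contr_pow_mul_symPoly, Nat.descFactorial_eq_zero_iff_lt.2 (Nat.lt_succ_self m)]
    simp

theorem sum_wick_pderiv_inr_mul (m n p q : ℕ) (ψ γ : Multiset κ → Multiset κ → ℂ) :
    ∑ x, wick (pderiv (Sum.inr x) (symPoly m n ψ)) * wick (pderiv (Sum.inl x) (symPoly p q γ)) =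
      ∑ i ∈ Finset.range (m + 1), ∑ j ∈ Finset.range (n + 1),
        ((j : ℂ) * productCoeff m n p q i j) • wick (tuplePoly (symContraction m n p q i j ψ γ)) := by
  have h1 (x : κ) : wick (pderiv (Sum.inr x) (symPoly m n ψ)) *
      wick (pderiv (Sum.inl x) (symPoly p q γ)) = wick (expContr (m + 1) (n + 1)
        (LinearMap.mul ℂ (Poly κ)) (pderiv (Sum.inr x) (symPoly m n ψ))
        (pderiv (Sum.inl x) (symPoly p q γ))) := by
    rcases n with _ | n
    · simp [pderiv_inr_symPoly_zero]
    · rw [pderiv_inr_symPoly_succ, map_smul, map_smul, LinearMap.smul_apply, map_smul,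
        smul_mul_assoc, symPoly, wick_tuplePoly_mul_wick _ _ (m + 1) (n + 1 + 1) (by omega) (by omega)]
  simp only [h1]
  rw [← map_sum]
  have h2 : ∑ x, expContr (m + 1) (n + 1) (LinearMap.mul ℂ (Poly κ))
      (pderiv (Sum.inr x) (symPoly m n ψ)) (pderiv (Sum.inl x) (symPoly p q γ)) =
      ∑ j ∈ Finset.range (n + 1), ((j.factorial : ℂ)⁻¹) • ∑ i ∈ Finset.range (m + 1),
        ((i.factorial : ℂ)⁻¹) • (contr Sum.inr ^ (j + 1)) ((contr Sum.inl ^ i)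
          (LinearMap.mul ℂ (Poly κ))) (symPoly m n ψ) (symPoly p q γ) := by
    simp only [expContr_apply, contr_pow_comm Sum.inl, pow_succ', Module.End.mul_apply, contr_apply,
      Sum.swap_inr, Finset.smul_sum, smul_smul]
    rw [Finset.sum_comm]
    trans ∑ i ∈ Finset.range (m + 1), ∑ j ∈ Finset.range (n + 1), ∑ x : κ,
      ((i.factorial : ℂ)⁻¹ * (j.factorial : ℂ)⁻¹) • (contr Sum.inr ^ j) ((contr Sum.inl ^ i)
          (LinearMap.mul ℂ (Poly κ))) (pderiv (Sum.inr x) (symPoly m n ψ))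
          (pderiv (Sum.inl x) (symPoly p q γ))
    · exact Finset.sum_congr rfl fun i _ => Finset.sum_comm
    · rw [Finset.sum_comm]
      simp only [mul_comm]
  rw [h2, sum_range_shift_factorial n fun j => ∑ i ∈ Finset.range (m + 1),
        ((i.factorial : ℂ)⁻¹) • (contr Sum.inr ^ j) ((contr Sum.inl ^ i)
          (LinearMap.mul ℂ (Poly κ))) (symPoly m n ψ) (symPoly p q γ)]
  · simp only [contr_pow_comm Sum.inr, contr_pow_mul_symPoly, map_sum, Finset.smul_sum, smul_smul,
      map_smul, productCoeff]
    rw [Finset.sum_comm]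
    refine Finset.sum_congr rfl fun i _ => Finset.sum_congr rfl fun j _ => ?_
    congr 1
    ring
  · refine Finset.sum_eq_zero fun j _ => ?_
    rw [contr_pow_comm, contr_pow_mul_symPoly, Nat.descFactorial_eq_zero_iff_lt.2 (Nat.lt_succ_self n)]
    simp

/-- Euler's identity. -/
theorem sum_X_mul_pderiv_word (A B : Multiset κ) :
    ∑ y, X y * pderiv y (word A B) = ((A.card + B.card : ℕ) : ℂ) • word A B := by
  have step (z : κ ⊕ κ) (p : Poly κ) (d : ℕ) (h : ∑ y, X y * pderiv y p = (d : ℂ) • p) :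
      ∑ y, X y * pderiv y (X z * p) = ((d + 1 : ℕ) : ℂ) • (X z * p) := by
    simp only [pderiv_X_mul, mul_add, Finset.sum_add_distrib, mul_ite, mul_zero,
      Finset.sum_ite_eq', Finset.mem_univ, if_true]
    have : ∑ y, X y * (X z * pderiv y p) = X z * ∑ y, X y * pderiv y p := by
      rw [Finset.mul_sum]
      exact Finset.sum_congr rfl fun y _ => mul_left_comm _ _ _
    rw [this, h, mul_smul_comm]
    push_cast
    module
  induction A, B using word_induction with
  | h0 => simp [word_zero]
  | hl x A B ih =>
    rw [word_cons_left, step _ _ _ ih, Multiset.card_cons, add_right_comm]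
  | hr x A B ih =>
    rw [word_cons_right, step _ _ _ ih, Multiset.card_cons, add_assoc]

theorem sum_X_mul_pderiv_tuplePoly {m n : ℕ} (φ : (Fin m → κ) × (Fin n → κ) → ℂ) :
    ∑ y, X y * pderiv y (tuplePoly φ) = ((m + n : ℕ) : ℂ) • tuplePoly φ := by
  simp only [tuplePoly, map_sum, Derivation.map_smul, Finset.mul_sum, Finset.smul_sum]
  rw [Finset.sum_comm]
  refine Finset.sum_congr rfl fun x _ => ?_
  simp only [mul_smul_comm]
  rw [← Finset.smul_sum, sum_X_mul_pderiv_word, card_entries, card_entries, smul_comm]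

/-- The number operator on a Wick power, in divergence form. -/
theorem sum_X_mul_wick_sub {m n : ℕ} (φ : (Fin m → κ) × (Fin n → κ) → ℂ) :
    ∑ y, (X y * wick (pderiv y (tuplePoly φ)) - pderiv y.swap (wick (pderiv y (tuplePoly φ)))) =
      ((m + n : ℕ) : ℂ) • wick (tuplePoly φ) := by
  rw [← map_smul, ← sum_X_mul_pderiv_tuplePoly, map_sum]
  exact Finset.sum_congr rfl fun y _ => by rw [wick_X_mul, pderiv_wick]

end Gamma

/-! ### Stein's identity -/

section Tame

variable {E E' : Type*} [NormedAddCommGroup E] [NormedSpace ℝ E] [NormedAddCommGroup E']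
  [NormedSpace ℝ E']

/-- A function of class `C¹` which has polynomial growth together with its derivative. -/
structure IsTame (g : E → ℂ) : Prop where
  contDiff : ContDiff ℝ 1 g
  growth : ∃ (k : ℕ) (C : ℝ), ∀ x, ‖g x‖ ≤ C * (1 + ‖x‖) ^ k
  growth_fderiv : ∃ (k : ℕ) (C : ℝ), ∀ x, ‖fderiv ℝ g x‖ ≤ C * (1 + ‖x‖) ^ k

theorem _root_.Function.HasTemperateGrowth.isTame {g : E → ℂ} (hg : g.HasTemperateGrowth) :
    IsTame g := by
  refine ⟨hg.1.of_le (by norm_cast), ?_, ?_⟩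
  · obtain ⟨k, C, h⟩ := hg.2 0
    exact ⟨k, C, fun x => by simpa using h x⟩
  · obtain ⟨k, C, h⟩ := hg.2 1
    exact ⟨k, C, fun x => by simpa [norm_iteratedFDeriv_one] using h x⟩

theorem IsTame.differentiable {g : E → ℂ} (hg : IsTame g) : Differentiable ℝ g :=
  hg.contDiff.differentiable (by norm_num)

theorem _root_.Function.HasTemperateGrowth.fderiv_apply {g : E → ℂ} (hg : g.HasTemperateGrowth)
    (v : E) : Function.HasTemperateGrowth fun x => fderiv ℝ g x v := by
  have h : Function.HasTemperateGrowth (fderiv ℝ g) := by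
    refine ⟨hg.1.fderiv_right (by norm_cast), fun n => ?_⟩
    obtain ⟨k, C, h⟩ := hg.2 (n + 1)
    exact ⟨k, C, fun x => by simpa [norm_iteratedFDeriv_fderiv] using h x⟩
  exact (ContinuousLinearMap.apply ℝ ℂ v).hasTemperateGrowth.comp h

theorem poly_growth_mul {a b : E → ℝ} (ha : ∃ (k : ℕ) (C : ℝ), ∀ x, |a x| ≤ C * (1 + ‖x‖) ^ k)
    (hb : ∃ (k : ℕ) (C : ℝ), ∀ x, |b x| ≤ C * (1 + ‖x‖) ^ k) :
    ∃ (k : ℕ) (C : ℝ), ∀ x, |a x * b x| ≤ C * (1 + ‖x‖) ^ k := by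
  obtain ⟨k, C, h⟩ := ha
  obtain ⟨k', C', h'⟩ := hb
  refine ⟨k + k', C * C', fun x => ?_⟩
  rw [abs_mul]
  calc _ ≤ (C * (1 + ‖x‖) ^ k) * (C' * (1 + ‖x‖) ^ k') :=
        mul_le_mul (h x) (h' x) (abs_nonneg _) ((abs_nonneg _).trans (h x))
    _ = _ := by ring

theorem poly_growth_add {a b : E → ℝ} (ha : ∃ (k : ℕ) (C : ℝ), ∀ x, |a x| ≤ C * (1 + ‖x‖) ^ k)
    (hb : ∃ (k : ℕ) (C : ℝ), ∀ x, |b x| ≤ C * (1 + ‖x‖) ^ k) :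
    ∃ (k : ℕ) (C : ℝ), ∀ x, |a x + b x| ≤ C * (1 + ‖x‖) ^ k := by
  obtain ⟨k, C, h⟩ := ha
  obtain ⟨k', C', h'⟩ := hb
  refine ⟨k + k', |C| + |C'|, fun x => ?_⟩
  have h1 : (1 : ℝ) ≤ 1 + ‖x‖ := by linarith [norm_nonneg x]
  have e1 : C * (1 + ‖x‖) ^ k ≤ |C| * (1 + ‖x‖) ^ (k + k') :=
    mul_le_mul (le_abs_self _) (pow_le_pow_right₀ h1 (by omega)) (by positivity) (abs_nonneg _)
  have e2 : C' * (1 + ‖x‖) ^ k' ≤ |C'| * (1 + ‖x‖) ^ (k + k') :=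
    mul_le_mul (le_abs_self _) (pow_le_pow_right₀ h1 (by omega)) (by positivity) (abs_nonneg _)
  have := abs_add_le (a x) (b x)
  have := h x
  have := h' x
  linarith

theorem IsTame.mul {f g : E → ℂ} (hf : IsTame f) (hg : IsTame g) :
    IsTame fun x => f x * g x := by
  have e {a : E → ℝ} (h0 : ∀ x, 0 ≤ a x) :
      (∃ (k : ℕ) (C : ℝ), ∀ x, a x ≤ C * (1 + ‖x‖) ^ k) ↔
      ∃ (k : ℕ) (C : ℝ), ∀ x, |a x| ≤ C * (1 + ‖x‖) ^ k := by
    simp only [abs_of_nonneg (h0 _)]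
  have f0 := (e fun x => norm_nonneg (f x)).1 hf.growth
  have f1 := (e fun x => norm_nonneg (fderiv ℝ f x)).1 hf.growth_fderiv
  have g0 := (e fun x => norm_nonneg (g x)).1 hg.growth
  have g1 := (e fun x => norm_nonneg (fderiv ℝ g x)).1 hg.growth_fderiv
  refine ⟨hf.contDiff.mul hg.contDiff, ?_, ?_⟩
  · simp only [norm_mul]
    exact (e fun x => by positivity).2 (poly_growth_mul f0 g0)
  · obtain ⟨k, C, h⟩ := poly_growth_add (poly_growth_mul f0 g1) (poly_growth_mul g0 f1)
    refine ⟨k, C, fun x => ?_⟩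
    rw [fderiv_fun_mul hf.differentiable.differentiableAt hg.differentiable.differentiableAt]
    refine (norm_add_le _ _).trans ?_
    rw [norm_smul, norm_smul]
    exact (le_abs_self _).trans (h x)

end Tame

section Moments

variable {E Ω : Type*} [NormedAddCommGroup E] [NormedSpace ℝ E] [MeasurableSpace E] [BorelSpace E]
  [CompleteSpace E] [SecondCountableTopology E] [MeasurableSpace Ω] {P : Measure Ω}

/-- A function of polynomial growth of a Gaussian vector has moments of all orders. -/
theorem HasGaussianLaw.memLp_comp {V : Type*} [NormedAddCommGroup V] {Y : Ω → E}
    (hY : HasGaussianLaw Y P) {g : E → V} (hg : Continuous g)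
    (h : ∃ (k : ℕ) (C : ℝ), ∀ x, ‖g x‖ ≤ C * (1 + ‖x‖) ^ k) (p : ℝ≥0∞) (hp : p ≠ ∞) :
    MemLp (fun ω => g (Y ω)) p P := by
  have := hY.isProbabilityMeasure
  obtain ⟨k, C, h⟩ := h
  have h1 (p : ℝ≥0∞) (hp : p ≠ ∞) : MemLp (fun ω => ((1 + ‖Y ω‖ : ℝ) : ℂ)) p P :=
    have a : MemLp (fun ω => 1 + ‖Y ω‖) p P :=
      MemLp.add (f := fun _ => (1 : ℝ)) (memLp_const 1) (hY.memLp hp).norm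
    a.ofReal
  have h2 := (memLp_pow_all h1 k p hp).norm.const_mul C
  refine h2.mono (hg.comp_aestronglyMeasurable hY.aemeasurable.aestronglyMeasurable)
    (ae_of_all _ fun ω => ?_)
  refine ((h _).trans (le_abs_self _)).trans_eq ?_
  rw [Real.norm_eq_abs, norm_pow, Complex.norm_real, Real.norm_of_nonneg (by positivity)]

end Moments

section RealStein

open Real in
theorem hasDerivAt_gaussianPDFReal {v : NNReal} (hv : v ≠ 0) (x : ℝ) :
    HasDerivAt (gaussianPDFReal 0 v) (-(x / v) * gaussianPDFReal 0 v x) x := by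
  have hv' : (v : ℝ) ≠ 0 := by exact_mod_cast hv
  simp only [gaussianPDFReal_def, sub_zero]
  have h1 : HasDerivAt (fun x : ℝ => -x ^ 2 / (2 * v)) (-(x / v)) x := by
    have := ((hasDerivAt_pow 2 x).neg).div_const (2 * (v : ℝ))
    convert! this using 1
    field_simp
    norm_num [mul_comm]
  convert! (h1.exp.const_mul ((√(2 * π * v))⁻¹)) using 1
  ring

/-- Stein's identity for a centred Gaussian law on the line. -/
theorem integral_mul_gaussianReal {v : NNReal} (hv : v ≠ 0) {h h' : ℝ → ℂ}
    (hd : ∀ x, HasDerivAt h (h' x) x) (h0 : Integrable h (gaussianReal 0 v))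
    (h1 : Integrable (fun x : ℝ => (x : ℂ) * h x) (gaussianReal 0 v))
    (h2 : Integrable h' (gaussianReal 0 v)) :
    ∫ x : ℝ, (x : ℂ) * h x ∂(gaussianReal 0 v) = v * ∫ x, h' x ∂(gaussianReal 0 v) := by
  have hv' : (v : ℂ) ≠ 0 := by exact_mod_cast hv
  have key (u : ℝ → ℂ) (hu : Integrable u (gaussianReal 0 v)) :
      Integrable fun x => u x * (gaussianPDFReal 0 v x : ℂ) := by
    rw [gaussianReal_of_var_ne_zero _ hv, integrable_withDensity_iff_integrable_smul'
      (measurable_gaussianPDF 0 v) (ae_of_all _ fun _ => gaussianPDF_lt_top)] at hu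
    refine hu.congr (ae_of_all _ fun x => ?_)
    simp [toReal_gaussianPDF, mul_comm]
  have hpdf (x : ℝ) : HasDerivAt (fun x => (gaussianPDFReal 0 v x : ℂ))
      (-((x : ℂ) / v) * gaussianPDFReal 0 v x) x := by
    have := (hasDerivAt_gaussianPDFReal hv x).ofReal_comp
    push_cast at this
    exact this
  have e := integral_mul_deriv_eq_deriv_mul_of_integrable (u := h) (u' := h')
    (fun x _ => hd x) (fun x _ => hpdf x) ?_ (key _ h2) (key _ h0)
  · rw [integral_gaussianReal_eq_integral_smul hv, integral_gaussianReal_eq_integral_smul hv]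
    have e1 : ∫ x : ℝ, gaussianPDFReal 0 v x • ((x : ℂ) * h x) =
        -(v * ∫ x : ℝ, h x * (-((x : ℂ) / v) * gaussianPDFReal 0 v x) ∂(volume : Measure ℝ)) := by
      rw [← integral_const_mul, ← integral_neg]
      refine integral_congr_ae (ae_of_all _ fun x => ?_)
      simp only [Complex.real_smul]
      field_simp
    rw [e1, e, mul_neg, neg_neg]
    congr 2
    ext x
    simp [mul_comm]
  · refine ((key _ h1).const_mul (-(v : ℂ)⁻¹)).congr (ae_of_all _ fun x => ?_)
    simp only [Pi.mul_apply]
    field_simp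

variable {E Ω : Type*} [NormedAddCommGroup E] [NormedSpace ℝ E] [MeasurableSpace E] [BorelSpace E]
  [CompleteSpace E] [SecondCountableTopology E] [MeasurableSpace Ω] {P : Measure Ω}

theorem integrable_mul_comp {X : Ω → ℝ} {Y : Ω → E}
    (hXY : HasGaussianLaw (fun ω => (X ω, Y ω)) P) {g : E → ℂ} (hg : IsTame g) :
    Integrable (fun ω => (X ω : ℂ) * g (Y ω)) P := by
  have h1 : MemLp (fun ω => (X ω : ℂ)) 2 P := (hXY.fst.memLp (by norm_num)).ofReal
  have h2 : MemLp (fun ω => g (Y ω)) 2 P :=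
    HasGaussianLaw.memLp_comp hXY.snd hg.contDiff.continuous hg.growth 2 (by norm_num)
  exact h1.integrable_mul h2

theorem integrable_fderiv_comp {Y : Ω → E} (hY : HasGaussianLaw Y P) {g : E → ℂ} (hg : IsTame g)
    (c : E) : Integrable (fun ω => fderiv ℝ g (Y ω) c) P := by
  have := hY.isProbabilityMeasure
  have h := HasGaussianLaw.memLp_comp hY (hg.contDiff.continuous_fderiv (by norm_num))
    hg.growth_fderiv 1 (by norm_num)
  exact (h.integrable le_rfl).apply_continuousLinearMap c

/-- Stein's identity: `E[X g(Y)] = E[Dg(Y) E[X Y]]` for `(X, Y)` jointly Gaussian and `X` centred.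
It follows from the one-dimensional identity, since `X` is independent of
`Y - (X / Var X) E[X Y]`. -/
theorem integral_mul_comp_eq {X : Ω → ℝ} {Y : Ω → E}
    (hXY : HasGaussianLaw (fun ω => (X ω, Y ω)) P) (hX : ∫ ω, X ω ∂P = 0) {g : E → ℂ}
    (hg : IsTame g) :
    ∫ ω, (X ω : ℂ) * g (Y ω) ∂P = ∫ ω, fderiv ℝ g (Y ω) (∫ ω', X ω' • Y ω' ∂P) ∂P := by
  have := hXY.isProbabilityMeasure
  set c := ∫ ω', X ω' • Y ω' ∂P with hc
  have hX2 : MemLp X 2 P := hXY.fst.memLp (by norm_num)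
  have hY2 : MemLp Y 2 P := hXY.snd.memLp (by norm_num)
  have hXYi : Integrable (fun ω => X ω • Y ω) P :=
    memLp_one_iff_integrable.1 (hY2.smul hX2)
  -- If `X` has variance `0`, then both sides vanish.
  by_cases hv : Var[X; P] = 0
  · have h0 : X =ᵐ[P] 0 := by
      have := ae_eq_integral_of_variance_eq_zero hX2 hv
      rw [hX] at this
      exact this
    have hc0 : c = 0 := by
      rw [hc, integral_congr_ae (g := fun _ => (0 : E)), integral_zero]
      filter_upwards [h0] with ω hω
      simp [hω]
    rw [hc0, integral_congr_ae (g := fun _ => (0 : ℂ))]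
    · simp
    · filter_upwards [h0] with ω hω
      simp [hω]
  set v := Var[X; P] with hvdef
  have hvar : ∫ ω, X ω * X ω ∂P = v := by
    rw [hvdef, variance_of_integral_eq_zero hX2.aestronglyMeasurable.aemeasurable hX]
    simp [sq]
  -- The residual `R` is uncorrelated with `X`, hence independent of it.
  let R : Ω → E := fun ω => Y ω - (X ω / v) • c
  have hXR : HasGaussianLaw (fun ω => (X ω, R ω)) P := by
    have := hXY.map_fun ((ContinuousLinearMap.fst ℝ ℝ E).prod (ContinuousLinearMap.snd ℝ ℝ E -
      (v⁻¹ • ContinuousLinearMap.fst ℝ ℝ E).smulRight c))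
    convert! this using 1
    ext ω <;> simp [R, div_eq_inv_mul]
  have hind : IndepFun X R P := by
    refine hXR.indepFun_of_covariance_strongDual fun L₁ L₂ => ?_
    have e1 : L₁ ∘ X = fun ω => L₁ 1 * X ω := by
      ext ω
      have : L₁ (X ω • 1) = X ω • L₁ 1 := L₁.map_smul _ _
      simpa [mul_comm] using this
    have hR2 : MemLp (L₂ ∘ R) 2 P := (hXR.snd.map L₂).memLp_two
    rw [e1, covariance_const_mul_left, covariance_eq_sub hX2 hR2, hX, zero_mul, sub_zero]
    have e2 : ∫ ω, (X * (L₂ ∘ R)) ω ∂P = L₂ (∫ ω, X ω • R ω ∂P) := by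
      rw [← L₂.integral_comp_comm]
      · simp
      · exact memLp_one_iff_integrable.1 ((hXR.snd.memLp (p := 2) (by norm_num)).smul hX2)
    have e3 : ∫ ω, X ω • R ω ∂P = 0 := by
      have : ∀ ω, X ω • R ω = X ω • Y ω - (X ω * X ω) • v⁻¹ • c := fun ω => by
        simp only [R, smul_sub, smul_smul]
        congr 2
        ring
      simp only [this]
      rw [integral_sub hXYi, integral_smul_const, hvar, smul_smul, mul_inv_cancel₀ hv, one_smul,
        ← hc, sub_self]
      exact (hX2.integrable_mul hX2).smul_const _
    rw [e2, e3]
    simp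
  have hlaw : P.map X = gaussianReal 0 v.toNNReal := by
    rw [hXY.fst.map_eq_gaussianReal, hX]
  have hv0 : v.toNNReal ≠ 0 := by
    simpa using lt_of_le_of_ne (variance_nonneg X P) (Ne.symm hv)
  have hvc : ((v.toNNReal : ℝ) : ℂ) = v := by
    rw [Real.coe_toNNReal _ (variance_nonneg X P)]
  have hXm := hXY.fst.aemeasurable
  have hRm := hXR.snd.aemeasurable
  have hmap : P.map (fun ω => (X ω, R ω)) = (gaussianReal 0 v.toNNReal).prod (P.map R) := by
    rw [(indepFun_iff_map_prod_eq_prod_map_map hXm hRm).1 hind, hlaw]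
  have hYR (ω : Ω) : Y ω = R ω + (X ω / v) • c := by simp [R]
  have hprob : IsProbabilityMeasure (P.map R) := Measure.isProbabilityMeasure_map hRm
  have hcont := hg.contDiff.continuous
  have hcontd := hg.contDiff.continuous_fderiv (by norm_num : (1 : WithTop ℕ∞) ≠ 0)
  let G : ℝ × E → ℂ := fun z => g (z.2 + (z.1 / v) • c)
  let G' : ℝ × E → ℂ := fun z => fderiv ℝ g (z.2 + (z.1 / v) • c) c
  have hGc : Continuous G := by fun_prop
  have hG'c : Continuous G' := by
    have : Continuous fun z : ℝ × E => fderiv ℝ g (z.2 + (z.1 / v) • c) := by fun_prop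
    exact this.clm_apply continuous_const
  -- Fubini's theorem for functions of the independent variables `X` and `R`.
  have tr (K : ℝ × E → ℂ) (hK : Continuous K) (hKi : Integrable (fun ω => K (X ω, R ω)) P) :
      Integrable K ((gaussianReal 0 v.toNNReal).prod (P.map R)) ∧
      ∫ ω, K (X ω, R ω) ∂P = ∫ r, ∫ x, K (x, r) ∂(gaussianReal 0 v.toNNReal) ∂(P.map R) := by
    have hi : Integrable K ((gaussianReal 0 v.toNNReal).prod (P.map R)) := by
      rw [← hmap, integrable_map_measure hK.aestronglyMeasurable (hXm.prodMk hRm)]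
      exact hKi
    refine ⟨hi, ?_⟩
    rw [← integral_prod_symm K hi, ← hmap, integral_map (hXm.prodMk hRm) hK.aestronglyMeasurable]
  have hG0 := tr G hGc (by
    have := (HasGaussianLaw.memLp_comp hXY.snd hcont hg.growth 1 (by norm_num)).integrable le_rfl
    exact this.congr (ae_of_all _ fun ω => by simp only [G, hYR]))
  have hG1 := tr (fun z => (z.1 : ℂ) * G z) (by fun_prop) (by
    exact (integrable_mul_comp hXY hg).congr (ae_of_all _ fun ω => by simp only [G, hYR]))
  have hG2 := tr G' hG'c (by
    exact (integrable_fderiv_comp hXY.snd hg c).congr (ae_of_all _ fun ω => by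
      simp only [G', hYR]))
  have l1 : ∫ ω, (X ω : ℂ) * g (Y ω) ∂P = ∫ ω, (X ω : ℂ) * G (X ω, R ω) ∂P := by
    simp only [G, hYR]
  have l2 : ∫ ω, fderiv ℝ g (Y ω) c ∂P = ∫ ω, G' (X ω, R ω) ∂P := by
    simp only [G', hYR]
  rw [l1, l2, hG1.2, hG2.2]
  refine integral_congr_ae ?_
  -- For fixed `r` the identity on the line applies to `x ↦ g (r + (x / v) • c)`.
  filter_upwards [hG0.1.prod_left_ae, hG1.1.prod_left_ae, hG2.1.prod_left_ae] with r h0 h1 h2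
  have hd (x : ℝ) : HasDerivAt (fun x => G (x, r)) ((v : ℂ)⁻¹ * G' (x, r)) x := by
    have ha : HasDerivAt (fun x : ℝ => r + (x / v) • c) (v⁻¹ • c) x := by
      have := ((hasDerivAt_id x).div_const v).smul_const c
      simpa using! this.const_add r
    have hb := (hg.differentiable (r + (x / v) • c)).hasFDerivAt.comp_hasDerivAt x ha
    convert! hb using 1
    simp [G']
  have hvC : (v : ℂ) ≠ 0 := by exact_mod_cast hv
  rw [integral_mul_gaussianReal hv0 hd h0 h1 (h2.const_mul _), integral_const_mul, hvc,
    ← mul_assoc, mul_inv_cancel₀ hvC, one_mul]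

end RealStein

/-! ### Integration by parts for isonormal processes -/

section Wirtinger

variable {κ : Type*} [Fintype κ] [DecidableEq κ]

/-- The Wirtinger derivative `∂/∂z_x` of a function of finitely many complex variables. -/
def dz (g : (κ → ℂ) → ℂ) (x : κ) (z : κ → ℂ) : ℂ :=
  (1 / 2 : ℂ) * (fderiv ℝ g z (Pi.single x 1) - Complex.I * fderiv ℝ g z (Pi.single x Complex.I))

/-- The Wirtinger derivative `∂/∂(conj z_x)` of a function of finitely many complex variables. -/
def dzbar (g : (κ → ℂ) → ℂ) (x : κ) (z : κ → ℂ) : ℂ :=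
  (1 / 2 : ℂ) * (fderiv ℝ g z (Pi.single x 1) + Complex.I * fderiv ℝ g z (Pi.single x Complex.I))

theorem fderiv_eq_sum_wirtinger (g : (κ → ℂ) → ℂ) (z c : κ → ℂ) :
    fderiv ℝ g z c = ∑ x, (dz g x z * c x + dzbar g x z * conj (c x)) := by
  have h1 : c = ∑ x, ((c x).re • (Pi.single x (1 : ℂ) : κ → ℂ) +
      (c x).im • (Pi.single x Complex.I : κ → ℂ)) := by
    ext y
    simp only [Finset.sum_apply, Pi.add_apply, Pi.smul_apply, Pi.single_apply, smul_ite, smul_zero]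
    rw [Finset.sum_eq_single y]
    · simp [Complex.re_add_im]
    · intro b _ hb
      simp [hb.symm]
    · simp
  conv_lhs => rw [h1]
  rw [map_sum]
  refine Finset.sum_congr rfl fun x _ => ?_
  rw [map_add, map_smul, map_smul]
  simp only [dz, dzbar, Complex.real_smul]
  have e1 : conj (c x) = (c x).re - (c x).im * Complex.I := by
    conv_lhs => rw [← Complex.re_add_im (c x)]
    simp only [map_add, map_mul, Complex.conj_ofReal, Complex.conj_I]
    ring
  have e2 : c x = (c x).re + (c x).im * Complex.I := (Complex.re_add_im (c x)).symm
  rw [e1]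
  conv_rhs => rw [e2]
  simp only [Complex.add_re, Complex.ofReal_re, Complex.mul_re, Complex.I_re, mul_zero,
    Complex.ofReal_im, Complex.I_im, mul_one, sub_self, add_zero, Complex.add_im, Complex.mul_im,
    zero_add]
  linear_combination ((c x).im * fderiv ℝ g z (Pi.single x Complex.I)) * Complex.I_sq

theorem fderiv_sub_I_mul (g : (κ → ℂ) → ℂ) (z c : κ → ℂ) :
    (1 / 2 : ℂ) * (fderiv ℝ g z c - Complex.I * fderiv ℝ g z (Complex.I • c)) =
      ∑ x, dz g x z * c x := by
  rw [fderiv_eq_sum_wirtinger, fderiv_eq_sum_wirtinger, Finset.mul_sum, ← Finset.sum_sub_distrib,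
    Finset.mul_sum]
  refine Finset.sum_congr rfl fun x _ => ?_
  simp only [Pi.smul_apply, smul_eq_mul, map_mul, Complex.conj_I]
  linear_combination (-(1 / 2 : ℂ) * (dz g x z * c x - dzbar g x z * conj (c x))) * Complex.I_sq

theorem fderiv_add_I_mul (g : (κ → ℂ) → ℂ) (z c : κ → ℂ) :
    (1 / 2 : ℂ) * (fderiv ℝ g z c + Complex.I * fderiv ℝ g z (Complex.I • c)) =
      ∑ x, dzbar g x z * conj (c x) := by
  rw [fderiv_eq_sum_wirtinger, fderiv_eq_sum_wirtinger, Finset.mul_sum, ← Finset.sum_add_distrib,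
    Finset.mul_sum]
  refine Finset.sum_congr rfl fun x _ => ?_
  simp only [Pi.smul_apply, smul_eq_mul, map_mul, Complex.conj_I]
  linear_combination ((1 / 2 : ℂ) * (dz g x z * c x - dzbar g x z * conj (c x))) * Complex.I_sq

theorem IsTame.continuous_dz {g : (κ → ℂ) → ℂ} (hg : IsTame g) (x : κ) : Continuous (dz g x) := by
  have := hg.contDiff.continuous_fderiv (by norm_num)
  unfold dz
  fun_prop

theorem norm_half_fderiv_le (L : (κ → ℂ) →L[ℝ] ℂ) (x : κ) (s : ℂ) (hs : ‖s‖ = 1) :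
    ‖(1 / 2 : ℂ) * (L (Pi.single x 1) + s * L (Pi.single x Complex.I))‖ ≤ ‖L‖ := by
  have h1 := L.le_opNorm (Pi.single x 1)
  have h2 := L.le_opNorm (Pi.single x Complex.I)
  rw [Pi.norm_single] at h1 h2
  simp only [norm_one, Complex.norm_I, mul_one] at h1 h2
  have h3 := norm_add_le (L (Pi.single x 1)) (s * L (Pi.single x Complex.I))
  rw [norm_mul, hs, one_mul] at h3
  rw [norm_mul]
  norm_num
  linarith

theorem IsTame.growth_dz {g : (κ → ℂ) → ℂ} (hg : IsTame g) (x : κ) :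
    ∃ (k : ℕ) (C : ℝ), ∀ z, ‖dz g x z‖ ≤ C * (1 + ‖z‖) ^ k := by
  obtain ⟨k, C, h⟩ := hg.growth_fderiv
  refine ⟨k, C, fun z => (le_trans ?_ (h z))⟩
  have := norm_half_fderiv_le (fderiv ℝ g z) x (-Complex.I) (by simp)
  simpa [dz, sub_eq_add_neg] using this

theorem dz_mul {f g : (κ → ℂ) → ℂ} (hf : IsTame f) (hg : IsTame g) (x : κ) (z : κ → ℂ) :
    dz (fun z => f z * g z) x z = f z * dz g x z + g z * dz f x z := by
  simp only [dz]
  rw [fderiv_fun_mul hf.differentiable.differentiableAt hg.differentiable.differentiableAt]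
  simp only [add_apply, smul_apply, smul_eq_mul]
  ring

theorem dzbar_mul {f g : (κ → ℂ) → ℂ} (hf : IsTame f) (hg : IsTame g) (x : κ) (z : κ → ℂ) :
    dzbar (fun z => f z * g z) x z = f z * dzbar g x z + g z * dzbar f x z := by
  simp only [dzbar]
  rw [fderiv_fun_mul hf.differentiable.differentiableAt hg.differentiable.differentiableAt]
  simp only [add_apply, smul_apply, smul_eq_mul]
  ring

end Wirtinger

section Isonormal

variable {H Ω : Type*} [NormedAddCommGroup H] [InnerProductSpace ℂ H] [MeasurableSpace Ω]
  {Z : H → Ω → ℂ} {P : Measure Ω}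

theorem IsComplexIsonormal.hasGaussianLaw_pi (hZ : IsComplexIsonormal Z P) {κ : Type*} [Fintype κ]
    (φ : κ → H) : HasGaussianLaw (fun ω x => Z (φ x) ω) P := by
  classical
  have h := hZ.gaussian.hasGaussianLaw (Finset.univ.image φ)
  exact h.map_fun (ContinuousLinearMap.pi fun x => ContinuousLinearMap.proj
    (R := ℝ) (φ := fun _ : Finset.univ.image φ => ℂ)
    ⟨φ x, Finset.mem_image_of_mem φ (Finset.mem_univ x)⟩)

theorem IsComplexIsonormal.hasGaussianLaw_prod (hZ : IsComplexIsonormal Z P) {κ : Type*} [Fintype κ]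
    (ψ : H) (φ : κ → H) : HasGaussianLaw (fun ω => (Z ψ ω, fun x => Z (φ x) ω)) P :=
  (hZ.hasGaussianLaw_pi fun o : Option κ => o.elim ψ φ).map_fun
    ((ContinuousLinearMap.proj (R := ℝ) (φ := fun _ : Option κ => ℂ) none).prod
      (ContinuousLinearMap.pi fun x => ContinuousLinearMap.proj
        (R := ℝ) (φ := fun _ : Option κ => ℂ) (some x)))

theorem IsComplexIsonormal.memLp (hZ : IsComplexIsonormal Z P) (h : H) (p : ℝ≥0∞) (hp : p ≠ ∞) :
    MemLp (Z h) p P :=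
  (hZ.gaussian.hasGaussianLaw_eval h).memLp hp

theorem IsComplexIsonormal.ae_add (hZ : IsComplexIsonormal Z P) (g h : H) :
    Z (g + h) =ᵐ[P] Z g + Z h := by
  let z : H → Lp ℂ 2 P := fun a => (hZ.memLp a 2 (by norm_num)).toLp
  have hin (a b : H) : inner ℂ (z a) (z b) = inner ℂ a b := by
    rw [L2.inner_def, ← hZ.covariance]
    refine integral_congr_ae ?_
    filter_upwards [(hZ.memLp a 2 (by norm_num)).coeFn_toLp,
      (hZ.memLp b 2 (by norm_num)).coeFn_toLp] with ω h1 h2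
    simp [z, h1, h2]
  have h0 : z (g + h) - (z g + z h) = 0 := by
    rw [← inner_self_eq_zero (𝕜 := ℂ)]
    simp only [inner_sub_left, inner_sub_right, inner_add_left, inner_add_right, hin]
    ring
  rw [sub_eq_zero] at h0
  refine (MemLp.toLp_eq_toLp_iff (hZ.memLp (g + h) 2 (by norm_num))
    ((hZ.memLp g 2 (by norm_num)).add (hZ.memLp h 2 (by norm_num)))).1 ?_
  rw [MemLp.toLp_add]
  exact h0

theorem IsComplexIsonormal.integral_mul_eq_zero (hZ : IsComplexIsonormal Z P) (g h : H) :
    ∫ ω, Z g ω * Z h ω ∂P = 0 := by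
  have i (a b : H) : Integrable (fun ω => Z a ω * Z b ω) P :=
    (hZ.memLp a 2 (by norm_num)).integrable_mul (hZ.memLp b 2 (by norm_num))
  have h1 : ∫ ω, Z (g + h) ω ^ 2 ∂P =
      ∫ ω, (Z g ω * Z g ω + Z h ω * Z h ω) + 2 * (Z g ω * Z h ω) ∂P := by
    refine integral_congr_ae ?_
    filter_upwards [hZ.ae_add g h] with ω hω
    rw [hω, Pi.add_apply]
    ring
  rw [hZ.pseudo_zero, integral_add (f := fun ω => Z g ω * Z g ω + Z h ω * Z h ω)
    ((i g g).add (i h h)) ((i g h).const_mul 2),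
    integral_add (i g g) (i h h), integral_const_mul] at h1
  have h2 (a : H) : ∫ ω, Z a ω * Z a ω ∂P = 0 := by
    rw [← hZ.pseudo_zero a]
    simp [sq]
  rw [h2, h2] at h1
  simpa using h1.symm

variable {κ : Type*} [Fintype κ] [DecidableEq κ]

theorem IsComplexIsonormal.integral_re_smul (hZ : IsComplexIsonormal Z P) (ψ : H) (φ : κ → H) :
    ∫ ω, (Z ψ ω).re • (fun x => Z (φ x) ω) ∂P = (1 / 2 : ℂ) • fun x => inner ℂ ψ (φ x) := by
  have hi (x : κ) : Integrable (fun ω => (Z ψ ω).re • Z (φ x) ω) P :=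
    memLp_one_iff_integrable.1 ((hZ.memLp (φ x) 2 (by norm_num)).smul
      (hZ.memLp ψ 2 (by norm_num)).re)
  ext x
  have ev : (∫ ω, (Z ψ ω).re • (fun x => Z (φ x) ω) ∂P) x = ∫ ω, (Z ψ ω).re • Z (φ x) ω ∂P :=
    eval_integral (f := fun ω x => (Z ψ ω).re • Z (φ x) ω) hi x
  rw [ev]
  have e (ω : Ω) : (Z ψ ω).re • Z (φ x) ω = (1 / 2 : ℂ) * (Z ψ ω * Z (φ x) ω) +
      (1 / 2 : ℂ) * (Z (φ x) ω * conj (Z ψ ω)) := by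
    rw [Complex.real_smul, Complex.re_eq_add_conj]
    ring
  simp only [Pi.smul_apply, e]
  rw [integral_add, integral_const_mul, integral_const_mul, hZ.integral_mul_eq_zero, hZ.covariance]
  · simp
  · exact ((hZ.memLp ψ 2 (by norm_num)).integrable_mul (hZ.memLp _ 2 (by norm_num))).const_mul _
  · exact ((hZ.memLp _ 2 (by norm_num)).integrable_mul
      (hZ.memLp ψ 2 (by norm_num)).star).const_mul _

theorem IsComplexIsonormal.integral_im_smul (hZ : IsComplexIsonormal Z P) (ψ : H) (φ : κ → H) :
    ∫ ω, (Z ψ ω).im • (fun x => Z (φ x) ω) ∂P =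
      (1 / 2 : ℂ) • Complex.I • fun x => inner ℂ ψ (φ x) := by
  have hi (x : κ) : Integrable (fun ω => (Z ψ ω).im • Z (φ x) ω) P :=
    memLp_one_iff_integrable.1 ((hZ.memLp (φ x) 2 (by norm_num)).smul
      (hZ.memLp ψ 2 (by norm_num)).im)
  ext x
  have ev : (∫ ω, (Z ψ ω).im • (fun x => Z (φ x) ω) ∂P) x = ∫ ω, (Z ψ ω).im • Z (φ x) ω ∂P :=
    eval_integral (f := fun ω x => (Z ψ ω).im • Z (φ x) ω) hi x
  rw [ev]
  have e (ω : Ω) : (Z ψ ω).im • Z (φ x) ω = (-Complex.I / 2 : ℂ) * (Z ψ ω * Z (φ x) ω) +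
      (Complex.I / 2 : ℂ) * (Z (φ x) ω * conj (Z ψ ω)) := by
    rw [Complex.real_smul, Complex.im_eq_sub_conj]
    field_simp
    linear_combination (-Z ψ ω * Z (φ x) ω + Z (φ x) ω * conj (Z ψ ω)) * (-Complex.I_sq)
  simp only [Pi.smul_apply, e]
  rw [integral_add, integral_const_mul, integral_const_mul, hZ.integral_mul_eq_zero, hZ.covariance]
  · simp
    ring
  · exact ((hZ.memLp ψ 2 (by norm_num)).integrable_mul (hZ.memLp _ 2 (by norm_num))).const_mul _
  · exact ((hZ.memLp _ 2 (by norm_num)).integrable_mul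
      (hZ.memLp ψ 2 (by norm_num)).star).const_mul _

theorem IsComplexIsonormal.stein_re (hZ : IsComplexIsonormal Z P) (ψ : H) (φ : κ → H)
    {g : (κ → ℂ) → ℂ} (hg : IsTame g) :
    ∫ ω, ((Z ψ ω).re : ℂ) * g (fun x => Z (φ x) ω) ∂P =
      ∫ ω, (1 / 2 : ℂ) * fderiv ℝ g (fun x => Z (φ x) ω) (fun x => inner ℂ ψ (φ x)) ∂P := by
  have h := (hZ.hasGaussianLaw_prod ψ φ).map_fun (Complex.reCLM.prodMap (.id ℝ (κ → ℂ)))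
  have := hZ.gaussian.isProbabilityMeasure
  have h0 : ∫ ω, (Z ψ ω).re ∂P = 0 := by
    have := Complex.reCLM.integral_comp_comm ((hZ.memLp ψ 1 (by norm_num)).integrable le_rfl)
    simpa [hZ.mean_zero] using this
  have := integral_mul_comp_eq h h0 hg
  have e0 := hZ.integral_re_smul ψ φ
  refine this.trans ?_
  erw [e0]
  refine integral_congr_ae (ae_of_all _ fun ω => ?_)
  have e : ((1 / 2 : ℂ) • fun x => inner ℂ ψ (φ x) : κ → ℂ) =
      (1 / 2 : ℝ) • fun x => inner ℂ ψ (φ x) := by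
    ext x
    simp
  simp only [e, map_smul, Complex.real_smul]
  norm_num

theorem IsComplexIsonormal.stein_im (hZ : IsComplexIsonormal Z P) (ψ : H) (φ : κ → H)
    {g : (κ → ℂ) → ℂ} (hg : IsTame g) :
    ∫ ω, ((Z ψ ω).im : ℂ) * g (fun x => Z (φ x) ω) ∂P =
      ∫ ω, (1 / 2 : ℂ) *
        fderiv ℝ g (fun x => Z (φ x) ω) (Complex.I • fun x => inner ℂ ψ (φ x)) ∂P := by
  have h := (hZ.hasGaussianLaw_prod ψ φ).map_fun (Complex.imCLM.prodMap (.id ℝ (κ → ℂ)))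
  have := hZ.gaussian.isProbabilityMeasure
  have h0 : ∫ ω, (Z ψ ω).im ∂P = 0 := by
    have := Complex.imCLM.integral_comp_comm ((hZ.memLp ψ 1 (by norm_num)).integrable le_rfl)
    simpa [hZ.mean_zero] using this
  have := integral_mul_comp_eq h h0 hg
  have e0 := hZ.integral_im_smul ψ φ
  refine this.trans ?_
  erw [e0]
  refine integral_congr_ae (ae_of_all _ fun ω => ?_)
  have e : ((1 / 2 : ℂ) • Complex.I • fun x => inner ℂ ψ (φ x) : κ → ℂ) =
      (1 / 2 : ℝ) • Complex.I • fun x => inner ℂ ψ (φ x) := by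
    ext x
    simp
  simp only [e, map_smul, Complex.real_smul]
  norm_num

theorem IsComplexIsonormal.integrable_re (hZ : IsComplexIsonormal Z P) (ψ : H) (φ : κ → H)
    {g : (κ → ℂ) → ℂ} (hg : IsTame g) :
    Integrable (fun ω => ((Z ψ ω).re : ℂ) * g (fun x => Z (φ x) ω)) P :=
  integrable_mul_comp
    ((hZ.hasGaussianLaw_prod ψ φ).map_fun (Complex.reCLM.prodMap (.id ℝ (κ → ℂ)))) hg

theorem IsComplexIsonormal.integrable_im (hZ : IsComplexIsonormal Z P) (ψ : H) (φ : κ → H)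
    {g : (κ → ℂ) → ℂ} (hg : IsTame g) :
    Integrable (fun ω => ((Z ψ ω).im : ℂ) * g (fun x => Z (φ x) ω)) P :=
  integrable_mul_comp
    ((hZ.hasGaussianLaw_prod ψ φ).map_fun (Complex.imCLM.prodMap (.id ℝ (κ → ℂ)))) hg

/-- Gaussian integration by parts against `conj Z(ψ)`. -/
theorem IsComplexIsonormal.integral_conj_mul (hZ : IsComplexIsonormal Z P) (ψ : H) (φ : κ → H)
    {g : (κ → ℂ) → ℂ} (hg : IsTame g) :
    ∫ ω, conj (Z ψ ω) * g (fun x => Z (φ x) ω) ∂P =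
      ∫ ω, ∑ x, dz g x (fun x => Z (φ x) ω) * inner ℂ ψ (φ x) ∂P := by
  have hY := hZ.hasGaussianLaw_pi φ
  simp only [← fderiv_sub_I_mul g _ fun x => inner ℂ ψ (φ x)]
  have e (ω : Ω) : conj (Z ψ ω) * g (fun x => Z (φ x) ω) =
      ((Z ψ ω).re : ℂ) * g (fun x => Z (φ x) ω) -
        Complex.I * (((Z ψ ω).im : ℂ) * g (fun x => Z (φ x) ω)) := by
    conv_lhs => rw [← Complex.re_add_im (Z ψ ω)]
    simp only [map_add, map_mul, Complex.conj_ofReal, Complex.conj_I]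
    ring
  simp only [e]
  rw [integral_sub (hZ.integrable_re ψ φ hg) ((hZ.integrable_im ψ φ hg).const_mul _),
    integral_const_mul, hZ.stein_re ψ φ hg, hZ.stein_im ψ φ hg, ← integral_const_mul,
    ← integral_sub]
  · refine integral_congr_ae (ae_of_all _ fun ω => ?_)
    ring
  · exact (integrable_fderiv_comp hY hg _).const_mul _
  · exact ((integrable_fderiv_comp hY hg _).const_mul _).const_mul _

/-- Gaussian integration by parts against `Z(ψ)`. -/
theorem IsComplexIsonormal.integral_mul (hZ : IsComplexIsonormal Z P) (ψ : H) (φ : κ → H)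
    {g : (κ → ℂ) → ℂ} (hg : IsTame g) :
    ∫ ω, Z ψ ω * g (fun x => Z (φ x) ω) ∂P =
      ∫ ω, ∑ x, dzbar g x (fun x => Z (φ x) ω) * inner ℂ (φ x) ψ ∂P := by
  have hY := hZ.hasGaussianLaw_pi φ
  have e' (x : κ) : inner ℂ (φ x) ψ = conj (inner ℂ ψ (φ x)) := (inner_conj_symm _ _).symm
  simp only [e']
  simp only [← fderiv_add_I_mul g _ fun x => inner ℂ ψ (φ x)]
  have e (ω : Ω) : Z ψ ω * g (fun x => Z (φ x) ω) =
      ((Z ψ ω).re : ℂ) * g (fun x => Z (φ x) ω) +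
        Complex.I * (((Z ψ ω).im : ℂ) * g (fun x => Z (φ x) ω)) := by
    conv_lhs => rw [← Complex.re_add_im (Z ψ ω)]
    ring
  simp only [e]
  rw [integral_add (hZ.integrable_re ψ φ hg) ((hZ.integrable_im ψ φ hg).const_mul _),
    integral_const_mul, hZ.stein_re ψ φ hg, hZ.stein_im ψ φ hg, ← integral_const_mul,
    ← integral_add]
  · refine integral_congr_ae (ae_of_all _ fun ω => ?_)
    ring
  · exact (integrable_fderiv_comp hY hg _).const_mul _
  · exact ((integrable_fderiv_comp hY hg _).const_mul _).const_mul _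

end Isonormal

/-! ### Polynomials in an isonormal process -/

section EvalPoly

variable {κ : Type*} [Fintype κ] [DecidableEq κ]

open MvPolynomial

theorem dz_of_fderiv {g : (κ → ℂ) → ℂ} {L : (κ → ℂ) →L[ℝ] ℂ} {z : κ → ℂ} (h : fderiv ℝ g z = L)
    (x : κ) : dz g x z =
      (1 / 2 : ℂ) * (L (Pi.single x 1) - Complex.I * L (Pi.single x Complex.I)) := by
  rw [dz, h]

theorem dzbar_of_fderiv {g : (κ → ℂ) → ℂ} {L : (κ → ℂ) →L[ℝ] ℂ} {z : κ → ℂ} (h : fderiv ℝ g z = L)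
    (x : κ) : dzbar g x z =
      (1 / 2 : ℂ) * (L (Pi.single x 1) + Complex.I * L (Pi.single x Complex.I)) := by
  rw [dzbar, h]

theorem fderiv_coord (y : κ) (z : κ → ℂ) :
    fderiv ℝ (fun z : κ → ℂ => z y) z = ContinuousLinearMap.proj y :=
  (ContinuousLinearMap.proj (R := ℝ) (φ := fun _ : κ => ℂ) y).fderiv

theorem fderiv_conj_coord (y : κ) (z : κ → ℂ) :
    fderiv ℝ (fun z : κ → ℂ => conj (z y)) z =
      (Complex.conjCLE : ℂ →L[ℝ] ℂ).comp (ContinuousLinearMap.proj y) :=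
  ((Complex.conjCLE : ℂ →L[ℝ] ℂ).comp
    (ContinuousLinearMap.proj (R := ℝ) (φ := fun _ : κ => ℂ) y)).fderiv

/-- The value of a polynomial in `z` and `conj z`. -/
def evalPoly (z : κ → ℂ) : Poly κ →ₐ[ℂ] ℂ :=
  aeval (Sum.elim z fun x => conj (z x))

@[simp] theorem evalPoly_X_inl (z : κ → ℂ) (x : κ) : evalPoly z (X (Sum.inl x)) = z x := by
  simp [evalPoly]

@[simp] theorem evalPoly_X_inr (z : κ → ℂ) (x : κ) : evalPoly z (X (Sum.inr x)) = conj (z x) := by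
  simp [evalPoly]

theorem hasTemperateGrowth_conj : Function.HasTemperateGrowth fun z : ℂ => conj z :=
  (Complex.conjCLE : ℂ →L[ℝ] ℂ).hasTemperateGrowth

theorem hasTemperateGrowth_coord (x : κ) : Function.HasTemperateGrowth fun z : κ → ℂ => z x :=
  (ContinuousLinearMap.proj (R := ℝ) (φ := fun _ : κ => ℂ) x).hasTemperateGrowth

theorem hasTemperateGrowth_evalPoly (p : Poly κ) :
    Function.HasTemperateGrowth fun z : κ → ℂ => evalPoly z p := by
  induction p using MvPolynomial.induction_on with
  | C a => simp
  | add p q hp hq => simpa only [map_add] using! hp.add hq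
  | mul_X p y hp =>
    simp only [map_mul]
    refine hp.mul ?_
    rcases y with x | x
    · simpa using! hasTemperateGrowth_coord x
    · simpa using! hasTemperateGrowth_conj.comp (hasTemperateGrowth_coord x)

theorem dz_evalPoly (p : Poly κ) (x : κ) (z : κ → ℂ) :
    dz (fun z => evalPoly z p) x z = evalPoly z (pderiv (Sum.inl x) p) := by
  induction p using MvPolynomial.induction_on with
  | C a => simp [dz]
  | add p q hp hq =>
    simp only [map_add, ← hp, ← hq, dz]
    rw [fderiv_fun_add (hasTemperateGrowth_evalPoly p).isTame.differentiable.differentiableAt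
      (hasTemperateGrowth_evalPoly q).isTame.differentiable.differentiableAt]
    simp only [add_apply]
    ring
  | mul_X p y hp =>
    simp only [map_mul]
    rw [dz_mul (hasTemperateGrowth_evalPoly p).isTame (hasTemperateGrowth_evalPoly (X y)).isTame,
      hp, Derivation.leibniz, map_add, smul_eq_mul, smul_eq_mul, map_mul, map_mul]
    congr 2
    rcases y with y | y
    · simp only [evalPoly_X_inl]
      rw [dz_of_fderiv (fderiv_coord y z), pderiv_X]
      by_cases h : y = x
      · subst h
        simp
        norm_num
      · have : (Sum.inl y : κ ⊕ κ) ≠ Sum.inl x := by simpa using h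
        simp [this, h]
    · simp only [evalPoly_X_inr]
      rw [dz_of_fderiv (fderiv_conj_coord y z), pderiv_X]
      by_cases h : y = x
      · subst h
        simp
      · simp [h]

theorem dzbar_evalPoly (p : Poly κ) (x : κ) (z : κ → ℂ) :
    dzbar (fun z => evalPoly z p) x z = evalPoly z (pderiv (Sum.inr x) p) := by
  induction p using MvPolynomial.induction_on with
  | C a => simp [dzbar]
  | add p q hp hq =>
    simp only [map_add, ← hp, ← hq, dzbar]
    rw [fderiv_fun_add (hasTemperateGrowth_evalPoly p).isTame.differentiable.differentiableAt
      (hasTemperateGrowth_evalPoly q).isTame.differentiable.differentiableAt]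
    simp only [add_apply]
    ring
  | mul_X p y hp =>
    simp only [map_mul]
    rw [dzbar_mul (hasTemperateGrowth_evalPoly p).isTame (hasTemperateGrowth_evalPoly (X y)).isTame,
      hp, Derivation.leibniz, map_add, smul_eq_mul, smul_eq_mul, map_mul, map_mul]
    congr 2
    rcases y with y | y
    · simp only [evalPoly_X_inl]
      rw [dzbar_of_fderiv (fderiv_coord y z), pderiv_X]
      by_cases h : y = x
      · subst h
        simp
      · simp [h]
    · simp only [evalPoly_X_inr]
      rw [dzbar_of_fderiv (fderiv_conj_coord y z), pderiv_X]
      by_cases h : y = x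
      · subst h
        simp
        norm_num
      · have : (Sum.inr y : κ ⊕ κ) ≠ Sum.inr x := by simpa using h
        simp [this, h]

end EvalPoly

section Functional

variable {H Ω : Type*} [NormedAddCommGroup H] [InnerProductSpace ℂ H] [MeasurableSpace Ω]
  {Z : H → Ω → ℂ} {P : Measure Ω} {κ : Type*} [Fintype κ] [DecidableEq κ]

open MvPolynomial

theorem IsComplexIsonormal.memLp_comp (hZ : IsComplexIsonormal Z P) (φ : κ → H)
    {g : (κ → ℂ) → ℂ} (hg : Continuous g)
    (h : ∃ (k : ℕ) (C : ℝ), ∀ x, ‖g x‖ ≤ C * (1 + ‖x‖) ^ k) (p : ℝ≥0∞) (hp : p ≠ ∞) :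
    MemLp (fun ω => g fun x => Z (φ x) ω) p P :=
  HasGaussianLaw.memLp_comp (hZ.hasGaussianLaw_pi φ) hg h p hp

theorem IsComplexIsonormal.memLp_evalPoly (hZ : IsComplexIsonormal Z P) (φ : κ → H) (p : Poly κ)
    (r : ℝ≥0∞) (hr : r ≠ ∞) : MemLp (fun ω => evalPoly (fun x => Z (φ x) ω) p) r P :=
  have h := (hasTemperateGrowth_evalPoly p).isTame
  hZ.memLp_comp φ h.contDiff.continuous h.growth r hr

theorem IsComplexIsonormal.integrable_evalPoly (hZ : IsComplexIsonormal Z P) (φ : κ → H)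
    (p : Poly κ) : Integrable (fun ω => evalPoly (fun x => Z (φ x) ω) p) P :=
  memLp_one_iff_integrable.1 (hZ.memLp_evalPoly φ p 1 (by norm_num))

/-- The functional `p ↦ E[p(Z(φ), conj Z(φ))]`. -/
def expectation (hZ : IsComplexIsonormal Z P) (φ : κ → H) : Poly κ →ₗ[ℂ] ℂ where
  toFun p := ∫ ω, evalPoly (fun x => Z (φ x) ω) p ∂P
  map_add' p q := by
    simp only [map_add]
    exact integral_add (hZ.integrable_evalPoly φ p) (hZ.integrable_evalPoly φ q)
  map_smul' a p := by
    simp only [map_smul, smul_eq_mul, RingHom.id_apply]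
    exact integral_const_mul _ _

theorem isGaussianFunctional_expectation (hZ : IsComplexIsonormal Z P) {φ : κ → H}
    (hφ : Orthonormal ℂ φ) : IsGaussianFunctional (expectation hZ φ) where
  map_one := by
    have := hZ.gaussian.isProbabilityMeasure
    simp [expectation]
  map_X_mul y p := by
    have hp := (hasTemperateGrowth_evalPoly p).isTame
    rw [orthonormal_iff_ite] at hφ
    rcases y with y | y
    · simp only [expectation, LinearMap.coe_mk, AddHom.coe_mk, map_mul, evalPoly_X_inl,
        Sum.swap_inl]
      rw [hZ.integral_mul (φ y) φ hp]
      refine integral_congr_ae (ae_of_all _ fun ω => ?_)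
      simp [dzbar_evalPoly, hφ]
    · simp only [expectation, LinearMap.coe_mk, AddHom.coe_mk, map_mul, evalPoly_X_inr,
        Sum.swap_inr]
      rw [hZ.integral_conj_mul (φ y) φ hp]
      refine integral_congr_ae (ae_of_all _ fun ω => ?_)
      simp [dz_evalPoly, hφ]

end Functional

/-! ### Closability of the Malliavin derivative -/

section Closable

variable {κ κ' : Type*} [Fintype κ] [DecidableEq κ] [Fintype κ'] [DecidableEq κ']

theorem sum_dz_comp {g : (κ → ℂ) → ℂ} (hg : Differentiable ℝ g) (s : κ → κ') (z c : κ' → ℂ) :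
    ∑ y, dz (fun z : κ' → ℂ => g (z ∘ s)) y z * c y = ∑ x, dz g x (z ∘ s) * c (s x) := by
  have h (c : κ' → ℂ) : fderiv ℝ (fun z : κ' → ℂ => g (z ∘ s)) z c = fderiv ℝ g (z ∘ s) (c ∘ s) := by
    let R : (κ' → ℂ) →L[ℝ] (κ → ℂ) :=
      ContinuousLinearMap.pi fun x => ContinuousLinearMap.proj (s x)
    have := ((hg (z ∘ s)).hasFDerivAt.comp z (f := R) R.hasFDerivAt).fderiv
    have e : (fun z : κ' → ℂ => g (z ∘ s)) = g ∘ R := rfl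
    rw [e, this]
    rfl
  have h' := fderiv_sub_I_mul g (z ∘ s) (c ∘ s)
  rw [← fderiv_sub_I_mul, h, h]
  exact h'

theorem hasTemperateGrowth_comp_reindex {g : (κ → ℂ) → ℂ} (hg : g.HasTemperateGrowth)
    (s : κ → κ') : Function.HasTemperateGrowth fun z : κ' → ℂ => g (z ∘ s) :=
  hg.comp (f := fun z : κ' → ℂ => z ∘ s) (ContinuousLinearMap.pi fun x =>
    ContinuousLinearMap.proj (R := ℝ) (φ := fun _ : κ' => ℂ) (s x)).hasTemperateGrowth

theorem hasTemperateGrowth_dz {g : (κ → ℂ) → ℂ} (hg : g.HasTemperateGrowth) (x : κ) :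
    (dz g x).HasTemperateGrowth := by
  have h1 := hg.fderiv_apply (Pi.single x (1 : ℂ))
  have h2 := hg.fderiv_apply (Pi.single x Complex.I)
  exact (Function.HasTemperateGrowth.const (1 / 2 : ℂ)).mul
    (h1.sub ((Function.HasTemperateGrowth.const Complex.I).mul h2))

variable {H Ω : Type*} [NormedAddCommGroup H] [InnerProductSpace ℂ H] [MeasurableSpace Ω]
  {Z : H → Ω → ℂ} {P : Measure Ω}

theorem isSmoothWithDeriv_of_fintype (Z : H → Ω → ℂ) (φ : κ → H) {g : (κ → ℂ) → ℂ}
    (hg : g.HasTemperateGrowth) :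
    IsSmoothWithDeriv Z (fun ω => g fun x => Z (φ x) ω)
      (fun ω => ∑ x, dz g x (fun x => Z (φ x) ω) • φ x) := by
  let s := Fintype.equivFin κ
  refine ⟨Fintype.card κ, φ ∘ s.symm, fun z => g (z ∘ s), hasTemperateGrowth_comp_reindex hg s,
    fun ω => ?_, fun ω => ?_⟩
  · simp [Function.comp_def]
  · rw [← s.sum_comp]
    refine Finset.sum_congr rfl fun x _ => ?_
    have h := sum_dz_comp hg.isTame.differentiable s (fun i => Z ((φ ∘ s.symm) i) ω)
      (Pi.single (s x) 1)
    simp only [Pi.single_apply, EmbeddingLike.apply_eq_iff_eq, mul_ite, mul_one, mul_zero,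
      Finset.sum_ite_eq', Finset.mem_univ, if_true] at h
    have e : (fun i => Z ((φ ∘ s.symm) i) ω) ∘ s = fun x => Z (φ x) ω := by
      ext x
      simp
    rw [e] at h
    rw [← h]
    simp [dz, wirtinger]

theorem IsSmoothWithDeriv.memLp (hZ : IsComplexIsonormal Z P) {G : Ω → ℂ} {V : Ω → H}
    (h : IsSmoothWithDeriv Z G V) : MemLp G 2 P ∧ MemLp V 2 P := by
  obtain ⟨N, φ, g, hg, hG, hV⟩ := h
  rw [funext hG, funext hV]
  refine ⟨hZ.memLp_comp φ hg.isTame.contDiff.continuous hg.isTame.growth 2 (by norm_num),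
    memLp_finsetSum _ fun i _ => ?_⟩
  have := hZ.memLp_comp φ (hg.isTame.continuous_dz i) (hg.isTame.growth_dz i) 2 (by norm_num)
  refine (this.norm.mul_const ‖φ i‖).mono
    (this.aestronglyMeasurable.smul_const _) (ae_of_all _ fun ω => ?_)
  rw [norm_smul, norm_mul, norm_norm, norm_norm]
  rfl

/-- Pairing with the derivative of a smooth random variable is a bounded operation on the random
variable itself. -/
theorem IsSmoothWithDeriv.exists_divergence (hZ : IsComplexIsonormal Z P) {G₀ : Ω → ℂ}
    {V₀ : Ω → H} (h₀ : IsSmoothWithDeriv Z G₀ V₀) :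
    ∃ T : Ω → ℂ, MemLp T 2 P ∧ ∀ (G : Ω → ℂ) (V : Ω → H), IsSmoothWithDeriv Z G V →
      ∫ ω, inner ℂ (V₀ ω) (V ω) ∂P = ∫ ω, T ω * G ω ∂P := by
  obtain ⟨N, φ, g, hg, -, hV⟩ := h₀
  -- With `K i = conj (∂_i g)`, the divergence of `V₀ = ∂_i g(Y) φ_i` (summed over `i`) is the
  -- sum of `conj Z(φ_i) K_i(Y) - ∑_j ∂_j K_i(Y) ⟨φ_j, φ_i⟩`.
  let K : Fin N → (Fin N → ℂ) → ℂ := fun i z => conj (dz g i z)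
  have hK (i : Fin N) : (K i).HasTemperateGrowth :=
    hasTemperateGrowth_conj.comp (hasTemperateGrowth_dz hg i)
  let Y : Ω → Fin N → ℂ := fun ω i => Z (φ i) ω
  let S : Fin N → Ω → ℂ := fun i ω => ∑ j, dz (K i) j (Y ω) * inner ℂ (φ i) (φ j)
  have hS (i : Fin N) : MemLp (S i) 2 P := memLp_finsetSum _ fun j _ =>
    (hZ.memLp_comp φ ((hK i).isTame.continuous_dz j) ((hK i).isTame.growth_dz j) 2
      (by norm_num)).mul_const _
  have hKm (i : Fin N) (p : ℝ≥0∞) (hp : p ≠ ∞) : MemLp (fun ω => K i (Y ω)) p P :=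
    hZ.memLp_comp φ (hK i).isTame.contDiff.continuous (hK i).isTame.growth p hp
  have hZK (i : Fin N) : MemLp (fun ω => conj (Z (φ i) ω) * K i (Y ω)) 2 P :=
    memLp_mul_all (fun p hp => (hZ.memLp (φ i) p hp).star) (hKm i) 2 (by norm_num)
  refine ⟨fun ω => ∑ i, (conj (Z (φ i) ω) * K i (Y ω) - S i ω),
    memLp_finsetSum _ fun i _ => (hZK i).sub (hS i), ?_⟩
  rintro G V ⟨N', φ', g', hg', hG', hV'⟩
  let Y' : Ω → Fin N' → ℂ := fun ω i => Z (φ' i) ω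
  have hg'm : MemLp G 2 P := by
    rw [funext hG']
    exact hZ.memLp_comp φ' hg'.isTame.contDiff.continuous hg'.isTame.growth 2 (by norm_num)
  have key (i : Fin N) : ∫ ω, K i (Y ω) * ∑ j, dz g' j (Y' ω) * inner ℂ (φ i) (φ' j) ∂P =
      ∫ ω, (conj (Z (φ i) ω) * K i (Y ω) - S i ω) * G ω ∂P := by
    -- Both families of variables are joined, so that integration by parts and the product rule
    -- apply to `K i * g'`.
    have a1 := (hasTemperateGrowth_comp_reindex (hK i) (Sum.inl : Fin N → Fin N ⊕ Fin N'))
    have a2 := (hasTemperateGrowth_comp_reindex hg' (Sum.inr : Fin N' → Fin N ⊕ Fin N'))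
    have h := hZ.integral_conj_mul (φ i) (Sum.elim φ φ') (a1.isTame.mul a2.isTame)
    have e1 (ω : Ω) : (fun x => Z (Sum.elim φ φ' x) ω) ∘ Sum.inl = Y ω := rfl
    have e2 (ω : Ω) : (fun x => Z (Sum.elim φ φ' x) ω) ∘ Sum.inr = Y' ω := rfl
    simp only [dz_mul a1.isTame a2.isTame, e1, e2, add_mul, Finset.sum_add_distrib, mul_assoc,
      ← Finset.mul_sum] at h
    simp only [sum_dz_comp (hK i).isTame.differentiable, sum_dz_comp hg'.isTame.differentiable,
      e1, e2, Sum.elim_inl, Sum.elim_inr] at h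
    have i2 : MemLp (fun ω => ∑ j, dz g' j (Y' ω) * inner ℂ (φ i) (φ' j)) 2 P :=
      memLp_finsetSum _ fun j _ =>
      (hZ.memLp_comp φ' (hg'.isTame.continuous_dz j) (hg'.isTame.growth_dz j) 2
        (by norm_num)).mul_const _
    have eG (ω : Ω) : g' (Y' ω) = G ω := (hG' ω).symm
    simp only [eG] at h
    rw [integral_add (f := fun ω => K i (Y ω) * ∑ j, dz g' j (Y' ω) * inner ℂ (φ i) (φ' j))
      (g := fun ω => G ω * S i ω) ((hKm i 2 (by norm_num)).integrable_mul i2)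
      (hg'm.integrable_mul (hS i))] at h
    have i3 := (hZK i).integrable_mul hg'm
    have i4 : Integrable (fun ω => G ω * S i ω) P := hg'm.integrable_mul (hS i)
    have e5 : ∫ ω, (conj (Z (φ i) ω) * K i (Y ω) - S i ω) * G ω ∂P =
        ∫ ω, conj (Z (φ i) ω) * (K i (Y ω) * G ω) ∂P - ∫ ω, G ω * S i ω ∂P := by
      rw [← integral_sub _ i4]
      · refine integral_congr_ae (ae_of_all _ fun ω => ?_)
        ring
      · refine i3.congr (ae_of_all _ fun ω => ?_)
        simp only [Pi.mul_apply]
        ring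
    rw [e5, h]
    ring
  have e3 (ω : Ω) : inner ℂ (V₀ ω) (V ω) =
      ∑ i, K i (Y ω) * ∑ j, dz g' j (Y' ω) * inner ℂ (φ i) (φ' j) := by
    rw [hV, hV', sum_inner]
    refine Finset.sum_congr rfl fun i _ => ?_
    rw [inner_sum, Finset.mul_sum]
    refine Finset.sum_congr rfl fun j _ => ?_
    rw [inner_smul_left, inner_smul_right]
    rfl
  simp only [e3, Finset.sum_mul]
  rw [integral_finsetSum, integral_finsetSum]
  · exact Finset.sum_congr rfl fun i _ => key i
  · exact fun i _ => ((hZK i).sub (hS i)).integrable_mul hg'm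
  · exact fun i _ => (hKm i 2 (by norm_num)).integrable_mul (memLp_finsetSum _ fun j _ =>
      (hZ.memLp_comp φ' (hg'.isTame.continuous_dz j) (hg'.isTame.growth_dz j) 2
        (by norm_num)).mul_const _)

theorem HasMalliavinDeriv.exists_near (hZ : IsComplexIsonormal Z P) {F : Ω → ℂ} {U : Lp H 2 P}
    (hF : MemLp F 2 P) (h : HasMalliavinDeriv Z P F U) {ε : ℝ} (hε : 0 < ε) :
    ∃ (G : Ω → ℂ) (V : Ω → H) (hG : MemLp G 2 P) (hV : MemLp V 2 P), IsSmoothWithDeriv Z G V ∧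
      ‖hF.toLp - hG.toLp‖ < ε ∧ ‖U - hV.toLp‖ < ε := by
  obtain ⟨G, V, hs, h1, h2⟩ := h (ENNReal.ofReal ε) (by simpa using hε)
  obtain ⟨hG, hV⟩ := hs.memLp hZ
  refine ⟨G, V, hG, hV, hs, ?_, ?_⟩
  · rw [← MemLp.toLp_sub, Lp.norm_toLp]
    exact (ENNReal.lt_ofReal_iff_toReal_lt h1.ne_top).1 h1
  · have e : U = (Lp.memLp U).toLp := (Lp.toLp_coeFn U (Lp.memLp U)).symm
    rw [e, ← MemLp.toLp_sub, Lp.norm_toLp]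
    exact (ENNReal.lt_ofReal_iff_toReal_lt h2.ne_top).1 h2

/-- The Malliavin derivative on smooth random variables is closable. -/
theorem HasMalliavinDeriv.unique (hZ : IsComplexIsonormal Z P) {F : Ω → ℂ} {U U' : Lp H 2 P}
    (hF : MemLp F 2 P) (h : HasMalliavinDeriv Z P F U) (h' : HasMalliavinDeriv Z P F U') :
    U = U' := by
  -- `U - U'` is orthogonal to the derivatives of smooth random variables, because `U` and `U'` are
  -- approximated by derivatives of smooth variables with the same limit `F`.
  have key (G₀ : Ω → ℂ) (V₀ : Ω → H) (h₀ : IsSmoothWithDeriv Z G₀ V₀) (hV₀ : MemLp V₀ 2 P) :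
      inner ℂ hV₀.toLp (U - U') = 0 := by
    obtain ⟨T, hT, hTG⟩ := h₀.exists_divergence hZ
    have hin (G : Ω → ℂ) (V : Ω → H) (hG : MemLp G 2 P) (hV : MemLp V 2 P)
        (hs : IsSmoothWithDeriv Z G V) :
        inner ℂ hV₀.toLp hV.toLp = inner ℂ hT.star.toLp hG.toLp := by
      rw [L2.inner_def, L2.inner_def]
      refine Eq.trans ?_ ((hTG G V hs).trans ?_)
      · refine integral_congr_ae ?_
        filter_upwards [hV₀.coeFn_toLp, hV.coeFn_toLp] with ω h1 h2
        rw [h1, h2]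
      · refine integral_congr_ae ?_
        filter_upwards [hT.star.coeFn_toLp, hG.coeFn_toLp] with ω h1 h2
        rw [h1, h2]
        simp [mul_comm]
    rw [← norm_le_zero_iff]
    refine le_of_forall_pos_le_add fun ε hε => ?_
    set C : ℝ := 2 * ‖hV₀.toLp‖ + 2 * ‖hT.star.toLp‖ + 1 with hC
    have hC0 : 0 < C := by positivity
    obtain ⟨G, V, hG, hV, hs, h1, h2⟩ := h.exists_near hZ hF (div_pos hε hC0)
    obtain ⟨G', V', hG', hV', hs', h1', h2'⟩ := h'.exists_near hZ hF (div_pos hε hC0)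
    have e : inner ℂ hV₀.toLp (U - U') = inner ℂ hV₀.toLp (U - hV.toLp) -
        inner ℂ hV₀.toLp (U' - hV'.toLp) + (inner ℂ hT.star.toLp (hF.toLp - hG'.toLp) -
          inner ℂ hT.star.toLp (hF.toLp - hG.toLp)) := by
      have a1 := hin G V hG hV hs
      have a2 := hin G' V' hG' hV' hs'
      simp only [inner_sub_right]
      rw [a1, a2]
      ring
    rw [e, zero_add]
    have b1 := norm_inner_le_norm (𝕜 := ℂ) hV₀.toLp (U - hV.toLp)
    have b2 := norm_inner_le_norm (𝕜 := ℂ) hV₀.toLp (U' - hV'.toLp)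
    have b3 := norm_inner_le_norm (𝕜 := ℂ) hT.star.toLp (hF.toLp - hG'.toLp)
    have b4 := norm_inner_le_norm (𝕜 := ℂ) hT.star.toLp (hF.toLp - hG.toLp)
    have n1 : 0 ≤ ‖hV₀.toLp‖ := norm_nonneg _
    have n2 : 0 ≤ ‖hT.star.toLp‖ := norm_nonneg _
    have c1 := b1.trans (mul_le_mul_of_nonneg_left h2.le n1)
    have c2 := b2.trans (mul_le_mul_of_nonneg_left h2'.le n1)
    have c3 := b3.trans (mul_le_mul_of_nonneg_left h1'.le n2)
    have c4 := b4.trans (mul_le_mul_of_nonneg_left h1.le n2)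
    have hε' : C * (ε / C) = ε := by field_simp
    have hd : 0 ≤ ε / C := (div_pos hε hC0).le
    refine (norm_add_le _ _).trans ((add_le_add (norm_sub_le _ _) (norm_sub_le _ _)).trans ?_)
    nlinarith
  -- It is also a limit of differences of such derivatives, hence zero.
  rw [← sub_eq_zero, ← norm_le_zero_iff]
  refine le_of_forall_pos_le_add fun ε hε => ?_
  obtain ⟨G, V, hG, hV, hs, h1, h2⟩ := h.exists_near hZ hF (half_pos hε)
  obtain ⟨G', V', hG', hV', hs', h1', h2'⟩ := h'.exists_near hZ hF (half_pos hε)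
  have k1 := key G V hs hV
  have k2 := key G' V' hs' hV'
  have e : inner ℂ (U - U') (U - U') =
      inner ℂ ((U - hV.toLp) - (U' - hV'.toLp)) (U - U') := by
    rw [inner_sub_left (U - hV.toLp), inner_sub_left U hV.toLp, inner_sub_left U' hV'.toLp, k1, k2,
      inner_sub_left]
    ring
  have e2 : ‖U - U'‖ ^ 2 ≤ ε * ‖U - U'‖ := by
    have hn : ‖U - U'‖ ^ 2 = ‖inner ℂ (U - U') (U - U')‖ := by
      rw [inner_self_eq_norm_sq_to_K]
      simp
    rw [hn, e]
    refine (norm_inner_le_norm _ _).trans (mul_le_mul_of_nonneg_right ?_ (norm_nonneg _))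
    refine (norm_sub_le _ _).trans ?_
    linarith
  by_contra hlt
  push Not at hlt
  nlinarith [norm_nonneg (U - U')]

theorem malliavinDeriv_eq (hZ : IsComplexIsonormal Z P) {F : Ω → ℂ} {U : Lp H 2 P}
    (hF : MemLp F 2 P) (h : HasMalliavinDeriv Z P F U) : malliavinDeriv Z P F = U := by
  have hm : MemMalliavinDomain Z P F := ⟨hF, U, h⟩
  rw [malliavinDeriv, dif_pos hm]
  exact HasMalliavinDeriv.unique hZ hF hm.2.choose_spec h

theorem hasMalliavinDeriv_of_tendsto {α : Type*} {l : Filter α} [l.NeBot] {G : α → Ω → ℂ}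
    {V : α → Ω → H} (hs : ∀ a, IsSmoothWithDeriv Z (G a) (V a)) {F : Ω → ℂ} {U : Lp H 2 P}
    (hG : Tendsto (fun a => eLpNorm (fun ω => F ω - G a ω) 2 P) l (𝓝 0))
    (hV : Tendsto (fun a => eLpNorm (fun ω => U ω - V a ω) 2 P) l (𝓝 0)) :
    HasMalliavinDeriv Z P F U := fun ε hε => by
  obtain ⟨a, h1, h2⟩ := ((hG.eventually_lt_const hε).and (hV.eventually_lt_const hε)).exists
  exact ⟨G a, V a, hs a, h1, h2⟩

end Closable

/-! ### Norms, truncations and contractions of kernels -/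

section Entries

variable {ι : Type*}

theorem exists_perm_of_entries_eq {m : ℕ} {j j' : Fin m → ι} (h : entries j = entries j') :
    ∃ π : Equiv.Perm (Fin m), j ∘ π = j' := by
  classical
  have hc (a : ι) : Nonempty ({x // j' x = a} ≃ {x // j x = a}) := by
    refine Fintype.card_eq.1 ?_
    have := congrArg (Multiset.count a) h
    simp only [entries, Multiset.count_map] at this
    rw [Fintype.card_subtype, Fintype.card_subtype, Finset.card_def, Finset.card_def,
      Finset.filter_val, Finset.filter_val]
    simpa only [eq_comm] using this.symm
  let E := fun a => (hc a).some
  let π : Fin m ≃ Fin m := (Equiv.sigmaFiberEquiv j').symm.trans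
    ((Equiv.sigmaCongrRight E).trans (Equiv.sigmaFiberEquiv j))
  exact ⟨π, funext fun x => (E (j' x) ⟨x, rfl⟩).2⟩

theorem entries_comp_perm {m : ℕ} (j : Fin m → ι) (π : Equiv.Perm (Fin m)) :
    entries (j ∘ π) = entries j := by
  unfold entries
  rw [← Multiset.map_map]
  congr 1
  simp

theorem entries_map {κ : Type*} {m : ℕ} (σ : κ → ι) (j : Fin m → κ) :
    (entries j).map σ = entries (σ ∘ j) := by
  rw [entries, entries, Multiset.map_map]

theorem entries_glue {m i : ℕ} (hi : i ≤ m) (t : Fin (m - i) → ι) (u : Fin i → ι) :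
    entries (glue hi t u) = entries t + entries u := by
  rw [← entries_append]
  exact entries_comp_cast (Nat.sub_add_cancel hi).symm (Fin.append t u)

open Classical in
/-- The coefficients of a kernel as a function of the multisets of its plain and of its conjugate
indices; it is meaningful for symmetric kernels, and `0` where the numbers of indices are wrong. -/
def Kernel.symCoeff {m n : ℕ} (f : Kernel ι m n) (A B : Multiset ι) : ℂ :=
  if h : ∃ x : (Fin m → ι) × (Fin n → ι), entries x.1 = A ∧ entries x.2 = B then f h.choose else 0

theorem Kernel.IsSymm.symCoeff_eq {m n : ℕ} {f : Kernel ι m n} (hf : f.IsSymm) (j : Fin m → ι)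
    (k : Fin n → ι) : f.symCoeff (entries j) (entries k) = f (j, k) := by
  have h : ∃ x : (Fin m → ι) × (Fin n → ι), entries x.1 = entries j ∧ entries x.2 = entries k :=
    ⟨(j, k), rfl, rfl⟩
  rw [symCoeff, dif_pos h]
  obtain ⟨h1, h2⟩ := h.choose_spec
  generalize h.choose = y at h1 h2 ⊢
  obtain ⟨π, hπ⟩ := exists_perm_of_entries_eq h1
  obtain ⟨τ, hτ⟩ := exists_perm_of_entries_eq h2
  rw [← hπ, ← hτ]
  exact (hf π τ y.1 y.2).symm

end Entries

section Norm

variable {ι : Type*} {m n p q : ℕ}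

theorem Kernel.norm_sq (f : Kernel ι m n) : ‖f‖ ^ 2 = ∑' x, ‖f x‖ ^ 2 := by
  have := lp.norm_rpow_eq_tsum (p := 2) (by norm_num) f
  simpa using this

theorem Kernel.norm_le_of_sq {f : Kernel ι m n} {C : ℝ} (hC : 0 ≤ C)
    (h : ∑' x, ‖f x‖ ^ 2 ≤ C ^ 2) : ‖f‖ ≤ C := by
  rw [← Kernel.norm_sq] at h
  exact (sq_le_sq₀ (norm_nonneg _) hC).1 h

theorem Kernel.norm_eq_of_sq {m' n' : ℕ} {f : Kernel ι m n} {g : Kernel ι m' n'}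
    (h : ∑' x, ‖f x‖ ^ 2 = ∑' x, ‖g x‖ ^ 2) : ‖f‖ = ‖g‖ := by
  rw [← Kernel.norm_sq, ← Kernel.norm_sq] at h
  exact (sq_eq_sq₀ (norm_nonneg _) (norm_nonneg _)).1 h

@[simp] theorem Kernel.revConj_apply (f : Kernel ι m n) (x : (Fin n → ι) × (Fin m → ι)) :
    f.revConj x = conj (f (x.2, x.1)) := rfl

theorem Kernel.revConj_revConj (f : Kernel ι m n) : f.revConj.revConj = f :=
  lp.ext (funext fun x => by simp)

theorem Kernel.norm_revConj (f : Kernel ι m n) : ‖f.revConj‖ = ‖f‖ := by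
  refine Kernel.norm_eq_of_sq ?_
  simp only [revConj_apply, RCLike.norm_conj]
  exact (Equiv.prodComm (Fin n → ι) (Fin m → ι)).tsum_eq fun x => ‖f x‖ ^ 2

theorem Kernel.IsSymm.revConj {f : Kernel ι m n} (hf : f.IsSymm) : f.revConj.IsSymm :=
  fun π τ j k => by simp [hf τ π k j]

theorem Kernel.symCoeff_revConj {f : Kernel ι m n} (hf : f.IsSymm) (j : Fin n → ι)
    (k : Fin m → ι) : f.revConj.symCoeff (entries j) (entries k) =
      symConj f.symCoeff (entries j) (entries k) := by
  rw [hf.revConj.symCoeff_eq, symConj, hf.symCoeff_eq, revConj_apply]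

@[simp] theorem Kernel.perm_apply (f : Kernel ι m n) (π : Equiv.Perm (Fin m))
    (τ : Equiv.Perm (Fin n)) (x : (Fin m → ι) × (Fin n → ι)) :
    f.perm π τ x = f (x.1 ∘ π, x.2 ∘ τ) := rfl

theorem Kernel.norm_perm (f : Kernel ι m n) (π : Equiv.Perm (Fin m)) (τ : Equiv.Perm (Fin n)) :
    ‖f.perm π τ‖ = ‖f‖ := by
  refine Kernel.norm_eq_of_sq ?_
  simp only [perm_apply]
  exact ((π.symm.arrowCongr (Equiv.refl ι)).prodCongr (τ.symm.arrowCongr (Equiv.refl ι))).tsum_eq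
    fun x => ‖f x‖ ^ 2

theorem Kernel.symmetrize_apply (f : Kernel ι m n) (x : (Fin m → ι) × (Fin n → ι)) :
    f.symmetrize x = ((m.factorial : ℂ) * (n.factorial : ℂ))⁻¹ *
      ∑ π : Equiv.Perm (Fin m), ∑ τ : Equiv.Perm (Fin n), f (x.1 ∘ π, x.2 ∘ τ) := by
  rw [symmetrize, lp.coeFn_smul, Pi.smul_apply, smul_eq_mul, lp.coeFn_sum, Finset.sum_apply]
  congr 1
  refine Finset.sum_congr rfl fun π _ => ?_
  rw [lp.coeFn_sum, Finset.sum_apply]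
  rfl

theorem Kernel.isSymm_symmetrize (f : Kernel ι m n) : f.symmetrize.IsSymm := by
  intro π τ j k
  rw [symmetrize_apply, symmetrize_apply]
  congr 1
  refine (Equiv.sum_comp (Equiv.mulLeft π) fun π' : Equiv.Perm (Fin m) =>
    ∑ τ' : Equiv.Perm (Fin n), f (j ∘ π', k ∘ τ ∘ τ')).trans (Finset.sum_congr rfl fun π' _ => ?_)
  exact Equiv.sum_comp (Equiv.mulLeft τ) fun τ' : Equiv.Perm (Fin n) => f (j ∘ π', k ∘ τ')

theorem factorial_mul_ne_zero (m n : ℕ) : ((m.factorial : ℂ) * (n.factorial : ℂ)) ≠ 0 :=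
  mul_ne_zero (by exact_mod_cast m.factorial_ne_zero) (by exact_mod_cast n.factorial_ne_zero)

theorem Kernel.IsSymm.symmetrize_eq {f : Kernel ι m n} (hf : f.IsSymm) : f.symmetrize = f := by
  refine lp.ext (funext fun x => ?_)
  rw [symmetrize_apply]
  simp only [hf _ _ x.1 x.2, Finset.sum_const, Finset.card_univ, Fintype.card_perm,
    Fintype.card_fin, nsmul_eq_mul]
  rw [← mul_assoc (m.factorial : ℂ), inv_mul_cancel_left₀ (factorial_mul_ne_zero m n)]

theorem Kernel.norm_symmetrize_le (f : Kernel ι m n) : ‖f.symmetrize‖ ≤ ‖f‖ := by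
  rw [symmetrize, norm_smul]
  have h : ‖∑ π : Equiv.Perm (Fin m), ∑ τ : Equiv.Perm (Fin n), f.perm π τ‖ ≤
      (m.factorial * n.factorial : ℝ) * ‖f‖ := by
    refine (norm_sum_le _ _).trans ((Finset.sum_le_sum fun π _ => norm_sum_le _ _).trans ?_)
    simp [norm_perm, Fintype.card_perm, mul_assoc]
  have h0 : (0 : ℝ) < m.factorial * n.factorial := by positivity
  have e : ‖((m.factorial : ℂ) * (n.factorial : ℂ))⁻¹‖ = ((m.factorial : ℝ) * n.factorial)⁻¹ := by
    simp
  rw [e, inv_mul_le_iff₀ h0]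
  exact h

theorem Kernel.symmetrize_sub (f g : Kernel ι m n) :
    (f - g).symmetrize = f.symmetrize - g.symmetrize := by
  refine lp.ext (funext fun x => ?_)
  rw [lp.coeFn_sub, Pi.sub_apply]
  simp only [symmetrize_apply, lp.coeFn_sub, Pi.sub_apply, Finset.sum_sub_distrib, mul_sub]

end Norm

section Support

variable {ι : Type*} {m n p q : ℕ}

/-- All the indices of a non-zero coefficient of the kernel belong to the finite set `s`. -/
def Kernel.IsSupportedOn (s : Finset ι) (f : Kernel ι m n) : Prop :=
  ∀ x, f x ≠ 0 → (∀ a, x.1 a ∈ s) ∧ ∀ a, x.2 a ∈ s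

theorem Kernel.IsSupportedOn.mono {s t : Finset ι} {f : Kernel ι m n} (hf : f.IsSupportedOn s)
    (h : s ⊆ t) : f.IsSupportedOn t :=
  fun x hx => ⟨fun a => h ((hf x hx).1 a), fun a => h ((hf x hx).2 a)⟩

theorem Kernel.IsSupportedOn.sub {s : Finset ι} {f g : Kernel ι m n} (hf : f.IsSupportedOn s)
    (hg : g.IsSupportedOn s) : (f - g).IsSupportedOn s := by
  intro x hx
  by_cases h : f x = 0
  · refine hg x fun h' => hx ?_
    rw [lp.coeFn_sub, Pi.sub_apply, h, h', sub_zero]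
  · exact hf x h

theorem Kernel.IsSupportedOn.revConj {s : Finset ι} {f : Kernel ι m n} (hf : f.IsSupportedOn s) :
    f.revConj.IsSupportedOn s := by
  intro x hx
  have : f (x.2, x.1) ≠ 0 := fun h => hx (by simp [h])
  exact (hf _ this).symm

theorem Kernel.IsSupportedOn.symmetrize {s : Finset ι} {f : Kernel ι m n}
    (hf : f.IsSupportedOn s) : f.symmetrize.IsSupportedOn s := by
  intro x hx
  rw [symmetrize_apply] at hx
  obtain ⟨π, -, hπ⟩ := Finset.exists_ne_zero_of_sum_ne_zero (right_ne_zero_of_mul hx)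
  obtain ⟨τ, -, hτ⟩ := Finset.exists_ne_zero_of_sum_ne_zero hπ
  obtain ⟨h1, h2⟩ := hf _ hτ
  exact ⟨fun a => by simpa using h1 (π.symm a), fun a => by simpa using h2 (τ.symm a)⟩

theorem memlp_indicator (f : Kernel ι m n) (T : Set ((Fin m → ι) × (Fin n → ι))) :
    Memℓp (T.indicator f) 2 := by
  rw [memlp_two_iff]
  refine Summable.of_nonneg_of_le (fun x => by positivity) (fun x => ?_) f.summable_sq
  exact pow_le_pow_left₀ (norm_nonneg _) (norm_indicator_le_norm_self _ _) 2

/-- The kernel with the coefficients outside of the set `T` replaced by `0`. -/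
def Kernel.cut (f : Kernel ι m n) (T : Set ((Fin m → ι) × (Fin n → ι))) : Kernel ι m n :=
  ⟨T.indicator f, memlp_indicator f T⟩

theorem Kernel.cut_apply (f : Kernel ι m n) (T : Set ((Fin m → ι) × (Fin n → ι)))
    (x : (Fin m → ι) × (Fin n → ι)) : f.cut T x = T.indicator f x := rfl

/-- The set of index tuples with entries in `s`. -/
def tuples (m n : ℕ) (s : Finset ι) : Set ((Fin m → ι) × (Fin n → ι)) :=
  {x | (∀ a, x.1 a ∈ s) ∧ ∀ a, x.2 a ∈ s}

theorem Kernel.isSupportedOn_cut (f : Kernel ι m n) (s : Finset ι) :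
    (f.cut (tuples m n s)).IsSupportedOn s := by
  intro x hx
  by_contra h
  exact hx (Set.indicator_of_notMem (s := tuples m n s) h _)

theorem Kernel.IsSymm.cut {f : Kernel ι m n} (hf : f.IsSymm) (s : Finset ι) :
    (f.cut (tuples m n s)).IsSymm := by
  intro π τ j k
  have : (j ∘ π, k ∘ τ) ∈ tuples m n s ↔ (j, k) ∈ tuples m n s := by
    simp only [tuples, Set.mem_ofPred_eq, Function.comp_apply]
    rw [π.forall_congr_right (q := fun a => j a ∈ s), τ.forall_congr_right (q := fun a => k a ∈ s)]
  by_cases h : (j, k) ∈ tuples m n s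
  · rw [cut_apply, cut_apply, Set.indicator_of_mem h, Set.indicator_of_mem (this.2 h), hf π τ j k]
  · rw [cut_apply, cut_apply, Set.indicator_of_notMem h,
      Set.indicator_of_notMem (mt this.1 h)]

theorem Kernel.revConj_cut (f : Kernel ι m n) (s : Finset ι) :
    (f.cut (tuples m n s)).revConj = f.revConj.cut (tuples n m s) := by
  classical
  refine lp.ext (funext fun x => ?_)
  have : (x.2, x.1) ∈ tuples m n s ↔ x ∈ tuples n m s := and_comm
  rw [revConj_apply, cut_apply, cut_apply]
  by_cases h : x ∈ tuples n m s
  · rw [Set.indicator_of_mem h, Set.indicator_of_mem (this.2 h), revConj_apply]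
  · rw [Set.indicator_of_notMem h, Set.indicator_of_notMem (mt this.1 h), map_zero]

theorem Kernel.tendsto_cut (f : Kernel ι m n) :
    Tendsto (fun s => f.cut (tuples m n s)) atTop (𝓝 f) := by
  classical
  rw [tendsto_iff_norm_sub_tendsto_zero]
  have h : Tendsto (fun s : Finset ι => ∑' x, ‖(f.cut (tuples m n s) - f) x‖ ^ 2) atTop
      (𝓝 (∑' _ : (Fin m → ι) × (Fin n → ι), (0 : ℝ))) := by
    refine tendsto_tsum_of_dominated_convergence f.summable_sq (fun x => ?_)
      (Eventually.of_forall fun s x => ?_)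
    · refine tendsto_const_nhds.congr' ?_
      filter_upwards [eventually_ge_atTop (Finset.univ.image x.1 ∪ Finset.univ.image x.2)] with s hs
      have hx : x ∈ tuples m n s :=
        ⟨fun a => hs (Finset.mem_union_left _ (Finset.mem_image_of_mem _ (Finset.mem_univ a))),
          fun a => hs (Finset.mem_union_right _ (Finset.mem_image_of_mem _ (Finset.mem_univ a)))⟩
      rw [lp.coeFn_sub, Pi.sub_apply, cut_apply, Set.indicator_of_mem hx]
      simp
    · rw [lp.coeFn_sub, Pi.sub_apply, cut_apply, Set.indicator_apply]
      split_ifs <;> simp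
  simp only [← Kernel.norm_sq, tsum_zero] at h
  have := (Real.continuous_sqrt.tendsto 0).comp h
  simpa [Function.comp_def, Real.sqrt_sq] using this

end Support

section Contraction

variable {ι : Type*} {m n p q : ℕ} {i j : ℕ} (him : i ≤ m) (hiq : i ≤ q) (hjn : j ≤ n) (hjp : j ≤ p)

theorem contraction_apply (f : Kernel ι m n) (g : Kernel ι p q)
    (x : (Fin (m - i + (p - j)) → ι) × (Fin (n - j + (q - i)) → ι)) :
    contraction f g i j him hiq hjn hjp x = ∑' w : (Fin i → ι) × (Fin j → ι),
      f (glue him (fun a => x.1 (Fin.castAdd (p - j) a)) w.1,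
        glue hjn (fun a => x.2 (Fin.castAdd (q - i) a)) w.2) *
      g (glue hjp (fun a => x.1 (Fin.natAdd (m - i) a)) w.2,
        glue hiq (fun a => x.2 (Fin.natAdd (n - j) a)) w.1) := rfl

theorem Kernel.summable_glue (f : Kernel ι m n) :
    Summable fun y : ((Fin (m - i) → ι) × (Fin (n - j) → ι)) × ((Fin i → ι) × (Fin j → ι)) =>
      ‖f (glue him y.1.1 y.2.1, glue hjn y.1.2 y.2.2)‖ ^ 2 := by
  refine f.summable_sq.comp_injective (i := fun y : ((Fin (m - i) → ι) × (Fin (n - j) → ι)) ×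
    ((Fin i → ι) × (Fin j → ι)) => (glue him y.1.1 y.2.1, glue hjn y.1.2 y.2.2)) ?_
  rintro ⟨⟨a, b⟩, c, d⟩ ⟨⟨a', b'⟩, c', d'⟩ h
  simp only [Prod.mk.injEq] at h
  obtain ⟨rfl, rfl⟩ := glue_inj him h.1
  obtain ⟨rfl, rfl⟩ := glue_inj hjn h.2
  rfl

theorem Kernel.tsum_glue_le (f : Kernel ι m n) :
    ∑' y : ((Fin (m - i) → ι) × (Fin (n - j) → ι)) × ((Fin i → ι) × (Fin j → ι)),
      ‖f (glue him y.1.1 y.2.1, glue hjn y.1.2 y.2.2)‖ ^ 2 ≤ ‖f‖ ^ 2 := by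
  rw [f.norm_sq]
  refine (f.summable_glue him hjn).tsum_le_tsum_of_inj
    (fun y : ((Fin (m - i) → ι) × (Fin (n - j) → ι)) ×
    ((Fin i → ι) × (Fin j → ι)) => (glue him y.1.1 y.2.1, glue hjn y.1.2 y.2.2)) ?_
    (fun _ _ => by positivity) (fun _ => le_rfl) f.summable_sq
  rintro ⟨⟨a, b⟩, c, d⟩ ⟨⟨a', b'⟩, c', d'⟩ h
  simp only [Prod.mk.injEq] at h
  obtain ⟨rfl, rfl⟩ := glue_inj him h.1
  obtain ⟨rfl, rfl⟩ := glue_inj hjn h.2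
  rfl

theorem summable_mul_of_sq {α : Type*} {F G : α → ℂ} (hF : Summable fun w => ‖F w‖ ^ 2)
    (hG : Summable fun w => ‖G w‖ ^ 2) : Summable fun w => F w * G w := by
  refine Summable.of_norm_bounded (hF.add hG) fun w => ?_
  rw [norm_mul]
  nlinarith [sq_nonneg (‖F w‖ - ‖G w‖), norm_nonneg (F w), norm_nonneg (G w)]

theorem summable_contraction (f : Kernel ι m n) (g : Kernel ι p q) (t : Fin (m - i) → ι)
    (t' : Fin (n - j) → ι) (r : Fin (p - j) → ι) (r' : Fin (q - i) → ι) :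
    Summable fun w : (Fin i → ι) × (Fin j → ι) =>
      f (glue him t w.1, glue hjn t' w.2) * g (glue hjp r w.2, glue hiq r' w.1) := by
  refine summable_mul_of_sq ((f.summable_glue him hjn).prod_factor (t, t')) ?_
  exact (Equiv.prodComm _ _).summable_iff.1 ((g.summable_glue hjp hiq).prod_factor (r, r'))

theorem contraction_sub_left (f f' : Kernel ι m n) (g : Kernel ι p q) :
    contraction (f - f') g i j him hiq hjn hjp =
      contraction f g i j him hiq hjn hjp - contraction f' g i j him hiq hjn hjp := by
  refine lp.ext (funext fun x => ?_)
  rw [lp.coeFn_sub, Pi.sub_apply]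
  simp only [contraction_apply]
  rw [← (summable_contraction him hiq hjn hjp f g _ _ _ _).tsum_sub
    (summable_contraction him hiq hjn hjp f' g _ _ _ _)]
  simp only [lp.coeFn_sub, Pi.sub_apply, sub_mul]

theorem contraction_sub_right (f : Kernel ι m n) (g g' : Kernel ι p q) :
    contraction f (g - g') i j him hiq hjn hjp =
      contraction f g i j him hiq hjn hjp - contraction f g' i j him hiq hjn hjp := by
  refine lp.ext (funext fun x => ?_)
  rw [lp.coeFn_sub, Pi.sub_apply]
  simp only [contraction_apply]
  rw [← (summable_contraction him hiq hjn hjp f g _ _ _ _).tsum_sub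
    (summable_contraction him hiq hjn hjp f g' _ _ _ _)]
  simp only [lp.coeFn_sub, Pi.sub_apply, mul_sub]

theorem norm_contraction_le (f : Kernel ι m n) (g : Kernel ι p q) :
    ‖contraction f g i j him hiq hjn hjp‖ ≤ ‖f‖ * ‖g‖ := by
  refine Kernel.norm_le_of_sq (by positivity) ?_
  have hf := f.summable_glue him hjn
  have hg0 := g.summable_glue hjp hiq
  have hg := ((Equiv.refl ((Fin (p - j) → ι) × (Fin (q - i) → ι))).prodCongr
    (Equiv.prodComm (Fin i → ι) (Fin j → ι))).summable_iff.2 hg0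
  let A : (Fin (m - i) → ι) × (Fin (n - j) → ι) → ℝ := fun y =>
    ∑' w : (Fin i → ι) × (Fin j → ι), ‖f (glue him y.1 w.1, glue hjn y.2 w.2)‖ ^ 2
  let B : (Fin (p - j) → ι) × (Fin (q - i) → ι) → ℝ := fun y =>
    ∑' w : (Fin i → ι) × (Fin j → ι), ‖g (glue hjp y.1 w.2, glue hiq y.2 w.1)‖ ^ 2
  have hA : Summable A := hf.prod
  have hB : Summable B := hg.prod
  have hA0 (y) : 0 ≤ A y := tsum_nonneg fun _ => by positivity
  have hB0 (y) : 0 ≤ B y := tsum_nonneg fun _ => by positivity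
  have hprod := hA.mul_of_nonneg hB hA0 hB0
  let φ : (Fin (m - i + (p - j)) → ι) × (Fin (n - j + (q - i)) → ι) →
      ((Fin (m - i) → ι) × (Fin (n - j) → ι)) × ((Fin (p - j) → ι) × (Fin (q - i) → ι)) :=
    fun x => ((fun a => x.1 (Fin.castAdd (p - j) a), fun a => x.2 (Fin.castAdd (q - i) a)),
      (fun a => x.1 (Fin.natAdd (m - i) a), fun a => x.2 (Fin.natAdd (n - j) a)))
  have hφ : Function.Injective φ := by
    rintro ⟨a, b⟩ ⟨a', b'⟩ h
    simp only [φ, Prod.mk.injEq] at h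
    obtain ⟨⟨h1, h2⟩, h3, h4⟩ := h
    refine Prod.ext (funext fun x => ?_) (funext fun x => ?_)
    · exact Fin.addCases (fun y => congrFun h1 y) (fun y => congrFun h3 y) x
    · exact Fin.addCases (fun y => congrFun h2 y) (fun y => congrFun h4 y) x
  have h1 : ∑' x, ‖contraction f g i j him hiq hjn hjp x‖ ^ 2 ≤ ∑' y : ((Fin (m - i) → ι) ×
      (Fin (n - j) → ι)) × ((Fin (p - j) → ι) × (Fin (q - i) → ι)), A y.1 * B y.2 :=
    (contraction f g i j him hiq hjn hjp).summable_sq.tsum_le_tsum_of_inj φ hφ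
      (fun y _ => mul_nonneg (hA0 _) (hB0 _))
      (fun x => norm_tsum_mul_sq_le (hf.prod_factor (φ x).1) (hg.prod_factor (φ x).2)) hprod
  refine h1.trans ((hA.tsum_mul_tsum hB hprod).symm.le.trans ?_)
  have h2 : ∑' y, A y ≤ ‖f‖ ^ 2 := hf.tsum_prod.symm.le.trans (f.tsum_glue_le him hjn)
  have h3 : ∑' y, B y ≤ ‖g‖ ^ 2 := by
    refine hg.tsum_prod.symm.le.trans ?_
    refine Eq.trans_le ?_ (g.tsum_glue_le hjp hiq)
    exact ((Equiv.refl ((Fin (p - j) → ι) × (Fin (q - i) → ι))).prodCongr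
      (Equiv.prodComm (Fin i → ι) (Fin j → ι))).tsum_eq fun y =>
        ‖g (glue hjp y.1.1 y.2.1, glue hiq y.1.2 y.2.2)‖ ^ 2
  rw [mul_pow]
  exact mul_le_mul h2 h3 (tsum_nonneg hB0) (by positivity)

theorem tendsto_contraction {α : Type*} {l : Filter α} {f : α → Kernel ι m n} {f₀ : Kernel ι m n}
    {g : α → Kernel ι p q} {g₀ : Kernel ι p q} (hf : Tendsto f l (𝓝 f₀)) (hg : Tendsto g l (𝓝 g₀)) :
    Tendsto (fun a => contraction (f a) (g a) i j him hiq hjn hjp) l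
      (𝓝 (contraction f₀ g₀ i j him hiq hjn hjp)) := by
  rw [tendsto_iff_norm_sub_tendsto_zero]
  have h1 : Tendsto (fun a => ‖f a - f₀‖ * ‖g a‖ + ‖f₀‖ * ‖g a - g₀‖) l (𝓝 0) := by
    have := ((tendsto_iff_norm_sub_tendsto_zero.1 hf).mul hg.norm).add
      ((tendsto_iff_norm_sub_tendsto_zero.1 hg).const_mul ‖f₀‖)
    simpa using this
  refine squeeze_zero (fun _ => norm_nonneg _) (fun a => ?_) h1
  have e : contraction (f a) (g a) i j him hiq hjn hjp - contraction f₀ g₀ i j him hiq hjn hjp =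
      contraction (f a - f₀) (g a) i j him hiq hjn hjp +
        contraction f₀ (g a - g₀) i j him hiq hjn hjp := by
    rw [contraction_sub_left, contraction_sub_right]
    abel
  rw [e]
  exact (norm_add_le _ _).trans
    (add_le_add (norm_contraction_le _ _ _ _ _ _) (norm_contraction_le _ _ _ _ _ _))

theorem glue_mem_iff {s : Finset ι} (t : Fin (m - i) → ι) (u : Fin i → ι) :
    (∀ a, glue him t u a ∈ s) ↔ (∀ a, t a ∈ s) ∧ ∀ a, u a ∈ s := by
  have h {r : ℕ} (k : Fin r → ι) : (∀ a, k a ∈ s) ↔ ∀ x ∈ entries k, x ∈ s := by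
    simp [entries]
  rw [h, h, h, entries_glue]
  simp only [Multiset.mem_add]
  grind

theorem Kernel.IsSupportedOn.contraction {s : Finset ι} {f : Kernel ι m n} {g : Kernel ι p q}
    (hf : f.IsSupportedOn s) (hg : g.IsSupportedOn s) :
    (contraction f g i j him hiq hjn hjp).IsSupportedOn s := by
  intro x hx
  rw [contraction_apply] at hx
  obtain ⟨w, hw⟩ : ∃ w : (Fin i → ι) × (Fin j → ι),
      f (glue him (fun a => x.1 (Fin.castAdd (p - j) a)) w.1,
        glue hjn (fun a => x.2 (Fin.castAdd (q - i) a)) w.2) *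
      g (glue hjp (fun a => x.1 (Fin.natAdd (m - i) a)) w.2,
        glue hiq (fun a => x.2 (Fin.natAdd (n - j) a)) w.1) ≠ 0 := by
    by_contra! h
    exact hx (by simp only [h, tsum_zero])
  obtain ⟨h1, h2⟩ := hf _ (left_ne_zero_of_mul hw)
  obtain ⟨h3, h4⟩ := hg _ (right_ne_zero_of_mul hw)
  simp only [glue_mem_iff] at h1 h2 h3 h4
  exact ⟨fun a => Fin.addCases h1.1 h3.1 a, fun a => Fin.addCases h2.1 h4.1 a⟩

/-- Transport of a function of multisets along a map of the index sets. -/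
def pullback {κ : Type*} (σ : κ → ι) (ψ : Multiset ι → Multiset ι → ℂ) (A B : Multiset κ) : ℂ :=
  ψ (A.map σ) (B.map σ)

theorem pullback_entries {κ : Type*} (σ : κ → ι) {f : Kernel ι m n} (hf : f.IsSymm)
    (j : Fin m → κ) (k : Fin n → κ) :
    pullback σ f.symCoeff (entries j) (entries k) = f (σ ∘ j, σ ∘ k) := by
  rw [pullback, entries_map, entries_map, hf.symCoeff_eq]

/-- On finitely supported symmetric kernels the contraction is given by finite sums. -/
theorem Kernel.IsSymm.contraction_comp_val {s : Finset ι} {f : Kernel ι m n} {g : Kernel ι p q}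
    (hf : f.IsSymm) (hg : g.IsSymm) (hfs : f.IsSupportedOn s)
    (x : (Fin (m - i + (p - j)) → s) × (Fin (n - j + (q - i)) → s)) :
    ComplexWiener.contraction f g i j him hiq hjn hjp (Subtype.val ∘ x.1, Subtype.val ∘ x.2) =
      symContraction m n p q i j (pullback Subtype.val f.symCoeff)
        (pullback Subtype.val g.symCoeff) x := by
  rw [contraction_apply, symContraction, ← Fintype.sum_prod_type']
  let T : (Fin i → s) × (Fin j → s) → (Fin i → ι) × (Fin j → ι) :=
    fun w => (Subtype.val ∘ w.1, Subtype.val ∘ w.2)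
  have hT : Function.Injective T := by
    rintro ⟨a, b⟩ ⟨a', b'⟩ h
    simp only [T, Prod.mk.injEq] at h
    exact Prod.ext (Subtype.val_injective.comp_left h.1) (Subtype.val_injective.comp_left h.2)
  rw [← hT.tsum_eq, tsum_fintype]
  · refine Finset.sum_congr rfl fun w _ => ?_
    simp only [pullback, Multiset.map_add, entries_map]
    rw [← hf.symCoeff_eq, ← hg.symCoeff_eq]
    simp only [entries_glue]
    rfl
  · intro w hw
    obtain ⟨h1, h2⟩ := hfs _ (left_ne_zero_of_mul hw)
    simp only [glue_mem_iff] at h1 h2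
    exact ⟨(fun a => ⟨w.1 a, h1.2 a⟩, fun a => ⟨w.2 a, h2.2 a⟩), rfl⟩

end Contraction

/-! ### Fourier–Hermite polynomials as Wick powers -/

section WickWord

open MvPolynomial

variable {κ : Type*} [Fintype κ] [DecidableEq κ]

theorem word_eq_monomial (A B : Multiset κ) :
    word A B = monomial (Finsupp.equivFunOnFinite.symm
      (Sum.elim (fun x => A.count x) fun x => B.count x)) (1 : ℂ) := by
  rw [monomial_eq, C_1, one_mul, Finsupp.prod_fintype _ _ (fun _ => pow_zero _),
    Fintype.prod_sum_type, word]
  simp only [Finset.prod_multiset_map_count, Finsupp.equivFunOnFinite_symm_apply_apply,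
    Sum.elim_inl, Sum.elim_inr]
  congr 1
  · exact Finset.prod_subset (Finset.subset_univ A.toFinset) fun x _ hx => by
      simp [Multiset.count_eq_zero.2 (mt Multiset.mem_toFinset.2 hx)]
  · exact Finset.prod_subset (Finset.subset_univ B.toFinset) fun x _ hx => by
      simp [Multiset.count_eq_zero.2 (mt Multiset.mem_toFinset.2 hx)]

theorem evalPoly_wick_word (z : κ → ℂ) (A B : Multiset κ) :
    evalPoly z (wick (word A B)) = ∏ x, complexHermite (A.count x) (B.count x) (z x) 1 := by
  rw [word_eq_monomial, wick_monomial, map_prod]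
  refine Finset.prod_congr rfl fun x _ => ?_
  have h := map_hermiteRing (evalPoly z : Poly κ →+* ℂ) (A.count x) (B.count x) (X (Sum.inl x))
    (X (Sum.inr x))
  rw [complexHermite_eq_hermiteRing]
  simpa [siteHermite] using h

theorem conj_complexHermite (a b : ℕ) (z : ℂ) :
    conj (complexHermite a b z 1) = complexHermite b a z 1 := by
  simp only [complexHermite, map_sum, map_mul, map_pow, map_neg, map_one, map_natCast,
    Complex.conj_conj, Complex.ofReal_one, one_pow, mul_one, min_comm a b]
  refine Finset.sum_congr rfl fun r _ => ?_
  ring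

theorem conj_evalPoly_wick_word (z : κ → ℂ) (A B : Multiset κ) :
    conj (evalPoly z (wick (word A B))) = evalPoly z (wick (word B A)) := by
  rw [evalPoly_wick_word, evalPoly_wick_word, map_prod]
  exact Finset.prod_congr rfl fun x _ => conj_complexHermite _ _ _

theorem conj_evalPoly_wick_symPoly (z : κ → ℂ) (p q : ℕ) (ψ : Multiset κ → Multiset κ → ℂ) :
    conj (evalPoly z (wick (symPoly p q ψ))) = evalPoly z (wick (symPoly q p (symConj ψ))) := by
  rw [symPoly_eq, symPoly_eq, Finset.sum_comm]
  simp only [map_sum, map_smul, smul_eq_mul, map_mul, conj_evalPoly_wick_word]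
  rfl

end WickWord

section Finite

variable {H Ω ι : Type*} [NormedAddCommGroup H] [InnerProductSpace ℂ H] [MeasurableSpace Ω]
  [DecidableEq ι] {Z : H → Ω → ℂ} {P : Measure Ω} {m n p q : ℕ}

theorem fourierHermite_eq_evalPoly (Z : H → Ω → ℂ) (e : ι → H) (s : Finset ι)
    (x : (Fin m → s) × (Fin n → s)) (ω : Ω) :
    fourierHermite Z e (Subtype.val ∘ x.1, Subtype.val ∘ x.2) ω =
      evalPoly (fun y : s => Z (e y) ω) (wick (word (entries x.1) (entries x.2))) := by
  classical
  rw [evalPoly_wick_word, fourierHermite]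
  have hc {r : ℕ} (j : Fin r → s) (y : s) :
      (Finset.univ.filter fun a => (Subtype.val ∘ j) a = (y : ι)).card = (entries j).count y := by
    rw [entries, Multiset.count_map, Finset.card_def, Finset.filter_val]
    simp only [Function.comp_apply, Subtype.val_inj, eq_comm]
  have h1 : ∏ y : s, complexHermite ((entries x.1).count y) ((entries x.2).count y)
        (Z (e y) ω) 1 = ∏ i ∈ s, complexHermite
          (Finset.univ.filter fun a => (Subtype.val ∘ x.1) a = i).card
          (Finset.univ.filter fun a => (Subtype.val ∘ x.2) a = i).card (Z (e i) ω) 1 := by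
    refine Eq.trans ?_ (Finset.prod_coe_sort s fun i => complexHermite
      (Finset.univ.filter fun a => (Subtype.val ∘ x.1) a = i).card
      (Finset.univ.filter fun a => (Subtype.val ∘ x.2) a = i).card (Z (e i) ω) 1)
    refine Finset.prod_congr rfl fun y _ => ?_
    rw [hc, hc]
  rw [h1]
  refine Eq.trans ?_ (Finset.prod_subset (s₁ := Finset.univ.image (Subtype.val ∘ x.1) ∪
    Finset.univ.image (Subtype.val ∘ x.2)) ?_ ?_)
  · congr!
  · intro i hi
    simp only [Finset.mem_union, Finset.mem_image, Finset.mem_univ, true_and,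
      Function.comp_apply] at hi
    rcases hi with ⟨a, rfl⟩ | ⟨a, rfl⟩
    · exact (x.1 a).2
    · exact (x.2 a).2
  · intro i _ hi
    simp only [Finset.mem_union, Finset.mem_image, Finset.mem_univ, true_and, not_or,
      not_exists] at hi
    rw [Finset.filter_false_of_mem fun a _ => hi.1 a, Finset.filter_false_of_mem fun a _ => hi.2 a]
    simp [complexHermite]

/-- The polynomial in the finitely many variables `Z(e_i)`, `i ∈ s`, and their conjugates, whose
Wick power is the multiple integral of a symmetric kernel supported on `s`. -/
def kernelPoly (s : Finset ι) (f : Kernel ι m n) : Poly s :=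
  symPoly m n (pullback Subtype.val f.symCoeff)

theorem Kernel.IsSymm.tuplePoly_eq {f : Kernel ι m n} (hf : f.IsSymm) (s : Finset ι) :
    tuplePoly (fun x : (Fin m → s) × (Fin n → s) => f (Subtype.val ∘ x.1, Subtype.val ∘ x.2)) =
      kernelPoly s f := by
  simp only [kernelPoly, symPoly, pullback_entries _ hf]

theorem tuplePoly_symmetrize (f : Kernel ι m n) (s : Finset ι) :
    tuplePoly (fun x : (Fin m → s) × (Fin n → s) =>
      f.symmetrize (Subtype.val ∘ x.1, Subtype.val ∘ x.2)) =
    tuplePoly (fun x : (Fin m → s) × (Fin n → s) => f (Subtype.val ∘ x.1, Subtype.val ∘ x.2)) := by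
  have h (π : Equiv.Perm (Fin m)) (τ : Equiv.Perm (Fin n)) :
      ∑ x : (Fin m → s) × (Fin n → s), f ((Subtype.val ∘ x.1) ∘ π, (Subtype.val ∘ x.2) ∘ τ) •
        word (entries x.1) (entries x.2) =
      ∑ x : (Fin m → s) × (Fin n → s), f (Subtype.val ∘ x.1, Subtype.val ∘ x.2) •
        word (entries x.1) (entries x.2) := by
    rw [← ((π.symm.arrowCongr (Equiv.refl s)).prodCongr
      (τ.symm.arrowCongr (Equiv.refl s))).sum_comp fun x : (Fin m → s) × (Fin n → s) =>
        f (Subtype.val ∘ x.1, Subtype.val ∘ x.2) • word (entries x.1) (entries x.2)]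
    refine Finset.sum_congr rfl fun x _ => ?_
    rw [← entries_comp_perm x.1 π, ← entries_comp_perm x.2 τ]
    rfl
  simp only [tuplePoly, Kernel.symmetrize_apply, mul_smul, Finset.sum_smul, ← Finset.smul_sum]
  rw [Finset.sum_comm]
  simp only [Finset.sum_comm (s := (Finset.univ : Finset ((Fin m → s) × (Fin n → s))))]
  simp only [h, Finset.sum_const, Finset.card_univ, Fintype.card_perm, Fintype.card_fin]
  rw [← Nat.cast_smul_eq_nsmul ℂ, ← Nat.cast_smul_eq_nsmul ℂ, smul_smul, smul_smul, mul_assoc,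
    inv_mul_cancel₀ (factorial_mul_ne_zero m n), one_smul]

end Finite

/-! ### The isometry property of the multiple integral -/

section FiniteIntegral

variable {H Ω ι : Type*} [NormedAddCommGroup H] [InnerProductSpace ℂ H] [MeasurableSpace Ω]
  [DecidableEq ι] {Z : H → Ω → ℂ} {P : Measure Ω} (hZ : IsComplexIsonormal Z P)
  (e : HilbertBasis ι ℂ H) {m n p q : ℕ}

theorem orthonormal_val (s : Finset ι) : Orthonormal ℂ fun y : s => e y :=
  e.orthonormal.comp _ Subtype.val_injective

/-- The multiple integral of a finitely supported kernel is a Wick polynomial. -/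
theorem multipleIntegral_ae_eq {s : Finset ι} {f : Kernel ι m n} (hf : f.IsSupportedOn s) :
    multipleIntegral hZ e f =ᵐ[P] fun ω => evalPoly (fun y : s => Z (e y) ω)
      (wick (tuplePoly fun x : (Fin m → s) × (Fin n → s) =>
        f (Subtype.val ∘ x.1, Subtype.val ∘ x.2))) := by
  let T : (Fin m → s) × (Fin n → s) → (Fin m → ι) × (Fin n → ι) :=
    fun x => (Subtype.val ∘ x.1, Subtype.val ∘ x.2)
  have hT : Function.Injective T := by
    rintro ⟨a, b⟩ ⟨a', b'⟩ h
    simp only [T, Prod.mk.injEq] at h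
    exact Prod.ext (Subtype.val_injective.comp_left h.1) (Subtype.val_injective.comp_left h.2)
  have hI : multipleIntegral hZ e f =
      ∑ x, f (T x) • (memLp_fourierHermite hZ e (T x)).toLp := by
    rw [multipleIntegral, ← hT.tsum_eq, tsum_fintype]
    intro x hx
    have hx' : f x ≠ 0 := fun h => hx (by simp [h])
    obtain ⟨h1, h2⟩ := hf x hx'
    exact ⟨(fun a => ⟨x.1 a, h1 a⟩, fun a => ⟨x.2 a, h2 a⟩), rfl⟩
  rw [hI]
  have h1 := Lp.coeFn_finsetSum (Finset.univ : Finset ((Fin m → s) × (Fin n → s))) fun x =>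
    f (T x) • (memLp_fourierHermite hZ e (T x)).toLp
  have h2 : ∀ᵐ ω ∂P, ∀ x : (Fin m → s) × (Fin n → s),
      (f (T x) • (memLp_fourierHermite hZ e (T x)).toLp : Lp ℂ 2 P) ω =
        f (T x) * fourierHermite Z e (T x) ω := by
    rw [ae_all_iff]
    intro x
    filter_upwards [Lp.coeFn_smul (f (T x)) (memLp_fourierHermite hZ e (T x)).toLp,
      (memLp_fourierHermite hZ e (T x)).coeFn_toLp] with ω h3 h4
    rw [h3, Pi.smul_apply, h4, smul_eq_mul]
  filter_upwards [h1, h2] with ω h3 h4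
  rw [h3, Finset.sum_apply]
  simp only [h4, tuplePoly, map_sum, map_smul, smul_eq_mul]
  exact Finset.sum_congr rfl fun x _ => by rw [fourierHermite_eq_evalPoly]

theorem multipleIntegral_ae_eq_kernelPoly {s : Finset ι} {f : Kernel ι m n}
    (hf : f.IsSupportedOn s) : multipleIntegral hZ e f =ᵐ[P]
      fun ω => evalPoly (fun y : s => Z (e y) ω) (wick (kernelPoly s f.symmetrize)) := by
  rw [← f.isSymm_symmetrize.tuplePoly_eq s, tuplePoly_symmetrize]
  exact multipleIntegral_ae_eq hZ e hf

theorem inner_multipleIntegral_of_supported {s : Finset ι} {f : Kernel ι m n} {g : Kernel ι p q}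
    (hf : f.IsSupportedOn s) (hg : g.IsSupportedOn s) :
    inner ℂ (multipleIntegral hZ e g) (multipleIntegral hZ e f) =
      if m = p ∧ n = q then (n.factorial : ℂ) * m.factorial *
        ∑ x : (Fin m → s) × (Fin n → s),
          pullback Subtype.val f.symmetrize.symCoeff (entries x.1) (entries x.2) *
            conj (pullback Subtype.val g.symmetrize.symCoeff (entries x.1) (entries x.2))
      else 0 := by
  rw [← (isGaussianFunctional_expectation hZ (orthonormal_val e s)).pairing_symPoly_symConj,
    L2.inner_def]
  refine integral_congr_ae ?_
  filter_upwards [multipleIntegral_ae_eq_kernelPoly hZ e hf,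
    multipleIntegral_ae_eq_kernelPoly hZ e hg] with ω h1 h2
  rw [h1, h2, RCLike.inner_apply]
  simp only [kernelPoly]
  rw [conj_evalPoly_wick_symPoly, ← map_mul]
  rfl

theorem Kernel.IsSupportedOn.sum_norm_sq {s : Finset ι} {f : Kernel ι m n}
    (hf : f.IsSupportedOn s) :
    ∑ x : (Fin m → s) × (Fin n → s), ‖f (Subtype.val ∘ x.1, Subtype.val ∘ x.2)‖ ^ 2 = ‖f‖ ^ 2 := by
  let T : (Fin m → s) × (Fin n → s) → (Fin m → ι) × (Fin n → ι) :=
    fun x => (Subtype.val ∘ x.1, Subtype.val ∘ x.2)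
  have hT : Function.Injective T := by
    rintro ⟨a, b⟩ ⟨a', b'⟩ h
    simp only [T, Prod.mk.injEq] at h
    exact Prod.ext (Subtype.val_injective.comp_left h.1) (Subtype.val_injective.comp_left h.2)
  rw [f.norm_sq, ← hT.tsum_eq, tsum_fintype]
  intro x hx
  have hx' : f x ≠ 0 := fun h => hx (by simp [h])
  obtain ⟨h1, h2⟩ := hf x hx'
  exact ⟨(fun a => ⟨x.1 a, h1 a⟩, fun a => ⟨x.2 a, h2 a⟩), rfl⟩

theorem norm_sq_multipleIntegral_of_supported {s : Finset ι} {f : Kernel ι m n}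
    (hf : f.IsSupportedOn s) :
    ‖multipleIntegral hZ e f‖ ^ 2 = (m.factorial * n.factorial : ℝ) * ‖f.symmetrize‖ ^ 2 := by
  have h := inner_multipleIntegral_of_supported hZ e hf hf
  rw [if_pos ⟨rfl, rfl⟩, inner_self_eq_norm_sq_to_K] at h
  simp only [pullback_entries _ f.isSymm_symmetrize, Complex.mul_conj, Complex.normSq_eq_norm_sq]
    at h
  rw [← hf.symmetrize.sum_norm_sq]
  have h' : ((‖multipleIntegral hZ e f‖ ^ 2 : ℝ) : ℂ) = (((m.factorial * n.factorial : ℝ) *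
      ∑ x : (Fin m → s) × (Fin n → s),
        ‖f.symmetrize (Subtype.val ∘ x.1, Subtype.val ∘ x.2)‖ ^ 2 : ℝ) : ℂ) := by
    push_cast
    push_cast at h
    rw [mul_comm (m.factorial : ℂ)]
    exact h
  exact_mod_cast h'

/-- The operator norm bound of the multiple integral. -/
def integralBound (m n : ℕ) : ℝ := √(m.factorial * n.factorial)

theorem integralBound_pos (m n : ℕ) : 0 < integralBound m n :=
  Real.sqrt_pos.2 (by positivity)

theorem integralBound_sq (m n : ℕ) : integralBound m n ^ 2 = m.factorial * n.factorial :=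
  Real.sq_sqrt (by positivity)

theorem norm_multipleIntegral_le_of_supported {s : Finset ι} {f : Kernel ι m n}
    (hf : f.IsSupportedOn s) : ‖multipleIntegral hZ e f‖ ≤ integralBound m n * ‖f‖ := by
  refine (sq_le_sq₀ (norm_nonneg _) (mul_nonneg (integralBound_pos m n).le (norm_nonneg _))).1 ?_
  rw [norm_sq_multipleIntegral_of_supported hZ e hf, mul_pow, integralBound_sq]
  exact mul_le_mul_of_nonneg_left (pow_le_pow_left₀ (norm_nonneg _) f.norm_symmetrize_le 2)
    (by positivity)

end FiniteIntegral

section Integral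

variable {H Ω ι : Type*} [NormedAddCommGroup H] [InnerProductSpace ℂ H] [MeasurableSpace Ω]
  {Z : H → Ω → ℂ} {P : Measure Ω} (hZ : IsComplexIsonormal Z P)
  (e : HilbertBasis ι ℂ H) {m n p q : ℕ}

theorem norm_sum_smul_fourierHermite_le (f : Kernel ι m n)
    (T : Finset ((Fin m → ι) × (Fin n → ι))) :
    ‖∑ x ∈ T, f x • (memLp_fourierHermite hZ e x).toLp‖ ≤ integralBound m n * ‖f.cut T‖ := by
  classical
  let s : Finset ι := T.biUnion fun x => Finset.univ.image x.1 ∪ Finset.univ.image x.2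
  have hs : (f.cut T).IsSupportedOn s := by
    intro x hx
    have hxT : x ∈ (T : Set _) := by
      by_contra h
      exact hx (Set.indicator_of_notMem h _)
    exact ⟨fun a => Finset.mem_biUnion.2 ⟨x, hxT, Finset.mem_union_left _
        (Finset.mem_image_of_mem _ (Finset.mem_univ a))⟩,
      fun a => Finset.mem_biUnion.2 ⟨x, hxT, Finset.mem_union_right _
        (Finset.mem_image_of_mem _ (Finset.mem_univ a))⟩⟩
  refine Eq.trans_le ?_ (norm_multipleIntegral_le_of_supported hZ e hs)
  rw [multipleIntegral, tsum_eq_sum (s := T)]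
  · congr 1
    refine Finset.sum_congr rfl fun x hx => ?_
    rw [Kernel.cut_apply, Set.indicator_of_mem (Finset.mem_coe.2 hx)]
  · intro x hx
    rw [Kernel.cut_apply, Set.indicator_of_notMem (mt Finset.mem_coe.1 hx), zero_smul]

theorem Kernel.norm_cut_sq (f : Kernel ι m n) (T : Finset ((Fin m → ι) × (Fin n → ι))) :
    ‖f.cut T‖ ^ 2 = ∑ x ∈ T, ‖f x‖ ^ 2 := by
  rw [Kernel.norm_sq, tsum_eq_sum (s := T)]
  · refine Finset.sum_congr rfl fun x hx => ?_
    rw [Kernel.cut_apply, Set.indicator_of_mem (Finset.mem_coe.2 hx)]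
  · intro x hx
    rw [Kernel.cut_apply, Set.indicator_of_notMem (mt Finset.mem_coe.1 hx), norm_zero]
    norm_num

theorem summable_multipleIntegral (f : Kernel ι m n) :
    Summable fun x => f x • (memLp_fourierHermite hZ e x).toLp := by
  rw [summable_iff_vanishing_norm]
  intro ε hε
  have hC := integralBound_pos m n
  obtain ⟨s, hs⟩ := summable_iff_vanishing_norm.1 f.summable_sq ((ε / integralBound m n) ^ 2)
    (by positivity)
  refine ⟨s, fun T hT => ?_⟩
  have h1 := hs T hT
  rw [Real.norm_of_nonneg (Finset.sum_nonneg fun _ _ => by positivity), ← f.norm_cut_sq,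
    sq_lt_sq₀ (norm_nonneg _) (by positivity)] at h1
  refine (norm_sum_smul_fourierHermite_le hZ e f T).trans_lt ?_
  rw [mul_comm]
  exact (lt_div_iff₀ hC).1 h1

theorem multipleIntegral_sub (f g : Kernel ι m n) : multipleIntegral hZ e (f - g) =
    multipleIntegral hZ e f - multipleIntegral hZ e g := by
  unfold multipleIntegral
  rw [← (summable_multipleIntegral hZ e f).tsum_sub (summable_multipleIntegral hZ e g)]
  simp only [lp.coeFn_sub, Pi.sub_apply, sub_smul]

theorem norm_multipleIntegral_le (f : Kernel ι m n) :
    ‖multipleIntegral hZ e f‖ ≤ integralBound m n * ‖f‖ := by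
  refine le_of_tendsto (summable_multipleIntegral hZ e f).hasSum.norm
    (Eventually.of_forall fun T => ?_)
  refine (norm_sum_smul_fourierHermite_le hZ e f T).trans
    (mul_le_mul_of_nonneg_left ?_ (integralBound_pos m n).le)
  refine (sq_le_sq₀ (norm_nonneg _) (norm_nonneg _)).1 ?_
  rw [f.norm_cut_sq, f.norm_sq]
  exact f.summable_sq.sum_le_tsum T fun _ _ => by positivity

theorem tendsto_multipleIntegral {α : Type*} {l : Filter α} {f : α → Kernel ι m n}
    {f₀ : Kernel ι m n} (hf : Tendsto f l (𝓝 f₀)) :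
    Tendsto (fun a => multipleIntegral hZ e (f a)) l (𝓝 (multipleIntegral hZ e f₀)) := by
  rw [tendsto_iff_norm_sub_tendsto_zero] at hf ⊢
  have := hf.const_mul (integralBound m n)
  rw [mul_zero] at this
  refine squeeze_zero (fun _ => norm_nonneg _) (fun a => ?_) this
  rw [← multipleIntegral_sub]
  exact norm_multipleIntegral_le hZ e _

theorem Kernel.tendsto_symmetrize {α : Type*} {l : Filter α} {f : α → Kernel ι m n}
    {f₀ : Kernel ι m n} (hf : Tendsto f l (𝓝 f₀)) :
    Tendsto (fun a => (f a).symmetrize) l (𝓝 f₀.symmetrize) := by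
  rw [tendsto_iff_norm_sub_tendsto_zero] at hf ⊢
  refine squeeze_zero (fun _ => norm_nonneg _) (fun a => ?_) hf
  rw [← Kernel.symmetrize_sub]
  exact Kernel.norm_symmetrize_le _

theorem Kernel.tendsto_revConj {α : Type*} {l : Filter α} {f : α → Kernel ι m n}
    {f₀ : Kernel ι m n} (hf : Tendsto f l (𝓝 f₀)) :
    Tendsto (fun a => (f a).revConj) l (𝓝 f₀.revConj) := by
  rw [tendsto_iff_norm_sub_tendsto_zero] at hf ⊢
  refine hf.congr fun a => ?_
  have : (f a).revConj - f₀.revConj = (f a - f₀).revConj :=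
    lp.ext (funext fun x => by simp)
  rw [this, Kernel.norm_revConj]

/-- The isometry property of the multiple integral. -/
theorem norm_sq_multipleIntegral (f : Kernel ι m n) :
    ‖multipleIntegral hZ e f‖ ^ 2 = (m.factorial * n.factorial : ℝ) * ‖f.symmetrize‖ ^ 2 := by
  classical
  have h1 := (tendsto_multipleIntegral hZ e f.tendsto_cut).norm.pow 2
  have h2 := ((Kernel.tendsto_symmetrize f.tendsto_cut).norm.pow 2).const_mul
    (m.factorial * n.factorial : ℝ)
  exact tendsto_nhds_unique (h1.congr fun s =>
    norm_sq_multipleIntegral_of_supported hZ e (f.isSupportedOn_cut s)) h2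

/-- Multiple integrals of different degrees are orthogonal. -/
theorem inner_multipleIntegral_eq_zero (f : Kernel ι m n) (g : Kernel ι p q)
    (h : ¬ (m = p ∧ n = q)) :
    inner ℂ (multipleIntegral hZ e g) (multipleIntegral hZ e f) = 0 := by
  classical
  have h1 := (tendsto_multipleIntegral hZ e g.tendsto_cut).inner
    (𝕜 := ℂ) (tendsto_multipleIntegral hZ e f.tendsto_cut)
  refine tendsto_nhds_unique (h1.congr fun s => ?_) tendsto_const_nhds
  rw [inner_multipleIntegral_of_supported hZ e (f.isSupportedOn_cut s) (g.isSupportedOn_cut s),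
    if_neg h]

theorem integral_multipleIntegral_zero (hm : m = 0) (hn : n = 0) (f : Kernel ι m n) :
    ‖∫ ω, multipleIntegral hZ e f ω ∂P‖ = ‖f‖ ∧
      ∃ c, multipleIntegral hZ e f =ᵐ[P] fun _ => c := by
  classical
  have := hZ.gaussian.isProbabilityMeasure
  subst hm hn
  have hf : f.IsSupportedOn ∅ := fun x _ => ⟨fun a => a.elim0, fun a => a.elim0⟩
  have h := multipleIntegral_ae_eq hZ e hf
  let x₀ : (Fin 0 → ι) × (Fin 0 → ι) := (Fin.elim0, Fin.elim0)
  have h1 : multipleIntegral hZ e f =ᵐ[P] fun _ => f x₀ := by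
    filter_upwards [h] with ω hω
    have h2 : ∀ x : (Fin 0 → (∅ : Finset ι)) × (Fin 0 → (∅ : Finset ι)),
        f (Subtype.val ∘ x.1, Subtype.val ∘ x.2) = f x₀ :=
      fun x => congrArg f (Subsingleton.elim _ _)
    rw [hω, tuplePoly]
    simp only [h2, entries_zero, word_zero, Finset.sum_const, Finset.card_univ, Fintype.card_prod,
      Fintype.card_pi, Finset.univ_eq_empty, Finset.prod_empty, mul_one, one_smul, map_smul,
      wick_one, map_one, smul_eq_mul]
  refine ⟨?_, _, h1⟩
  rw [integral_congr_ae h1, integral_const, probReal_univ, one_smul]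
  refine (sq_eq_sq₀ (norm_nonneg _) (norm_nonneg _)).1 ?_
  rw [f.norm_sq, tsum_eq_single x₀ (fun y hy => absurd (Subsingleton.elim _ _) hy)]

theorem integral_multipleIntegral_of_ne (h : ¬ (m = 0 ∧ n = 0)) (f : Kernel ι m n) :
    ∫ ω, multipleIntegral hZ e f ω ∂P = 0 := by
  classical
  have := hZ.gaussian.isProbabilityMeasure
  let g : Kernel ι 0 0 := lp.single 2 (Fin.elim0, Fin.elim0) 1
  obtain ⟨h1, c, hc⟩ := integral_multipleIntegral_zero hZ e rfl rfl g
  have hg : ‖g‖ = 1 := by simp [g, lp.norm_single]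
  have hc1 : ‖c‖ = 1 := by
    rw [integral_congr_ae hc, integral_const, probReal_univ, one_smul] at h1
    rw [h1, hg]
  have h2 := inner_multipleIntegral_eq_zero hZ e f g h
  rw [L2.inner_def] at h2
  have h3 : ∫ ω, multipleIntegral hZ e f ω * conj c ∂P = 0 := by
    rw [← h2]
    refine integral_congr_ae ?_
    filter_upwards [hc] with ω hω
    rw [hω, RCLike.inner_apply]
  rw [integral_mul_const] at h3
  rcases mul_eq_zero.1 h3 with h4 | h4
  · exact h4
  · rw [map_eq_zero] at h4
    rw [h4, norm_zero] at hc1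
    norm_num at hc1

end Integral

/-! ### The product formula for multiple integrals -/

section Closed

variable {Ω : Type*} [MeasurableSpace Ω] {P : Measure Ω}
  {E F G : Type*} [NormedAddCommGroup E] [NormedAddCommGroup F] [NormedAddCommGroup G]

theorem exists_subseq_tendsto_ae {u : ℕ → Lp E 2 P} {u₀ : Lp E 2 P}
    (hu : Tendsto u atTop (𝓝 u₀)) : ∃ ns : ℕ → ℕ, StrictMono ns ∧
      ∀ᵐ ω ∂P, Tendsto (fun k => u (ns k) ω) atTop (𝓝 (u₀ ω)) :=
  (tendstoInMeasure_of_tendsto_Lp hu).exists_seq_tendsto_ae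

/-- A pointwise continuous relation between square integrable functions is stable under limits
in `L²`. -/
theorem ae_eq_of_tendsto_Lp {α : Type*} {l : Filter α} [l.NeBot] {u : α → Lp E 2 P}
    {v : α → Lp F 2 P} {w : α → Lp G 2 P} {u₀ : Lp E 2 P} {v₀ : Lp F 2 P} {w₀ : Lp G 2 P}
    (hu : Tendsto u l (𝓝 u₀)) (hv : Tendsto v l (𝓝 v₀)) (hw : Tendsto w l (𝓝 w₀))
    {Φ : E × F → G} (hΦ : Continuous Φ) (h : ∀ a, ∀ᵐ ω ∂P, Φ (u a ω, v a ω) = w a ω) :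
    ∀ᵐ ω ∂P, Φ (u₀ ω, v₀ ω) = w₀ ω := by
  let S : Set (Lp E 2 P × Lp F 2 P × Lp G 2 P) :=
    {x | ∀ᵐ ω ∂P, Φ (x.1 ω, x.2.1 ω) = x.2.2 ω}
  have hS : IsClosed S := by
    refine IsSeqClosed.isClosed fun x x₀ hx hx₀ => ?_
    have h1 := (Prod.tendsto_iff _ _).1 hx₀
    have h2 := (Prod.tendsto_iff _ _).1 h1.2
    obtain ⟨n1, hn1, a1⟩ := exists_subseq_tendsto_ae h1.1
    obtain ⟨n2, hn2, a2⟩ := exists_subseq_tendsto_ae (h2.1.comp hn1.tendsto_atTop)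
    obtain ⟨n3, hn3, a3⟩ := exists_subseq_tendsto_ae
      (h2.2.comp (hn1.comp hn2).tendsto_atTop)
    filter_upwards [a1, a2, a3, ae_all_iff.2 hx] with ω b1 b2 b3 b4
    have c1 := b1.comp (hn2.comp hn3).tendsto_atTop
    have c2 := b2.comp hn3.tendsto_atTop
    refine tendsto_nhds_unique ((hΦ.tendsto _).comp (c1.prodMk_nhds c2)) ?_
    exact b3.congr fun k => (b4 _).symm
  exact hS.mem_of_tendsto (hu.prodMk_nhds (hv.prodMk_nhds hw)) (Eventually.of_forall h)

end Closed

section Contr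

variable {ι : Type*} {m n p q : ℕ}

open Classical in
/-- The contraction `f ⊗_{i,j} g`, extended by `0` to the values of `(i, j)` for which there are
not enough variables to contract. -/
def contr₀ (f : Kernel ι m n) (g : Kernel ι p q) (i j : ℕ) :
    Kernel ι (m - i + (p - j)) (n - j + (q - i)) :=
  if h : i ≤ m ∧ i ≤ q ∧ j ≤ n ∧ j ≤ p then contraction f g i j h.1 h.2.1 h.2.2.1 h.2.2.2 else 0

theorem contr₀_eq (f : Kernel ι m n) (g : Kernel ι p q) {i j : ℕ} (h1 : i ≤ m) (h2 : i ≤ q)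
    (h3 : j ≤ n) (h4 : j ≤ p) : contr₀ f g i j = contraction f g i j h1 h2 h3 h4 :=
  dif_pos ⟨h1, h2, h3, h4⟩

theorem norm_contr₀_le (f : Kernel ι m n) (g : Kernel ι p q) (i j : ℕ) :
    ‖contr₀ f g i j‖ ≤ ‖f‖ * ‖g‖ := by
  unfold contr₀
  split_ifs with h
  · exact norm_contraction_le _ _ _ _ _ _
  · rw [norm_zero]
    positivity

theorem tendsto_contr₀ {α : Type*} {l : Filter α} {f : α → Kernel ι m n} {f₀ : Kernel ι m n}
    {g : α → Kernel ι p q} {g₀ : Kernel ι p q} (hf : Tendsto f l (𝓝 f₀)) (hg : Tendsto g l (𝓝 g₀))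
    (i j : ℕ) : Tendsto (fun a => contr₀ (f a) (g a) i j) l (𝓝 (contr₀ f₀ g₀ i j)) := by
  by_cases h : i ≤ m ∧ i ≤ q ∧ j ≤ n ∧ j ≤ p
  · simp only [contr₀, dif_pos h]
    exact tendsto_contraction _ _ _ _ hf hg
  · simp only [contr₀, dif_neg h]
    exact tendsto_const_nhds

theorem Kernel.IsSupportedOn.contr₀ {s : Finset ι} {f : Kernel ι m n} {g : Kernel ι p q}
    (hf : f.IsSupportedOn s) (hg : g.IsSupportedOn s) (i j : ℕ) :
    (contr₀ f g i j).IsSupportedOn s := by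
  unfold ComplexWiener.contr₀
  split_ifs with h
  · exact hf.contraction _ _ _ _ hg
  · intro x hx
    exact absurd rfl hx

theorem productCoeff_eq_zero {i j : ℕ} (h : ¬ (i ≤ m ∧ i ≤ q ∧ j ≤ n ∧ j ≤ p)) :
    productCoeff m n p q i j = 0 := by
  have h' : m < i ∨ q < i ∨ n < j ∨ p < j := by omega
  rcases h' with h | h | h | h <;> simp [productCoeff, Nat.descFactorial_eq_zero_iff_lt.2 h]

theorem productCoeff_smul_tuplePoly [DecidableEq ι] {s : Finset ι} {f : Kernel ι m n}
    {g : Kernel ι p q} (hf : f.IsSymm) (hg : g.IsSymm) (hfs : f.IsSupportedOn s) (i j : ℕ) :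
    productCoeff m n p q i j • tuplePoly (fun x : (Fin (m - i + (p - j)) → s) ×
        (Fin (n - j + (q - i)) → s) => contr₀ f g i j (Subtype.val ∘ x.1, Subtype.val ∘ x.2)) =
      productCoeff m n p q i j • tuplePoly (symContraction m n p q i j
        (pullback Subtype.val f.symCoeff) (pullback Subtype.val g.symCoeff)) := by
  by_cases h : i ≤ m ∧ i ≤ q ∧ j ≤ n ∧ j ≤ p
  · obtain ⟨h1, h2, h3, h4⟩ := h
    congr 2
    funext x
    rw [contr₀_eq f g h1 h2 h3 h4]
    exact hf.contraction_comp_val h1 h2 h3 h4 hg hfs x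
  · rw [productCoeff_eq_zero h, zero_smul, zero_smul]

theorem tuplePoly_symContraction_zero {κ : Type*} [Fintype κ] [DecidableEq κ] (m n p q : ℕ)
    (ψ γ : Multiset κ → Multiset κ → ℂ) :
    tuplePoly (symContraction m n p q 0 0 ψ γ) = symPoly m n ψ * symPoly p q γ := by
  have h := contr_pow_mul_symPoly 0 0 m n p q ψ γ
  simpa using h.symm

theorem conj_evalPoly_wick_tuplePoly {κ : Type*} [Fintype κ] [DecidableEq κ] (z : κ → ℂ) {a b : ℕ}
    (φ : (Fin a → κ) × (Fin b → κ) → ℂ) : conj (evalPoly z (wick (tuplePoly φ))) =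
      evalPoly z (wick (tuplePoly fun x => conj (φ x.swap))) := by
  simp only [tuplePoly, map_sum, map_smul, smul_eq_mul, map_mul, conj_evalPoly_wick_word]
  exact Fintype.sum_equiv (Equiv.prodComm _ _) _ _ fun x => rfl

theorem conj_evalPoly_wick_mul {κ : Type*} [Fintype κ] [DecidableEq κ] (z : κ → ℂ) (m n p q : ℕ)
    (ψ γ : Multiset κ → Multiset κ → ℂ) :
    conj (evalPoly z (wick (symPoly m n ψ * symPoly p q γ))) =
      evalPoly z (wick (symPoly n m (symConj ψ) * symPoly q p (symConj γ))) := by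
  rw [symPoly_mul_symPoly, symPoly_mul_symPoly, conj_evalPoly_wick_tuplePoly]
  simp only [map_mul]
  rfl

end Contr

section Product

variable {H Ω ι : Type*} [NormedAddCommGroup H] [InnerProductSpace ℂ H] [MeasurableSpace Ω]
  {Z : H → Ω → ℂ} {P : Measure Ω} (hZ : IsComplexIsonormal Z P)
  (e : HilbertBasis ι ℂ H) {m n p q : ℕ}

/-- The sum `∑ w(i, j) c(i, j) I(f ⊗_{i,j} g)`, where `c(i, j)` are the coefficients of the product
formula. -/
def chaosSum (w : ℕ → ℕ → ℂ) (f : Kernel ι m n) (g : Kernel ι p q) : Lp ℂ 2 P :=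
  ∑ i ∈ Finset.range (m + 1), ∑ j ∈ Finset.range (n + 1),
    (w i j * productCoeff m n p q i j) • multipleIntegral hZ e (contr₀ f g i j)

theorem chaosSum_ae_eq [DecidableEq ι] (w : ℕ → ℕ → ℂ) {s : Finset ι} {f : Kernel ι m n}
    {g : Kernel ι p q} (hf : f.IsSymm) (hg : g.IsSymm) (hfs : f.IsSupportedOn s)
    (hgs : g.IsSupportedOn s) : chaosSum hZ e w f g =ᵐ[P] fun ω =>
      evalPoly (fun y : s => Z (e y) ω) (∑ i ∈ Finset.range (m + 1), ∑ j ∈ Finset.range (n + 1),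
        (w i j * productCoeff m n p q i j) • wick (tuplePoly (symContraction m n p q i j
          (pullback Subtype.val f.symCoeff) (pullback Subtype.val g.symCoeff)))) := by
  unfold chaosSum
  have h0 : ∀ᵐ ω ∂P, ∀ i j, ((w i j * productCoeff m n p q i j) •
      multipleIntegral hZ e (contr₀ f g i j) : Lp ℂ 2 P) ω =
      evalPoly (fun y : s => Z (e y) ω) ((w i j * productCoeff m n p q i j) •
        wick (tuplePoly (symContraction m n p q i j
          (pullback Subtype.val f.symCoeff) (pullback Subtype.val g.symCoeff)))) := by
    rw [ae_all_iff]
    intro i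
    rw [ae_all_iff]
    intro j
    filter_upwards [Lp.coeFn_smul (w i j * productCoeff m n p q i j)
      (multipleIntegral hZ e (contr₀ f g i j)),
      multipleIntegral_ae_eq hZ e (hfs.contr₀ hgs i j)] with ω h1 h2
    rw [h1, Pi.smul_apply, h2, mul_smul, mul_smul, ← map_smul wick (productCoeff m n p q i j),
      ← productCoeff_smul_tuplePoly hf hg hfs, map_smul, map_smul, map_smul]
  have h3 (i : ℕ) := Lp.coeFn_finsetSum (Finset.range (n + 1)) fun j =>
    (w i j * productCoeff m n p q i j) • multipleIntegral hZ e (contr₀ f g i j)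
  filter_upwards [h0, Lp.coeFn_finsetSum (Finset.range (m + 1)) fun i =>
    ∑ j ∈ Finset.range (n + 1), (w i j * productCoeff m n p q i j) •
      multipleIntegral hZ e (contr₀ f g i j), ae_all_iff.2 h3] with ω h1 h2 h4
  rw [h2, Finset.sum_apply, map_sum]
  refine Finset.sum_congr rfl fun i _ => ?_
  rw [h4, Finset.sum_apply, map_sum]
  exact Finset.sum_congr rfl fun j _ => h1 i j

theorem tendsto_chaosSum (w : ℕ → ℕ → ℂ) {α : Type*} {l : Filter α} {f : α → Kernel ι m n}
    {f₀ : Kernel ι m n} {g : α → Kernel ι p q} {g₀ : Kernel ι p q} (hf : Tendsto f l (𝓝 f₀))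
    (hg : Tendsto g l (𝓝 g₀)) :
    Tendsto (fun a => chaosSum hZ e w (f a) (g a)) l (𝓝 (chaosSum hZ e w f₀ g₀)) :=
  tendsto_finsetSum _ fun i _ => tendsto_finsetSum _ fun j _ =>
    (tendsto_multipleIntegral hZ e (tendsto_contr₀ hf hg i j)).const_smul _

/-- The product formula for multiple integrals of symmetric kernels. -/
theorem multipleIntegral_mul {f : Kernel ι m n} {g : Kernel ι p q} (hf : f.IsSymm)
    (hg : g.IsSymm) : ∀ᵐ ω ∂P, multipleIntegral hZ e f ω * multipleIntegral hZ e g ω =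
      chaosSum hZ e 1 f g ω := by
  classical
  refine ae_eq_of_tendsto_Lp (Φ := fun x : ℂ × ℂ => x.1 * x.2)
    (tendsto_multipleIntegral hZ e f.tendsto_cut) (tendsto_multipleIntegral hZ e g.tendsto_cut)
    (tendsto_chaosSum hZ e 1 f.tendsto_cut g.tendsto_cut) (by fun_prop) fun s => ?_
  have hfs := f.isSupportedOn_cut s
  have hgs := g.isSupportedOn_cut s
  filter_upwards [multipleIntegral_ae_eq hZ e hfs, multipleIntegral_ae_eq hZ e hgs,
    chaosSum_ae_eq hZ e 1 (hf.cut s) (hg.cut s) hfs hgs] with ω h1 h2 h3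
  rw [h1, h2, h3, (hf.cut s).tuplePoly_eq, (hg.cut s).tuplePoly_eq, ← map_mul]
  simp only [kernelPoly, wick_symPoly_mul_wick_symPoly, Pi.one_apply, one_mul]

theorem conj_multipleIntegral (f : Kernel ι m n) :
    ∀ᵐ ω ∂P, conj (multipleIntegral hZ e f ω) = multipleIntegral hZ e f.revConj ω := by
  classical
  refine ae_eq_of_tendsto_Lp (Φ := fun x : ℂ × ℂ => conj x.1)
    (tendsto_multipleIntegral hZ e f.tendsto_cut) (tendsto_multipleIntegral hZ e f.tendsto_cut)
    (tendsto_multipleIntegral hZ e (Kernel.tendsto_revConj f.tendsto_cut)) (by fun_prop)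
    fun s => ?_
  have hfs := f.isSupportedOn_cut s
  filter_upwards [multipleIntegral_ae_eq hZ e hfs, multipleIntegral_ae_eq hZ e hfs.revConj]
    with ω h1 h2
  rw [h1, h2, conj_evalPoly_wick_tuplePoly]
  rfl

/-- The contractions of `f` with the reversed conjugate of `g` are controlled by the norm of the
multiple integral of `f ⊗ g`. -/
theorem sum_norm_sq_contr₀_le {f : Kernel ι m n} {g : Kernel ι p q} (hf : f.IsSymm)
    (hg : g.IsSymm) :
    (m.factorial : ℝ) * p.factorial * (n.factorial * q.factorial) *
      ∑ a ∈ Finset.range (min m p + 1), ∑ b ∈ Finset.range (min n q + 1),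
        ‖contr₀ f g.revConj a b‖ ^ 2 ≤ ‖multipleIntegral hZ e (contr₀ f g 0 0)‖ ^ 2 := by
  classical
  have h1 := (((tendsto_finsetSum (Finset.range (min m p + 1)) fun a _ => tendsto_finsetSum
    (Finset.range (min n q + 1)) fun b _ => (tendsto_contr₀ f.tendsto_cut
      (Kernel.tendsto_revConj g.tendsto_cut) a b).norm.pow 2)).const_mul
      ((m.factorial : ℝ) * p.factorial * (n.factorial * q.factorial)))
  have h2 := (tendsto_multipleIntegral hZ e
    (tendsto_contr₀ f.tendsto_cut g.tendsto_cut 0 0)).norm.pow 2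
  -- Both sides are continuous in the kernels, which may therefore be truncated to a finite set.
  refine le_of_tendsto_of_tendsto' h1 h2 fun s => ?_
  have hfs := f.isSupportedOn_cut s
  have hgs := g.isSupportedOn_cut s
  have h3 := (isGaussianFunctional_expectation hZ (orthonormal_val e s)).sum_contraction_le m n p q
    (pullback Subtype.val (f.cut (tuples m n s)).symCoeff)
    (pullback Subtype.val (g.cut (tuples p q s)).symCoeff)
  refine le_trans (le_of_eq ?_) (h3.trans (le_of_eq ?_))
  · congr 1
    refine Finset.sum_congr rfl fun a ha => Finset.sum_congr rfl fun b hb => ?_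
    rw [Finset.mem_range] at ha hb
    have a1 : a ≤ m := by omega
    have a2 : a ≤ p := by omega
    have a3 : b ≤ n := by omega
    have a4 : b ≤ q := by omega
    rw [← (hfs.contr₀ hgs.revConj a b).sum_norm_sq]
    refine Finset.sum_congr rfl fun x _ => ?_
    rw [contr₀_eq _ _ a1 a2 a3 a4, (hf.cut s).contraction_comp_val a1 a2 a3 a4 (hg.cut s).revConj
      hfs x, symContraction, symContraction]
    simp only [← entries_glue a2, ← entries_glue a4, pullback, symConj, entries_map,
      Kernel.symCoeff_revConj (hg.cut s)]
  · have h4 : ∀ᵐ ω ∂P, multipleIntegral hZ e (contr₀ (f.cut (tuples m n s))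
        (g.cut (tuples p q s)) 0 0) ω = evalPoly (fun y : s => Z (e y) ω)
          (wick (symPoly m n (pullback Subtype.val (f.cut (tuples m n s)).symCoeff) *
            symPoly p q (pullback Subtype.val (g.cut (tuples p q s)).symCoeff))) := by
      filter_upwards [multipleIntegral_ae_eq hZ e (hfs.contr₀ hgs 0 0)] with ω h5
      rw [h5, ← tuplePoly_symContraction_zero]
      have h6 := productCoeff_smul_tuplePoly (hf.cut s) (hg.cut s) hfs 0 0
      have h7 : productCoeff m n p q 0 0 = 1 := by simp [productCoeff]
      rw [h7, one_smul, one_smul] at h6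
      exact congrArg _ (congrArg _ h6)
    rw [pairing_apply, expectation, LinearMap.coe_mk, AddHom.coe_mk]
    have h5 : ∫ ω, evalPoly (fun y : s => Z (e y) ω)
        (wick (symPoly m n (pullback Subtype.val (f.cut (tuples m n s)).symCoeff) *
            symPoly p q (pullback Subtype.val (g.cut (tuples p q s)).symCoeff)) *
          wick (symPoly n m (symConj (pullback Subtype.val (f.cut (tuples m n s)).symCoeff)) *
            symPoly q p (symConj (pullback Subtype.val (g.cut (tuples p q s)).symCoeff)))) ∂P =
        inner ℂ (multipleIntegral hZ e (contr₀ (f.cut (tuples m n s)) (g.cut (tuples p q s)) 0 0))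
          (multipleIntegral hZ e (contr₀ (f.cut (tuples m n s)) (g.cut (tuples p q s)) 0 0)) := by
      rw [L2.inner_def]
      refine integral_congr_ae ?_
      filter_upwards [h4] with ω h6
      rw [h6, RCLike.inner_apply, conj_evalPoly_wick_mul, map_mul]
    rw [h5, inner_self_eq_norm_sq_to_K]
    norm_cast

end Product

/-! ### Moments of multiple integrals -/

section Moments

variable {H Ω ι : Type*} [NormedAddCommGroup H] [InnerProductSpace ℂ H] [MeasurableSpace Ω]
  {Z : H → Ω → ℂ} {P : Measure Ω} (hZ : IsComplexIsonormal Z P)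
  (e : HilbertBasis ι ℂ H) {m n p q : ℕ}

theorem multipleIntegral_symmetrize (f : Kernel ι m n) :
    multipleIntegral hZ e f.symmetrize = multipleIntegral hZ e f := by
  have h := norm_sq_multipleIntegral hZ e (f - f.symmetrize)
  rw [Kernel.symmetrize_sub, f.isSymm_symmetrize.symmetrize_eq, sub_self, norm_zero,
    multipleIntegral_sub] at h
  norm_num at h
  exact (sub_eq_zero.1 h).symm

theorem coeFn_chaosSum (w : ℕ → ℕ → ℂ) (f : Kernel ι m n) (g : Kernel ι p q) :
    chaosSum hZ e w f g =ᵐ[P] ∑ i ∈ Finset.range (m + 1), ∑ j ∈ Finset.range (n + 1),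
      (w i j * productCoeff m n p q i j) • (multipleIntegral hZ e (contr₀ f g i j) : Ω → ℂ) := by
  have h0 (i j : ℕ) := Lp.coeFn_smul (w i j * productCoeff m n p q i j)
    (multipleIntegral hZ e (contr₀ f g i j))
  have h3 (i : ℕ) := Lp.coeFn_finsetSum (Finset.range (n + 1)) fun j =>
    (w i j * productCoeff m n p q i j) • multipleIntegral hZ e (contr₀ f g i j)
  filter_upwards [ae_all_iff.2 fun i => ae_all_iff.2 (h0 i),
    Lp.coeFn_finsetSum (Finset.range (m + 1)) fun i =>
      ∑ j ∈ Finset.range (n + 1), (w i j * productCoeff m n p q i j) •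
        multipleIntegral hZ e (contr₀ f g i j), ae_all_iff.2 h3] with ω h1 h2 h4
  rw [chaosSum, h2, Finset.sum_apply, Finset.sum_apply]
  refine Finset.sum_congr rfl fun i _ => ?_
  rw [h4, Finset.sum_apply, Finset.sum_apply]
  exact Finset.sum_congr rfl fun j _ => h1 i j

/-- Hypercontractivity for the exponents `2, 4, 8, …`.  It follows from the product formula, which
expresses the square of a multiple integral through multiple integrals. -/
theorem exists_eLpNorm_le (k m n : ℕ) : ∃ C : ℝ≥0∞, C ≠ ∞ ∧ ∀ f : Kernel ι m n,
    eLpNorm (multipleIntegral hZ e f) (2 ^ (k + 1)) P ≤ C * ‖f‖ₑ := by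
  induction k generalizing m n with
  | zero =>
    refine ⟨ENNReal.ofReal (integralBound m n), ENNReal.ofReal_ne_top, fun f => ?_⟩
    have h := norm_multipleIntegral_le hZ e f
    rw [zero_add, pow_one, ← Lp.enorm_def, ← ofReal_norm, ← ofReal_norm,
      ← ENNReal.ofReal_mul (integralBound_pos m n).le]
    exact ENNReal.ofReal_le_ofReal h
  | succ k ih =>
    choose C hC hCf using ih
    set S : ℝ≥0∞ := ∑ i ∈ Finset.range (m + 1), ∑ j ∈ Finset.range (n + 1),
      ‖(1 : ℂ) * productCoeff m n m n i j‖ₑ * C (m - i + (m - j)) (n - j + (n - i)) with hS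
    have hStop : S ≠ ∞ := ENNReal.sum_ne_top.2 fun i _ => ENNReal.sum_ne_top.2 fun j _ =>
      ENNReal.mul_ne_top enorm_ne_top (hC _ _)
    -- The square of `I(f)` is bounded by `S ‖f‖²`, and `S ≤ (S + 1)²`.
    refine ⟨S + 1, by simp [hStop], fun f => ?_⟩
    rw [← multipleIntegral_symmetrize]
    set g := f.symmetrize with hg
    have hgs : g.IsSymm := f.isSymm_symmetrize
    have hgf : ‖g‖ₑ ≤ ‖f‖ₑ := enorm_le_iff_norm_le.2 f.norm_symmetrize_le
    have hr : (1 : ℝ≥0∞) ≤ 2 ^ (k + 1) := one_le_pow₀ (by norm_num)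
    have h1 : eLpNorm (multipleIntegral hZ e g) (2 ^ (k + 1 + 1)) P ^ 2 =
        eLpNorm (chaosSum hZ e 1 g g) (2 ^ (k + 1)) P := by
      have h2 := eLpNorm_norm_rpow (p := 2 ^ (k + 1)) (μ := P)
        (multipleIntegral hZ e g : Ω → ℂ) (q := 2) (by norm_num)
      rw [ENNReal.ofReal_ofNat, ← pow_succ, ENNReal.rpow_two] at h2
      rw [← h2]
      refine eLpNorm_congr_norm_ae ?_
      filter_upwards [multipleIntegral_mul hZ e hgs hgs] with ω h3
      rw [← h3]
      simp [pow_two]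
    have h2 : eLpNorm (chaosSum hZ e 1 g g) (2 ^ (k + 1)) P ≤ S * ‖f‖ₑ ^ 2 := by
      rw [eLpNorm_congr_ae (coeFn_chaosSum hZ e 1 g g), hS, Finset.sum_mul]
      refine (eLpNorm_sum_le (fun i _ => ?_) hr).trans (Finset.sum_le_sum fun i _ => ?_)
      · exact Finset.aestronglyMeasurable_sum _ fun j _ =>
          (Lp.aestronglyMeasurable _).const_smul _
      rw [Finset.sum_mul]
      refine (eLpNorm_sum_le (fun j _ => ?_) hr).trans (Finset.sum_le_sum fun j _ => ?_)
      · exact (Lp.aestronglyMeasurable _).const_smul _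
      rw [eLpNorm_const_smul, mul_assoc]
      refine mul_le_mul_right ((hCf _ _ _).trans (mul_le_mul_right ?_ _)) _
      have h4 : ‖contr₀ g g i j‖ₑ ≤ ‖g‖ₑ * ‖g‖ₑ := by
        rw [← ofReal_norm, ← ofReal_norm, ← ENNReal.ofReal_mul (norm_nonneg _)]
        exact ENNReal.ofReal_le_ofReal (norm_contr₀_le g g i j)
      refine h4.trans ?_
      rw [pow_two]
      exact mul_le_mul' hgf hgf
    refine (ENNReal.pow_le_pow_left_iff two_ne_zero).1 ?_
    rw [h1, mul_pow]
    refine h2.trans (mul_le_mul_left ?_ _)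
    calc S ≤ S + 1 := le_self_add
      _ = (S + 1) ^ 1 := (pow_one _).symm
      _ ≤ (S + 1) ^ 2 := pow_le_pow_right₀ le_add_self (by norm_num)

theorem memLp_multipleIntegral (k : ℕ) (f : Kernel ι m n) :
    MemLp (multipleIntegral hZ e f) (2 ^ (k + 1)) P := by
  obtain ⟨C, hC, h⟩ := exists_eLpNorm_le hZ e k m n
  exact ⟨Lp.aestronglyMeasurable _, (h f).trans_lt (ENNReal.mul_lt_top hC.lt_top enorm_lt_top)⟩

theorem integral_norm_sq_eq (u : Lp ℂ 2 P) : ∫ ω, ‖u ω‖ ^ 2 ∂P = ‖u‖ ^ 2 := by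
  have h := inner_self_eq_norm_sq_to_K (𝕜 := ℂ) u
  rw [L2.inner_def] at h
  have h1 : ((∫ ω, ‖u ω‖ ^ 2 ∂P : ℝ) : ℂ) = ((‖u‖ ^ 2 : ℝ) : ℂ) := by
    rw [← integral_complex_ofReal, Complex.ofReal_pow]
    refine Eq.trans ?_ h
    refine integral_congr_ae (ae_of_all _ fun ω => ?_)
    simp only [inner_self_eq_norm_sq_to_K]
    push_cast
    rfl
  exact_mod_cast h1

/-- A constant bounding the eighth moments of the multiple integrals of order `(m, n)`. -/
theorem exists_integral_norm_pow_eight_le (m n : ℕ) : ∃ C : ℝ, 0 ≤ C ∧ ∀ f : Kernel ι m n,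
    ∫ ω, ‖multipleIntegral hZ e f ω‖ ^ 8 ∂P ≤ C * ‖f‖ ^ 8 := by
  obtain ⟨C, hC, h⟩ := exists_eLpNorm_le hZ e 2 m n
  refine ⟨C.toReal ^ 8, by positivity, fun f => ?_⟩
  have h1 := h f
  have e8 : (2 : ℝ≥0∞) ^ (2 + 1) = 8 := by norm_num
  have hm := memLp_multipleIntegral hZ e 2 f
  rw [e8] at h1 hm
  rw [hm.eLpNorm_eq_integral_rpow_norm (by norm_num) (by norm_num)] at h1
  have h2 := ENNReal.toReal_mono (ENNReal.mul_ne_top hC enorm_ne_top) h1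
  rw [ENNReal.toReal_mul, toReal_enorm, ENNReal.toReal_ofReal (by positivity)] at h2
  norm_num at h2
  have h3 := pow_le_pow_left₀ (by positivity) h2 8
  rw [mul_pow] at h3
  refine le_trans (le_of_eq ?_) h3
  rw [← Real.rpow_natCast (_ ^ _), ← Real.rpow_mul (by positivity)]
  norm_num

/-- The product of two multiple integrals of symmetric kernels splits into its top chaos and an
orthogonal remainder with the same mean. -/
theorem norm_sq_integral_add_le [IsProbabilityMeasure P] {f : Kernel ι m n} {g : Kernel ι p q}
    (h : m + p + (n + q) ≠ 0) :
    ‖∫ ω, chaosSum hZ e 1 f g ω ∂P‖ ^ 2 + ‖multipleIntegral hZ e (contr₀ f g 0 0)‖ ^ 2 ≤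
      ‖chaosSum hZ e 1 f g‖ ^ 2 := by
  set X := chaosSum hZ e 1 f g with hX
  set T := multipleIntegral hZ e (contr₀ f g 0 0) with hT
  -- All terms of `X` except for `T` are multiple integrals of lower degree.
  have horth : inner ℂ T (X - T) = 0 := by
    rw [inner_sub_right, sub_eq_zero, hX, chaosSum, inner_sum,
      Finset.sum_eq_single_of_mem 0 (by simp), inner_sum,
      Finset.sum_eq_single_of_mem 0 (by simp)]
    · have h7 : productCoeff m n p q 0 0 = 1 := by simp [productCoeff]
      rw [h7, Pi.one_apply, Pi.one_apply, one_mul, one_smul]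
    · intro j _ hj
      rw [inner_smul_right]
      by_cases hc : 0 ≤ m ∧ 0 ≤ q ∧ j ≤ n ∧ j ≤ p
      · rw [inner_multipleIntegral_eq_zero, mul_zero]
        omega
      · rw [productCoeff_eq_zero hc, mul_zero, zero_mul]
    · intro i _ hi
      rw [inner_sum]
      refine Finset.sum_eq_zero fun j _ => ?_
      rw [inner_smul_right]
      by_cases hc : i ≤ m ∧ i ≤ q ∧ j ≤ n ∧ j ≤ p
      · rw [inner_multipleIntegral_eq_zero, mul_zero]
        omega
      · rw [productCoeff_eq_zero hc, mul_zero, zero_mul]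
  have h1 : ‖X‖ ^ 2 = ‖T‖ ^ 2 + ‖X - T‖ ^ 2 := by
    have h2 := norm_add_sq_eq_norm_sq_add_norm_sq_of_inner_eq_zero T (X - T) horth
    rw [add_sub_cancel] at h2
    rw [pow_two, pow_two, pow_two, h2]
  have hi (u : Lp ℂ 2 P) : Integrable u P := (Lp.memLp u).integrable (by norm_num)
  have h3 : ∫ ω, X ω ∂P = ∫ ω, (X - T) ω ∂P := by
    rw [integral_congr_ae (Lp.coeFn_sub X T)]
    simp only [Pi.sub_apply]
    rw [integral_sub (hi X) (hi T), hT, integral_multipleIntegral_of_ne hZ e _ (contr₀ f g 0 0),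
      sub_zero]
    omega
  have h4 (u : Lp ℂ 2 P) : ‖∫ ω, u ω ∂P‖ ≤ ‖u‖ := by
    have h5 : eLpNorm u 1 P ≤ eLpNorm u 2 P :=
      eLpNorm_le_eLpNorm_of_exponent_le (by norm_num) (Lp.aestronglyMeasurable u)
    refine (norm_integral_le_integral_norm _).trans ?_
    rw [integral_norm_eq_lintegral_enorm (Lp.aestronglyMeasurable u), ← eLpNorm_one_eq_lintegral_enorm,
      Lp.norm_def]
    exact ENNReal.toReal_mono (Lp.eLpNorm_ne_top u) h5
  rw [h1, h3, add_comm]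
  exact add_le_add le_rfl (pow_le_pow_left₀ (norm_nonneg _) (h4 _) 2)

/-- Only the full contraction contributes to the mean of a product of multiple integrals. -/
theorem integral_chaosSum (w : ℕ → ℕ → ℂ) (f : Kernel ι m n) (g : Kernel ι p q) :
    ∫ ω, chaosSum hZ e w f g ω ∂P = w m n * productCoeff m n p q m n *
      ∫ ω, multipleIntegral hZ e (contr₀ f g m n) ω ∂P := by
  have := hZ.gaussian.isProbabilityMeasure
  have hi (u : Lp ℂ 2 P) : Integrable u P := (Lp.memLp u).integrable (by norm_num)
  rw [integral_congr_ae (coeFn_chaosSum hZ e w f g)]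
  simp only [Finset.sum_apply, Pi.smul_apply, smul_eq_mul]
  have h0 (i j : ℕ) (hij : ¬ (i = m ∧ j = n)) : w i j * productCoeff m n p q i j *
      ∫ ω, multipleIntegral hZ e (contr₀ f g i j) ω ∂P = 0 := by
    by_cases hc : i ≤ m ∧ i ≤ q ∧ j ≤ n ∧ j ≤ p
    · rw [integral_multipleIntegral_of_ne, mul_zero]
      omega
    · rw [productCoeff_eq_zero hc, mul_zero, zero_mul]
  rw [integral_finsetSum _ fun i _ => integrable_finsetSum _ fun j _ => (hi _).const_mul _,
    Finset.sum_eq_single_of_mem m (by simp),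
    integral_finsetSum _ fun j _ => (hi _).const_mul _, Finset.sum_eq_single_of_mem n (by simp),
    integral_const_mul]
  · intro j _ hj
    rw [integral_const_mul, h0 m j (by tauto)]
  · intro i _ hi'
    rw [integral_finsetSum _ fun j _ => (hi _).const_mul _]
    exact Finset.sum_eq_zero fun j _ => by rw [integral_const_mul, h0 i j (by tauto)]

end Moments

/-! ### The Malliavin derivative of multiple integrals -/

section ConjWirtinger

variable {κ : Type*} [Fintype κ] [DecidableEq κ]

open MvPolynomial

theorem conj_dz {g : (κ → ℂ) → ℂ} (hg : Differentiable ℝ g) (x : κ) (z : κ → ℂ) :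
    conj (dz g x z) = dzbar (fun z => conj (g z)) x z := by
  have h : fderiv ℝ (fun z => conj (g z)) z =
      (Complex.conjCLE : ℂ →L[ℝ] ℂ).comp (fderiv ℝ g z) :=
    ((Complex.conjCLE : ℂ →L[ℝ] ℂ).hasFDerivAt.comp z (hg z).hasFDerivAt).fderiv
  rw [dzbar_of_fderiv h, dz]
  simp only [map_mul, map_sub, map_div₀, map_one, map_ofNat, Complex.conj_I,
    ContinuousLinearMap.comp_apply]
  simp

theorem conj_evalPoly_pderiv {p p' : Poly κ}
    (h : ∀ z : κ → ℂ, conj (evalPoly z p) = evalPoly z p') (x : κ) (z : κ → ℂ) :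
    conj (evalPoly z (pderiv (Sum.inl x) p)) = evalPoly z (pderiv (Sum.inr x) p') := by
  rw [← dz_evalPoly, conj_dz (hasTemperateGrowth_evalPoly p).isTame.differentiable,
    ← dzbar_evalPoly]
  simp only [h]

end ConjWirtinger

section Derivative

variable {H Ω ι : Type*} [NormedAddCommGroup H] [InnerProductSpace ℂ H] [MeasurableSpace Ω]
  {Z : H → Ω → ℂ} {P : Measure Ω} (hZ : IsComplexIsonormal Z P)
  (e : HilbertBasis ι ℂ H) {m n p q : ℕ}

theorem HasMalliavinDeriv.congr {F F' : Ω → ℂ} {U : Lp H 2 P} (h : HasMalliavinDeriv Z P F U)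
    (hF : F =ᵐ[P] F') : HasMalliavinDeriv Z P F' U := fun ε hε => by
  obtain ⟨G, V, hs, h1, h2⟩ := h ε hε
  refine ⟨G, V, hs, (eLpNorm_congr_ae ?_).trans_lt h1, h2⟩
  filter_upwards [hF] with ω hω
  rw [hω]

theorem kernelPoly_sub [DecidableEq ι] {s : Finset ι} {f g : Kernel ι m n} (hf : f.IsSymm)
    (hg : g.IsSymm) (hfg : (f - g).IsSymm) :
    kernelPoly s (f - g) = kernelPoly s f - kernelPoly s g := by
  rw [← hf.tuplePoly_eq, ← hg.tuplePoly_eq, ← hfg.tuplePoly_eq, tuplePoly, tuplePoly, tuplePoly,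
    ← Finset.sum_sub_distrib]
  exact Finset.sum_congr rfl fun x _ => by rw [lp.coeFn_sub, Pi.sub_apply, sub_smul]

theorem Kernel.IsSymm.sub {f g : Kernel ι m n} (hf : f.IsSymm) (hg : g.IsSymm) :
    (f - g).IsSymm := fun π τ j k => by
  rw [lp.coeFn_sub, Pi.sub_apply, Pi.sub_apply, hf, hg]

theorem conj_evalPoly_kernelPoly [DecidableEq ι] {s : Finset ι} {f : Kernel ι m n} (hf : f.IsSymm)
    (z : s → ℂ) : conj (evalPoly z (wick (kernelPoly s f))) =
      evalPoly z (wick (kernelPoly s f.revConj)) := by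
  rw [← hf.tuplePoly_eq, ← hf.revConj.tuplePoly_eq, conj_evalPoly_wick_tuplePoly]
  rfl

/-- The Malliavin derivative `∑_x ∂_x F e_x` of the multiple integral of a symmetric kernel
supported on the finite set `s`. -/
def finiteDeriv [DecidableEq ι] (Z : H → Ω → ℂ) (e : HilbertBasis ι ℂ H) (s : Finset ι)
    (f : Kernel ι m n) (ω : Ω) : H :=
  ∑ x : s, evalPoly (fun y : s => Z (e y) ω)
    (MvPolynomial.pderiv (Sum.inl x) (wick (kernelPoly s f))) • e x

theorem isSmoothWithDeriv_finiteDeriv [DecidableEq ι] (Z : H → Ω → ℂ) (e : HilbertBasis ι ℂ H)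
    (s : Finset ι) (f : Kernel ι m n) :
    IsSmoothWithDeriv Z (fun ω => evalPoly (fun y : s => Z (e y) ω) (wick (kernelPoly s f)))
      (finiteDeriv Z e s f) := by
  have h := isSmoothWithDeriv_of_fintype Z (fun y : s => e y)
    (hasTemperateGrowth_evalPoly (wick (kernelPoly s f)))
  simp only [dz_evalPoly] at h
  exact h

theorem memLp_finiteDeriv [DecidableEq ι] (hZ : IsComplexIsonormal Z P)
    (e : HilbertBasis ι ℂ H) (s : Finset ι) (f : Kernel ι m n) :
    MemLp (finiteDeriv Z e s f) 2 P :=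
  ((isSmoothWithDeriv_finiteDeriv Z e s f).memLp hZ).2

theorem hasMalliavinDeriv_finiteDeriv [DecidableEq ι] {s : Finset ι} {f : Kernel ι m n}
    (hf : f.IsSymm) (hfs : f.IsSupportedOn s) :
    HasMalliavinDeriv Z P (multipleIntegral hZ e f) (memLp_finiteDeriv hZ e s f).toLp := by
  intro ε hε
  refine ⟨_, _, isSmoothWithDeriv_finiteDeriv Z e s f, ?_, ?_⟩
  · refine lt_of_eq_of_lt ?_ hε
    rw [← eLpNorm_zero (p := 2) (μ := P) (ε := ℂ)]
    refine eLpNorm_congr_ae ?_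
    filter_upwards [multipleIntegral_ae_eq hZ e hfs] with ω h
    rw [h, hf.tuplePoly_eq, sub_self]
    rfl
  · refine lt_of_eq_of_lt ?_ hε
    rw [← eLpNorm_zero (p := 2) (μ := P) (ε := H)]
    refine eLpNorm_congr_ae ?_
    filter_upwards [(memLp_finiteDeriv hZ e s f).coeFn_toLp] with ω h
    rw [h, sub_self]
    rfl

theorem malliavinDeriv_of_supported [DecidableEq ι] {s : Finset ι} {f : Kernel ι m n}
    (hf : f.IsSymm) (hfs : f.IsSupportedOn s) :
    malliavinDeriv Z P (multipleIntegral hZ e f) = (memLp_finiteDeriv hZ e s f).toLp :=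
  malliavinDeriv_eq hZ (Lp.memLp _) (hasMalliavinDeriv_finiteDeriv hZ e hf hfs)

theorem inner_finiteDeriv [DecidableEq ι] (s : Finset ι) (f : Kernel ι m n) (g : Kernel ι p q)
    (ω : Ω) : inner ℂ (finiteDeriv Z e s g ω) (finiteDeriv Z e s f ω) =
      ∑ x : s, conj (evalPoly (fun y : s => Z (e y) ω)
        (MvPolynomial.pderiv (Sum.inl x) (wick (kernelPoly s g)))) *
        evalPoly (fun y : s => Z (e y) ω)
          (MvPolynomial.pderiv (Sum.inl x) (wick (kernelPoly s f))) := by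
  unfold finiteDeriv
  rw [(orthonormal_val e s).inner_sum]

theorem inner_finiteDeriv_revConj_left [DecidableEq ι] {s : Finset ι} {f : Kernel ι m n}
    {g : Kernel ι p q} (hf : f.IsSymm) (hg : g.IsSymm) (hfs : f.IsSupportedOn s)
    (hgs : g.IsSupportedOn s) : ∀ᵐ ω ∂P,
      inner ℂ (finiteDeriv Z e s g.revConj ω) (finiteDeriv Z e s f ω) =
        chaosSum hZ e (fun i _ => i) f g ω := by
  filter_upwards [chaosSum_ae_eq hZ e (fun i _ => i) hf hg hfs hgs] with ω h1
  rw [h1, inner_finiteDeriv]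
  have h2 := sum_wick_pderiv_inl_mul m n p q (pullback Subtype.val f.symCoeff)
    (pullback (Subtype.val : s → ι) g.symCoeff)
  rw [← h2, map_sum]
  refine Finset.sum_congr rfl fun x _ => ?_
  rw [conj_evalPoly_pderiv (conj_evalPoly_kernelPoly hg.revConj), Kernel.revConj_revConj,
    pderiv_wick, pderiv_wick, map_mul, mul_comm]
  rfl

theorem inner_finiteDeriv_revConj_right [DecidableEq ι] {s : Finset ι} {f : Kernel ι m n}
    {g : Kernel ι p q} (hf : f.IsSymm) (hg : g.IsSymm) (hfs : f.IsSupportedOn s)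
    (hgs : g.IsSupportedOn s) : ∀ᵐ ω ∂P,
      inner ℂ (finiteDeriv Z e s f.revConj ω) (finiteDeriv Z e s g ω) =
        chaosSum hZ e (fun _ j => j) f g ω := by
  filter_upwards [chaosSum_ae_eq hZ e (fun _ j => j) hf hg hfs hgs] with ω h1
  rw [h1, inner_finiteDeriv]
  have h2 := sum_wick_pderiv_inr_mul m n p q (pullback Subtype.val f.symCoeff)
    (pullback (Subtype.val : s → ι) g.symCoeff)
  rw [← h2, map_sum]
  refine Finset.sum_congr rfl fun x _ => ?_
  rw [conj_evalPoly_pderiv (conj_evalPoly_kernelPoly hf.revConj), Kernel.revConj_revConj,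
    pderiv_wick, pderiv_wick, map_mul]
  rfl

theorem finiteDeriv_sub [DecidableEq ι] {s : Finset ι} {f g : Kernel ι m n} (hf : f.IsSymm)
    (hg : g.IsSymm) (ω : Ω) :
    finiteDeriv Z e s (f - g) ω = finiteDeriv Z e s f ω - finiteDeriv Z e s g ω := by
  unfold finiteDeriv
  rw [kernelPoly_sub hf hg (hf.sub hg), ← Finset.sum_sub_distrib]
  exact Finset.sum_congr rfl fun x _ => by rw [map_sub, map_sub, map_sub, sub_smul]

theorem malliavinDeriv_sub_of_supported [DecidableEq ι] {s : Finset ι} {f g : Kernel ι m n}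
    (hf : f.IsSymm) (hg : g.IsSymm) (hfs : f.IsSupportedOn s) (hgs : g.IsSupportedOn s) :
    malliavinDeriv Z P (multipleIntegral hZ e (f - g)) =
      malliavinDeriv Z P (multipleIntegral hZ e f) -
        malliavinDeriv Z P (multipleIntegral hZ e g) := by
  rw [malliavinDeriv_of_supported hZ e hf hfs, malliavinDeriv_of_supported hZ e hg hgs,
    malliavinDeriv_of_supported hZ e (hf.sub hg) (hfs.sub hgs), ← MemLp.toLp_sub]
  exact MemLp.toLp_congr _ _ (ae_of_all _ fun ω => finiteDeriv_sub e hf hg ω)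

/-- `E‖DF‖² = m E|F|²`: only the full contraction has a mean, and its weight is `m`. -/
theorem norm_malliavinDeriv_of_supported [DecidableEq ι] {s : Finset ι} {f : Kernel ι m n}
    (hf : f.IsSymm) (hfs : f.IsSupportedOn s) :
    ‖malliavinDeriv Z P (multipleIntegral hZ e f)‖ ^ 2 = m * ‖multipleIntegral hZ e f‖ ^ 2 := by
  have h1 : inner ℂ (malliavinDeriv Z P (multipleIntegral hZ e f))
      (malliavinDeriv Z P (multipleIntegral hZ e f)) =
        ∫ ω, chaosSum hZ e (fun i _ => i) f f.revConj ω ∂P := by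
    rw [malliavinDeriv_of_supported hZ e hf hfs, L2.inner_def]
    refine integral_congr_ae ?_
    filter_upwards [inner_finiteDeriv_revConj_left hZ e hf hf.revConj hfs hfs.revConj,
      (memLp_finiteDeriv hZ e s f).coeFn_toLp] with ω h2 h3
    rw [h3, ← h2, Kernel.revConj_revConj]
  have h2 : inner ℂ (multipleIntegral hZ e f) (multipleIntegral hZ e f) =
        ∫ ω, chaosSum hZ e 1 f f.revConj ω ∂P := by
    rw [L2.inner_def]
    refine integral_congr_ae ?_
    filter_upwards [multipleIntegral_mul hZ e hf hf.revConj, conj_multipleIntegral hZ e f]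
      with ω h3 h4
    rw [← h3, RCLike.inner_apply, h4]
  rw [integral_chaosSum, inner_self_eq_norm_sq_to_K] at h1 h2
  rw [Pi.one_apply, Pi.one_apply, one_mul] at h2
  rw [mul_assoc, ← h2] at h1
  have h3 : ((‖malliavinDeriv Z P (multipleIntegral hZ e f)‖ ^ 2 : ℝ) : ℂ) =
      ((m * ‖multipleIntegral hZ e f‖ ^ 2 : ℝ) : ℂ) := by
    push_cast
    exact h1
  exact Complex.ofReal_injective h3

theorem cauchySeq_malliavinDeriv_cut [DecidableEq ι] {f : Kernel ι m n} (hf : f.IsSymm) :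
    CauchySeq fun s : Finset ι => malliavinDeriv Z P
      (multipleIntegral hZ e (f.cut (tuples m n s))) := by
  have hI := (tendsto_multipleIntegral hZ e f.tendsto_cut).cauchySeq
  rw [Metric.cauchySeq_iff] at hI ⊢
  intro ε hε
  have hm : (0 : ℝ) < √m + 1 := by positivity
  obtain ⟨N, hN⟩ := hI (ε / (√m + 1)) (by positivity)
  refine ⟨N, fun s hs t ht => ?_⟩
  have h := hN s hs t ht
  rw [dist_eq_norm] at h ⊢
  -- Two truncations have a common finite support, on which `E‖DF‖² = m E|F|²` is known.
  have h1 : (f.cut (tuples m n s)).IsSupportedOn (s ∪ t) :=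
    (f.isSupportedOn_cut s).mono Finset.subset_union_left
  have h2 : (f.cut (tuples m n t)).IsSupportedOn (s ∪ t) :=
    (f.isSupportedOn_cut t).mono Finset.subset_union_right
  rw [← malliavinDeriv_sub_of_supported hZ e (hf.cut s) (hf.cut t) h1 h2]
  rw [← multipleIntegral_sub] at h
  have h3 := norm_malliavinDeriv_of_supported hZ e ((hf.cut s).sub (hf.cut t)) (h1.sub h2)
  set a := ‖malliavinDeriv Z P (multipleIntegral hZ e
    (f.cut (tuples m n s) - f.cut (tuples m n t)))‖
  set b := ‖multipleIntegral hZ e (f.cut (tuples m n s) - f.cut (tuples m n t))‖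
  have h4 : a = √m * b := by
    refine (sq_eq_sq₀ (norm_nonneg _) (mul_nonneg (Real.sqrt_nonneg _) (norm_nonneg _))).1 ?_
    rw [h3, mul_pow, Real.sq_sqrt (by positivity)]
  have hb : 0 ≤ b := norm_nonneg _
  rw [lt_div_iff₀ hm] at h
  rw [h4]
  linarith

variable [CompleteSpace H]

theorem exists_malliavinDeriv [DecidableEq ι] {f : Kernel ι m n} (hf : f.IsSymm) :
    ∃ U : Lp H 2 P, HasMalliavinDeriv Z P (multipleIntegral hZ e f) U ∧
      Tendsto (fun s : Finset ι => malliavinDeriv Z P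
        (multipleIntegral hZ e (f.cut (tuples m n s)))) atTop (𝓝 U) := by
  obtain ⟨U, hU⟩ := cauchySeq_tendsto_of_complete (cauchySeq_malliavinDeriv_cut hZ e hf)
  refine ⟨U, ?_, hU⟩
  have h1 := (tendsto_multipleIntegral hZ e f.tendsto_cut)
  refine hasMalliavinDeriv_of_tendsto (l := (atTop : Filter (Finset ι)))
    (fun s => isSmoothWithDeriv_finiteDeriv Z e s (f.cut (tuples m n s))) ?_ ?_
  · have h2 := ((Lp.tendsto_Lp_iff_tendsto_eLpNorm' _ _).1 h1)
    refine h2.congr fun s => ?_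
    rw [eLpNorm_sub_comm]
    refine eLpNorm_congr_ae ?_
    filter_upwards [multipleIntegral_ae_eq hZ e (f.isSupportedOn_cut s)] with ω h
    rw [Pi.sub_apply, h, (hf.cut s).tuplePoly_eq]
  · have h2 := ((Lp.tendsto_Lp_iff_tendsto_eLpNorm' _ _).1 hU)
    refine h2.congr fun s => ?_
    rw [eLpNorm_sub_comm]
    refine eLpNorm_congr_ae ?_
    rw [malliavinDeriv_of_supported hZ e (hf.cut s) (f.isSupportedOn_cut s)]
    filter_upwards [(memLp_finiteDeriv hZ e s (f.cut (tuples m n s))).coeFn_toLp] with ω h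
    rw [Pi.sub_apply, h]

theorem hasMalliavinDeriv_multipleIntegral {f : Kernel ι m n} (hf : f.IsSymm) :
    HasMalliavinDeriv Z P (multipleIntegral hZ e f)
      (malliavinDeriv Z P (multipleIntegral hZ e f)) := by
  classical
  obtain ⟨U, hU, -⟩ := exists_malliavinDeriv hZ e hf
  rwa [malliavinDeriv_eq hZ (Lp.memLp _) hU]

theorem tendsto_malliavinDeriv_cut [DecidableEq ι] {f : Kernel ι m n} (hf : f.IsSymm) :
    Tendsto (fun s : Finset ι => malliavinDeriv Z P
      (multipleIntegral hZ e (f.cut (tuples m n s)))) atTop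
        (𝓝 (malliavinDeriv Z P (multipleIntegral hZ e f))) := by
  obtain ⟨U, hU, h⟩ := exists_malliavinDeriv hZ e hf
  rwa [malliavinDeriv_eq hZ (Lp.memLp _) hU]

/-- `⟨D I(f), D conj I(g)⟩` in terms of multiple integrals of contractions. -/
theorem inner_malliavinDeriv_revConj_left {f : Kernel ι m n} {g : Kernel ι p q} (hf : f.IsSymm)
    (hg : g.IsSymm) : ∀ᵐ ω ∂P,
      inner ℂ (malliavinDeriv Z P (multipleIntegral hZ e g.revConj) ω)
        (malliavinDeriv Z P (multipleIntegral hZ e f) ω) =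
          chaosSum hZ e (fun i _ => i) f g ω := by
  classical
  refine ae_eq_of_tendsto_Lp (Φ := fun x : H × H => inner ℂ x.1 x.2)
    (tendsto_malliavinDeriv_cut hZ e hg.revConj) (tendsto_malliavinDeriv_cut hZ e hf)
    (tendsto_chaosSum hZ e (fun i _ => i) f.tendsto_cut g.tendsto_cut) (by fun_prop) fun s => ?_
  have hfs := f.isSupportedOn_cut s
  have hgs := g.isSupportedOn_cut s
  have hgs' := g.revConj.isSupportedOn_cut s
  rw [malliavinDeriv_of_supported hZ e (hf.cut s) hfs,
    malliavinDeriv_of_supported hZ e (hg.revConj.cut s) hgs']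
  filter_upwards [(memLp_finiteDeriv hZ e s (f.cut (tuples m n s))).coeFn_toLp,
    (memLp_finiteDeriv hZ e s (g.revConj.cut (tuples q p s))).coeFn_toLp,
    inner_finiteDeriv_revConj_left hZ e (hf.cut s) (hg.cut s) hfs hgs] with ω h1 h2 h3
  rw [h1, h2, ← h3, Kernel.revConj_cut]

/-- `⟨D I(g), D conj I(f)⟩` in terms of multiple integrals of contractions. -/
theorem inner_malliavinDeriv_revConj_right {f : Kernel ι m n} {g : Kernel ι p q} (hf : f.IsSymm)
    (hg : g.IsSymm) : ∀ᵐ ω ∂P,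
      inner ℂ (malliavinDeriv Z P (multipleIntegral hZ e f.revConj) ω)
        (malliavinDeriv Z P (multipleIntegral hZ e g) ω) =
          chaosSum hZ e (fun _ j => j) f g ω := by
  classical
  refine ae_eq_of_tendsto_Lp (Φ := fun x : H × H => inner ℂ x.1 x.2)
    (tendsto_malliavinDeriv_cut hZ e hf.revConj) (tendsto_malliavinDeriv_cut hZ e hg)
    (tendsto_chaosSum hZ e (fun _ j => j) f.tendsto_cut g.tendsto_cut) (by fun_prop) fun s => ?_
  have hfs := f.isSupportedOn_cut s
  have hgs := g.isSupportedOn_cut s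
  have hfs' := f.revConj.isSupportedOn_cut s
  rw [malliavinDeriv_of_supported hZ e (hg.cut s) hgs,
    malliavinDeriv_of_supported hZ e (hf.revConj.cut s) hfs']
  filter_upwards [(memLp_finiteDeriv hZ e s (g.cut (tuples p q s))).coeFn_toLp,
    (memLp_finiteDeriv hZ e s (f.revConj.cut (tuples n m s))).coeFn_toLp,
    inner_finiteDeriv_revConj_right hZ e (hf.cut s) (hg.cut s) hfs hgs] with ω h1 h2 h3
  rw [h1, h2, ← h3, Kernel.revConj_cut]

end Derivative

/-! ### Integration by parts for the characteristic function -/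

section ExpPoly

variable {κ : Type*} [Fintype κ] [DecidableEq κ]

open MvPolynomial

theorem fderiv_exp_evalPoly (U : Poly κ) (z : κ → ℂ) :
    fderiv ℝ (fun z => Complex.exp (evalPoly z U)) z =
      Complex.exp (evalPoly z U) • fderiv ℝ (fun z => evalPoly z U) z :=
  ((hasTemperateGrowth_evalPoly U).isTame.differentiable z).hasFDerivAt.cexp.fderiv

theorem isTame_exp_evalPoly {U : Poly κ} (hU : ∀ z : κ → ℂ, (evalPoly z U).re = 0) :
    IsTame fun z : κ → ℂ => Complex.exp (evalPoly z U) := by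
  have h := (hasTemperateGrowth_evalPoly U).isTame
  have hn (z : κ → ℂ) : ‖Complex.exp (evalPoly z U)‖ = 1 := by
    rw [Complex.norm_exp, hU, Real.exp_zero]
  refine ⟨?_, ⟨0, 1, fun z => by simp [hn]⟩, ?_⟩
  · exact Complex.contDiff_exp.comp h.contDiff
  · obtain ⟨k, C, hC⟩ := h.growth_fderiv
    refine ⟨k, C, fun z => ?_⟩
    rw [fderiv_exp_evalPoly, norm_smul, hn, one_mul]
    exact hC z

theorem dz_exp_evalPoly (U : Poly κ) (x : κ) (z : κ → ℂ) :
    dz (fun z => Complex.exp (evalPoly z U)) x z =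
      Complex.exp (evalPoly z U) * evalPoly z (pderiv (Sum.inl x) U) := by
  rw [dz_of_fderiv (fderiv_exp_evalPoly U z), ← dz_evalPoly, dz]
  simp only [smul_apply, smul_eq_mul]
  ring

theorem dzbar_exp_evalPoly (U : Poly κ) (x : κ) (z : κ → ℂ) :
    dzbar (fun z => Complex.exp (evalPoly z U)) x z =
      Complex.exp (evalPoly z U) * evalPoly z (pderiv (Sum.inr x) U) := by
  rw [dzbar_of_fderiv (fderiv_exp_evalPoly U z), ← dzbar_evalPoly, dzbar]
  simp only [smul_apply, smul_eq_mul]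
  ring

variable {H Ω : Type*} [NormedAddCommGroup H] [InnerProductSpace ℂ H] [MeasurableSpace Ω]
  {Z : H → Ω → ℂ} {P : Measure Ω}

theorem IsComplexIsonormal.integrable_evalPoly_mul_exp (hZ : IsComplexIsonormal Z P) (φ : κ → H)
    {U : Poly κ} (hU : ∀ z : κ → ℂ, (evalPoly z U).re = 0) (p : Poly κ) :
    Integrable (fun ω => evalPoly (fun x => Z (φ x) ω) p *
      Complex.exp (evalPoly (fun x => Z (φ x) ω) U)) P := by
  have h := (hasTemperateGrowth_evalPoly p).isTame.mul (isTame_exp_evalPoly hU)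
  exact memLp_one_iff_integrable.1
    (hZ.memLp_comp φ h.contDiff.continuous h.growth 1 (by norm_num))

theorem IsComplexIsonormal.integral_X_mul_exp (hZ : IsComplexIsonormal Z P) {φ : κ → H}
    (hφ : Orthonormal ℂ φ) {U : Poly κ} (hU : ∀ z : κ → ℂ, (evalPoly z U).re = 0) (y : κ ⊕ κ)
    (p : Poly κ) :
    ∫ ω, evalPoly (fun x => Z (φ x) ω) (X y * p) *
        Complex.exp (evalPoly (fun x => Z (φ x) ω) U) ∂P =
      ∫ ω, evalPoly (fun x => Z (φ x) ω) (pderiv y.swap p + p * pderiv y.swap U) *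
        Complex.exp (evalPoly (fun x => Z (φ x) ω) U) ∂P := by
  have hp := (hasTemperateGrowth_evalPoly p).isTame
  have hE := isTame_exp_evalPoly hU
  rw [orthonormal_iff_ite] at hφ
  rcases y with y | y
  · simp only [map_mul, map_add, evalPoly_X_inl, Sum.swap_inl, mul_assoc]
    rw [hZ.integral_mul (φ y) φ (hp.mul hE)]
    refine integral_congr_ae (ae_of_all _ fun ω => ?_)
    simp only [dzbar_mul hp hE, dzbar_evalPoly, dzbar_exp_evalPoly, hφ, mul_ite, mul_one, mul_zero,
      Finset.sum_ite_eq', Finset.mem_univ, if_true]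
    ring
  · simp only [map_mul, map_add, evalPoly_X_inr, Sum.swap_inr, mul_assoc]
    rw [hZ.integral_conj_mul (φ y) φ (hp.mul hE)]
    refine integral_congr_ae (ae_of_all _ fun ω => ?_)
    simp only [dz_mul hp hE, dz_evalPoly, dz_exp_evalPoly, hφ, mul_ite, mul_one, mul_zero,
      Finset.sum_ite_eq, Finset.mem_univ, if_true]
    ring

/-- Integration by parts for a Wick power of order `(m, n)` against `exp U`, where `U` is a purely
imaginary polynomial.  The factor `m + n` is the eigenvalue of the number operator. -/
theorem IsComplexIsonormal.integral_wick_mul_exp (hZ : IsComplexIsonormal Z P) {φ : κ → H}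
    (hφ : Orthonormal ℂ φ) {U : Poly κ} (hU : ∀ z : κ → ℂ, (evalPoly z U).re = 0) {m n : ℕ}
    (ψ : (Fin m → κ) × (Fin n → κ) → ℂ) :
    ((m + n : ℕ) : ℂ) * ∫ ω, evalPoly (fun x => Z (φ x) ω) (wick (tuplePoly ψ)) *
        Complex.exp (evalPoly (fun x => Z (φ x) ω) U) ∂P =
      ∫ ω, evalPoly (fun x => Z (φ x) ω)
        (∑ y : κ ⊕ κ, wick (pderiv y (tuplePoly ψ)) * pderiv y.swap U) *
        Complex.exp (evalPoly (fun x => Z (φ x) ω) U) ∂P := by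
  have hi := hZ.integrable_evalPoly_mul_exp φ hU
  rw [← integral_const_mul]
  have h1 (ω : Ω) : ((m + n : ℕ) : ℂ) * (evalPoly (fun x => Z (φ x) ω) (wick (tuplePoly ψ)) *
      Complex.exp (evalPoly (fun x => Z (φ x) ω) U)) =
      ∑ y : κ ⊕ κ, (evalPoly (fun x => Z (φ x) ω) (X y * wick (pderiv y (tuplePoly ψ))) *
        Complex.exp (evalPoly (fun x => Z (φ x) ω) U) -
        evalPoly (fun x => Z (φ x) ω) (pderiv y.swap (wick (pderiv y (tuplePoly ψ)))) *
        Complex.exp (evalPoly (fun x => Z (φ x) ω) U)) := by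
    have h2 := congrArg (evalPoly fun x => Z (φ x) ω) (sum_X_mul_wick_sub ψ)
    rw [map_smul, smul_eq_mul, map_sum] at h2
    rw [← mul_assoc, ← h2, Finset.sum_mul]
    exact Finset.sum_congr rfl fun y _ => by rw [map_sub, sub_mul]
  simp only [h1]
  rw [integral_finsetSum]
  swap
  · exact fun y _ => (hi _).sub (hi _)
  simp only [map_sum, Finset.sum_mul]
  rw [integral_finsetSum _ fun y _ => hi _]
  refine Finset.sum_congr rfl fun y _ => ?_
  rw [integral_sub (hi _) (hi _), hZ.integral_X_mul_exp hφ hU, ← integral_sub (hi _) (hi _)]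
  refine integral_congr_ae (ae_of_all _ fun ω => ?_)
  simp only [map_add]
  ring

theorem sum_wick_pderiv_mul_swap (m n p q : ℕ) (ψ γ : Multiset κ → Multiset κ → ℂ) :
    ∑ y : κ ⊕ κ, wick (pderiv y (symPoly m n ψ)) * wick (pderiv y.swap (symPoly p q γ)) =
      ∑ i ∈ Finset.range (m + 1), ∑ j ∈ Finset.range (n + 1),
        (((i : ℂ) + j) * productCoeff m n p q i j) •
          wick (tuplePoly (symContraction m n p q i j ψ γ)) := by
  rw [Fintype.sum_sum_type]
  simp only [Sum.swap_inl, Sum.swap_inr]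
  rw [sum_wick_pderiv_inl_mul, sum_wick_pderiv_inr_mul, ← Finset.sum_add_distrib]
  refine Finset.sum_congr rfl fun i _ => ?_
  rw [← Finset.sum_add_distrib]
  exact Finset.sum_congr rfl fun j _ => by rw [add_mul, add_smul]

end ExpPoly

section Phase

/-- The value `exp(i Re(conj ζ x))` at `x` of the character of `ℂ` with frequency `ζ`. -/
def phase (ζ x : ℂ) : ℂ := Complex.exp (((conj ζ * x).re : ℝ) * Complex.I)

theorem norm_phase (ζ x : ℂ) : ‖phase ζ x‖ = 1 := Complex.norm_exp_ofReal_mul_I _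

theorem norm_phase_sub_le (ζ x y : ℂ) : ‖phase ζ x - phase ζ y‖ ≤ ‖ζ‖ * ‖x - y‖ := by
  have h : phase ζ x - phase ζ y = phase ζ y *
      (Complex.exp (Complex.I * ((conj ζ * (x - y)).re : ℝ)) - 1) := by
    rw [mul_sub, mul_one, phase, phase, ← Complex.exp_add, mul_sub, Complex.sub_re]
    congr 2
    push_cast
    ring
  rw [h, norm_mul, norm_phase, one_mul]
  refine (Real.norm_exp_I_mul_ofReal_sub_one_le).trans ?_
  refine (Complex.abs_re_le_norm _).trans ?_
  rw [norm_mul, RCLike.norm_conj]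

theorem continuous_phase (ζ : ℂ) : Continuous (phase ζ) := by
  unfold phase
  fun_prop

variable {Ω : Type*} [MeasurableSpace Ω] {P : Measure Ω}

theorem integral_norm_mul_norm_le (u v : Lp ℂ 2 P) :
    ∫ ω, ‖u ω‖ * ‖v ω‖ ∂P ≤ ‖u‖ * ‖v‖ := by
  have h := integral_mul_norm_le_Lp_mul_Lq (μ := P) (f := (u : Ω → ℂ)) (g := (v : Ω → ℂ))
    Real.HolderConjugate.two_two (by simpa using Lp.memLp u) (by simpa using Lp.memLp v)
  refine h.trans (le_of_eq ?_)
  simp only [Real.rpow_two]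
  rw [integral_norm_sq_eq, integral_norm_sq_eq, ← Real.sqrt_eq_rpow, ← Real.sqrt_eq_rpow,
    Real.sqrt_sq (norm_nonneg _), Real.sqrt_sq (norm_nonneg _)]

theorem aestronglyMeasurable_phase (ζ : ℂ) (F : Lp ℂ 2 P) :
    AEStronglyMeasurable (fun ω => phase ζ (F ω)) P :=
  (continuous_phase ζ).comp_aestronglyMeasurable (Lp.aestronglyMeasurable F)

variable [IsProbabilityMeasure P]

theorem integral_norm_le_norm (u : Lp ℂ 2 P) : ∫ ω, ‖u ω‖ ∂P ≤ ‖u‖ := by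
  have h5 : eLpNorm u 1 P ≤ eLpNorm u 2 P :=
    eLpNorm_le_eLpNorm_of_exponent_le (by norm_num) (Lp.aestronglyMeasurable u)
  rw [integral_norm_eq_lintegral_enorm (Lp.aestronglyMeasurable u), ← eLpNorm_one_eq_lintegral_enorm,
    Lp.norm_def]
  exact ENNReal.toReal_mono (Lp.eLpNorm_ne_top u) h5

theorem integrable_mul_phase (ζ : ℂ) (u F : Lp ℂ 2 P) :
    Integrable (fun ω => u ω * phase ζ (F ω)) P :=
  ((Lp.memLp u).integrable (by norm_num)).mul_bdd (c := 1) (aestronglyMeasurable_phase ζ F)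
    (ae_of_all _ fun ω => (norm_phase _ _).le)

theorem tendsto_integral_mul_phase (ζ : ℂ) {α : Type*} {l : Filter α} {u F : α → Lp ℂ 2 P}
    {u₀ F₀ : Lp ℂ 2 P} (hu : Tendsto u l (𝓝 u₀)) (hF : Tendsto F l (𝓝 F₀)) :
    Tendsto (fun a => ∫ ω, u a ω * phase ζ (F a ω) ∂P) l
      (𝓝 (∫ ω, u₀ ω * phase ζ (F₀ ω) ∂P)) := by
  rw [tendsto_iff_norm_sub_tendsto_zero] at hu hF ⊢
  have h0 : Tendsto (fun a => ‖u a - u₀‖ + ‖ζ‖ * (‖u₀‖ * ‖F a - F₀‖)) l (𝓝 0) := by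
    simpa using hu.add ((hF.const_mul ‖u₀‖).const_mul ‖ζ‖)
  refine squeeze_zero (fun _ => norm_nonneg _) (fun a => ?_) h0
  rw [← integral_sub (integrable_mul_phase ζ _ _) (integrable_mul_phase ζ _ _)]
  have i1 : Integrable (fun ω => ‖(u a - u₀) ω‖) P :=
    ((Lp.memLp (u a - u₀)).integrable (by norm_num)).norm
  have i2 : Integrable (fun ω => ‖ζ‖ * (‖u₀ ω‖ * ‖(F a - F₀) ω‖)) P :=
    ((Lp.memLp u₀).norm.integrable_mul (Lp.memLp (F a - F₀)).norm).const_mul _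
  refine (norm_integral_le_integral_norm _).trans
    ((integral_mono_ae (g := fun ω => ‖(u a - u₀) ω‖ + ‖ζ‖ * (‖u₀ ω‖ * ‖(F a - F₀) ω‖))
      ((integrable_mul_phase ζ _ _).sub (integrable_mul_phase ζ _ _)).norm (i1.add i2) ?_).trans ?_)
  · filter_upwards [Lp.coeFn_sub (u a) u₀, Lp.coeFn_sub (F a) F₀] with ω h1 h2
    simp only [h1, h2, Pi.sub_apply]
    have h3 : u a ω * phase ζ (F a ω) - u₀ ω * phase ζ (F₀ ω) =
        (u a ω - u₀ ω) * phase ζ (F a ω) + u₀ ω * (phase ζ (F a ω) - phase ζ (F₀ ω)) := by ring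
    rw [h3]
    refine (norm_add_le _ _).trans ?_
    rw [norm_mul, norm_mul, norm_phase, mul_one]
    have h4 := mul_le_mul_of_nonneg_left (norm_phase_sub_le ζ (F a ω) (F₀ ω)) (norm_nonneg (u₀ ω))
    linarith
  · rw [integral_add i1 i2, integral_const_mul]
    exact add_le_add (integral_norm_le_norm _)
      (mul_le_mul_of_nonneg_left (integral_norm_mul_norm_le _ _) (norm_nonneg _))

end Phase

section IntegrationByParts

variable {H Ω ι : Type*} [NormedAddCommGroup H] [InnerProductSpace ℂ H] [MeasurableSpace Ω]
  {Z : H → Ω → ℂ} {P : Measure Ω} (hZ : IsComplexIsonormal Z P)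
  (e : HilbertBasis ι ℂ H) {m n : ℕ}

theorem integral_mul_phase_of_supported [DecidableEq ι] {s : Finset ι} {f : Kernel ι m n}
    (hf : f.IsSymm) (hfs : f.IsSupportedOn s) (ζ : ℂ) :
    ((m + n : ℕ) : ℂ) * ∫ ω, multipleIntegral hZ e f ω * phase ζ (multipleIntegral hZ e f ω) ∂P =
      Complex.I / 2 * ∫ ω, (conj ζ • chaosSum hZ e (fun i j => i + j) f f +
        ζ • chaosSum hZ e (fun i j => i + j) f f.revConj : Lp ℂ 2 P) ω *
          phase ζ (multipleIntegral hZ e f ω) ∂P := by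
  set w : Poly s := kernelPoly s f with hw
  set w' : Poly s := kernelPoly s f.revConj with hw'
  -- The phase is `exp U` with the purely imaginary polynomial `U = i Re(conj ζ F)`.
  set U : Poly s := (Complex.I / 2) • (conj ζ • wick w + ζ • wick w') with hU
  have hconj (z : s → ℂ) : conj (evalPoly z (wick w)) = evalPoly z (wick w') :=
    conj_evalPoly_kernelPoly hf z
  have hUe (z : s → ℂ) : evalPoly z U = ((conj ζ * evalPoly z (wick w)).re : ℝ) * Complex.I := by
    rw [Complex.re_eq_add_conj, hU, map_smul, map_add, map_smul, map_smul, ← hconj, map_mul,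
      Complex.conj_conj]
    simp only [smul_eq_mul]
    ring
  have hU0 (z : s → ℂ) : (evalPoly z U).re = 0 := by
    rw [hUe, Complex.re_ofReal_mul, Complex.I_re, mul_zero]
  have key := hZ.integral_wick_mul_exp (orthonormal_val e s) hU0
    (fun x : (Fin m → s) × (Fin n → s) => f (Subtype.val ∘ x.1, Subtype.val ∘ x.2))
  rw [hf.tuplePoly_eq, ← hw] at key
  have hsum : ∑ y : s ⊕ s, wick (MvPolynomial.pderiv y w) * MvPolynomial.pderiv y.swap U =
      (Complex.I / 2) • (conj ζ • (∑ i ∈ Finset.range (m + 1), ∑ j ∈ Finset.range (n + 1),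
        (((i : ℂ) + j) * productCoeff m n m n i j) • wick (tuplePoly (symContraction m n m n i j
          (pullback Subtype.val f.symCoeff) (pullback (Subtype.val : s → ι) f.symCoeff)))) +
      ζ • (∑ i ∈ Finset.range (m + 1), ∑ j ∈ Finset.range (n + 1),
        (((i : ℂ) + j) * productCoeff m n n m i j) • wick (tuplePoly (symContraction m n n m i j
          (pullback Subtype.val f.symCoeff)
            (pullback (Subtype.val : s → ι) f.revConj.symCoeff))))) := by
    rw [← sum_wick_pderiv_mul_swap, ← sum_wick_pderiv_mul_swap, Finset.smul_sum, Finset.smul_sum,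
      ← Finset.sum_add_distrib, Finset.smul_sum]
    refine Finset.sum_congr rfl fun y _ => ?_
    rw [hU, Derivation.map_smul, map_add, Derivation.map_smul, Derivation.map_smul, pderiv_wick,
      pderiv_wick, mul_smul_comm, mul_add, mul_smul_comm, mul_smul_comm]
    rfl
  have hF := multipleIntegral_ae_eq hZ e hfs
  refine Eq.trans ?_ (key.trans ?_)
  · congr 1
    refine integral_congr_ae ?_
    filter_upwards [hF] with ω h1
    rw [h1, hf.tuplePoly_eq, hUe, phase]
  · rw [← integral_const_mul]
    refine integral_congr_ae ?_
    filter_upwards [hF, chaosSum_ae_eq hZ e (fun i j => i + j) hf hf hfs hfs,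
      chaosSum_ae_eq hZ e (fun i j => i + j) hf hf.revConj hfs hfs.revConj,
      Lp.coeFn_add (conj ζ • chaosSum hZ e (fun i j => i + j) f f)
        (ζ • chaosSum hZ e (fun i j => i + j) f f.revConj),
      Lp.coeFn_smul (conj ζ) (chaosSum hZ e (fun i j => i + j) f f),
      Lp.coeFn_smul ζ (chaosSum hZ e (fun i j => i + j) f f.revConj)] with ω h1 h2 h3 h4 h5 h6
    rw [h4, Pi.add_apply, h5, h6, Pi.smul_apply, Pi.smul_apply, h2, h3, h1, hf.tuplePoly_eq, hUe,
      phase, hsum, map_smul, map_add, map_smul, map_smul, smul_eq_mul]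
    ring

/-- The integration by parts formula: with `F = I(f)` and `l = m + n`, the variable
`l F exp(i Re(conj ζ F))` has the same mean as
`(i/2) (2 conj ζ ⟨DF, D conj F⟩ + ζ (‖DF‖² + ‖D conj F‖²)) exp(i Re(conj ζ F))`. -/
theorem integral_mul_phase {f : Kernel ι m n} (hf : f.IsSymm) (ζ : ℂ) :
    ((m + n : ℕ) : ℂ) * ∫ ω, multipleIntegral hZ e f ω * phase ζ (multipleIntegral hZ e f ω) ∂P =
      Complex.I / 2 * ∫ ω, (conj ζ • chaosSum hZ e (fun i j => i + j) f f +
        ζ • chaosSum hZ e (fun i j => i + j) f f.revConj : Lp ℂ 2 P) ω *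
          phase ζ (multipleIntegral hZ e f ω) ∂P := by
  classical
  have := hZ.gaussian.isProbabilityMeasure
  have h1 := tendsto_multipleIntegral hZ e f.tendsto_cut
  have h2 := tendsto_chaosSum hZ e (fun i j => i + j) f.tendsto_cut f.tendsto_cut
  have h3 := tendsto_chaosSum hZ e (fun i j => i + j) f.tendsto_cut
    (Kernel.tendsto_revConj f.tendsto_cut)
  exact tendsto_nhds_unique
    (((tendsto_integral_mul_phase ζ h1 h1).const_mul _).congr fun s =>
      integral_mul_phase_of_supported hZ e (hf.cut s) (f.isSupportedOn_cut s) ζ)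
    ((tendsto_integral_mul_phase ζ ((h2.const_smul (conj ζ)).add (h3.const_smul ζ)) h1).const_mul _)

end IntegrationByParts

/-! ### The fourth moment dominates the contractions -/

section FourthMoment

theorem add_le_sum_range {T : ℕ → ℕ → ℝ} (hT : ∀ a b, 0 ≤ T a b) {M N : ℕ} {s : Finset (ℕ × ℕ)}
    (hs : ∀ x ∈ s, x.1 < M ∧ x.2 < N) : ∑ x ∈ s, T x.1 x.2 ≤
      ∑ a ∈ Finset.range M, ∑ b ∈ Finset.range N, T a b := by
  rw [← Finset.sum_product' (f := T)]
  refine Finset.sum_le_sum_of_subset_of_nonneg (fun x hx => ?_) fun x _ _ => hT _ _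
  rw [Finset.mem_product, Finset.mem_range, Finset.mem_range]
  exact hs x hx

variable {H Ω ι : Type*} [NormedAddCommGroup H] [InnerProductSpace ℂ H] [MeasurableSpace Ω]
  {Z : H → Ω → ℂ} {P : Measure Ω} (hZ : IsComplexIsonormal Z P)
  (e : HilbertBasis ι ℂ H) {m n p q : ℕ}

/-- The contraction of order `(0, 0)` is the tensor product. -/
theorem norm_contr₀_zero (f : Kernel ι m n) (g : Kernel ι p q) :
    ‖contr₀ f g 0 0‖ = ‖f‖ * ‖g‖ := by
  refine (sq_eq_sq₀ (norm_nonneg _) (by positivity)).1 ?_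
  rw [contr₀_eq f g (Nat.zero_le m) (Nat.zero_le q) (Nat.zero_le n) (Nat.zero_le p),
    Kernel.norm_sq, mul_pow, Kernel.norm_sq, Kernel.norm_sq]
  have hg0 {r : ℕ} (t : Fin r → ι) (u : Fin 0 → ι) : glue (Nat.zero_le r) t u = t := by
    funext x
    have : x = Fin.cast (Nat.sub_add_cancel (Nat.zero_le r)) (Fin.castAdd 0 x) := rfl
    rw [this]
    simp only [glue, Fin.cast_eq_self]
    exact Fin.append_left t u x
  have h1 (x : (Fin (m + p) → ι) × (Fin (n + q) → ι)) :
      contraction f g 0 0 (Nat.zero_le m) (Nat.zero_le q) (Nat.zero_le n) (Nat.zero_le p) x =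
        f (fun a => x.1 (Fin.castAdd p a), fun a => x.2 (Fin.castAdd q a)) *
          g (fun a => x.1 (Fin.natAdd m a), fun a => x.2 (Fin.natAdd n a)) := by
    rw [contraction_apply, tsum_eq_single (Fin.elim0, Fin.elim0)
      fun y hy => absurd (Subsingleton.elim _ _) hy]
    simp only [hg0]
    rfl
  have h2 : ∑' x : (Fin (m + p) → ι) × (Fin (n + q) → ι),
      ‖contraction f g 0 0 (Nat.zero_le m) (Nat.zero_le q) (Nat.zero_le n) (Nat.zero_le p) x‖ ^ 2 =
      ∑' y : ((Fin m → ι) × (Fin n → ι)) × ((Fin p → ι) × (Fin q → ι)),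
        ‖f y.1‖ ^ 2 * ‖g y.2‖ ^ 2 := by
    let E : ((Fin m → ι) × (Fin n → ι)) × ((Fin p → ι) × (Fin q → ι)) ≃
        (Fin (m + p) → ι) × (Fin (n + q) → ι) :=
      (Equiv.prodProdProdComm _ _ _ _).trans
        ((Fin.appendEquiv m p).prodCongr (Fin.appendEquiv n q))
    rw [← E.tsum_eq]
    refine tsum_congr fun y => ?_
    rw [h1, norm_mul, mul_pow]
    have e1 : (E y).1 = Fin.append y.1.1 y.2.1 := rfl
    have e2 : (E y).2 = Fin.append y.1.2 y.2.2 := rfl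
    simp only [e1, e2, Fin.append_left, Fin.append_right]
  refine h2.trans ?_
  exact (tsum_mul_tsum_of_summable_norm (f := fun y => ‖f y‖ ^ 2) (g := fun y => ‖g y‖ ^ 2)
    f.summable_sq.norm g.summable_sq.norm).symm

theorem integral_norm_sq_multipleIntegral {f : Kernel ι m n} (hf : f.IsSymm) :
    ∫ ω, ‖multipleIntegral hZ e f ω‖ ^ 2 ∂P = (m.factorial * n.factorial : ℝ) * ‖f‖ ^ 2 := by
  rw [integral_norm_sq_eq, norm_sq_multipleIntegral, hf.symmetrize_eq]

theorem integral_sq_eq {f : Kernel ι m n} (hf : f.IsSymm) :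
    ∫ ω, multipleIntegral hZ e f ω ^ 2 ∂P = ∫ ω, chaosSum hZ e 1 f f ω ∂P := by
  refine integral_congr_ae ?_
  filter_upwards [multipleIntegral_mul hZ e hf hf] with ω h
  rw [← h, pow_two]

theorem normSq_ae_eq {f : Kernel ι m n} (hf : f.IsSymm) :
    ∀ᵐ ω ∂P, ((‖multipleIntegral hZ e f ω‖ ^ 2 : ℝ) : ℂ) = chaosSum hZ e 1 f f.revConj ω := by
  filter_upwards [multipleIntegral_mul hZ e hf hf.revConj, conj_multipleIntegral hZ e f]
    with ω h1 h2
  rw [← h1, ← h2, Complex.mul_conj, Complex.normSq_eq_norm_sq]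

theorem integral_chaosSum_revConj {f : Kernel ι m n} (hf : f.IsSymm) :
    ∫ ω, chaosSum hZ e 1 f f.revConj ω ∂P =
      ((∫ ω, ‖multipleIntegral hZ e f ω‖ ^ 2 ∂P : ℝ) : ℂ) := by
  rw [← integral_complex_ofReal]
  refine integral_congr_ae ?_
  filter_upwards [normSq_ae_eq hZ e hf] with ω h
  rw [h]

theorem integral_norm_pow_four_eq {f : Kernel ι m n} (hf : f.IsSymm) :
    ∫ ω, ‖multipleIntegral hZ e f ω‖ ^ 4 ∂P = ‖chaosSum hZ e 1 f f‖ ^ 2 := by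
  rw [← integral_norm_sq_eq]
  refine integral_congr_ae ?_
  filter_upwards [multipleIntegral_mul hZ e hf hf] with ω h
  rw [← h, norm_mul]
  ring

theorem integral_norm_pow_four_eq_revConj {f : Kernel ι m n} (hf : f.IsSymm) :
    ∫ ω, ‖multipleIntegral hZ e f ω‖ ^ 4 ∂P = ‖chaosSum hZ e 1 f f.revConj‖ ^ 2 := by
  rw [← integral_norm_sq_eq]
  refine integral_congr_ae ?_
  filter_upwards [normSq_ae_eq hZ e hf] with ω h
  rw [← h, Complex.norm_real, Real.norm_eq_abs, sq_abs]
  ring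

/-- The second moment without conjugation vanishes off the diagonal orders. -/
theorem integral_sq_eq_zero (h : m ≠ n) (f : Kernel ι m n) :
    ∫ ω, multipleIntegral hZ e f ω ^ 2 ∂P = 0 := by
  rw [← inner_multipleIntegral_eq_zero hZ e f f.revConj (fun h' => h h'.1), L2.inner_def]
  refine integral_congr_ae ?_
  filter_upwards [conj_multipleIntegral hZ e f] with ω h1
  rw [RCLike.inner_apply, ← h1, Complex.conj_conj, pow_two]

/-- The mean of a product is given by the full contraction. -/
theorem norm_integral_chaosSum (f : Kernel ι m n) (g : Kernel ι n m) :
    ‖∫ ω, chaosSum hZ e 1 f g ω ∂P‖ = (m.factorial * n.factorial : ℝ) * ‖contr₀ f g m n‖ := by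
  have hc : productCoeff m n n m m n = (m.factorial * n.factorial : ℂ) := by
    have h1 : (m.factorial : ℂ) ≠ 0 := by exact_mod_cast m.factorial_ne_zero
    have h2 : (n.factorial : ℂ) ≠ 0 := by exact_mod_cast n.factorial_ne_zero
    simp only [productCoeff, Nat.descFactorial_self]
    field_simp
  rw [integral_chaosSum, hc, Pi.one_apply, Pi.one_apply, one_mul, norm_mul,
    (integral_multipleIntegral_zero hZ e (by omega) (by omega) (contr₀ f g m n)).1]
  simp

/-- The fourth moment controls the contractions of `f` with its reversed conjugate. -/
theorem sq_norm_contr₀_revConj_le {f : Kernel ι m n} (hf : f.IsSymm) {a b : ℕ} (ha : a ≤ m)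
    (hb : b ≤ n) (h0 : 0 < a + b) (hl : a + b < m + n) :
    ((m.factorial * n.factorial : ℝ) * ‖contr₀ f f.revConj a b‖) ^ 2 +
        2 * (∫ ω, ‖multipleIntegral hZ e f ω‖ ^ 2 ∂P) ^ 2 +
        ‖∫ ω, multipleIntegral hZ e f ω ^ 2 ∂P‖ ^ 2 ≤
      ∫ ω, ‖multipleIntegral hZ e f ω‖ ^ 4 ∂P := by
  have := hZ.gaussian.isProbabilityMeasure
  have h1 := norm_sq_integral_add_le hZ e (f := f) (g := f) (by omega)
  have h2 := sum_norm_sq_contr₀_le hZ e hf hf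
  rw [← integral_sq_eq hZ e hf, ← integral_norm_pow_four_eq hZ e hf] at h1
  have h3 := norm_integral_chaosSum hZ e f f.revConj
  rw [integral_chaosSum_revConj hZ e hf, Complex.norm_real, Real.norm_eq_abs,
    abs_of_nonneg (integral_nonneg fun _ => by positivity)] at h3
  have h4 := norm_contr₀_zero f f.revConj
  rw [Kernel.norm_revConj] at h4
  have h5 := integral_norm_sq_multipleIntegral hZ e hf
  -- the contractions of orders `(0, 0)` and `(m, n)` both contribute the squared second moment
  have h6 := add_le_sum_range (T := fun a b => ‖contr₀ f f.revConj a b‖ ^ 2)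
    (fun _ _ => by positivity) (M := min m m + 1) (N := min n n + 1)
    (s := {(0, 0), (m, n), (a, b)}) (by
      simp only [Finset.mem_insert, Finset.mem_singleton, forall_eq_or_imp, forall_eq]
      omega)
  have d1 : ((0, 0) : ℕ × ℕ) ∉ ({(m, n), (a, b)} : Finset (ℕ × ℕ)) := by
    simp only [Finset.mem_insert, Finset.mem_singleton, Prod.mk.injEq]
    omega
  have d2 : ((m, n) : ℕ × ℕ) ∉ ({(a, b)} : Finset (ℕ × ℕ)) := by
    simp only [Finset.mem_singleton, Prod.mk.injEq]
    omega
  rw [Finset.sum_insert d1, Finset.sum_insert d2, Finset.sum_singleton, h4] at h6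
  set c : ℝ := (m.factorial * n.factorial : ℝ) with hc
  have h7 : (m.factorial : ℝ) * m.factorial * (n.factorial * n.factorial) = c ^ 2 := by
    rw [hc]
    ring
  rw [h7] at h2
  have h8 := mul_le_mul_of_nonneg_left h6 (sq_nonneg c)
  rw [mul_pow]
  have h9 : (∫ ω, ‖multipleIntegral hZ e f ω‖ ^ 2 ∂P) ^ 2 = c ^ 2 * (‖f‖ * ‖f‖) ^ 2 := by
    rw [h5]
    ring
  have h10 : (∫ ω, ‖multipleIntegral hZ e f ω‖ ^ 2 ∂P) ^ 2 =
      c ^ 2 * ‖contr₀ f f.revConj m n‖ ^ 2 := by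
    rw [h3]
    ring
  linarith

/-- The fourth moment controls the contractions of `f` with itself. -/
theorem sq_norm_contr₀_le {f : Kernel ι m n} (hf : f.IsSymm) {a b : ℕ} (ham : a ≤ m) (han : a ≤ n)
    (hbn : b ≤ n) (hbm : b ≤ m) (h0 : 0 < a + b) (hl : a + b < m + n) :
    ((m.factorial * n.factorial : ℝ) * ‖contr₀ f f a b‖) ^ 2 +
        2 * (∫ ω, ‖multipleIntegral hZ e f ω‖ ^ 2 ∂P) ^ 2 +
        ‖∫ ω, multipleIntegral hZ e f ω ^ 2 ∂P‖ ^ 2 ≤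
      ∫ ω, ‖multipleIntegral hZ e f ω‖ ^ 4 ∂P := by
  have := hZ.gaussian.isProbabilityMeasure
  have h1 := norm_sq_integral_add_le hZ e (f := f) (g := f.revConj) (by omega)
  have h2 := sum_norm_sq_contr₀_le hZ e hf hf.revConj
  rw [Kernel.revConj_revConj] at h2
  rw [integral_chaosSum_revConj hZ e hf, ← integral_norm_pow_four_eq_revConj hZ e hf,
    Complex.norm_real, Real.norm_eq_abs, sq_abs] at h1
  have h4 := norm_contr₀_zero f f
  have h5 := integral_norm_sq_multipleIntegral hZ e hf
  set c : ℝ := (m.factorial * n.factorial : ℝ) with hc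
  have h7 : (m.factorial : ℝ) * n.factorial * (n.factorial * m.factorial) = c ^ 2 := by
    rw [hc]
    ring
  rw [h7] at h2
  have h9 : (∫ ω, ‖multipleIntegral hZ e f ω‖ ^ 2 ∂P) ^ 2 = c ^ 2 * (‖f‖ * ‖f‖) ^ 2 := by
    rw [h5]
    ring
  rw [mul_pow]
  by_cases hmn : m = n
  · subst hmn
    have h3 := norm_integral_chaosSum hZ e f f
    rw [← integral_sq_eq hZ e hf] at h3
    -- the contraction of order `(m, n)` contributes the squared modulus of `E[F²]`
    have h6 := add_le_sum_range (T := fun a b => ‖contr₀ f f a b‖ ^ 2)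
      (fun _ _ => by positivity) (M := min m m + 1) (N := min m m + 1)
      (s := {(0, 0), (m, m), (a, b)}) (by
        simp only [Finset.mem_insert, Finset.mem_singleton, forall_eq_or_imp, forall_eq]
        omega)
    have d1 : ((0, 0) : ℕ × ℕ) ∉ ({(m, m), (a, b)} : Finset (ℕ × ℕ)) := by
      simp only [Finset.mem_insert, Finset.mem_singleton, Prod.mk.injEq]
      omega
    have d2 : ((m, m) : ℕ × ℕ) ∉ ({(a, b)} : Finset (ℕ × ℕ)) := by
      simp only [Finset.mem_singleton, Prod.mk.injEq]
      omega
    rw [Finset.sum_insert d1, Finset.sum_insert d2, Finset.sum_singleton, h4] at h6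
    have h8 := mul_le_mul_of_nonneg_left h6 (sq_nonneg c)
    have h10 : ‖∫ ω, multipleIntegral hZ e f ω ^ 2 ∂P‖ ^ 2 = c ^ 2 * ‖contr₀ f f m m‖ ^ 2 := by
      rw [h3]
      ring
    linarith
  · have h6 := add_le_sum_range (T := fun a b => ‖contr₀ f f a b‖ ^ 2)
      (fun _ _ => by positivity) (M := min m n + 1) (N := min n m + 1)
      (s := {(0, 0), (a, b)}) (by
        simp only [Finset.mem_insert, Finset.mem_singleton, forall_eq_or_imp, forall_eq]
        omega)
    have d1 : ((0, 0) : ℕ × ℕ) ∉ ({(a, b)} : Finset (ℕ × ℕ)) := by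
      simp only [Finset.mem_singleton, Prod.mk.injEq]
      omega
    rw [Finset.sum_insert d1, Finset.sum_singleton, h4] at h6
    have h8 := mul_le_mul_of_nonneg_left h6 (sq_nonneg c)
    rw [integral_sq_eq_zero hZ e hmn f, norm_zero]
    linarith

end FourthMoment

/-! ### Variances of sums of multiple integrals -/

section Center

variable {Ω : Type*} [MeasurableSpace Ω] {P : Measure Ω} [IsProbabilityMeasure P]

theorem integrable_Lp_two {E : Type*} [NormedAddCommGroup E] (u : Lp E 2 P) : Integrable u P :=
  (Lp.memLp u).integrable (by norm_num)

/-- The projection `u ↦ u - E[u]` of `L²`. -/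
def center (P : Measure Ω) [IsProbabilityMeasure P] : Lp ℂ 2 P →ₗ[ℂ] Lp ℂ 2 P where
  toFun u := u - Lp.const 2 P (∫ ω, u ω ∂P)
  map_add' u v := by
    rw [integral_congr_ae (Lp.coeFn_add u v)]
    simp only [Pi.add_apply]
    rw [integral_add (integrable_Lp_two u) (integrable_Lp_two v), map_add]
    abel
  map_smul' a u := by
    rw [integral_congr_ae (Lp.coeFn_smul a u)]
    simp only [Pi.smul_apply, RingHom.id_apply]
    rw [integral_smul, smul_sub]
    rfl

theorem center_apply (u : Lp ℂ 2 P) : center P u = u - Lp.const 2 P (∫ ω, u ω ∂P) := rfl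

theorem norm_const_Lp (a : ℂ) : ‖Lp.const 2 P a‖ = ‖a‖ := by
  refine (Lp.norm_const' (μ := P) (c := a) (p := 2) (by simp) (by simp)).trans ?_
  simp

theorem coeFn_const_Lp (a : ℂ) : Lp.const 2 P a =ᵐ[P] fun _ => a := Lp.coeFn_const 2 P a

theorem coeFn_center (u : Lp ℂ 2 P) : center P u =ᵐ[P] fun ω => u ω - ∫ ω', u ω' ∂P := by
  filter_upwards [Lp.coeFn_sub u (Lp.const 2 P (∫ ω, u ω ∂P)),
    coeFn_const_Lp (P := P) (∫ ω, u ω ∂P)] with ω h1 h2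
  rw [center_apply, h1, Pi.sub_apply, h2]

theorem center_const (a : ℂ) : center P (Lp.const 2 P a) = 0 := by
  rw [center_apply, integral_congr_ae (coeFn_const_Lp (P := P) a), integral_const, probReal_univ,
    one_smul, sub_self]

theorem norm_center_le (u : Lp ℂ 2 P) : ‖center P u‖ ≤ 2 * ‖u‖ := by
  rw [center_apply]
  refine (norm_sub_le _ _).trans ?_
  rw [norm_const_Lp]
  have := (norm_integral_le_integral_norm (μ := P) (u : Ω → ℂ)).trans (integral_norm_le_norm u)
  linarith

theorem complexVariance_eq {X : Ω → ℂ} {u : Lp ℂ 2 P} (h : X =ᵐ[P] u) :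
    complexVariance X P = ‖center P u‖ₑ ^ 2 := by
  rw [Lp.enorm_def, eLpNorm_congr_ae (coeFn_center u), complexVariance, integral_congr_ae h,
    eLpNorm_eq_lintegral_rpow_enorm_toReal (by norm_num) (by norm_num)]
  simp only [ENNReal.toReal_ofNat, ENNReal.rpow_two, one_div]
  rw [← ENNReal.rpow_natCast, ← ENNReal.rpow_mul]
  norm_num
  refine lintegral_congr_ae ?_
  filter_upwards [h] with ω hω
  rw [hω]

theorem evariance_eq {X : Ω → ℝ} {u : Lp ℂ 2 P} (h : (fun ω => (X ω : ℂ)) =ᵐ[P] u) :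
    evariance X P = ‖center P u‖ₑ ^ 2 := by
  rw [← complexVariance_eq h, evariance, complexVariance, integral_complex_ofReal]
  refine lintegral_congr fun ω => ?_
  rw [← Complex.ofReal_sub, ← ofReal_norm (_ : ℂ), Complex.norm_real, ofReal_norm]

theorem eLpNorm_sub_const_eq {X : Ω → ℂ} {u : Lp ℂ 2 P} (h : X =ᵐ[P] u) (a : ℂ) :
    eLpNorm (fun ω => X ω - a) 2 P = ‖u - Lp.const 2 P a‖ₑ := by
  rw [Lp.enorm_def]
  refine eLpNorm_congr_ae ?_
  filter_upwards [h, Lp.coeFn_sub u (Lp.const 2 P a), coeFn_const_Lp (P := P) a] with ω h1 h2 h3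
  rw [h1, h2, Pi.sub_apply, h3]

theorem eLpNorm_ofReal_sub_const_eq {X : Ω → ℝ} {u : Lp ℂ 2 P}
    (h : (fun ω => (X ω : ℂ)) =ᵐ[P] u) (a : ℝ) :
    eLpNorm (fun ω => X ω - a) 2 P = ‖u - Lp.const 2 P (a : ℂ)‖ₑ := by
  rw [← eLpNorm_sub_const_eq h]
  refine eLpNorm_congr_norm_ae (ae_of_all _ fun ω => ?_)
  rw [← Complex.ofReal_sub, Complex.norm_real]

theorem tendsto_enorm_iff {E α : Type*} [NormedAddCommGroup E] {l : Filter α} {u : α → E} :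
    Tendsto (fun a => ‖u a‖ₑ) l (𝓝 0) ↔ Tendsto u l (𝓝 0) := by
  rw [tendsto_zero_iff_norm_tendsto_zero]
  simp only [← ofReal_norm]
  refine ⟨fun h => ?_, fun h => by simpa using ENNReal.tendsto_ofReal h⟩
  have := (ENNReal.tendsto_toReal ENNReal.zero_ne_top).comp h
  refine this.congr fun a => ?_
  simp

theorem tendsto_enorm_sq_iff {E α : Type*} [NormedAddCommGroup E] {l : Filter α} {u : α → E} :
    Tendsto (fun a => ‖u a‖ₑ ^ 2) l (𝓝 0) ↔ Tendsto u l (𝓝 0) := by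
  rw [← tendsto_enorm_iff]
  refine ⟨fun h => ?_, fun h => by simpa using ENNReal.Tendsto.pow (n := 2) h⟩
  have := (ENNReal.continuous_rpow_const (y := (1 / 2 : ℝ))).tendsto (0 : ℝ≥0∞) |>.comp h
  refine (this.congr fun a => ?_).trans (by simp)
  simp only [Function.comp_apply]
  rw [← ENNReal.rpow_natCast, ← ENNReal.rpow_mul]
  norm_num

theorem tendsto_const_of_tendsto_center {α : Type*} {l : Filter α} {u : α → Lp ℂ 2 P} {a : ℂ}
    (h : Tendsto (fun k => center P (u k)) l (𝓝 0))
    (ha : Tendsto (fun k => ∫ ω, u k ω ∂P) l (𝓝 a)) :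
    Tendsto u l (𝓝 (Lp.const 2 P a)) := by
  rw [tendsto_iff_norm_sub_tendsto_zero] at h ha ⊢
  have h1 := h.add ha
  rw [add_zero] at h1
  refine squeeze_zero (fun _ => norm_nonneg _) (fun k => ?_) h1
  have e1 : u k - Lp.const 2 P a =
      (center P (u k) - 0) + Lp.const 2 P (∫ ω, u k ω ∂P - a) := by
    rw [center_apply, map_sub]
    abel
  rw [e1]
  refine (norm_add_le _ _).trans ?_
  rw [norm_const_Lp]

theorem tendsto_center_of_tendsto_const {α : Type*} {l : Filter α} {u : α → Lp ℂ 2 P} {a : ℂ}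
    (h : Tendsto u l (𝓝 (Lp.const 2 P a))) : Tendsto (fun k => center P (u k)) l (𝓝 0) := by
  rw [tendsto_iff_norm_sub_tendsto_zero] at h ⊢
  have h1 := h.const_mul 2
  rw [mul_zero] at h1
  refine squeeze_zero (fun _ => norm_nonneg _) (fun k => ?_) h1
  rw [sub_zero, ← sub_zero (center P (u k)), ← center_const (P := P) a, ← map_sub]
  exact norm_center_le _

end Center

section Variance

variable {H Ω ι : Type*} [NormedAddCommGroup H] [InnerProductSpace ℂ H] [MeasurableSpace Ω]
  {Z : H → Ω → ℂ} {P : Measure Ω} [IsProbabilityMeasure P] (hZ : IsComplexIsonormal Z P)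
  (e : HilbertBasis ι ℂ H) {m n p q : ℕ}

theorem center_multipleIntegral_zero (hm : m = 0) (hn : n = 0) (f : Kernel ι m n) :
    center P (multipleIntegral hZ e f) = 0 := by
  obtain ⟨-, c, hc⟩ := integral_multipleIntegral_zero hZ e hm hn f
  have : multipleIntegral hZ e f = Lp.const 2 P c :=
    Lp.ext (hc.trans (coeFn_const_Lp c).symm)
  rw [this, center_const]

theorem norm_center_multipleIntegral_le (f : Kernel ι m n) :
    ‖center P (multipleIntegral hZ e f)‖ ≤ integralBound m n * ‖f.symmetrize‖ := by
  by_cases h : m = 0 ∧ n = 0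
  · rw [center_multipleIntegral_zero hZ e h.1 h.2, norm_zero]
    exact mul_nonneg (integralBound_pos m n).le (norm_nonneg _)
  · rw [center_apply, integral_multipleIntegral_of_ne hZ e h, map_zero, sub_zero,
      ← multipleIntegral_symmetrize]
    exact norm_multipleIntegral_le hZ e _

/-- Sums of multiple integrals of contractions are asymptotically constant when the symmetrized
contractions, other than the tensor product and the full contraction, are negligible. -/
theorem tendsto_center_chaosSum {w : ℕ → ℕ → ℂ} (hw : w 0 0 = 0) {α : Type*} {l : Filter α}
    {f : α → Kernel ι m n} {g : α → Kernel ι p q}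
    (h : ∀ i j, i ≤ m → i ≤ q → j ≤ n → j ≤ p → 0 < i + j →
      0 < m - i + (p - j) + (n - j + (q - i)) →
      Tendsto (fun k => ‖(contr₀ (f k) (g k) i j).symmetrize‖) l (𝓝 0)) :
    Tendsto (fun k => center P (chaosSum hZ e w (f k) (g k))) l (𝓝 0) := by
  simp only [chaosSum, map_sum, map_smul]
  have h0 : (0 : Lp ℂ 2 P) = ∑ i ∈ Finset.range (m + 1), ∑ j ∈ Finset.range (n + 1), 0 := by simp
  rw [h0]
  refine tendsto_finsetSum _ fun i _ => tendsto_finsetSum _ fun j _ => ?_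
  by_cases hc : i ≤ m ∧ i ≤ q ∧ j ≤ n ∧ j ≤ p
  swap
  · simp only [productCoeff_eq_zero hc, mul_zero, zero_smul]
    exact tendsto_const_nhds
  by_cases hij : 0 < i + j
  swap
  · have hi : i = 0 := by omega
    have hj : j = 0 := by omega
    subst hi hj
    simp only [hw, zero_mul, zero_smul]
    exact tendsto_const_nhds
  by_cases hd : 0 < m - i + (p - j) + (n - j + (q - i))
  · have h1 := h i j hc.1 hc.2.1 hc.2.2.1 hc.2.2.2 hij hd
    have h2 := h1.const_mul (integralBound (m - i + (p - j)) (n - j + (q - i)))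
    rw [mul_zero] at h2
    have h3 : Tendsto (fun k => center P (multipleIntegral hZ e (contr₀ (f k) (g k) i j))) l
        (𝓝 0) := by
      rw [tendsto_zero_iff_norm_tendsto_zero]
      exact squeeze_zero (fun _ => norm_nonneg _)
        (fun k => norm_center_multipleIntegral_le hZ e _) h2
    simpa using h3.const_smul (w i j * productCoeff m n p q i j)
  · have hz (k : α) : center P (multipleIntegral hZ e (contr₀ (f k) (g k) i j)) = 0 :=
      center_multipleIntegral_zero hZ e (by omega) (by omega) _
    simp only [hz, smul_zero]
    exact tendsto_const_nhds

theorem chaosSum_add (w w' : ℕ → ℕ → ℂ) (f : Kernel ι m n) (g : Kernel ι p q) :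
    chaosSum hZ e (fun i j => w i j + w' i j) f g = chaosSum hZ e w f g + chaosSum hZ e w' f g := by
  unfold chaosSum
  rw [← Finset.sum_add_distrib]
  refine Finset.sum_congr rfl fun i _ => ?_
  rw [← Finset.sum_add_distrib]
  exact Finset.sum_congr rfl fun j _ => by rw [add_mul, add_smul]

theorem integral_chaosSum_eq_mul (w : ℕ → ℕ → ℂ) (f : Kernel ι m n) (g : Kernel ι p q) :
    ∫ ω, chaosSum hZ e w f g ω ∂P = w m n * ∫ ω, chaosSum hZ e 1 f g ω ∂P := by
  rw [integral_chaosSum, integral_chaosSum hZ e 1, Pi.one_apply, Pi.one_apply, one_mul, mul_assoc]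

variable [CompleteSpace H]

/-- `‖DF‖²` is the product formula for `F conj F` with the contraction of order `(i, j)` weighted by
`i`. -/
theorem norm_sq_malliavinDeriv_ae_eq {f : Kernel ι m n} (hf : f.IsSymm) :
    (fun ω => ((‖malliavinDeriv Z P (multipleIntegral hZ e f) ω‖ ^ 2 : ℝ) : ℂ)) =ᵐ[P]
      chaosSum hZ e (fun i _ => i) f f.revConj := by
  filter_upwards [inner_malliavinDeriv_revConj_left hZ e hf hf.revConj] with ω h
  rw [← h, Kernel.revConj_revConj, inner_self_eq_norm_sq_to_K]
  push_cast
  rfl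

theorem norm_sq_malliavinDeriv_revConj_ae_eq {f : Kernel ι m n} (hf : f.IsSymm) :
    (fun ω => ((‖malliavinDeriv Z P (multipleIntegral hZ e f.revConj) ω‖ ^ 2 : ℝ) : ℂ)) =ᵐ[P]
      chaosSum hZ e (fun _ j => j) f f.revConj := by
  filter_upwards [inner_malliavinDeriv_revConj_right hZ e hf hf.revConj] with ω h
  rw [← h, inner_self_eq_norm_sq_to_K]
  push_cast
  rfl

/-- Both sides are `⟨DF, D conj F⟩`; the contractions of order `(i, j)` and `(j, i)` of `f` with
itself have the same multiple integral. -/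
theorem chaosSum_fst_eq_snd {f : Kernel ι m n} (hf : f.IsSymm) :
    chaosSum hZ e (fun i _ => i) f f = chaosSum hZ e (fun _ j => j) f f := by
  refine Lp.ext ?_
  filter_upwards [inner_malliavinDeriv_revConj_left hZ e hf hf,
    inner_malliavinDeriv_revConj_right hZ e hf hf] with ω h1 h2
  rw [← h1, ← h2]

end Variance

/-! ### Convergence of characteristic functions -/

section CharacteristicFunction

variable {Ω : Type*} [MeasurableSpace Ω] {P : Measure Ω} [IsProbabilityMeasure P]

theorem phase_ofReal_mul (ζ x : ℂ) (t : ℝ) :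
    phase (t * ζ) x = Complex.exp ((t : ℂ) * ((conj ζ * x).re * Complex.I)) := by
  have h : (conj ((t : ℂ) * ζ) * x).re = t * (conj ζ * x).re := by
    rw [map_mul, Complex.conj_ofReal, mul_assoc, Complex.re_ofReal_mul]
  rw [phase, h]
  congr 1
  push_cast
  ring

theorem conj_phase (ζ x : ℂ) : conj (phase ζ x) = phase (-ζ) x := by
  rw [phase, phase, ← Complex.exp_conj]
  congr 1
  simp
  ring

theorem phase_zero (x : ℂ) : phase 0 x = 1 := by simp [phase]

theorem hasDerivAt_integral_phase (ζ : ℂ) (F : Lp ℂ 2 P) (t : ℝ) :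
    HasDerivAt (fun t : ℝ => ∫ ω, phase (t * ζ) (F ω) ∂P)
      (∫ ω, ((conj ζ * F ω).re * Complex.I) * phase (t * ζ) (F ω) ∂P) t := by
  have hF := integrable_Lp_two F
  refine (hasDerivAt_integral_of_dominated_loc_of_deriv_le (s := Set.univ) (x₀ := t)
    (F := fun (t : ℝ) ω => phase (t * ζ) (F ω)) (bound := fun ω => ‖ζ‖ * ‖F ω‖) (F' := fun (t : ℝ) ω => ((conj ζ * F ω).re * Complex.I) *
      phase (t * ζ) (F ω)) Filter.univ_mem
    (Eventually.of_forall fun s => aestronglyMeasurable_phase _ F) ?_ ?_ ?_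
    (hF.norm.const_mul _) ?_).2
  · exact (integrable_const (1 : ℝ)).mono' (aestronglyMeasurable_phase _ F)
      (ae_of_all _ fun ω => (norm_phase _ _).le)
  · refine AEStronglyMeasurable.mul ?_ (aestronglyMeasurable_phase _ F)
    have hc : Continuous fun x : ℂ => ((conj ζ * x).re : ℂ) * Complex.I := by fun_prop
    exact hc.comp_aestronglyMeasurable (Lp.aestronglyMeasurable F)
  · refine ae_of_all _ fun ω s _ => ?_
    rw [norm_mul, norm_phase, mul_one, norm_mul, Complex.norm_I, mul_one, Complex.norm_real]
    refine (Complex.abs_re_le_norm _).trans ?_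
    rw [norm_mul, RCLike.norm_conj]
  · refine ae_of_all _ fun ω s _ => ?_
    simp only [phase_ofReal_mul]
    have h := ((Complex.ofRealCLM.hasDerivAt (x := s)).mul_const
      ((conj ζ * F ω).re * Complex.I)).cexp
    simpa [mul_comm] using h

theorem norm_integral_mul_phase_sub_le (ζ a : ℂ) (u F : Lp ℂ 2 P) :
    ‖∫ ω, u ω * phase ζ (F ω) ∂P - a * ∫ ω, phase ζ (F ω) ∂P‖ ≤ ‖u - Lp.const 2 P a‖ := by
  have hp : Integrable (fun ω => phase ζ (F ω)) P :=
    (integrable_const (1 : ℝ)).mono' (aestronglyMeasurable_phase _ F)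
      (ae_of_all _ fun ω => (norm_phase _ _).le)
  rw [← integral_const_mul, ← integral_sub (integrable_mul_phase ζ u F) (hp.const_mul a)]
  refine (norm_integral_le_integral_norm _).trans ?_
  refine le_trans (le_of_eq ?_) (integral_norm_le_norm _)
  refine integral_congr_ae ?_
  filter_upwards [Lp.coeFn_sub u (Lp.const 2 P a), coeFn_const_Lp (P := P) a] with ω h1 h2
  rw [h1, Pi.sub_apply, h2, ← sub_mul, norm_mul, norm_phase, mul_one]

theorem integral_re_mul_phase (ζ ξ : ℂ) (F : Lp ℂ 2 P) :
    ∫ ω, ((conj ζ * F ω).re * Complex.I) * phase ξ (F ω) ∂P =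
      Complex.I / 2 * (conj ζ * ∫ ω, F ω * phase ξ (F ω) ∂P +
        ζ * conj (∫ ω, F ω * phase (-ξ) (F ω) ∂P)) := by
  have h1 : conj (∫ ω, F ω * phase (-ξ) (F ω) ∂P) = ∫ ω, conj (F ω) * phase ξ (F ω) ∂P := by
    rw [← integral_conj]
    refine integral_congr_ae (ae_of_all _ fun ω => ?_)
    simp only [map_mul, conj_phase, neg_neg]
  have hi : Integrable (fun ω => conj (F ω) * phase ξ (F ω)) P := by
    have := (Complex.conjCLE : ℂ →L[ℝ] ℂ).integrable_comp (integrable_mul_phase (-ξ) F F)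
    refine this.congr (ae_of_all _ fun ω => ?_)
    simp [conj_phase]
  rw [h1, ← integral_const_mul, ← integral_const_mul, ← integral_add
    ((integrable_mul_phase ξ F F).const_mul _) (hi.const_mul _), ← integral_const_mul]
  refine integral_congr_ae (ae_of_all _ fun ω => ?_)
  simp only [Complex.re_eq_add_conj, map_mul, Complex.conj_conj]
  ring

/-- If the integration by parts formula holds with asymptotically constant coefficients, then the
characteristic functions converge to a Gaussian one.  In the differential equation
`φ'(t) = -(κ/2) t φ(t) + o(1)` for the characteristic function `φ` along a ray, the error is
controlled by the distance of the coefficients to their limits. -/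
theorem tendsto_integral_phase {l : ℕ} (hl : l ≠ 0) {F u v : ℕ → Lp ℂ 2 P}
    (ibp : ∀ k ζ, (l : ℂ) * ∫ ω, F k ω * phase ζ (F k ω) ∂P =
      Complex.I / 2 * ∫ ω, (conj ζ • u k + ζ • v k : Lp ℂ 2 P) ω * phase ζ (F k ω) ∂P)
    {γ : ℂ} {s : ℝ} (hu : Tendsto u atTop (𝓝 (Lp.const 2 P (l * γ))))
    (hv : Tendsto v atTop (𝓝 (Lp.const 2 P (l * s : ℂ)))) (ζ : ℂ) :
    Tendsto (fun k => ∫ ω, phase ζ (F k ω) ∂P) atTop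
      (𝓝 (Complex.exp (-((((conj ζ ^ 2 * γ).re + ‖ζ‖ ^ 2 * s : ℝ) : ℂ) / 4)))) := by
  set κ : ℝ := (conj ζ ^ 2 * γ).re + ‖ζ‖ ^ 2 * s with hκ
  have hlC : (l : ℂ) ≠ 0 := by exact_mod_cast hl
  set U : ℕ → Lp ℂ 2 P := fun k => conj ζ • u k + ζ • v k with hU
  set a : ℂ := conj ζ * (l * γ) + ζ * (l * s) with ha
  have hUa : Tendsto U atTop (𝓝 (Lp.const 2 P a)) := by
    have h := (hu.const_smul (conj ζ)).add (hv.const_smul ζ)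
    have e1 : conj ζ • Lp.const 2 P (l * γ : ℂ) + ζ • Lp.const 2 P (l * s : ℂ) =
        Lp.const 2 P a := by
      rw [ha, map_add]
      rfl
    rwa [e1] at h
  set δ : ℕ → ℝ := fun k => ‖U k - Lp.const 2 P a‖ with hδ
  have hδ0 : Tendsto δ atTop (𝓝 0) := tendsto_iff_norm_sub_tendsto_zero.1 hUa
  have haκ : conj ζ * a + ζ * conj a = 2 * l * κ := by
    have h1 : (κ : ℂ) = (conj ζ ^ 2 * γ + ζ ^ 2 * conj γ) / 2 + ζ * conj ζ * s := by
      rw [hκ]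
      push_cast
      rw [Complex.re_eq_add_conj, Complex.mul_conj, Complex.normSq_eq_norm_sq]
      simp only [map_mul, map_pow, Complex.conj_conj]
      push_cast
      ring
    rw [h1, ha]
    simp only [map_add, map_mul, Complex.conj_conj, Complex.conj_natCast, Complex.conj_ofReal]
    ring
  -- the error term of the differential equation
  let φ : ℕ → ℝ → ℂ := fun k t => ∫ ω, phase (t * ζ) (F k ω) ∂P
  let A : ℕ → ℂ → ℂ := fun k ξ => ∫ ω, U k ω * phase ξ (F k ω) ∂P
  let R : ℕ → ℝ → ℂ := fun k t => conj ζ * (A k (t * ζ) - a * φ k t) +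
    ζ * conj (A k (-(t * ζ)) - a * ∫ ω, phase (-(t * ζ)) (F k ω) ∂P)
  have hR (k : ℕ) (t : ℝ) : ‖R k t‖ ≤ 2 * ‖ζ‖ * δ k := by
    refine (norm_add_le _ _).trans ?_
    rw [norm_mul, norm_mul, RCLike.norm_conj, RCLike.norm_conj]
    have h1 := mul_le_mul_of_nonneg_left
      (norm_integral_mul_phase_sub_le (t * ζ) a (U k) (F k)) (norm_nonneg ζ)
    have h2 := mul_le_mul_of_nonneg_left
      (norm_integral_mul_phase_sub_le (-(t * ζ)) a (U k) (F k)) (norm_nonneg ζ)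
    exact (add_le_add h1 h2).trans (le_of_eq (by ring))
  have hibp (k : ℕ) (t : ℝ) : (l : ℂ) * ∫ ω, F k ω * phase (t * ζ) (F k ω) ∂P =
      Complex.I / 2 * t * A k (t * ζ) := by
    have e1 : conj ((t : ℂ) * ζ) • u k + ((t : ℂ) * ζ) • v k = (t : ℂ) • U k := by
      rw [hU, map_mul, Complex.conj_ofReal, smul_add, smul_smul, smul_smul]
    have e2 : ∫ ω, ((t : ℂ) • U k : Lp ℂ 2 P) ω * phase (t * ζ) (F k ω) ∂P =
        t * A k (t * ζ) := by
      simp only [A]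
      rw [← integral_const_mul]
      refine integral_congr_ae ?_
      filter_upwards [Lp.coeFn_smul (t : ℂ) (U k)] with ω h1
      rw [h1, Pi.smul_apply, smul_eq_mul, mul_assoc]
    rw [ibp, e1, e2, mul_assoc]
  have hderiv (k : ℕ) (t : ℝ) : HasDerivAt (φ k)
      (-(t / (4 * l) : ℂ) * (2 * l * κ * φ k t + R k t)) t := by
    have h := hasDerivAt_integral_phase ζ (F k) t
    rw [integral_re_mul_phase] at h
    have h1 := hibp k t
    have h2 := hibp k (-t)
    have e2 : ((-t : ℝ) : ℂ) * ζ = -(t * ζ) := by push_cast; ring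
    rw [e2] at h2
    have h3 : (l : ℂ) * conj (∫ ω, F k ω * phase (-(t * ζ)) (F k ω) ∂P) =
        Complex.I / 2 * t * conj (A k (-(t * ζ))) := by
      have := congrArg conj h2
      simp only [map_mul, map_div₀, Complex.conj_natCast, Complex.conj_I, map_ofNat,
        Complex.conj_ofReal] at this
      rw [this]
      push_cast
      ring
    have h4 : conj (∫ ω, phase (-(t * ζ)) (F k ω) ∂P) = φ k t := by
      rw [← integral_conj]
      simp only [conj_phase, neg_neg]
      rfl
    convert h using 1
    have h5 : ∫ ω, F k ω * phase (t * ζ) (F k ω) ∂P = Complex.I / 2 * t * A k (t * ζ) / l := by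
      rw [eq_div_iff hlC, mul_comm, h1]
    have h6 : conj (∫ ω, F k ω * phase (-(t * ζ)) (F k ω) ∂P) =
        Complex.I / 2 * t * conj (A k (-(t * ζ))) / l := by
      rw [eq_div_iff hlC, mul_comm, h3]
    rw [h5, h6, ← haκ]
    simp only [R, map_sub, map_mul, h4]
    field_simp
    linear_combination (-4 * (t : ℂ)) * (conj ζ * A k (t * ζ) + ζ * conj (A k (-(t * ζ)))) *
      Complex.I_sq
  -- The integrating factor `exp(κ t² / 4)` turns `φ` into a function which is almost constant on
  -- `[0, 1]`.
  have hχ (k : ℕ) (t : ℝ) : HasDerivAt (fun t : ℝ => φ k t * Complex.exp ((κ * t ^ 2 / 4 : ℝ) : ℂ))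
      (-(t / (4 * l) : ℂ) * R k t * Complex.exp ((κ * t ^ 2 / 4 : ℝ) : ℂ)) t := by
    have h1 : HasDerivAt (fun t : ℝ => κ * t ^ 2 / 4) (κ * (2 * t) / 4) t := by
      simpa using (((hasDerivAt_id t).pow 2).const_mul κ).div_const 4
    have h2 := (hderiv k t).mul (h1.ofReal_comp.cexp)
    refine h2.congr_deriv ?_
    have h3 : (t / (4 * l) : ℂ) * (2 * l) = t / 2 := by
      field_simp
      norm_num
    push_cast
    linear_combination (-φ k t * κ * Complex.exp (κ * t ^ 2 / 4)) * h3
  have hbound (k : ℕ) : ‖φ k 1 * Complex.exp ((κ * 1 ^ 2 / 4 : ℝ) : ℂ) -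
      φ k 0 * Complex.exp ((κ * 0 ^ 2 / 4 : ℝ) : ℂ)‖ ≤
        1 / (4 * l) * (2 * ‖ζ‖ * δ k) * Real.exp (|κ| / 4) := by
    refine norm_image_sub_le_of_norm_deriv_le_segment_01'
      (f := fun t : ℝ => φ k t * Complex.exp ((κ * t ^ 2 / 4 : ℝ) : ℂ))
      (fun t _ => (hχ k t).hasDerivWithinAt) fun t ht => ?_
    rw [norm_mul, norm_mul, norm_neg, norm_div, Complex.norm_real, Real.norm_of_nonneg ht.1,
      Complex.norm_exp, Complex.ofReal_re]
    have h1 : ‖(4 * l : ℂ)‖ = 4 * l := by simp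
    rw [h1]
    have hl0 : (0 : ℝ) < l := by exact_mod_cast Nat.pos_of_ne_zero hl
    have h2 : t / (4 * (l : ℝ)) ≤ 1 / (4 * l) :=
      div_le_div_of_nonneg_right ht.2.le (by positivity)
    have h3 : κ * t ^ 2 / 4 ≤ |κ| / 4 := by
      have h4 : κ * t ^ 2 ≤ |κ| * 1 :=
        mul_le_mul (le_abs_self κ) (pow_le_one₀ ht.1 ht.2.le) (by positivity) (abs_nonneg κ)
      linarith
    exact mul_le_mul (mul_le_mul h2 (hR k t) (norm_nonneg _) (by positivity))
      (Real.exp_le_exp.2 h3) (Real.exp_pos _).le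
      (mul_nonneg (by positivity) (mul_nonneg (by positivity) (norm_nonneg _)))
  have hlim : Tendsto (fun k => φ k 1 * Complex.exp ((κ / 4 : ℝ) : ℂ)) atTop (𝓝 1) := by
    rw [tendsto_iff_norm_sub_tendsto_zero]
    have h0 : Tendsto (fun k => 1 / (4 * l) * (2 * ‖ζ‖ * δ k) * Real.exp (|κ| / 4)) atTop (𝓝 0) := by
      have := ((hδ0.const_mul (2 * ‖ζ‖)).const_mul (1 / (4 * (l : ℝ)))).mul_const
        (Real.exp (|κ| / 4))
      simpa using this
    refine squeeze_zero (fun _ => norm_nonneg _) (fun k => ?_) h0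
    have h1 := hbound k
    have h2 : φ k 0 = 1 := by
      simp only [φ, Complex.ofReal_zero, zero_mul, phase_zero, integral_const, probReal_univ,
        one_smul]
    rw [h2] at h1
    simpa using h1
  have h1 := hlim.mul_const (Complex.exp (-((κ : ℂ) / 4)))
  rw [one_mul] at h1
  refine h1.congr fun k => ?_
  rw [mul_assoc, ← Complex.exp_add]
  have h2 : ((κ / 4 : ℝ) : ℂ) + -((κ : ℂ) / 4) = 0 := by push_cast; ring
  rw [h2, Complex.exp_zero, mul_one]
  simp only [φ, Complex.ofReal_one, one_mul]

end CharacteristicFunction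

/-! ### Gaussian laws in the plane -/

/-- Weak convergence together with a uniform bound on the second moments of a nonnegative
continuous function `g` implies convergence of the integrals of `g`. -/
theorem tendsto_integral_of_integral_sq_le {E : Type*} [TopologicalSpace E] [MeasurableSpace E]
    [BorelSpace E] {μ : ℕ → ProbabilityMeasure E} {ν : ProbabilityMeasure E}
    (hμ : Tendsto μ atTop (𝓝 ν)) {g : E → ℝ} (hg : Continuous g) (h0 : ∀ x, 0 ≤ g x) {K : ℝ}
    (hi : ∀ k, Integrable (fun x => g x ^ 2) (μ k : Measure E))
    (hK : ∀ k, ∫ x, g x ^ 2 ∂(μ k : Measure E) ≤ K)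
    (hν : Integrable (fun x => g x ^ 2) (ν : Measure E)) :
    Tendsto (fun k => ∫ x, g x ∂(μ k : Measure E)) atTop (𝓝 (∫ x, g x ∂(ν : Measure E))) := by
  have key : ∀ (ρ : ProbabilityMeasure E) (M : ℝ), 0 < M →
      Integrable (fun x => g x ^ 2) (ρ : Measure E) →
      |∫ x, g x ∂(ρ : Measure E) - ∫ x, min (g x) M ∂(ρ : Measure E)|
        ≤ (∫ x, g x ^ 2 ∂(ρ : Measure E)) / M := by
    intro ρ M hM hρ
    have hmeas : AEStronglyMeasurable g (ρ : Measure E) :=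
      hg.measurable.aestronglyMeasurable
    have hgi : Integrable g (ρ : Measure E) := by
      refine ((integrable_const (1 : ℝ)).add hρ).mono' hmeas (ae_of_all _ fun x => ?_)
      rw [Real.norm_of_nonneg (h0 x), Pi.add_apply]
      nlinarith [sq_nonneg (g x - 1), h0 x]
    have hmin : Integrable (fun x => min (g x) M) (ρ : Measure E) :=
      hgi.inf (integrable_const M)
    rw [← integral_sub hgi hmin, abs_of_nonneg (integral_nonneg fun x => by simp),
      ← integral_div]
    refine integral_mono (hgi.sub hmin) (hρ.div_const M) fun x => ?_
    rw [le_div_iff₀ hM]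
    rcases le_total (g x) M with h | h
    · simp only [min_eq_left h, sub_self, zero_mul]
      positivity
    · simp only [min_eq_right h]
      nlinarith [h0 x, sq_nonneg M]
  rw [ProbabilityMeasure.tendsto_iff_forall_integral_tendsto] at hμ
  set K' : ℝ := max K (∫ x, g x ^ 2 ∂(ν : Measure E)) with hK'
  have hK'0 : 0 ≤ K' := le_max_of_le_right (integral_nonneg fun x => sq_nonneg _)
  rw [Metric.tendsto_atTop]
  intro ε hε
  set M : ℝ := 3 * (K' + 1) / ε with hMdef
  have hM : 0 < M := by positivity
  have hKM : K' / M < ε / 3 := by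
    rw [div_lt_iff₀ hM, hMdef]
    field_simp
    linarith
  obtain ⟨N, hN⟩ := Metric.tendsto_atTop.1 (hμ (BoundedContinuousFunction.ofNormedAddCommGroup
    (fun x => min (g x) M) (hg.min continuous_const) M fun x => by
      rw [Real.norm_of_nonneg (le_min (h0 x) hM.le)]
      exact min_le_right _ _)) (ε / 3) (by positivity)
  refine ⟨N, fun k hk => ?_⟩
  have h1 := (key (μ k) M hM (hi k)).trans
    (div_le_div_of_nonneg_right ((hK k).trans (le_max_left K (∫ x, g x ^ 2 ∂(ν : Measure E)))) hM.le)
  have h2 := (key ν M hM hν).trans (div_le_div_of_nonneg_right (le_max_right K _) hM.le)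
  have h3 := hN k hk
  simp only [Real.dist_eq, BoundedContinuousFunction.coe_ofNormedAddCommGroup] at h3 ⊢
  rw [abs_lt] at h3 ⊢
  rw [abs_le] at h1 h2
  constructor <;> linarith

theorem integral_pow_four_gaussianReal (v : NNReal) :
    ∫ x : ℝ, x ^ 4 ∂(gaussianReal 0 v) = 3 * (v : ℝ) ^ 2 := by
  rcases eq_or_ne v 0 with rfl | hv
  · simp
  have hmem : ∀ p : ℕ, Integrable (fun x : ℝ => (x : ℂ) ^ p) (gaussianReal 0 v) := by
    intro p
    have h : MemLp (id : ℝ → ℝ) p (gaussianReal 0 v) := IsGaussian.memLp_id _ _ (by simp)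
    have h2 := h.integrable_norm_pow'
    refine h2.mono' (by fun_prop) (ae_of_all _ fun x => ?_)
    simp
  have hid : ∀ x : ℝ, HasDerivAt (fun x : ℝ => (x : ℂ)) 1 x := fun x => (hasDerivAt_id x).ofReal_comp
  have h1 := integral_mul_gaussianReal hv (h := fun x : ℝ => (x : ℂ) ^ 3)
    (h' := fun x : ℝ => 3 * (x : ℂ) ^ 2)
    (fun x => ((hid x).pow 3).congr_deriv (by simp))
    (hmem 3) (by simpa [← pow_succ'] using hmem 4) ((hmem 2).const_mul 3)
  have h2 := integral_mul_gaussianReal hv (h := fun x : ℝ => (x : ℂ))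
    (h' := fun _ : ℝ => 1)
    hid
    (by simpa using hmem 1) (by simpa [← sq] using hmem 2) (integrable_const _)
  have h3 : ∫ x : ℝ, (x : ℂ) ^ 2 ∂(gaussianReal 0 v) = v := by
    simpa [← sq] using h2
  have h4 : ∫ x : ℝ, (x : ℂ) ^ 4 ∂(gaussianReal 0 v) = 3 * (v : ℂ) ^ 2 := by
    rw [integral_const_mul, h3] at h1
    simp only [← pow_succ'] at h1
    rw [h1]
    ring
  apply Complex.ofReal_injective
  rw [← integral_complex_ofReal]
  push_cast
  exact h4

theorem dotProduct_covariance (s c b : ℝ) (x : Fin 2 → ℝ) :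
    x ⬝ᵥ ((1 / 2 : ℝ) • !![s + c, b; b, s - c] : Matrix (Fin 2) (Fin 2) ℝ).mulVec x =
      (s * (x 0 ^ 2 + x 1 ^ 2) + (c * (x 0 ^ 2 - x 1 ^ 2) + b * (2 * (x 0 * x 1)))) / 2 := by
  simp [Matrix.mulVec, dotProduct, Fin.sum_univ_two]
  ring

theorem posSemidef_covariance {s c b : ℝ} (hs : 0 ≤ s) (h : c ^ 2 + b ^ 2 ≤ s ^ 2) :
    ((1 / 2 : ℝ) • !![s + c, b; b, s - c] : Matrix (Fin 2) (Fin 2) ℝ).PosSemidef := by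
  refine Matrix.PosSemidef.of_dotProduct_mulVec_nonneg ?_ fun x => ?_
  · ext i j
    fin_cases i <;> fin_cases j <;> simp
  · rw [star_trivial, dotProduct_covariance]
    have h1 : (c * (x 0 ^ 2 - x 1 ^ 2) + b * (2 * (x 0 * x 1))) ^ 2 ≤
        (s * (x 0 ^ 2 + x 1 ^ 2)) ^ 2 := by
      have h2 : (c ^ 2 + b ^ 2) * (x 0 ^ 2 + x 1 ^ 2) ^ 2 ≤ s ^ 2 * (x 0 ^ 2 + x 1 ^ 2) ^ 2 :=
        mul_le_mul_of_nonneg_right h (sq_nonneg _)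
      nlinarith [sq_nonneg (c * (2 * (x 0 * x 1)) - b * (x 0 ^ 2 - x 1 ^ 2))]
    have h3 := (abs_le.1 (abs_le_of_sq_le_sq h1 (by positivity))).1
    linarith

/-- The plane vector with coordinates `(Re z, Im z)`. -/
abbrev plane (z : ℂ) : EuclideanSpace ℝ (Fin 2) :=
  !₂[z.re, z.im]

theorem continuous_plane : Continuous plane := by
  refine (PiLp.continuous_toLp 2 _).comp (continuous_pi fun i => ?_)
  fin_cases i
  · exact Complex.continuous_re
  · exact Complex.continuous_im

theorem norm_plane (z : ℂ) : ‖plane z‖ = ‖z‖ := by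
  rw [EuclideanSpace.norm_eq, Complex.norm_eq_sqrt_sq_add_sq]
  simp [Fin.sum_univ_two]

variable {Ω : Type*} [MeasurableSpace Ω] {P : Measure Ω}

theorem aemeasurable_plane (F : Lp ℂ 2 P) : AEMeasurable (fun ω => plane (F ω)) P :=
  continuous_plane.measurable.comp_aemeasurable (Lp.aestronglyMeasurable F).aemeasurable

theorem charFun_map_plane (F : Lp ℂ 2 P) (t : EuclideanSpace ℝ (Fin 2)) :
    charFun (P.map fun ω => plane (F ω)) t = ∫ ω, phase (t 0 + t 1 * Complex.I) (F ω) ∂P := by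
  rw [charFun_apply, integral_map (aemeasurable_plane F)
    (Continuous.aestronglyMeasurable (by fun_prop))]
  refine integral_congr_ae (ae_of_all _ fun ω => ?_)
  simp [phase, PiLp.inner_apply, Fin.sum_univ_two]

/-- If the characteristic functions of `F_k` converge to that of a complex Gaussian variable with
`E|F|² = s` and `E F² = c + ib`, then `(Re F_k, Im F_k)` converges in law. -/
theorem tendstoInDistribution_plane [IsProbabilityMeasure P] {F : ℕ → Lp ℂ 2 P} {s c b : ℝ}
    (hs : 0 ≤ s) (hcb : c ^ 2 + b ^ 2 ≤ s ^ 2)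
    (h : ∀ ζ : ℂ, Tendsto (fun k => ∫ ω, phase ζ (F k ω) ∂P) atTop
      (𝓝 (Complex.exp (-((((conj ζ ^ 2 * (c + Complex.I * b)).re + ‖ζ‖ ^ 2 * s : ℝ) : ℂ) / 4))))) :
    TendstoInDistribution (fun k ω => !₂[(F k ω).re, (F k ω).im]) atTop
      (id : EuclideanSpace ℝ (Fin 2) → EuclideanSpace ℝ (Fin 2)) (fun _ => P)
      (multivariateGaussian 0
        ((1 / 2 : ℝ) • !![s + c, b; b, s - c] : Matrix (Fin 2) (Fin 2) ℝ)) where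
  forall_aemeasurable k := aemeasurable_plane (F k)
  aemeasurable_limit := aemeasurable_id
  tendsto := by
    refine ProbabilityMeasure.tendsto_of_tendsto_charFun fun t => ?_
    simp only [ProbabilityMeasure.coe_mk, Measure.map_id]
    rw [charFun_multivariateGaussian (posSemidef_covariance hs hcb)]
    have h1 := h (t 0 + t 1 * Complex.I)
    have h2 : (inner ℝ t (0 : EuclideanSpace ℝ (Fin 2)) : ℂ) * Complex.I -
        ((t.ofLp ⬝ᵥ ((1 / 2 : ℝ) • !![s + c, b; b, s - c] :
          Matrix (Fin 2) (Fin 2) ℝ).mulVec t.ofLp : ℝ) : ℂ) / 2 =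
        -((((conj (t 0 + t 1 * Complex.I : ℂ) ^ 2 * (c + Complex.I * b)).re +
          ‖(t 0 + t 1 * Complex.I : ℂ)‖ ^ 2 * s : ℝ) : ℂ) / 4) := by
      rw [dotProduct_covariance, ← Complex.normSq_eq_norm_sq, inner_zero_right]
      simp only [sq, Complex.mul_re, Complex.mul_im, Complex.conj_re, Complex.conj_im,
        Complex.add_re, Complex.add_im, Complex.ofReal_re, Complex.ofReal_im, Complex.I_re,
        Complex.I_im, Complex.normSq_apply]
      push_cast
      ring
    refine (h1.congr fun k => (charFun_map_plane (F k) t).symm).trans ?_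
    rw [← h2]

theorem integral_inner_pow_four {S : Matrix (Fin 2) (Fin 2) ℝ} (hS : S.PosSemidef)
    (t : EuclideanSpace ℝ (Fin 2)) :
    ∫ x, inner ℝ t x ^ 4 ∂(multivariateGaussian 0 S) =
      3 * (t.ofLp ⬝ᵥ S.mulVec t.ofLp) ^ 2 := by
  have h1 := IsGaussian.map_eq_gaussianReal (μ := multivariateGaussian 0 S) (innerSL ℝ t)
  have hmean : ∫ x, innerSL ℝ t x ∂(multivariateGaussian 0 S) = 0 := by
    rw [ContinuousLinearMap.integral_comp_comm _ IsGaussian.integrable_fun_id,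
      integral_id_multivariateGaussian, map_zero]
  have hvar : Var[innerSL ℝ t; multivariateGaussian 0 S] = t.ofLp ⬝ᵥ S.mulVec t.ofLp := by
    rw [← covarianceBilin_multivariateGaussian (μ := 0) hS t t,
      covarianceBilin_self IsGaussian.memLp_two_id]
    rfl
  rw [hmean, hvar] at h1
  have h2 : ∫ x, inner ℝ t x ^ 4 ∂(multivariateGaussian 0 S) =
      ∫ y, y ^ 4 ∂((multivariateGaussian 0 S).map (innerSL ℝ t)) := by
    rw [integral_map (by fun_prop) (by fun_prop)]
    rfl
  have h3 : 0 ≤ t.ofLp ⬝ᵥ S.mulVec t.ofLp := by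
    rw [← hvar]
    exact variance_nonneg _ _
  rw [h2, h1, integral_pow_four_gaussianReal, Real.coe_toNNReal _ h3]

theorem integrable_norm_pow_multivariateGaussian (S : Matrix (Fin 2) (Fin 2) ℝ) (p : ℕ) :
    Integrable (fun x : EuclideanSpace ℝ (Fin 2) => ‖x‖ ^ p) (multivariateGaussian 0 S) :=
  (IsGaussian.memLp_id (multivariateGaussian 0 S) p (by simp)).integrable_norm_pow'

/-- The fourth moment of a complex Gaussian variable with `E|F|² = s` and `E F² = c + ib`. -/
theorem integral_norm_pow_four_multivariateGaussian {s c b : ℝ} (hs : 0 ≤ s)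
    (hcb : c ^ 2 + b ^ 2 ≤ s ^ 2) :
    ∫ x, ‖x‖ ^ 4 ∂(multivariateGaussian 0
      ((1 / 2 : ℝ) • !![s + c, b; b, s - c] : Matrix (Fin 2) (Fin 2) ℝ)) =
      c ^ 2 + b ^ 2 + 2 * s ^ 2 := by
  set S : Matrix (Fin 2) (Fin 2) ℝ := (1 / 2 : ℝ) • !![s + c, b; b, s - c] with hSdef
  have hS : S.PosSemidef := posSemidef_covariance hs hcb
  have hint (t : EuclideanSpace ℝ (Fin 2)) :
      Integrable (fun x => inner ℝ t x ^ 4) (multivariateGaussian 0 S) := by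
    refine ((integrable_norm_pow_multivariateGaussian S 4).const_mul (‖t‖ ^ 4)).mono'
      (Continuous.aestronglyMeasurable (by fun_prop)) (ae_of_all _ fun x => ?_)
    rw [norm_pow, ← mul_pow]
    exact pow_le_pow_left₀ (norm_nonneg _) (norm_inner_le_norm t x) 4
  have hexp (x : EuclideanSpace ℝ (Fin 2)) : ‖x‖ ^ 4 =
      2 / 3 * inner ℝ !₂[(1 : ℝ), 0] x ^ 4 + 2 / 3 * inner ℝ !₂[(0 : ℝ), 1] x ^ 4 +
      (1 / 6 * inner ℝ !₂[(1 : ℝ), 1] x ^ 4 + 1 / 6 * inner ℝ !₂[(1 : ℝ), -1] x ^ 4) := by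
    have h4 : ‖x‖ ^ 4 = (‖x‖ ^ 2) ^ 2 := by ring
    rw [h4, EuclideanSpace.norm_sq_eq]
    simp [PiLp.inner_apply, Fin.sum_univ_two]
    ring
  have hint' (a : ℝ) (t u : EuclideanSpace ℝ (Fin 2)) :
      Integrable (fun x => a * inner ℝ t x ^ 4 + a * inner ℝ u x ^ 4) (multivariateGaussian 0 S) :=
    ((hint t).const_mul a).add ((hint u).const_mul a)
  simp only [hexp]
  rw [integral_add (hint' _ _ _) (hint' _ _ _),
    integral_add ((hint _).const_mul _) ((hint _).const_mul _),
    integral_add ((hint _).const_mul _) ((hint _).const_mul _)]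
  simp only [integral_const_mul, integral_inner_pow_four hS]
  simp only [hSdef, dotProduct_covariance]
  simp
  ring

/-- Convergence in law to a Gaussian variable with bounded eighth moments gives convergence of the
fourth moments. -/
theorem tendsto_integral_norm_pow_four [IsProbabilityMeasure P] {F : ℕ → Lp ℂ 2 P} {s c b K : ℝ}
    (hs : 0 ≤ s) (hcb : c ^ 2 + b ^ 2 ≤ s ^ 2)
    (hi : ∀ k, Integrable (fun ω => ‖F k ω‖ ^ 8) P) (hK : ∀ k, ∫ ω, ‖F k ω‖ ^ 8 ∂P ≤ K)
    (h : TendstoInDistribution (fun k ω => !₂[(F k ω).re, (F k ω).im]) atTop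
      (id : EuclideanSpace ℝ (Fin 2) → EuclideanSpace ℝ (Fin 2)) (fun _ => P)
      (multivariateGaussian 0
        ((1 / 2 : ℝ) • !![s + c, b; b, s - c] : Matrix (Fin 2) (Fin 2) ℝ))) :
    Tendsto (fun k => ∫ ω, ‖F k ω‖ ^ 4 ∂P) atTop (𝓝 (c ^ 2 + b ^ 2 + 2 * s ^ 2)) := by
  have h8 (x : EuclideanSpace ℝ (Fin 2)) : (‖x‖ ^ 4) ^ 2 = ‖x‖ ^ 8 := by ring
  have hmap (p k : ℕ) : ∫ x, ‖x‖ ^ p ∂(P.map fun ω => plane (F k ω)) = ∫ ω, ‖F k ω‖ ^ p ∂P := by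
    rw [integral_map (aemeasurable_plane (F k)) (Continuous.aestronglyMeasurable (by fun_prop))]
    simp only [norm_plane]
  have h1 := tendsto_integral_of_integral_sq_le h.tendsto
    (g := fun x : EuclideanSpace ℝ (Fin 2) => ‖x‖ ^ 4) (by fun_prop) (fun x => by positivity)
    (K := K) (fun k => ?_) (fun k => ?_) ?_
  · simp only [ProbabilityMeasure.coe_mk, Measure.map_id,
      integral_norm_pow_four_multivariateGaussian hs hcb] at h1
    exact h1.congr fun k => hmap 4 k
  · simp only [h8, ProbabilityMeasure.coe_mk]
    rw [integrable_map_measure (Continuous.aestronglyMeasurable (by fun_prop))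
      (aemeasurable_plane (F k))]
    simpa only [Function.comp_def, norm_plane] using hi k
  · simp only [h8, ProbabilityMeasure.coe_mk]
    exact (hmap 8 k).trans_le (hK k)
  · simp only [h8, ProbabilityMeasure.coe_mk, Measure.map_id]
    exact integrable_norm_pow_multivariateGaussian _ 8

end ComplexWiener

end

/-! ### Equivalence of the conditions -/

theorem mainTheorem9
    {H Ω ι : Type*} [NormedAddCommGroup H] [InnerProductSpace ℂ H] [CompleteSpace H]
    [TopologicalSpace.SeparableSpace H] [MeasurableSpace Ω]
    (P : Measure Ω) [IsProbabilityMeasure P]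
    (Z : H → Ω → ℂ) (hZ : ComplexWiener.IsComplexIsonormal Z P)
    (e : HilbertBasis ι ℂ H)
    (m n : ℕ) (hmn : 2 ≤ m + n)
    (f : ℕ → ComplexWiener.Kernel ι m n) (hf : ∀ k, (f k).IsSymm)
    (h : ℕ → ComplexWiener.Kernel ι n m) (hh : ∀ k, h k = (f k).revConj)
    (F : ℕ → Lp ℂ 2 P) (hF : ∀ k, F k = ComplexWiener.multipleIntegral hZ e (f k))
    (Fbar : ℕ → Ω → ℂ) (hFbar : ∀ k ω, Fbar k ω = conj (F k ω))
    (DF DFbar : ℕ → Lp H 2 P)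
    (hDF : ∀ k, DF k = ComplexWiener.malliavinDeriv Z P (F k))
    (hDFbar : ∀ k, DFbar k = ComplexWiener.malliavinDeriv Z P (Fbar k))
    (σ c b : ℝ)
    (hσ : Tendsto (fun k => ∫ ω, ‖F k ω‖ ^ 2 ∂P) atTop (𝓝 (σ ^ 2)))
    (hcb : Tendsto (fun k => ∫ ω, F k ω ^ 2 ∂P) atTop (𝓝 ((c : ℂ) + Complex.I * (b : ℂ)))) :
    -- the objects in the conditions below are well defined
    (∀ k, MemLp (F k) 4 P ∧
      Fbar k =ᵐ[P] ComplexWiener.multipleIntegral hZ e (h k) ∧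
      ComplexWiener.MemMalliavinDomain Z P (F k) ∧
      ComplexWiener.MemMalliavinDomain Z P (Fbar k)) ∧
    -- the equivalent conditions
    List.TFAE [
      -- (i) convergence in law
      TendstoInDistribution (fun k ω => !₂[(F k ω).re, (F k ω).im]) atTop
        (id : EuclideanSpace ℝ (Fin 2) → EuclideanSpace ℝ (Fin 2)) (fun _ => P)
        (multivariateGaussian 0
          ((1 / 2 : ℝ) • !![σ ^ 2 + c, b; b, σ ^ 2 - c] : Matrix (Fin 2) (Fin 2) ℝ)),
      -- (ii) fourth moments
      Tendsto (fun k => ∫ ω, ‖F k ω‖ ^ 4 ∂P) atTop (𝓝 (c ^ 2 + b ^ 2 + 2 * σ ^ 4)),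
      -- (iii) contractions
      (∀ (i j : ℕ) (him : i ≤ m) (hin : i ≤ n) (hjn : j ≤ n) (hjm : j ≤ m),
        0 < i + j → i + j ≤ m + n - 1 →
        Tendsto (fun k => ‖ComplexWiener.contraction (f k) (f k) i j him hin hjn hjm‖)
          atTop (𝓝 0)) ∧
      (∀ (i j : ℕ) (him : i ≤ m) (hjn : j ≤ n), 0 < i + j → i + j ≤ m + n - 1 →
        Tendsto (fun k => ‖ComplexWiener.contraction (f k) (h k) i j him him hjn hjn‖)
          atTop (𝓝 0)),
      -- (iv) symmetrized contractions
      (∀ (i j : ℕ) (him : i ≤ m) (hin : i ≤ n) (hjn : j ≤ n) (hjm : j ≤ m),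
        0 < i + j → i + j ≤ m + n - 1 →
        Tendsto (fun k =>
          ‖(ComplexWiener.contraction (f k) (f k) i j him hin hjn hjm).symmetrize‖)
          atTop (𝓝 0)) ∧
      (∀ (i j : ℕ) (him : i ≤ m) (hjn : j ≤ n), 0 < i + j → i + j ≤ m + n - 1 →
        Tendsto (fun k =>
          ‖(ComplexWiener.contraction (f k) (h k) i j him him hjn hjn).symmetrize‖)
          atTop (𝓝 0)),
      -- (v) convergence to constants in `L²(Ω)`
      (∃ a : ℝ, Tendsto (fun k => eLpNorm (fun ω => ‖DF k ω‖ ^ 2 - a) 2 P) atTop (𝓝 0)) ∧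
      (∃ a : ℝ, Tendsto (fun k => eLpNorm (fun ω => ‖DFbar k ω‖ ^ 2 - a) 2 P) atTop (𝓝 0)) ∧
      (∃ a : ℂ, Tendsto (fun k => eLpNorm (fun ω => inner ℂ (DFbar k ω) (DF k ω) - a) 2 P)
        atTop (𝓝 0)),
      -- (v), restated through variances
      Tendsto (fun k => evariance (fun ω => ‖DF k ω‖ ^ 2) P) atTop (𝓝 0) ∧
      Tendsto (fun k => evariance (fun ω => ‖DFbar k ω‖ ^ 2) P) atTop (𝓝 0) ∧
      Tendsto (fun k => ComplexWiener.complexVariance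
        (fun ω => inner ℂ (DFbar k ω) (DF k ω)) P) atTop (𝓝 0)] := by
  obtain rfl : h = fun k => (f k).revConj := funext hh
  obtain rfl : F = fun k => ComplexWiener.multipleIntegral hZ e (f k) := funext hF
  obtain rfl : Fbar = fun k ω => conj (ComplexWiener.multipleIntegral hZ e (f k) ω) :=
    funext fun k => funext (hFbar k)
  obtain rfl : DF = _ := funext hDF
  have hbar (k : ℕ) : (fun ω => conj (ComplexWiener.multipleIntegral hZ e (f k) ω)) =ᵐ[P]
      ComplexWiener.multipleIntegral hZ e (f k).revConj :=
    ComplexWiener.conj_multipleIntegral hZ e (f k)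
  have hDbar (k : ℕ) : ComplexWiener.HasMalliavinDeriv Z P
      (fun ω => conj (ComplexWiener.multipleIntegral hZ e (f k) ω))
      (ComplexWiener.malliavinDeriv Z P
        (ComplexWiener.multipleIntegral hZ e (f k).revConj)) :=
    (ComplexWiener.hasMalliavinDeriv_multipleIntegral hZ e (hf k).revConj).congr (hbar k).symm
  have hbarL (k : ℕ) : MemLp (fun ω => conj (ComplexWiener.multipleIntegral hZ e (f k) ω)) 2 P :=
    (Lp.memLp _).star
  obtain rfl : DFbar = fun k => ComplexWiener.malliavinDeriv Z P
      (ComplexWiener.multipleIntegral hZ e (f k).revConj) :=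
    funext fun k => (hDFbar k).trans (ComplexWiener.malliavinDeriv_eq hZ (hbarL k) (hDbar k))
  have hwell (k : ℕ) : MemLp (ComplexWiener.multipleIntegral hZ e (f k)) 4 P ∧
      (fun ω => conj (ComplexWiener.multipleIntegral hZ e (f k) ω)) =ᵐ[P]
        ComplexWiener.multipleIntegral hZ e (f k).revConj ∧
      ComplexWiener.MemMalliavinDomain Z P (ComplexWiener.multipleIntegral hZ e (f k)) ∧
      ComplexWiener.MemMalliavinDomain Z P
        (fun ω => conj (ComplexWiener.multipleIntegral hZ e (f k) ω)) := by
    refine ⟨?_, hbar k,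
      ⟨Lp.memLp _, _, ComplexWiener.hasMalliavinDeriv_multipleIntegral hZ e (hf k)⟩,
      ⟨hbarL k, _, hDbar k⟩⟩
    have h1 := ComplexWiener.memLp_multipleIntegral hZ e 1 (f k)
    norm_num at h1
    exact h1
  refine ⟨hwell, ?_⟩
  have hcov : c ^ 2 + b ^ 2 ≤ (σ ^ 2) ^ 2 := by
    have h1 : ‖(c : ℂ) + Complex.I * b‖ ≤ σ ^ 2 := le_of_tendsto_of_tendsto' hcb.norm hσ fun k =>
      (norm_integral_le_integral_norm _).trans_eq (integral_congr_ae (ae_of_all _ fun ω =>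
        norm_pow _ 2))
    have h2 := pow_le_pow_left₀ (norm_nonneg _) h1 2
    rw [← Complex.normSq_eq_norm_sq, Complex.normSq_apply] at h2
    simpa [sq] using h2
  have h1 (k : ℕ) := ComplexWiener.norm_sq_malliavinDeriv_ae_eq hZ e (hf k)
  have h2 (k : ℕ) := ComplexWiener.norm_sq_malliavinDeriv_revConj_ae_eq hZ e (hf k)
  have h3 (k : ℕ) : (fun ω => inner ℂ
      (ComplexWiener.malliavinDeriv Z P (ComplexWiener.multipleIntegral hZ e (f k).revConj) ω)
      (ComplexWiener.malliavinDeriv Z P (ComplexWiener.multipleIntegral hZ e (f k)) ω)) =ᵐ[P]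
        ComplexWiener.chaosSum hZ e (fun i _ => i) (f k) (f k) :=
    ComplexWiener.inner_malliavinDeriv_revConj_left hZ e (hf k) (hf k)
  have hvar : (Tendsto (fun k => evariance (fun ω => ‖ComplexWiener.malliavinDeriv Z P
        (ComplexWiener.multipleIntegral hZ e (f k)) ω‖ ^ 2) P) atTop (𝓝 0) ∧
      Tendsto (fun k => evariance (fun ω => ‖ComplexWiener.malliavinDeriv Z P
        (ComplexWiener.multipleIntegral hZ e (f k).revConj) ω‖ ^ 2) P) atTop (𝓝 0) ∧
      Tendsto (fun k => ComplexWiener.complexVariance (fun ω => inner ℂ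
        (ComplexWiener.malliavinDeriv Z P (ComplexWiener.multipleIntegral hZ e (f k).revConj) ω)
        (ComplexWiener.malliavinDeriv Z P (ComplexWiener.multipleIntegral hZ e (f k)) ω)) P)
          atTop (𝓝 0)) ↔
      Tendsto (fun k => ComplexWiener.center P
        (ComplexWiener.chaosSum hZ e (fun i _ => i) (f k) (f k).revConj)) atTop (𝓝 0) ∧
      Tendsto (fun k => ComplexWiener.center P
        (ComplexWiener.chaosSum hZ e (fun _ j => j) (f k) (f k).revConj)) atTop (𝓝 0) ∧
      Tendsto (fun k => ComplexWiener.center P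
        (ComplexWiener.chaosSum hZ e (fun i _ => i) (f k) (f k))) atTop (𝓝 0) := by
    rw [tendsto_congr fun k => ComplexWiener.evariance_eq (h1 k),
      tendsto_congr fun k => ComplexWiener.evariance_eq (h2 k),
      tendsto_congr fun k => ComplexWiener.complexVariance_eq (h3 k),
      ComplexWiener.tendsto_enorm_sq_iff, ComplexWiener.tendsto_enorm_sq_iff,
      ComplexWiener.tendsto_enorm_sq_iff]
  have hσC : Tendsto (fun k => ∫ ω, ComplexWiener.chaosSum hZ e 1 (f k) (f k).revConj ω ∂P) atTop
      (𝓝 ((σ ^ 2 : ℝ) : ℂ)) :=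
    ((Complex.continuous_ofReal.tendsto _).comp hσ).congr fun k =>
      (ComplexWiener.integral_chaosSum_revConj hZ e (hf k)).symm
  have hcbC : Tendsto (fun k => ∫ ω, ComplexWiener.chaosSum hZ e 1 (f k) (f k) ω ∂P) atTop
      (𝓝 ((c : ℂ) + Complex.I * b)) :=
    hcb.congr fun k => ComplexWiener.integral_sq_eq hZ e (hf k)
  -- Centred convergence of the three chaos sums is convergence to the limits of their means.
  have hlim1 (hc : Tendsto (fun k => ComplexWiener.center P
      (ComplexWiener.chaosSum hZ e (fun i _ => i) (f k) (f k).revConj)) atTop (𝓝 0)) :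
      Tendsto (fun k => ComplexWiener.chaosSum hZ e (fun i _ => i) (f k) (f k).revConj) atTop
        (𝓝 (Lp.const 2 P (((m * σ ^ 2 : ℝ)) : ℂ))) := by
    refine ComplexWiener.tendsto_const_of_tendsto_center hc ?_
    simp only [ComplexWiener.integral_chaosSum_eq_mul hZ e (fun i _ => (i : ℂ))]
    simpa using hσC.const_mul (m : ℂ)
  have hlim2 (hc : Tendsto (fun k => ComplexWiener.center P
      (ComplexWiener.chaosSum hZ e (fun _ j => j) (f k) (f k).revConj)) atTop (𝓝 0)) :
      Tendsto (fun k => ComplexWiener.chaosSum hZ e (fun _ j => j) (f k) (f k).revConj) atTop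
        (𝓝 (Lp.const 2 P (((n * σ ^ 2 : ℝ)) : ℂ))) := by
    refine ComplexWiener.tendsto_const_of_tendsto_center hc ?_
    simp only [ComplexWiener.integral_chaosSum_eq_mul hZ e (fun _ j => (j : ℂ))]
    simpa using hσC.const_mul (n : ℂ)
  have hlim3 (hc : Tendsto (fun k => ComplexWiener.center P
      (ComplexWiener.chaosSum hZ e (fun i _ => i) (f k) (f k))) atTop (𝓝 0)) :
      Tendsto (fun k => ComplexWiener.chaosSum hZ e (fun i _ => i) (f k) (f k)) atTop
        (𝓝 (Lp.const 2 P (m * (c + Complex.I * b)))) := by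
    refine ComplexWiener.tendsto_const_of_tendsto_center hc ?_
    simp only [ComplexWiener.integral_chaosSum_eq_mul hZ e (fun i _ => (i : ℂ))]
    exact hcbC.const_mul (m : ℂ)
  tfae_have 1 → 2 := fun H => by
    obtain ⟨C, hC0, hC⟩ := ComplexWiener.exists_integral_norm_pow_eight_le (P := P) hZ e m n
    -- The eighth moments are bounded because `m! n! ‖f_k‖² = E|F_k|²` converges.
    obtain ⟨B, hB⟩ := hσ.bddAbove_range
    have hfact : (1 : ℝ) ≤ m.factorial * n.factorial := by
      exact_mod_cast Nat.one_le_iff_ne_zero.2 (mul_ne_zero m.factorial_ne_zero n.factorial_ne_zero)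
    have hnorm (k : ℕ) : ‖f k‖ ^ 2 ≤ B := by
      refine le_trans ?_ (hB ⟨k, rfl⟩)
      simp only [ComplexWiener.integral_norm_sq_multipleIntegral hZ e (hf k)]
      exact le_mul_of_one_le_left (sq_nonneg _) hfact
    have H1 := ComplexWiener.tendsto_integral_norm_pow_four (K := C * B ^ 4) (sq_nonneg σ) hcov
      (fun k => ?_) (fun k => (hC (f k)).trans ?_) H
    · convert H1 using 3
      ring
    · have h8 := ComplexWiener.memLp_multipleIntegral hZ e 2 (f k)
      norm_num at h8
      simpa using h8.integrable_norm_pow (p := 8) (by norm_num)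
    · have h8 : ‖f k‖ ^ 8 = (‖f k‖ ^ 2) ^ 4 := by ring
      rw [h8]
      gcongr
      exact hnorm k
  tfae_have 2 → 3 := fun H => by
    have hfact : (0 : ℝ) < m.factorial * n.factorial := by positivity
    have hnorm : c ^ 2 + b ^ 2 = ‖(c : ℂ) + Complex.I * b‖ ^ 2 := by
      rw [← Complex.normSq_eq_norm_sq, Complex.normSq_apply]
      simp [sq]
    have hδ : Tendsto (fun k => ∫ ω, ‖ComplexWiener.multipleIntegral hZ e (f k) ω‖ ^ 4 ∂P -
        2 * (∫ ω, ‖ComplexWiener.multipleIntegral hZ e (f k) ω‖ ^ 2 ∂P) ^ 2 -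
        ‖∫ ω, ComplexWiener.multipleIntegral hZ e (f k) ω ^ 2 ∂P‖ ^ 2) atTop (𝓝 0) := by
      refine ((H.sub ((hσ.pow 2).const_mul 2)).sub (hcb.norm.pow 2)).trans ?_
      rw [← hnorm]
      ring_nf
      exact le_rfl
    -- Each contraction norm is dominated by the excess of the fourth moment.
    have hsq (u : ℕ → ℝ) (hu : ∀ k, 0 ≤ u k)
        (hle : ∀ k, ((m.factorial * n.factorial : ℝ) * u k) ^ 2 +
          2 * (∫ ω, ‖ComplexWiener.multipleIntegral hZ e (f k) ω‖ ^ 2 ∂P) ^ 2 +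
          ‖∫ ω, ComplexWiener.multipleIntegral hZ e (f k) ω ^ 2 ∂P‖ ^ 2 ≤
            ∫ ω, ‖ComplexWiener.multipleIntegral hZ e (f k) ω‖ ^ 4 ∂P) :
        Tendsto u atTop (𝓝 0) := by
      have h4 : Tendsto (fun k => ((m.factorial * n.factorial : ℝ) * u k) ^ 2) atTop (𝓝 0) :=
        squeeze_zero (fun _ => sq_nonneg _) (fun k => by linarith [hle k]) hδ
      have h5 := (h4.sqrt.const_mul (m.factorial * n.factorial : ℝ)⁻¹)
      rw [Real.sqrt_zero, mul_zero] at h5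
      refine h5.congr fun k => ?_
      rw [Real.sqrt_sq (mul_nonneg hfact.le (hu k)), inv_mul_cancel_left₀ hfact.ne']
    refine ⟨fun i j him hin hjn hjm h0 hl => hsq _ (fun _ => norm_nonneg _) fun k => ?_,
      fun i j him hjn h0 hl => hsq _ (fun _ => norm_nonneg _) fun k => ?_⟩
    · rw [← ComplexWiener.contr₀_eq]
      exact ComplexWiener.sq_norm_contr₀_le hZ e (hf k) him hin hjn hjm h0 (by omega)
    · rw [← ComplexWiener.contr₀_eq]
      exact ComplexWiener.sq_norm_contr₀_revConj_le hZ e (hf k) him hjn h0 (by omega)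
  tfae_have 3 → 4 := fun H =>
    ⟨fun i j him hin hjn hjm h0 hl => squeeze_zero (fun _ => norm_nonneg _)
      (fun k => ComplexWiener.Kernel.norm_symmetrize_le _) (H.1 i j him hin hjn hjm h0 hl),
    fun i j him hjn h0 hl => squeeze_zero (fun _ => norm_nonneg _)
      (fun k => ComplexWiener.Kernel.norm_symmetrize_le _) (H.2 i j him hjn h0 hl)⟩
  tfae_have 4 → 6 := fun H => by
    refine hvar.2 ⟨?_, ?_, ?_⟩
    · refine ComplexWiener.tendsto_center_chaosSum hZ e (by simp) fun i j hi _ hj _ h0 hl => ?_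
      simp only [ComplexWiener.contr₀_eq _ _ hi hi hj hj]
      exact H.2 i j hi hj h0 (by omega)
    · refine ComplexWiener.tendsto_center_chaosSum hZ e (by simp) fun i j hi _ hj _ h0 hl => ?_
      simp only [ComplexWiener.contr₀_eq _ _ hi hi hj hj]
      exact H.2 i j hi hj h0 (by omega)
    · refine ComplexWiener.tendsto_center_chaosSum hZ e (by simp) fun i j hi hi' hj hj' h0 hl => ?_
      simp only [ComplexWiener.contr₀_eq _ _ hi hi' hj hj']
      exact H.1 i j hi hi' hj hj' h0 (by omega)
  tfae_have 6 → 5 := fun H => by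
    obtain ⟨c1, c2, c3⟩ := hvar.1 H
    refine ⟨⟨m * σ ^ 2, ?_⟩, ⟨n * σ ^ 2, ?_⟩, ⟨m * (c + Complex.I * b), ?_⟩⟩
    · simp only [fun k => ComplexWiener.eLpNorm_ofReal_sub_const_eq (h1 k)]
      exact ComplexWiener.tendsto_enorm_iff.2 (tendsto_sub_nhds_zero_iff.2 (hlim1 c1))
    · simp only [fun k => ComplexWiener.eLpNorm_ofReal_sub_const_eq (h2 k)]
      exact ComplexWiener.tendsto_enorm_iff.2 (tendsto_sub_nhds_zero_iff.2 (hlim2 c2))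
    · simp only [fun k => ComplexWiener.eLpNorm_sub_const_eq (h3 k)]
      exact ComplexWiener.tendsto_enorm_iff.2 (tendsto_sub_nhds_zero_iff.2 (hlim3 c3))
  tfae_have 5 → 6 := fun ⟨⟨a1, H1⟩, ⟨a2, H2⟩, ⟨a3, H3⟩⟩ => by
    simp only [fun k => ComplexWiener.eLpNorm_ofReal_sub_const_eq (h1 k)] at H1
    simp only [fun k => ComplexWiener.eLpNorm_ofReal_sub_const_eq (h2 k)] at H2
    simp only [fun k => ComplexWiener.eLpNorm_sub_const_eq (h3 k)] at H3
    exact hvar.2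
      ⟨ComplexWiener.tendsto_center_of_tendsto_const
        (tendsto_sub_nhds_zero_iff.1 (ComplexWiener.tendsto_enorm_iff.1 H1)),
      ComplexWiener.tendsto_center_of_tendsto_const
        (tendsto_sub_nhds_zero_iff.1 (ComplexWiener.tendsto_enorm_iff.1 H2)),
      ComplexWiener.tendsto_center_of_tendsto_const
        (tendsto_sub_nhds_zero_iff.1 (ComplexWiener.tendsto_enorm_iff.1 H3))⟩
  tfae_have 6 → 1 := fun H => by
    obtain ⟨c1, c2, c3⟩ := hvar.1 H
    refine ComplexWiener.tendstoInDistribution_plane (sq_nonneg σ) hcov fun ζ => ?_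
    have hγ : (m : ℂ) * (c + Complex.I * b) + m * (c + Complex.I * b) =
        ((m + n : ℕ) : ℂ) * (c + Complex.I * b) := by
      -- For `m ≠ n` both sides vanish, because then `E F_k² = 0`.
      rcases eq_or_ne m n with rfl | hne
      · push_cast
        ring
      · have h0 : (c : ℂ) + Complex.I * b = 0 := by
          refine tendsto_nhds_unique hcb ?_
          simp only [fun k => ComplexWiener.integral_sq_eq_zero hZ e hne (f k)]
          exact tendsto_const_nhds
        rw [h0]
        simp
    refine ComplexWiener.tendsto_integral_phase (l := m + n) (by omega)
      (fun k ζ => ComplexWiener.integral_mul_phase hZ e (hf k) ζ) ?_ ?_ ζ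
    · rw [← hγ, map_add]
      refine ((hlim3 c3).add (hlim3 c3)).congr fun k => ?_
      rw [ComplexWiener.chaosSum_add hZ e (fun i _ => (i : ℂ)) (fun _ j => (j : ℂ)),
        ComplexWiener.chaosSum_fst_eq_snd hZ e (hf k)]
    · have hs : ((m + n : ℕ) : ℂ) * ((σ ^ 2 : ℝ) : ℂ) =
          ((m * σ ^ 2 : ℝ) : ℂ) + ((n * σ ^ 2 : ℝ) : ℂ) := by
        push_cast
        ring
      rw [hs, map_add]
      refine ((hlim1 c1).add (hlim2 c2)).congr fun k => ?_
      rw [ComplexWiener.chaosSum_add hZ e (fun i _ => (i : ℂ)) (fun _ j => (j : ℂ))]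
  tfae_finish
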